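/- **Setting.** Let $A_\mu(x)$, $x\in\mathbb R^4$, be a smooth gauge potential with values in the (Hermitian) Lie algebra of a gauge group $\mathcal G$ of unitary $N\times N$ matrices, let $D_\mu=\partial_\mu-iA_\mu$, and let $\mathcal D_\mu F=\partial_\mu F-i[A_\mu,F]$ be the covariant derivative in the adjoint representation. Fermions $\psi$ in the fundamental representation, with additional (spinor and other internal) indices, have the action $S=-\int d^4x\,\bar\psi\,Q(x,-iD)\,\psi$, where $$Q(x,-iD)=\sum_{n,m\ge 0} \mathbf f^{\mu_1\dots\mu_m}_{\nu_1\dots\nu_n}\bigl(x^{\nu_1}\cdots x^{\nu_n}D_{\mu_1}\cdots D_{\mu_m}+\text{all permutations}\bigr)$$ is of finite order in $D$, with matrices $\mathbf f$ acting on the non-gauge indices and with everywhere convergent power series in $x$; $Q(x,p)$ is the function obtained by $-iD\to p$. For an operator with kernel $X(x,y)$ put $$X_W(x,p)=\int dy\,e^{ipy}\,U(x,x-\tfrac y2)\,X(x-\tfrac y2,x+\tfrac y2)\,U(x+\tfrac y2,x),$$ where $U(w,x)$ is the path-ordered exponential of $i\int dz\,A(z)$ along the straight path from $x$ to $w$.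 $\mathrm{tr}_D$ is the trace over the non-gauge indices and $\mathrm{tr}_G$ that over the gauge indices. A Noether current of the local gauge transformation $\psi\to e^{i\alpha}\psi$, $\bar\psi\to\bar\psi e^{-i\alpha}$ is a smooth local functional $J_\mu$ of the (smooth, compactly supported, Grassmann-valued) fields for which $\delta S=\int d^4x\,\mathrm{tr}_G(\alpha\,\mathcal D_\mu J_\mu)$ for every smooth compactly supported Lie algebra valued $\alpha$. **Theorem.** (1) With $\rho(x,y)=\psi(x)\bar\psi(y)$, $$J_\mu(x)=-\mathrm{tr}_D\int\frac{d^4p}{(2\pi)^4}\sum_{k\ge0}\frac{(-1)^k}{4^k(2k+1)!}\,\mathcal D_{\mu_1}\cdots\mathcal D_{\mu_{2k}}\bigl(\rho_W\,\partial_{p_{\mu_1}}\cdots\partial_{p_{\mu_{2k}}}\partial_{p_\mu}Q\bigr)$$ is a Noether current, the integral being absolutely convergent. If all $p$-derivatives of $Q$ of order at least three vanish, then $J_\mu=-\mathrm{tr}_D\int\frac{d^4p}{(2\pi)^4}\rho_W\,\partial_{p_\mu}Q$ is a Noether current. (2) Let $\langle\,\cdot\,\rangle$ be the expectation of the functional integral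 $Z=\int D[\bar\psi,\psi]\,e^S$, and let the two-point function $G(x,y)=\langle\psi(x)\bar\psi(y)\rangle$ be a function whose Wigner transform $G_W$ converges absolutely (locally uniformly in the mean over $x$). Then $G$ is the Green function, $\hat Q\hat G=\hat G\hat Q=1$, and, as distributions in $x$: if all $p$-derivatives of $Q$ of order at least three vanish, then $$\langle J_\mu(x)\rangle=-\mathrm{tr}_D\int\frac{d^4p}{(2\pi)^4}\,G_W\,\partial_{p_\mu}Q .$$ For general $Q$ the right-hand side is the $k=0$ term of the exact expression, which is obtained from that of (1) by replacing $\rho_W$ by $G_W$. These identities hold at every finite point splitting $\delta>0$, when a regulator $\chi(p)=\int dy\,\eta(y)e^{i\delta py}$, with $\eta$ smooth, compactly supported and $\int\eta=1$, is inserted into the momentum integrals of both sides; as $\delta\to0$ the regularized current tends to $J_\mu$ on fields, and the identities hold without regulator whenever the momentum integrals on the right-hand side converge absolutely (locally integrably in $x$). (3) The same formula holds up to an error $O(\varepsilon^2)$ in a slowly varying background: for $A^\varepsilon_\mu(x)=\varepsilon A_\mu(\varepsilon x)$, $Q^\varepsilon(x,p)=Q(\varepsilon x,p)$, $0<\varepsilon\le1$,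 with two-point functions $G^\varepsilon$ whose Wigner transforms, as functions of $X=\varepsilon x$, converge absolutely, locally in $X$, uniformly in $\varepsilon$, one has for every smooth compactly supported matrix-valued $h$ $$\int d^4X\,\mathrm{tr}_G\, h(X)\Bigl[\langle J_\mu\rangle+\mathrm{tr}_D\int\frac{d^4p}{(2\pi)^4}\,G^\varepsilon_W\,\partial_{p_\mu}Q^\varepsilon\Bigr]_{x=X/\varepsilon}=O(\varepsilon^2),$$ with any fixed regulator $\chi$ in the momentum integrals, and also without regulator if the momentum integrals converge absolutely, locally in $X$, uniformly in $\varepsilon$. -/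

import Mathlib

open scoped ContDiff Kronecker Topology
open MeasureTheory Filter

noncomputable section

/-- Four-dimensional Euclidean spacetime; also the space of momenta. -/
abbrev Spacetime : Type := EuclideanSpace ℝ (Fin 4)

/-- The coordinate unit vector in direction `μ`. -/
def unitVec (μ : Fin 4) : Spacetime := EuclideanSpace.single μ 1

/-! ### Entrywise calculus for matrix-valued functions -/

section Matrices

variable {m n : Type*} {V : Type*} [NormedAddCommGroup V] [NormedSpace ℂ V]

/-- All entries are smooth functions. -/
def SmoothMat (F : Spacetime → Matrix m n V) : Prop :=
  ∀ i j, ContDiff ℝ ∞ (fun x => F x i j)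

/-- The partial derivative `∂_μ F`, entry by entry. -/
def matPartial (μ : Fin 4) (F : Spacetime → Matrix m n V) (x : Spacetime) : Matrix m n V :=
  Matrix.of fun i j => fderiv ℝ (fun z => F z i j) x (unitVec μ)

/-- Iterated partial derivatives `∂_{l₁} ∂_{l₂} ⋯ F`. -/
def matPartials (l : List (Fin 4)) (F : Spacetime → Matrix m n V) : Spacetime → Matrix m n V :=
  l.foldr matPartial F

/-- The integral of a matrix-valued function, entry by entry. -/
def matIntegral {X : Type*} [MeasurableSpace X] (ν : Measure X) (F : X → Matrix m n V) :
    Matrix m n V :=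
  Matrix.of fun i j => ∫ x, F x i j ∂ν

end Matrices

/-! ### Gauge field, covariant derivatives, Wilson lines -/

/-- The Lie algebra, in the physicists' convention (Hermitian generators), of a group `𝒢` of
unitary matrices: the Hermitian `X` with `e^{itX} ∈ 𝒢` for all real `t`. -/
def gaugeLieAlgebra {N : ℕ} (𝒢 : Subgroup (Matrix.unitaryGroup (Fin N) ℂ)) :
    Set (Matrix (Fin N) (Fin N) ℂ) :=
  {X | X.IsHermitian ∧
    ∀ t : ℝ, ∃ g ∈ 𝒢, (g : Matrix (Fin N) (Fin N) ℂ) = NormedSpace.exp ((Complex.I * t) • X)}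

/-- A gauge potential `A_μ(x)`. -/
abbrev GaugeField (N : ℕ) : Type := Fin 4 → Spacetime → Matrix (Fin N) (Fin N) ℂ

/-- A smooth gauge potential with values in the Lie algebra of the gauge group. -/
def IsGaugeField {N : ℕ} (𝒢 : Subgroup (Matrix.unitaryGroup (Fin N) ℂ)) (A : GaugeField N) : Prop :=
  ∀ μ, SmoothMat (A μ) ∧ ∀ x, A μ x ∈ gaugeLieAlgebra 𝒢

section Gauge

variable {N : ℕ} {s : Type*}

/-- `u` is the solution of the transport equation `u' = i ż^μ A_μ(z) u`, `u(0) = 1`, along the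
straight path `z(t) = x + t (w - x)`. -/
def IsTransport (A : GaugeField N) (w x : Spacetime) (u : ℝ → Matrix (Fin N) (Fin N) ℂ) : Prop :=
  u 0 = 1 ∧ ∀ t i j, HasDerivAt (fun τ => u τ i j)
    ((∑ μ, (Complex.I * ((w - x) μ : ℝ)) • (A μ (x + t • (w - x)) * u t)) i j) t

open Classical in
/-- The Wilson line `U(w, x) = Pexp (i ∫_{x → w} dz A(z))` along the straight path from `x` to `w`
(`A(w)` stands on the left): the value at time `1` of the solution of the transport equation. -/
def wilsonLine (A : GaugeField N) (w x : Spacetime) : Matrix (Fin N) (Fin N) ℂ :=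
  if h : ∃ u, IsTransport A w x u then h.choose 1 else 1

variable (Λ : Type*) [NormedRing Λ] [NormedAlgebra ℂ Λ]

/-- A gauge matrix, with entries regarded in the algebra `Λ`. -/
def gaugeMat (U : Matrix (Fin N) (Fin N) ℂ) : Matrix (Fin N) (Fin N) Λ :=
  U.map (algebraMap ℂ Λ)

/-- A gauge matrix acting on spinor ⊗ gauge indices. -/
def liftGauge [DecidableEq s] (U : Matrix (Fin N) (Fin N) ℂ) :
    Matrix (s × Fin N) (s × Fin N) Λ :=
  ((1 : Matrix s s ℂ) ⊗ₖ U).map (algebraMap ℂ Λ)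

/-- A spinor matrix acting on spinor ⊗ gauge indices. -/
def liftSpin (M : Matrix s s ℂ) : Matrix (s × Fin N) (s × Fin N) Λ :=
  (M ⊗ₖ (1 : Matrix (Fin N) (Fin N) ℂ)).map (algebraMap ℂ Λ)

variable {Λ}

/-- `tr_D`: the trace over the indices that are not gauge indices. -/
def trD [Fintype s] (X : Matrix (s × Fin N) (s × Fin N) Λ) : Matrix (Fin N) (Fin N) Λ :=
  Matrix.of fun i j => ∑ a, X (a, i) (a, j)

/-- The covariant derivative in the adjoint representation, `𝒟_μ F = ∂_μ F - i [A_μ, F]`. -/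
def covAdj (A : GaugeField N) (μ : Fin 4) (F : Spacetime → Matrix (Fin N) (Fin N) Λ)
    (x : Spacetime) : Matrix (Fin N) (Fin N) Λ :=
  matPartial μ F x - Complex.I • (gaugeMat Λ (A μ x) * F x - F x * gaugeMat Λ (A μ x))

/-- Iterated adjoint covariant derivatives `𝒟_{l₁} 𝒟_{l₂} ⋯ F`. -/
def covAdjs (A : GaugeField N) (l : List (Fin 4)) (F : Spacetime → Matrix (Fin N) (Fin N) Λ) :
    Spacetime → Matrix (Fin N) (Fin N) Λ :=
  l.foldr (covAdj A) F

/-- A complex gauge matrix acting on a `Λ`-valued fermion field at a point. -/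
def gaugeAct (U : Matrix (Fin N) (Fin N) ℂ) (v : s × Fin N → Λ) : s × Fin N → Λ :=
  fun a => ∑ j, U a.2 j • v (a.1, j)

/-- A complex gauge matrix acting from the right on a `Λ`-valued conjugate field at a point. -/
def gaugeActRight (v : s × Fin N → Λ) (U : Matrix (Fin N) (Fin N) ℂ) : s × Fin N → Λ :=
  fun a => ∑ j, U j a.2 • v (a.1, j)

/-- The covariant derivative in the fundamental representation, `D_μ ψ = ∂_μ ψ - i A_μ ψ`. -/
def covFund (A : GaugeField N) (μ : Fin 4) (ψ : Spacetime → s × Fin N → Λ) (x : Spacetime) :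
    s × Fin N → Λ :=
  fun a => fderiv ℝ (fun z => ψ z a) x (unitVec μ) - Complex.I • gaugeAct (A μ x) (ψ x) a

/-- Grassmann-valued fields `ψ`, `ψ̄`: smooth, compactly supported, with values that anticommute in
the algebra `Λ`. -/
structure IsGrassmannPair (ψ ψb : Spacetime → s × Fin N → Λ) : Prop where
  smooth : ∀ a, ContDiff ℝ ∞ (fun x => ψ x a)
  smooth_bar : ∀ a, ContDiff ℝ ∞ (fun x => ψb x a)
  compact : HasCompactSupport ψ
  compact_bar : HasCompactSupport ψb
  anticomm : ∀ x y a b, ψ x a * ψ y b = -(ψ y b * ψ x a)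
  anticomm_bar : ∀ x y a b, ψb x a * ψb y b = -(ψb y b * ψb x a)
  anticomm_mixed : ∀ x y a b, ψ x a * ψb y b = -(ψb y b * ψ x a)

/-- The kernel `ρ(x, y) = ψ(x) ψ̄(y)`. -/
def fieldKernel (ψ ψb : Spacetime → s × Fin N → Λ) (x y : Spacetime) :
    Matrix (s × Fin N) (s × Fin N) Λ :=
  Matrix.of fun a b => ψ x a * ψb y b

/-! ### The Dirac operator -/

/-- The coefficients of `Q(x, -iD) = ∑_{n,m} f^{μ₁…μ_m}_{ν₁…ν_n}
(x^{ν₁}…x^{ν_n} D_{μ₁}…D_{μ_m} + all permutations)`: spinor matrices `f`, of finite order in `D`,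
the power series in `x` being convergent everywhere. -/
structure DiracSymbol (s : Type*) [Fintype s] where
  /-- the order in `D` -/
  order : ℕ
  /-- the coefficient `f^{μ₁…μ_m}_{ν₁…ν_n}` -/
  coeff : (n m : ℕ) → (Fin n → Fin 4) → (Fin m → Fin 4) → Matrix s s ℂ
  coeff_eq_zero : ∀ n m ν μ, order < m → coeff n m ν μ = 0
  summable_coeff : ∀ (m : ℕ) (R : ℝ), 0 ≤ R → ∀ a b,
    Summable fun n : ℕ => ((n + m).factorial : ℝ) * R ^ n * ∑ ν, ∑ μ, ‖coeff n m ν μ a b‖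

/-- The operator of a single letter: `inl ν` is multiplication by `x^ν`, `inr μ` is `D_μ`. -/
def letterOp (A : GaugeField N) :
    Fin 4 ⊕ Fin 4 → (Spacetime → s × Fin N → Λ) → (Spacetime → s × Fin N → Λ)
  | .inl ν, ψ => fun x a => ((x ν : ℝ) : ℂ) • ψ x a
  | .inr μ, ψ => covFund A μ ψ

/-- The operator of a word in the letters `x^ν` and `D_μ`; the leftmost letter acts last. -/
def wordOp (A : GaugeField N) (w : List (Fin 4 ⊕ Fin 4)) (ψ : Spacetime → s × Fin N → Λ) :
    Spacetime → s × Fin N → Λ :=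
  w.foldr (letterOp A) ψ

/-- `x^{ν₁}…x^{ν_n} D_{μ₁}…D_{μ_m} + all permutations`. -/
def symmetrizedOp (A : GaugeField N) {n m : ℕ} (ν : Fin n → Fin 4) (μ : Fin m → Fin 4)
    (ψ : Spacetime → s × Fin N → Λ) (x : Spacetime) : s × Fin N → Λ :=
  let w : Fin (n + m) → Fin 4 ⊕ Fin 4 := Fin.append (fun i => .inl (ν i)) (fun j => .inr (μ j))
  ∑ σ : Equiv.Perm (Fin (n + m)), wordOp A (List.ofFn (w ∘ σ)) ψ x

variable [Fintype s]

/-- The operator `Q(x, -iD)` on fermion fields. -/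
def diracOp (A : GaugeField N) (Q : DiracSymbol s) (ψ : Spacetime → s × Fin N → Λ)
    (x : Spacetime) : s × Fin N → Λ :=
  fun a => ∑ m ∈ Finset.range (Q.order + 1), ∑' n, ∑ ν : Fin n → Fin 4, ∑ μ : Fin m → Fin 4,
    ∑ b, Q.coeff n m ν μ a.1 b • symmetrizedOp A ν μ ψ x (b, a.2)

/-- The action `S = -∫ d⁴x ψ̄(x) Q(x, -iD) ψ(x)`. -/
def fermionAction (A : GaugeField N) (Q : DiracSymbol s) (ψ ψb : Spacetime → s × Fin N → Λ) : Λ :=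
  -∫ x, ∑ a, ψb x a * diracOp A Q ψ x a

/-- The function `Q(x, p)`, obtained from `Q(x, -iD)` by the replacement `-iD → p`. -/
def DiracSymbol.symbol (Q : DiracSymbol s) (x p : Spacetime) : Matrix s s ℂ :=
  ∑ m ∈ Finset.range (Q.order + 1), ∑' n, ∑ ν : Fin n → Fin 4, ∑ μ : Fin m → Fin 4,
    (((n + m).factorial : ℂ) * (∏ i, ((x (ν i) : ℝ) : ℂ)) *
      ∏ j, (Complex.I * ((p (μ j) : ℝ) : ℂ))) • Q.coeff n m ν μ

/-- The momentum derivatives `∂_{p_{l₁}} ∂_{p_{l₂}} ⋯ Q(x, p)`. -/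
def DiracSymbol.pDerivs (Q : DiracSymbol s) (l : List (Fin 4)) (x p : Spacetime) : Matrix s s ℂ :=
  matPartials l (fun q => Q.symbol x q) p

/-- All momentum derivatives of `Q` of order three (hence of all higher orders) vanish. -/
def DiracSymbol.HigherDerivsVanish (Q : DiracSymbol s) : Prop :=
  ∀ (μ ν ρ : Fin 4) (x p : Spacetime), Q.pDerivs [μ, ν, ρ] x p = 0

variable [DecidableEq s]

/-! ### Generalized Wigner transform and currents -/

/-- The generalized Wigner transform of the operator with kernel `X(x, y) = ⟨x|X|y⟩`:
`X_W(x,p) = ∫ dy e^{ipy} U(x, x-y/2) X(x-y/2, x+y/2) U(x+y/2, x)`. -/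
def wigner (A : GaugeField N) (X : Spacetime → Spacetime → Matrix (s × Fin N) (s × Fin N) Λ)
    (x p : Spacetime) : Matrix (s × Fin N) (s × Fin N) Λ :=
  matIntegral volume fun y : Spacetime =>
    Complex.exp (Complex.I * (inner ℝ p y : ℝ)) •
      (liftGauge Λ (wilsonLine A x (x - (2⁻¹ : ℝ) • y)) *
        X (x - (2⁻¹ : ℝ) • y) (x + (2⁻¹ : ℝ) • y) *
        liftGauge Λ (wilsonLine A (x + (2⁻¹ : ℝ) • y) x))

/-- `tr_D (X_W ∂_{p_{l₁}} ∂_{p_{l₂}} ⋯ Q)` at `(x, p)`. -/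
def momentDensity (A : GaugeField N) (Q : DiracSymbol s)
    (X : Spacetime → Spacetime → Matrix (s × Fin N) (s × Fin N) Λ) (l : List (Fin 4))
    (x p : Spacetime) : Matrix (Fin N) (Fin N) Λ :=
  trD (wigner A X x p * liftSpin Λ (Q.pDerivs l x p))

/-- The momentum integral `∫ d⁴p / (2π)⁴`, with a regulator `χ(p)` inserted. -/
def momentumIntegral (χ : Spacetime → ℂ) (F : Spacetime → Matrix (Fin N) (Fin N) Λ) :
    Matrix (Fin N) (Fin N) Λ :=
  matIntegral volume fun p => (((2 * Real.pi) ^ 4 : ℝ)⁻¹ * χ p : ℂ) • F p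

/-- `(-1)^k / (4^k (2k+1)!)`. -/
def gradCoeff (k : ℕ) : ℂ := (-1) ^ k / (4 ^ k * ((2 * k + 1).factorial : ℂ))

/-- `∑_k (-1)^k / (4^k (2k+1)!) 𝒟_{μ₁}…𝒟_{μ_{2k}} tr_D (X_W ∂_{p_{μ₁}}…∂_{p_{μ_{2k}}} ∂_{p_μ} Q)`. -/
def currentDensity (A : GaugeField N) (Q : DiracSymbol s)
    (X : Spacetime → Spacetime → Matrix (s × Fin N) (s × Fin N) Λ) (μ : Fin 4)
    (x p : Spacetime) : Matrix (Fin N) (Fin N) Λ :=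
  ∑' k : ℕ, gradCoeff k • ∑ l : Fin (2 * k) → Fin 4,
    covAdjs A (List.ofFn l) (fun z => momentDensity A Q X (List.ofFn l ++ [μ]) z p) x

/-- The vector current `J_μ(x)`, to all orders in the covariant derivative, as a linear functional
of the kernel `X` (for fields, `X(x, y) = ψ(x) ψ̄(y)`); `χ = 1` is the current itself and other
`χ` give its gauge covariant regularizations. -/
def vectorCurrent (A : GaugeField N) (Q : DiracSymbol s) (χ : Spacetime → ℂ)
    (X : Spacetime → Spacetime → Matrix (s × Fin N) (s × Fin N) Λ) (μ : Fin 4)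
    (x : Spacetime) : Matrix (Fin N) (Fin N) Λ :=
  -momentumIntegral χ (currentDensity A Q X μ x)

/-- `-tr_D ∫ d⁴p / (2π)⁴ X_W ∂_{p_μ} Q`, with a regulator `χ(p)`. -/
def leadingCurrent (A : GaugeField N) (Q : DiracSymbol s) (χ : Spacetime → ℂ)
    (X : Spacetime → Spacetime → Matrix (s × Fin N) (s × Fin N) Λ) (μ : Fin 4)
    (x : Spacetime) : Matrix (Fin N) (Fin N) Λ :=
  -momentumIntegral χ (momentDensity A Q X [μ] x)

/-- A smooth, compactly supported, Lie algebra valued gauge parameter `α(x)`. -/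
def IsGaugeParameter (𝒢 : Subgroup (Matrix.unitaryGroup (Fin N) ℂ))
    (α : Spacetime → Matrix (Fin N) (Fin N) ℂ) : Prop :=
  SmoothMat α ∧ HasCompactSupport α ∧ ∀ x, α x ∈ gaugeLieAlgebra 𝒢

/-- `J` is a Noether current of the local gauge transformation `ψ → e^{iα} ψ`, `ψ̄ → ψ̄ e^{-iα}`:
it is a smooth local functional of the fields, and the first variation of the action under every
such transformation is `δS = ∫ d⁴x tr_G (α 𝒟_μ J_μ)`. -/
structure IsNoetherCurrent (𝒢 : Subgroup (Matrix.unitaryGroup (Fin N) ℂ)) (A : GaugeField N)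
    (Q : DiracSymbol s)
    (J : (Spacetime → s × Fin N → Λ) → (Spacetime → s × Fin N → Λ) →
      Fin 4 → Spacetime → Matrix (Fin N) (Fin N) Λ) : Prop where
  smooth : ∀ ψ ψb, IsGrassmannPair ψ ψb → ∀ μ, SmoothMat (J ψ ψb μ)
  isLocal : ∀ ψ ψb φ φb, IsGrassmannPair ψ ψb → IsGrassmannPair φ φb →
    ∀ x, ψ =ᶠ[𝓝 x] φ → ψb =ᶠ[𝓝 x] φb → ∀ μ, J ψ ψb μ x = J φ φb μ x
  variation : ∀ ψ ψb, IsGrassmannPair ψ ψb → ∀ α, IsGaugeParameter 𝒢 α →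
    HasDerivAt
      (fun t : ℝ => fermionAction A Q
        (fun x => gaugeAct (NormedSpace.exp ((Complex.I * t) • α x)) (ψ x))
        (fun x => gaugeActRight (ψb x) (NormedSpace.exp ((-Complex.I * t) • α x))))
      (∫ x, (gaugeMat Λ (α x) * ∑ μ, covAdj A μ (J ψ ψb μ) x).trace) 0

end Gauge

/-! ### The functional integral -/

section FunctionalIntegral

variable {ι : Type*}

/-- Smooth compactly supported test functions. -/
def testSpace (ι : Type*) : Submodule ℂ (Spacetime → ι → ℂ) where
  carrier := {f | (∀ a, ContDiff ℝ ∞ (fun x => f x a)) ∧ HasCompactSupport f}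
  add_mem' := fun hf hg => ⟨fun a => (hf.1 a).add (hg.1 a), hf.2.add hg.2⟩
  zero_mem' := ⟨fun _ => contDiff_const, HasCompactSupport.zero⟩
  smul_mem' := fun c _ hf =>
    ⟨fun a => (contDiff_const (c := c)).smul (hf.1 a), HasCompactSupport.smul_left (f := fun _ => c) hf.2⟩

/-- The Grassmann algebra of the field variables, generated by the smeared fields `ψ(f)`, `ψ̄(g)`. -/
abbrev FieldAlgebra (ι : Type*) : Type _ := ExteriorAlgebra ℂ (testSpace ι × testSpace ι)

/-- The generator `ψ(f) = ∫ d⁴x f_a(x) ψ_a(x)`. -/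
def psi (f : testSpace ι) : FieldAlgebra ι := ExteriorAlgebra.ι ℂ (f, 0)

/-- The generator `ψ̄(g) = ∫ d⁴x ψ̄_a(x) g_a(x)`. -/
def psiBar (g : testSpace ι) : FieldAlgebra ι := ExteriorAlgebra.ι ℂ (0, g)

variable [Fintype ι]

lemma testSpace_integrable (h v : testSpace ι) :
    Integrable fun x : Spacetime => ∑ a, h.1 x a * v.1 x a := by
  obtain ⟨h, hs, hc⟩ := h
  obtain ⟨v, vs, vc⟩ := v
  refine integrable_finsetSum _ fun a _ => ?_
  refine Continuous.integrable_of_hasCompactSupport ((hs a).continuous.mul (vs a).continuous) ?_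
  have : HasCompactSupport fun x : Spacetime => h x a :=
    hc.comp_left (g := fun w : ι → ℂ => w a) rfl
  exact this.mul_right

/-- The bilinear pairing `∫ d⁴x h_a(x) v_a(x)`. -/
def pairing (h : testSpace ι) : testSpace ι →ₗ[ℂ] ℂ where
  toFun v := ∫ x, ∑ a, h.1 x a * v.1 x a
  map_add' v w := by
    rw [← integral_add (testSpace_integrable h v) (testSpace_integrable h w)]
    simp [mul_add, Finset.sum_add_distrib]
  map_smul' c v := by
    rw [RingHom.id_apply, smul_eq_mul, ← integral_const_mul]
    simp [Finset.mul_sum, mul_left_comm]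

/-- The left derivative `∫ d⁴x f_a(x) ∂/∂ψ_a(x)` of the field algebra. -/
def derivPsi (f : testSpace ι) : FieldAlgebra ι →ₗ[ℂ] FieldAlgebra ι :=
  CliffordAlgebra.contractLeft (pairing f ∘ₗ LinearMap.fst ℂ _ _)

/-- The left derivative `∫ d⁴x h_a(x) ∂/∂ψ̄_a(x)` of the field algebra. -/
def derivPsiBar (h : testSpace ι) : FieldAlgebra ι →ₗ[ℂ] FieldAlgebra ι :=
  CliffordAlgebra.contractLeft (pairing h ∘ₗ LinearMap.snd ℂ _ _)

variable {N : ℕ} {s : Type*} [Fintype s]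

/-- `E F = ⟨F⟩ = Z⁻¹ ∫ D[ψ̄,ψ] F e^S` with `S = -∫ ψ̄ Q ψ`: the normalized linear functional for which
the Berezin integrals of the total derivatives `∂/∂ψ̄ (F e^S)` and `∂/∂ψ (F e^S)` vanish. With
`∂S/∂ψ̄ = -Qψ` and `∂S/∂ψ = ψ̄Q` this means `⟨(Qψ)(x) F⟩ = ⟨∂F/∂ψ̄(x)⟩` and
`⟨(ψ̄Q)(x) F⟩ = -⟨∂F/∂ψ(x)⟩`, smeared with test functions. -/
structure IsFermionExpectation (A : GaugeField N) (Q : DiracSymbol s)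
    (E : FieldAlgebra (s × Fin N) →ₗ[ℂ] ℂ) : Prop where
  normalized : E 1 = 1
  total_derivPsiBar : ∀ h k : testSpace (s × Fin N),
    (∀ f : testSpace (s × Fin N),
      pairing k f = ∫ x, ∑ a, h.1 x a * diracOp A Q f.1 x a) →
    ∀ F, E (psi k * F) = E (derivPsiBar h F)
  total_derivPsi : ∀ f k : testSpace (s × Fin N), k.1 = diracOp A Q f.1 →
    ∀ F, E (psiBar k * F) = -E (derivPsi f F)

/-- The kernels of operators on fermion fields. -/
abbrev Kernel4 (s : Type*) (N : ℕ) : Type _ :=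
  Spacetime → Spacetime → Matrix (s × Fin N) (s × Fin N) ℂ

/-- `G(x, y) = ⟨ψ(x) ψ̄(y)⟩`, as the kernel of the two-point distribution. -/
def IsTwoPointFunction (E : FieldAlgebra (s × Fin N) →ₗ[ℂ] ℂ) (G : Kernel4 s N) : Prop :=
  ∀ f g : testSpace (s × Fin N), E (psi f * psiBar g) =
    ∫ z : Spacetime × Spacetime, ∑ a, ∑ b, f.1 z.1 a * G z.1 z.2 a b * g.1 z.2 b

/-- `G` is the kernel of the inverse of `Q̂`: `Q̂ Ĝ = 1` and `Ĝ Q̂ = 1`, in the sense of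
distributions. -/
def IsGreenFunction (A : GaugeField N) (Q : DiracSymbol s) (G : Kernel4 s N) : Prop :=
  (∀ h k g : testSpace (s × Fin N),
    (∀ f : testSpace (s × Fin N),
      pairing k f = ∫ x, ∑ a, h.1 x a * diracOp A Q f.1 x a) →
    ∫ z : Spacetime × Spacetime, ∑ a, ∑ b, k.1 z.1 a * G z.1 z.2 a b * g.1 z.2 b = pairing h g) ∧
  (∀ u f k : testSpace (s × Fin N), k.1 = diracOp A Q f.1 →
    ∫ z : Spacetime × Spacetime, ∑ a, ∑ b, u.1 z.1 a * G z.1 z.2 a b * k.1 z.2 b = pairing u f)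

/-- The Wigner transform of `G` converges absolutely, locally uniformly in the mean over `x`. -/
def WignerIntegrable (G : Kernel4 s N) : Prop :=
  ∀ C : Set Spacetime, IsCompact C → ∀ a b, IntegrableOn
    (fun z : Spacetime × Spacetime => G (z.1 - (2⁻¹ : ℝ) • z.2) (z.1 + (2⁻¹ : ℝ) • z.2) a b)
    (C ×ˢ Set.univ)

/-- `v = ⟨B⟩` for the bilinear functional `B = ∬ ψ̄_b(y) K_{ba} ψ_a(x)` of the fields, given as a linear
functional of the kernel `ψ(x) ψ̄(y)`: `B` is represented by a test function `K` on pairs of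
points, and the expectation value is obtained by inserting `⟨ψ(x) ψ̄(y)⟩ = G(x, y)`. -/
def HasExpectation (G : Kernel4 s N) (B : Kernel4 s N → ℂ) (v : ℂ) : Prop :=
  ∃ K : Spacetime × Spacetime → Matrix (s × Fin N) (s × Fin N) ℂ,
    (∀ a b, ContDiff ℝ ∞ (fun z => K z b a)) ∧ HasCompactSupport K ∧
    (∀ f g : testSpace (s × Fin N), B (fun x y => Matrix.vecMulVec (f.1 x) (g.1 y)) =
      ∫ z : Spacetime × Spacetime, ∑ a, ∑ b, K z b a * (f.1 z.1 a * g.1 z.2 b)) ∧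
    v = ∫ z : Spacetime × Spacetime, (K z * G z.1 z.2).trace

/-! ### Regularization by point splitting, and expectation values of the current -/

/-- The regulator `χ(p) = ∫ d⁴y η(y) e^{i δ p y}`: multiplication by it in the momentum integral
separates the arguments of `ψ` and `ψ̄` covariantly, with weight `η`, at distances of order `δ`. -/
def cutoff (η : Spacetime → ℂ) (δ : ℝ) (p : Spacetime) : ℂ :=
  ∫ y, η y * Complex.exp (Complex.I * (δ * (inner ℝ p y : ℝ)))

/-- A profile for point splitting: a smooth compactly supported function with integral one. -/
def IsProfile (η : Spacetime → ℂ) : Prop :=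
  ContDiff ℝ ∞ η ∧ HasCompactSupport η ∧ ∫ y, η y = 1

/-- A smooth compactly supported matrix-valued test function. -/
def IsMatTest (h : Spacetime → Matrix (Fin N) (Fin N) ℂ) : Prop :=
  SmoothMat h ∧ HasCompactSupport h

variable [DecidableEq s]

/-- The smeared, regularized current `∫ d⁴x tr_G (h(x) J_μ(x))`. -/
def smearedCurrent (A : GaugeField N) (Q : DiracSymbol s) (χ : Spacetime → ℂ)
    (h : Spacetime → Matrix (Fin N) (Fin N) ℂ) (μ : Fin 4) (X : Kernel4 s N) : ℂ :=
  ∫ x, (h x * vectorCurrent A Q χ X μ x).trace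

/-- `∫ d⁴x tr_G (h(x) (-tr_D ∫ d⁴p / (2π)⁴ χ(p) G_W ∂_{p_μ} Q))`. -/
def leadingValue (A : GaugeField N) (Q : DiracSymbol s) (χ : Spacetime → ℂ)
    (h : Spacetime → Matrix (Fin N) (Fin N) ℂ) (μ : Fin 4) (G : Kernel4 s N) : ℂ :=
  ∫ x, (h x * leadingCurrent A Q χ G μ x).trace

/-- The contribution of the `p`-derivatives of `Q` of order `2k+1` to the expectation value of the
smeared current; the covariant derivatives are moved to the test function. -/
def gradientTerm (A : GaugeField N) (Q : DiracSymbol s) (χ : Spacetime → ℂ)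
    (h : Spacetime → Matrix (Fin N) (Fin N) ℂ) (μ : Fin 4) (G : Kernel4 s N) (k : ℕ) : ℂ :=
  -(gradCoeff k * ∑ l : Fin (2 * k) → Fin 4, ∫ x, (covAdjs A (List.ofFn l) h x *
    momentumIntegral χ (momentDensity A Q G (List.ofFn l ++ [μ]) x)).trace)

/-- `v = ⟨∫ d⁴x tr_G (h J_μ)⟩`: the limit in which the point splitting of the current is removed,
for every splitting profile. -/
def HasCurrentExpectation (A : GaugeField N) (Q : DiracSymbol s) (G : Kernel4 s N)
    (h : Spacetime → Matrix (Fin N) (Fin N) ℂ) (μ : Fin 4) (v : ℂ) : Prop :=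
  ∀ η, IsProfile η → ∃ e : ℝ → ℂ,
    (∀ δ, 0 < δ → HasExpectation G (smearedCurrent A Q (cutoff η δ) h μ) (e δ)) ∧
    Tendsto e (𝓝[>] 0) (𝓝 v)

/-! ### Slowly varying backgrounds -/

/-- The slowly varying Dirac operator `Q(εx, p)`. -/
def DiracSymbol.slow {s : Type*} [Fintype s] (ε : ℝ) (Q : DiracSymbol s) : DiracSymbol s where
  order := Q.order
  coeff n m ν μ := ((ε : ℂ) ^ n) • Q.coeff n m ν μ
  coeff_eq_zero n m ν μ h := by rw [Q.coeff_eq_zero n m ν μ h, smul_zero]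
  summable_coeff m R hR a b := by
    refine (Q.summable_coeff m (R * |ε|) (by positivity) a b).congr fun n => ?_
    simp only [Matrix.smul_apply, norm_smul, norm_pow, Complex.norm_real, Real.norm_eq_abs,
      ← Finset.mul_sum]
    ring

/-- The slowly varying gauge field `ε A(εx)`. -/
def slowGauge {N : ℕ} (ε : ℝ) (A : GaugeField N) : GaugeField N :=
  fun μ x => (ε : ℂ) • A μ (ε • x)

/-- The test function `ε⁴ h(εx)`, which averages over the scale of the background. -/
def slowTest {N : ℕ} (ε : ℝ) (h : Spacetime → Matrix (Fin N) (Fin N) ℂ) (x : Spacetime) :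
    Matrix (Fin N) (Fin N) ℂ :=
  ((ε : ℂ) ^ 4) • h (ε • x)

/-- A family of functions on pairs of points is integrable over `C × ℝ⁴`, uniformly in `0 < ε ≤ 1`,
for every compact set `C`. -/
def UniformlyIntegrable (F : ℝ → Spacetime × Spacetime → ℂ) : Prop :=
  ∀ C : Set Spacetime, IsCompact C → ∃ B : ℝ, ∀ ε ∈ Set.Ioc (0 : ℝ) 1,
    IntegrableOn (F ε) (C ×ˢ Set.univ) ∧ ∫ z in C ×ˢ Set.univ, ‖F ε z‖ ≤ B

end FunctionalIntegral

end

/-! Everything reduces to one kind of symbol. By polarization a monomial in `p` is a linear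
combination of powers ⟨b,p⟩^m of linear forms, so Q(x,p) is a finite sum of terms ⟨b,p⟩^m f(x) with
smooth f (`symbol_eq_sum_ridge`). Polarization of the operator in the same way leaves words in the
coordinates and in a single covariant derivative D_b. The D_μ do not commute with one another, but
[D_b, x^ν] = b^ν is a scalar; hence the half anticommutators with the letters commute, and the sum
over all permutations is, up to a factorial, 2^{-m} ∑_i C(m,i) D_b^i f D_b^{m-i}
(`sum_perm_append_const`, `symmetrizedOp_eq`). No curvature term appears.

Integration by parts puts D_b^i on ψ̄ with the sign (-1)^i (`integral_sum_mul_diracOp`). On the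
other hand, the derivative of U(x,z)ψ(z) along a ray from x is the transported covariant derivative.
By the Leibniz rule the m-th derivative at y = 0 of the kernel ρ(x-y/2, x+y/2), transported to x, is
therefore the same binomial sum of products of D_b^i ψ̄ and D_b^{m-i} ψ
(`sum_dirDeriv_transportedKernel`). So the action is the integral over x of a differential operator
in y applied to the transported kernel at y = 0 (`fermionAction_eq`); in momentum space this is ∫dx
∫dp/(2π)⁴ tr(ρ_W Q).

A gauge transformation changes ρ by iαρ - ρiα, with α taken at x-y/2 and at x+y/2. After transport
to x, the n-th derivative of α along b is D_b^n α. In the difference of the two values the even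
orders cancel, and order 2k+1 occurs with the coefficient (-1)^k/(4^k (2k+1)!) and 2k+1 momentum
derivatives of Q (`trace_momentKernel_gaugeVariation`). Moving 2k of these derivatives from α to the
moments, and the last one to the current, gives the Noether identity (`integral_trace_divergence`).
Fourier inversion at the origin turns values at y = 0 into momentum integrals (`vectorCurrent_one`).

For the expectation value, the Parseval formula turns a regularized momentum integral into an
integral over y against derivatives of the splitting profile. With the covariant derivatives moved
to h, the smeared current is thus the pairing of the kernel with a smooth compactly supported
function of two points (`isRepresentedBy_momentumIntegral`), which makes sense for a kernel G that
is merely integrable. The regulator is removed by dominated convergence. The Green function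
equations are the Schwinger-Dyson equations for a single field.

In a slowly varying background the substitution X = εx extracts a factor ε from each covariant
derivative of the test function, so the k-th gradient term is of order ε^{2k}. The integrals that
remain are bounded uniformly in ε because Wilson lines are unitary
(`exists_bound_momentumIntegral_cutoff`, `exists_bound_sum_gradientTerm`).

The analytic groundwork is the smoothness of Wilson lines in their end points. It follows from
Duhamel's formula by induction on the order of differentiability (`contDiff_transport_nat`). -/

section Polarization

/-! ### Polarization of multilinear maps. -/

/-- Polarization of a multilinear map: the sum over all permutations of the arguments is an
alternating sum of values on the diagonal. -/
theorem MultilinearMap.sum_perm_eq_sum_diagonal {R V W : Type*} [CommRing R] [AddCommGroup V]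
    [Module R V] [AddCommGroup W] [Module R W] {m : ℕ}
    (f : MultilinearMap R (fun _ : Fin m => V) W) (v : Fin m → V) :
    ∑ σ : Equiv.Perm (Fin m), f (v ∘ σ) =
      ∑ S : Finset (Fin m), (-1 : ℤ) ^ S.card • f (fun _ => ∑ i ∈ Sᶜ, v i) := by
  classical
  -- Expanding the diagonal value multilinearly gives all maps `r` into the complement of `S`; the
  -- condition is written as one on `S` so that the sum over `S` can be done first.
  have h1 : ∀ S : Finset (Fin m), f (fun _ => ∑ i ∈ Sᶜ, v i) =
      ∑ r : Fin m → Fin m, if S ⊆ (Finset.univ.image r)ᶜ then f (v ∘ r) else 0 := by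
    intro S
    rw [MultilinearMap.map_sum_finset f (fun _ j => v j) (fun _ => Sᶜ), ← Finset.sum_filter]
    refine Finset.sum_congr ?_ fun r _ => rfl
    ext r
    simp only [Fintype.mem_piFinset, Finset.mem_compl, Finset.mem_filter, Finset.mem_univ,
      true_and, Finset.subset_iff, Finset.mem_image, not_exists]
    constructor
    · rintro h x hx a rfl
      exact h a hx
    · intro h a ha
      exact h ha a rfl
  simp_rw [h1, Finset.smul_sum]
  rw [Finset.sum_comm]
  -- Inclusion-exclusion: the alternating sum over the subsets of the complement of the image
  -- vanishes unless that complement is empty, and a surjective self-map of a finite set is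
  -- bijective.
  have h2 : ∀ r : Fin m → Fin m, ∑ S : Finset (Fin m), (-1 : ℤ) ^ S.card •
      (if S ⊆ (Finset.univ.image r)ᶜ then f (v ∘ r) else 0) =
      if Function.Bijective r then f (v ∘ r) else 0 := by
    intro r
    have h3 : ∑ S : Finset (Fin m), (-1 : ℤ) ^ S.card •
        (if S ⊆ (Finset.univ.image r)ᶜ then f (v ∘ r) else 0) =
        (∑ S ∈ ((Finset.univ.image r)ᶜ).powerset, (-1 : ℤ) ^ S.card) • f (v ∘ r) := by
      rw [Finset.sum_smul]
      simp only [smul_ite, smul_zero]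
      rw [← Finset.sum_filter]
      refine Finset.sum_congr ?_ fun _ _ => rfl
      ext S
      simp
    rw [h3, Finset.sum_powerset_neg_one_pow_card]
    have : (Finset.univ.image r)ᶜ = ∅ ↔ Function.Bijective r := by
      rw [Finset.compl_eq_empty_iff, ← Finite.surjective_iff_bijective, Finset.eq_univ_iff_forall]
      simp [Function.Surjective]
    simp only [this]
    split_ifs <;> simp
  simp_rw [h2]
  rw [← Finset.sum_filter]
  refine Finset.sum_bij (fun σ _ => (σ : Fin m → Fin m)) (fun σ _ => ?_) (fun a _ b _ h => ?_)
    (fun r hr => ?_) (fun _ _ => rfl)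
  · exact Finset.mem_filter.2 ⟨Finset.mem_univ _, σ.bijective⟩
  · exact Equiv.coe_fn_injective h
  · exact ⟨Equiv.ofBijective r (Finset.mem_filter.1 hr).2, Finset.mem_univ _, rfl⟩

end Polarization

/-! ### Symmetrized products in a noncommutative algebra (Weyl ordering). -/

section SymmetrizedProducts

variable {R : Type*} [Ring R] [Algebra ℂ R]

/-- Half the anticommutator with `a`. -/
noncomputable def halfAnticomm (a : R) : Module.End ℂ R :=
  (2⁻¹ : ℂ) • (LinearMap.mulLeft ℂ a + LinearMap.mulRight ℂ a)

lemma halfAnticomm_sum {ι : Type*} (S : Finset ι) (w : ι → R) :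
    halfAnticomm (∑ i ∈ S, w i) = ∑ i ∈ S, halfAnticomm (w i) := by
  ext x
  simp [halfAnticomm, Finset.sum_mul, Finset.mul_sum, Finset.smul_sum, Finset.sum_add_distrib]

lemma halfAnticomm_pow_one (a : R) (r : ℕ) : (halfAnticomm a ^ r) 1 = a ^ r := by
  induction r with
  | zero => simp
  | succ r ih =>
    rw [pow_succ', Module.End.mul_apply, ih]
    simp only [halfAnticomm, LinearMap.smul_apply, LinearMap.add_apply, LinearMap.mulLeft_apply,
      LinearMap.mulRight_apply, ← pow_succ, ← pow_succ']
    rw [← two_smul ℂ, smul_smul]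
    simp

lemma sum_perm_prod_eq {r : ℕ} (w : Fin r → R) :
    ∑ σ : Equiv.Perm (Fin r), (List.ofFn (w ∘ σ)).prod =
      ∑ S : Finset (Fin r), (-1 : ℤ) ^ S.card • (∑ i ∈ Sᶜ, w i) ^ r := by
  have := MultilinearMap.sum_perm_eq_sum_diagonal (MultilinearMap.mkPiAlgebraFin ℂ r R) w
  simpa [MultilinearMap.mkPiAlgebraFin_apply] using this

/-- If the half anticommutators with the letters commute, they produce the symmetrized product. -/
theorem sum_perm_prod_eq_halfAnticomm {r : ℕ} (w : Fin r → R)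
    (hw : ∀ i j, Commute (halfAnticomm (w i)) (halfAnticomm (w j))) :
    ∑ σ : Equiv.Perm (Fin r), (List.ofFn (w ∘ σ)).prod =
      (r.factorial : ℂ) • (List.ofFn fun i => halfAnticomm (w i)).prod 1 := by
  -- Polarization is used twice: for the half anticommutators in the endomorphism ring, where
  -- commutativity makes all permutations equal, and for the letters themselves. Evaluated at `1`,
  -- both give the same alternating sum of powers.
  have h1 := sum_perm_prod_eq (fun i => halfAnticomm (w i))
  have h2 : ∀ σ : Equiv.Perm (Fin r), (List.ofFn ((fun i => halfAnticomm (w i)) ∘ σ)).prod =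
      (List.ofFn fun i => halfAnticomm (w i)).prod := by
    intro σ
    refine List.Perm.prod_eq' (Equiv.Perm.ofFn_comp_perm σ _) ?_
    rw [List.pairwise_ofFn]
    intro i j _
    exact hw _ _
  simp_rw [h2] at h1
  rw [Finset.sum_const, Finset.card_univ, Fintype.card_perm, Fintype.card_fin] at h1
  have h3 := congrArg (fun L : Module.End ℂ R => L 1) h1
  simp only [LinearMap.sum_apply, LinearMap.smul_apply, ← halfAnticomm_sum,
    halfAnticomm_pow_one] at h3
  rw [sum_perm_prod_eq, ← h3, Nat.cast_smul_eq_nsmul]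

/-- The commutator of L_a + R_a and L_b + R_b is L_c - R_c with c = [a,b], which vanishes for
central c. This is why only the commutators of derivatives with coordinates have to be scalars. -/
lemma halfAnticomm_commute_of_central {a b c : R} (hc : ∀ x, Commute c x) (h : a * b = b * a + c) :
    Commute (halfAnticomm a) (halfAnticomm b) := by
  ext x
  have hx := (hc x).eq
  simp only [halfAnticomm, Module.End.mul_apply, LinearMap.smul_apply, LinearMap.add_apply,
    LinearMap.mulLeft_apply, LinearMap.mulRight_apply, smul_add, mul_add, add_mul,
    Algebra.smul_mul_assoc, Algebra.mul_smul_comm]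
  have e1 : a * (b * x) = b * (a * x) + c * x := by
    rw [← mul_assoc, h, add_mul, mul_assoc]
  have e2 : x * b * a = x * a * b - x * c := by
    rw [mul_assoc, mul_assoc, h, mul_add]; abel
  rw [e1, e2, ← hx, ← mul_assoc a x b, ← mul_assoc b x a]
  simp only [smul_add, smul_sub]
  abel

/-- Left and right multiplication commute, so the binomial theorem applies to their sum. -/
lemma halfAnticomm_pow (y x : R) (m : ℕ) :
    (halfAnticomm y ^ m) x = ((2⁻¹ : ℂ) ^ m) • ∑ i ∈ Finset.range (m + 1),
      (m.choose i : ℂ) • (y ^ i * x * y ^ (m - i)) := by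
  have hc : Commute (LinearMap.mulLeft ℂ y) (LinearMap.mulRight ℂ y) := by
    ext z; simp [mul_assoc]
  rw [halfAnticomm, smul_pow, hc.add_pow, LinearMap.smul_apply, LinearMap.sum_apply]
  congr 1
  refine Finset.sum_congr rfl fun i _ => ?_
  simp only [LinearMap.pow_mulLeft, LinearMap.pow_mulRight, Module.End.mul_apply,
    LinearMap.mulLeft_apply, LinearMap.mulRight_apply, Module.End.natCast_apply]
  rw [← Nat.cast_smul_eq_nsmul ℂ]
  simp [mul_assoc]

lemma list_prod_halfAnticomm_one {n : ℕ} (x : Fin n → R) (h : ∀ i j, Commute (x i) (x j)) :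
    (List.ofFn fun i => halfAnticomm (x i)).prod 1 = (List.ofFn x).prod := by
  induction n with
  | zero => simp
  | succ n ih =>
    rw [List.ofFn_succ, List.prod_cons, Module.End.mul_apply, ih _ fun i j => h _ _,
      List.ofFn_succ, List.prod_cons]
    have hc : Commute (x 0) (List.ofFn fun i : Fin n => x i.succ).prod := by
      refine Commute.list_prod_right _ _ fun y hy => ?_
      obtain ⟨i, rfl⟩ := List.mem_ofFn' .. |>.1 hy
      exact h _ _
    simp only [halfAnticomm, LinearMap.smul_apply, LinearMap.add_apply, LinearMap.mulLeft_apply,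
      LinearMap.mulRight_apply]
    rw [← hc.eq, ← two_smul ℂ, smul_smul]
    simp

/-- The Weyl ordered product of commuting `x i` and a power of `y`, if the commutators of `y` with
the `x i` are central. -/
theorem sum_perm_append_const {n m : ℕ} (x : Fin n → R) (y : R) (h : ∀ i j, Commute (x i) (x j))
    (c : Fin n → R) (hc : ∀ i z, Commute (c i) z) (hy : ∀ i, y * x i = x i * y + c i) :
    ∑ σ : Equiv.Perm (Fin (n + m)), (List.ofFn (Fin.append x (fun _ : Fin m => y) ∘ σ)).prod =
      ((n + m).factorial : ℂ) • ((2⁻¹ : ℂ) ^ m) • ∑ i ∈ Finset.range (m + 1),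
        (m.choose i : ℂ) • (y ^ i * (List.ofFn x).prod * y ^ (m - i)) := by
  have c0 : ∀ z : R, Commute (0 : R) z := fun z => Commute.zero_left z
  have cy : ∀ i, Commute (halfAnticomm y) (halfAnticomm (x i)) := fun i =>
    halfAnticomm_commute_of_central (hc i) (hy i)
  have cx : ∀ i j, Commute (halfAnticomm (x i)) (halfAnticomm (x j)) := fun i j =>
    halfAnticomm_commute_of_central c0 (by rw [(h i j).eq, add_zero])
  rw [sum_perm_prod_eq_halfAnticomm]
  · congr 1
    have e : (fun i => halfAnticomm (Fin.append x (fun _ : Fin m => y) i)) =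
        Fin.append (fun i => halfAnticomm (x i)) (fun _ : Fin m => halfAnticomm y) := by
      ext i : 1
      refine Fin.addCases (fun i => ?_) (fun i => ?_) i <;> simp
    rw [e, List.ofFn_fin_append, List.prod_append, List.ofFn_const, List.prod_replicate]
    -- The anticommutators with the coordinates are moved to act first on `1`, where they give a
    -- plain product; the powers of the anticommutator with `y` then spread over both sides of it.
    have cm : Commute (List.ofFn fun i => halfAnticomm (x i)).prod (halfAnticomm y ^ m) := by
      refine Commute.list_prod_left _ _ fun z hz => ?_
      obtain ⟨i, rfl⟩ := List.mem_ofFn' .. |>.1 hz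
      exact ((cy i).symm).pow_right m
    rw [cm.eq, Module.End.mul_apply, list_prod_halfAnticomm_one x h, halfAnticomm_pow]
  · intro i j
    refine Fin.addCases (fun i => ?_) (fun i => ?_) i <;>
      refine Fin.addCases (fun j => ?_) (fun j => ?_) j <;>
      simp only [Fin.append_left, Fin.append_right]
    · exact cx i j
    · exact (cy i).symm
    · exact cy j
    · exact Commute.refl _

/-- Polarization in the last `m` arguments of the symmetrized product. -/
theorem factorial_smul_sum_perm_append {n m : ℕ} (x : Fin n → R) (y : Fin m → R) :
    (m.factorial : ℂ) • ∑ σ : Equiv.Perm (Fin (n + m)), (List.ofFn (Fin.append x y ∘ σ)).prod =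
      ∑ S : Finset (Fin m), (-1 : ℂ) ^ S.card • ∑ σ : Equiv.Perm (Fin (n + m)),
        (List.ofFn (Fin.append x (fun _ : Fin m => ∑ i ∈ Sᶜ, y i) ∘ σ)).prod := by
  let f : MultilinearMap ℂ (fun _ : Fin (n + m) => R) R :=
    ∑ σ : Equiv.Perm (Fin (n + m)), (MultilinearMap.mkPiAlgebraFin ℂ (n + m) R).domDomCongr σ
  have hf : ∀ w, f w = ∑ σ : Equiv.Perm (Fin (n + m)), (List.ofFn (w ∘ σ)).prod := by
    intro w
    simp only [f, sum_apply, MultilinearMap.domDomCongr_apply,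
      MultilinearMap.mkPiAlgebraFin_apply]
    rfl
  -- The symmetrized product is polarized in its last `m` arguments only, the first `n` being frozen
  -- at `x`.
  let g : MultilinearMap ℂ (fun _ : Fin m => R) R :=
    MultilinearMap.currySum (f.domDomCongr finSumFinEquiv.symm) x
  have hg : ∀ v, g v = f (Fin.append x v) := by
    intro v
    simp only [g, MultilinearMap.currySum_apply, MultilinearMap.domDomCongr_apply]
    congr 1
    ext i
    refine Fin.addCases (fun i => ?_) (fun i => ?_) i <;> simp
  have h1 := MultilinearMap.sum_perm_eq_sum_diagonal g y
  -- A permutation of the last arguments is absorbed by the sum over all permutations, so the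
  -- left-hand side of the polarization formula is m! times a single value.
  have h2 : ∀ τ : Equiv.Perm (Fin m), g (y ∘ τ) = g y := by
    intro τ
    rw [hg, hg, hf, hf]
    let τ' : Equiv.Perm (Fin (n + m)) :=
      finSumFinEquiv.permCongr (Equiv.sumCongr (Equiv.refl _) τ)
    have e : Fin.append x (y ∘ τ) = Fin.append x y ∘ τ' := by
      ext i
      refine Fin.addCases (fun i => ?_) (fun i => ?_) i <;> simp [τ']
    rw [e]
    refine Fintype.sum_equiv (Equiv.mulLeft τ') _ _ fun σ => ?_
    rfl
  simp_rw [h2] at h1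
  rw [Finset.sum_const, Finset.card_univ, Fintype.card_perm, Fintype.card_fin, hg, hf] at h1
  simp_rw [hg, hf] at h1
  rw [Nat.cast_smul_eq_nsmul, h1]
  refine Finset.sum_congr rfl fun S _ => ?_
  rw [← Int.cast_smul_eq_zsmul ℂ]
  push_cast
  rfl

end SymmetrizedProducts

/-! ### Smooth dependence of integrals on parameters. -/

section ParametricIntegrals

variable {P G V : Type*} [NormedAddCommGroup P] [NormedSpace ℝ P] [NormedAddCommGroup G]
  [NormedSpace ℝ G] [MeasurableSpace G] [BorelSpace G] {ν : Measure G}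
  [NormedAddCommGroup V] [NormedSpace ℝ V]

/-- A weighted integral of a smooth function is smooth in the parameter, if the integrand is
supported in a fixed compact set. -/
theorem contDiff_integral_smul {n : ℕ∞} {f : G → ℝ} {F : P → G → V} {k : Set G} (hk : IsCompact k)
    (hFk : ∀ p y, y ∉ k → F p y = 0) (hf : LocallyIntegrable f ν) (hF : ContDiff ℝ n ↿F) :
    ContDiff ℝ n fun p => ∫ y, f y • F p y ∂ν := by
  -- The integral is the value at `0` of the convolution of `f` with the reflection of `F p`.
  have h := contDiffOn_convolution_right_with_param (μ := ν) (f := f) (n := n)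
    (ContinuousLinearMap.lsmul ℝ ℝ (E := V)) (g := fun p x => F p (-x)) (s := Set.univ) (k := -k)
    isOpen_univ hk.neg (fun p x _ hx => hFk p _ (by simpa using hx)) hf
    (by
      rw [Set.univ_prod_univ, contDiffOn_univ]
      exact hF.comp (contDiff_fst.prodMk contDiff_snd.neg))
  rw [Set.univ_prod_univ, contDiffOn_univ] at h
  have h2 := h.comp ((contDiff_id (𝕜 := ℝ) (E := P)).prodMk (contDiff_const (c := (0 : G))))
  convert h2 using 2 with p
  simp [convolution]

/-- Differentiation under a weighted integral. -/
theorem hasFDerivAt_integral_smul [CompleteSpace V] {f : G → ℝ} {F : P → G → V} {k : Set G} (hk : IsCompact k)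
    (hFk : ∀ p y, y ∉ k → F p y = 0) (hf : LocallyIntegrable f ν) (hF : ContDiff ℝ 1 ↿F) (p : P) :
    HasFDerivAt (fun p => ∫ y, f y • F p y ∂ν) (∫ y, f y • fderiv ℝ (fun q => F q y) p ∂ν) p := by
  have hF' : ContDiff ℝ 1 ↿(fun p x => F p (-x)) :=
    hF.comp (contDiff_fst.prodMk contDiff_snd.neg)
  have h := hasFDerivAt_convolution_right_with_param (μ := ν) (f := f)
    (ContinuousLinearMap.lsmul ℝ ℝ (E := V)) (g := fun p x => F p (-x)) (s := Set.univ) (k := -k)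
    isOpen_univ hk.neg (fun p x _ hx => hFk p _ (by simpa using hx)) hf
    (by rw [Set.univ_prod_univ, contDiffOn_univ]; exact hF') (p, 0) (Set.mem_univ _)
  have hl : HasFDerivAt (fun x : P => (x, (0 : G))) (ContinuousLinearMap.inl ℝ P G) p :=
    hasFDerivAt_prodMk_left p 0
  have h2 := HasFDerivAt.comp (x := p) (f := fun x : P => (x, (0 : G))) h hl
  have e1 : (fun q : P × G => (convolution f (fun x => F q.1 (-x))
      (ContinuousLinearMap.lsmul ℝ ℝ (E := V)) ν) q.2) ∘ (fun x : P => (x, (0 : G))) =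
      fun p => ∫ y, f y • F p y ∂ν := by
    ext p
    simp [convolution]
  rw [e1] at h2
  refine h2.congr_fderiv ?_
  have e2 : ∀ y, fderiv ℝ (fun q => F q y) p =
      (fderiv ℝ (↿(fun p x => F p (-x))) (p, -y)).comp (ContinuousLinearMap.inl ℝ P G) := by
    intro y
    have h3 : HasFDerivAt (↿(fun p x => F p (-x)))
      (fderiv ℝ (↿(fun p x => F p (-x))) (p, -y)) (p, -y) :=
      (hF'.differentiable one_ne_zero (p, -y)).hasFDerivAt
    have hl : HasFDerivAt (fun x : P => (x, -y)) (ContinuousLinearMap.inl ℝ P G) p :=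
      hasFDerivAt_prodMk_left p (-y)
    have h4 := HasFDerivAt.comp (x := p) (f := fun x : P => (x, -y)) h3 hl
    have e3 : (↿(fun p x => F p (-x))) ∘ (fun x : P => (x, -y)) = fun q => F q y := by
      ext q
      simp [Function.HasUncurry.uncurry]
    rw [e3] at h4
    rw [h4.fderiv]
  simp_rw [e2]
  have e4 : ContinuousLinearMap.prod (ContinuousLinearMap.id ℝ P) (0 : P →L[ℝ] G) =
    ContinuousLinearMap.inl ℝ P G := rfl
  have e5 := ((ContinuousLinearMap.compL ℝ P (P × G) V).flip
    (ContinuousLinearMap.inl ℝ P G)).integral_comp_comm (μ := ν)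
    (φ := fun y => f y • fderiv ℝ (↿(fun p x => F p (-x))) (p, -y)) ?_
  · simp only [ContinuousLinearMap.flip_apply, ContinuousLinearMap.compL_apply,
      ContinuousLinearMap.smul_comp] at e5
    rw [e5]
    simp [convolution, ContinuousLinearMap.precompR]
    rfl
  · have hc : Continuous fun y => fderiv ℝ (↿(fun p x => F p (-x))) (p, -y) :=
      (hF'.continuous_fderiv one_ne_zero).comp (by fun_prop)
    refine hf.integrable_smul_right_of_hasCompactSupport hc ?_
    refine HasCompactSupport.intro hk fun y hy => ?_
    have hn : (fun q : P × G => ↿(fun p x => F p (-x)) q) =ᶠ[𝓝 (p, -y)] fun _ => 0 := by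
      have : (Set.univ ×ˢ (-k)ᶜ : Set (P × G)) ∈ 𝓝 (p, -y) := by
        refine prod_mem_nhds univ_mem (hk.neg.isClosed.isOpen_compl.mem_nhds ?_)
        simpa using hy
      filter_upwards [this] with q hq
      exact hFk _ _ (by simpa using hq.2)
    rw [hn.fderiv_eq]
    simp

/-- Integrals over the unit interval are smooth in parameters. -/
theorem contDiff_intervalIntegral {n : ℕ∞} {F : P → ℝ → V} (hF : ContDiff ℝ n ↿F) :
    ContDiff ℝ n fun p => ∫ t in (0 : ℝ)..1, F p t := by
  -- The bump function equals 1 on [-1,1], hence on the interval of integration; it makes the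
  -- integrand compactly supported without changing the integral.
  let b : ContDiffBump (0 : ℝ) := ⟨1, 2, one_pos, one_lt_two⟩
  have h := contDiff_integral_smul (ν := volume) (f := (Set.Ioc (0 : ℝ) 1).indicator fun _ => 1)
    (F := fun p t => b t • F p t) (k := Metric.closedBall 0 2) (isCompact_closedBall _ _)
    (fun p y hy => by
      rw [b.zero_of_le_dist, zero_smul]
      simpa using (not_le.1 (by simpa using hy)).le)
    (n := n) ?_ ?_
  · convert h using 2 with p
    rw [intervalIntegral.integral_of_le zero_le_one, ← integral_indicator measurableSet_Ioc]
    refine integral_congr_ae (Eventually.of_forall fun t => ?_)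
    by_cases ht : t ∈ Set.Ioc (0 : ℝ) 1
    · have : b t = 1 := b.one_of_mem_closedBall (by
        simp only [Metric.mem_closedBall, dist_zero_right, Real.norm_eq_abs, b]
        rw [abs_of_pos ht.1]
        exact ht.2)
      simp [ht, this]
    · simp [ht]
  · refine Integrable.locallyIntegrable ?_
    rw [integrable_indicator_iff measurableSet_Ioc]
    exact integrableOn_const (by simp)
  · exact (b.contDiff.comp contDiff_snd).smul hF

end ParametricIntegrals

/-! ### Linear transport equations: existence and smooth dependence on parameters. -/

section LinearTransport

variable {𝔸 : Type*} [NormedRing 𝔸] [NormedAlgebra ℝ 𝔸] [CompleteSpace 𝔸]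

/-- The terms of the time-ordered exponential series. -/
noncomputable def dysonTerm (M : ℝ → 𝔸) : ℕ → ℝ → 𝔸
  | 0, _ => 1
  | n + 1, t => ∫ s in (0 : ℝ)..t, M s * dysonTerm M n s

lemma dysonTerm_hasDerivAt {M : ℝ → 𝔸} (hM : Continuous M) (n : ℕ) (t : ℝ) :
    HasDerivAt (dysonTerm M (n + 1)) (M t * dysonTerm M n t) t := by
  induction n generalizing t with
  | zero =>
    exact (hM.mul continuous_const).integral_hasStrictDerivAt 0 t |>.hasDerivAt
  | succ n ih =>
    have hc : Continuous (dysonTerm M (n + 1)) :=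
      continuous_iff_continuousAt.2 fun t => (ih t).continuousAt
    exact (hM.mul hc).integral_hasStrictDerivAt 0 t |>.hasDerivAt

lemma dysonTerm_zero (M : ℝ → 𝔸) (n : ℕ) : dysonTerm M (n + 1) 0 = 0 := by
  simp [dysonTerm]

/-- Each iterated integration of a constant bound adds a factor C|t|/n, which gives the terms of an
exponential series; no smallness of the time interval is needed. -/
lemma norm_dysonTerm_le {M : ℝ → 𝔸} {T C : ℝ}
    (hC : ∀ t, |t| ≤ T → ‖M t‖ ≤ C) (n : ℕ) (t : ℝ) (ht : |t| ≤ T) :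
    ‖dysonTerm M n t‖ ≤ (C * |t|) ^ n / n.factorial * ‖(1 : 𝔸)‖ := by
  have hC0 : 0 ≤ C := (norm_nonneg _).trans (hC 0 (by simpa using (abs_nonneg t).trans ht))
  induction n generalizing t with
  | zero => simp [dysonTerm]
  | succ n ih =>
    have key : ∀ s, |s| ≤ |t| → ‖M s * dysonTerm M n s‖ ≤
        C * ((C * |s|) ^ n / n.factorial * ‖(1 : 𝔸)‖) := fun s hs =>
      (norm_mul_le _ _).trans (mul_le_mul (hC s (hs.trans ht)) (ih s (hs.trans ht))
        (norm_nonneg _) hC0)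
    have hI : ∀ t : ℝ, 0 ≤ t → ∫ s in (0 : ℝ)..t, C * ((C * |s|) ^ n / n.factorial * ‖(1 : 𝔸)‖) =
        (C * |t|) ^ (n + 1) / (n + 1).factorial * ‖(1 : 𝔸)‖ := by
      intro t ht
      have : ∫ s in (0 : ℝ)..t, C * ((C * |s|) ^ n / n.factorial * ‖(1 : 𝔸)‖) =
          ∫ s in (0 : ℝ)..t, (C ^ (n + 1) / n.factorial * ‖(1 : 𝔸)‖) * s ^ n := by
        refine intervalIntegral.integral_congr fun s hs => ?_
        rw [Set.uIcc_of_le ht] at hs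
        simp only [abs_of_nonneg hs.1]
        ring
      rw [this, intervalIntegral.integral_const_mul, integral_pow, abs_of_nonneg ht,
        Nat.factorial_succ]
      push_cast
      field_simp
      ring
    rcases le_total 0 t with h0 | h0
    · rw [dysonTerm, ← hI t h0]
      refine intervalIntegral.norm_integral_le_of_norm_le h0 (Eventually.of_forall fun s hs => ?_) ?_
      · exact key s (by rw [abs_of_pos hs.1, abs_of_nonneg h0]; exact hs.2)
      · exact Continuous.intervalIntegrable (by fun_prop) _ _
    · rw [dysonTerm, ← abs_neg t, ← hI (-t) (by linarith), intervalIntegral.integral_symm, norm_neg,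
        ← neg_zero, ← intervalIntegral.integral_comp_neg]
      simp only [neg_zero]
      refine intervalIntegral.norm_integral_le_of_norm_le h0 (Eventually.of_forall fun s hs => ?_) ?_
      · rw [abs_neg]
        exact key s (by rw [abs_of_nonpos hs.2, abs_of_nonpos h0]; linarith [hs.1])
      · exact Continuous.intervalIntegrable (by fun_prop) _ _

/-- Global existence for linear transport equations. -/
theorem exists_linear_transport {M : ℝ → 𝔸} (hM : Continuous M) :
    ∃ u : ℝ → 𝔸, u 0 = 1 ∧ ∀ t, HasDerivAt u (M t * u t) t := by
  have hbound : ∀ T : ℝ, ∃ C, 0 ≤ C ∧ ∀ t, |t| ≤ T → ‖M t‖ ≤ C := by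
    intro T
    obtain ⟨C, hC⟩ := (isCompact_Icc (a := -T) (b := T)).exists_bound_of_continuousOn hM.continuousOn
    exact ⟨max C 0, le_max_right _ _, fun t ht => (hC t (abs_le.1 ht)).trans (le_max_left _ _)⟩
  have hsum : ∀ t, Summable fun n => dysonTerm M n t := by
    intro t
    obtain ⟨C, hC0, hC⟩ := hbound |t|
    exact Summable.of_norm_bounded ((Real.summable_pow_div_factorial (C * |t|)).mul_right ‖(1 : 𝔸)‖)
      fun n => norm_dysonTerm_le hC n t le_rfl
  refine ⟨fun t => ∑' n, dysonTerm M n t, ?_, fun t => ?_⟩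
  · beta_reduce
    rw [tsum_eq_single 0]
    · rfl
    · intro n hn
      obtain ⟨k, rfl⟩ := Nat.exists_eq_succ_of_ne_zero hn
      exact dysonTerm_zero M k
  -- The derivative of term n + 1 is M times term n. With the constant term split off, the
  -- differentiated series is M times the full series.
  · have e : (fun t => ∑' n, dysonTerm M n t) = fun t => 1 + ∑' n, dysonTerm M (n + 1) t := by
      ext t
      rw [(hsum t).tsum_eq_zero_add]
      rfl
    obtain ⟨C, hC0, hC⟩ := hbound (|t| + 1)
    have hT : 0 ≤ |t| + 1 := by positivity
    have h := hasDerivAt_tsum_of_isPreconnected (𝕜 := ℝ) (g := fun n => dysonTerm M (n + 1))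
      (g' := fun n t => M t * dysonTerm M n t)
      (u := fun n => C * ((C * (|t| + 1)) ^ n / n.factorial * ‖(1 : 𝔸)‖))
      (t := Metric.ball 0 (|t| + 1)) (y₀ := 0) (y := t)
      (((Real.summable_pow_div_factorial _).mul_right _).mul_left _) Metric.isOpen_ball
      (convex_ball _ _).isPreconnected (fun n y _ => dysonTerm_hasDerivAt hM n y)
      (fun n y hy => ?_) (Metric.mem_ball_self (by positivity)) ?_ (by simp)
    · rw [(hsum t).tsum_mul_left] at h
      have h' := h.const_add (1 : 𝔸)
      rw [← e] at h'
      exact h'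
    · have hy' : |y| ≤ |t| + 1 := by
        simpa using (Metric.mem_ball.1 hy).le
      refine (norm_mul_le _ _).trans (mul_le_mul (hC y hy') ?_ (norm_nonneg _) hC0)
      refine (norm_dysonTerm_le hC n y hy').trans ?_
      gcongr
    · exact (summable_nat_add_iff 1).2 (hsum 0)

/-- Duhamel's formula. -/
lemma transport_sub_eq {M M' U V U' : ℝ → 𝔸} (hM : Continuous M) (hM' : Continuous M')
    (hU' : ∀ t, HasDerivAt U' (M' t * U' t) t) (hV : ∀ t, HasDerivAt V (-(V t * M t)) t)
    (hU'0 : U' 0 = 1) (hV0 : V 0 = 1) (hUV : U 1 * V 1 = 1) :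
    U' 1 - U 1 = U 1 * ∫ t in (0 : ℝ)..1, V t * (M' t - M t) * U' t := by
  have hd : ∀ t, HasDerivAt (fun t => V t * U' t) (V t * (M' t - M t) * U' t) t := by
    intro t
    refine ((hV t).mul (hU' t)).congr_deriv ?_
    noncomm_ring
  have hcV : Continuous V := continuous_iff_continuousAt.2 fun t => (hV t).continuousAt
  have hcU : Continuous U' := continuous_iff_continuousAt.2 fun t => (hU' t).continuousAt
  rw [intervalIntegral.integral_eq_sub_of_hasDerivAt (fun t _ => hd t)
    (Continuous.intervalIntegrable (by fun_prop) _ _), hU'0, hV0, mul_sub, ← mul_assoc, hUV]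
  simp

/-- Carathéodory's criterion: a slope operator that is continuous at the base point is the
derivative there. It turns Duhamel's formula into differentiability. -/
lemma hasFDerivAt_of_continuousAt_slope {P F : Type*} [NormedAddCommGroup P] [NormedSpace ℝ P]
    [NormedAddCommGroup F] [NormedSpace ℝ F] {f : P → F} {x : P} {Ψ : P → P →L[ℝ] F}
    (hΨ : ContinuousAt Ψ x) (h : ∀ y, f y - f x = Ψ y (y - x)) : HasFDerivAt f (Ψ x) x := by
  rw [hasFDerivAt_iff_isLittleO, Asymptotics.isLittleO_iff]
  intro c hc
  have := Metric.continuousAt_iff'.1 hΨ c hc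
  filter_upwards [this] with y hy
  rw [h y, ← sub_apply]
  refine (ContinuousLinearMap.le_opNorm _ _).trans ?_
  gcongr
  rw [← dist_eq_norm]
  exact hy.le

/-- The solution of a linear transport equation depends smoothly on parameters; the finite order
version. -/
theorem contDiff_transport_nat (n : ℕ) : ∀ (P : Type*) [NormedAddCommGroup P] [NormedSpace ℝ P]
    (M U V : P → ℝ → 𝔸), ContDiff ℝ ∞ ↿M →
    (∀ p t, HasDerivAt (U p) (M p t * U p t) t) → (∀ p t, HasDerivAt (V p) (-(V p t * M p t)) t) →
    (∀ p, U p 0 = 1) → (∀ p, V p 0 = 1) → (∀ p t, U p t * V p t = 1) →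
    (∀ p t, V p t * U p t = 1) → (∀ p t, ‖U p t‖ ≤ 1) → (∀ p t, ‖V p t‖ ≤ 1) →
    ContDiff ℝ n fun p => U p 1 := by
  have hMc : ∀ {P : Type _} [NormedAddCommGroup P] [NormedSpace ℝ P] {M : P → ℝ → 𝔸},
      ContDiff ℝ ∞ ↿M → ∀ p, Continuous (M p) := fun hM p =>
    hM.continuous.comp (Continuous.prodMk_right p)
  induction n with
  | zero =>
    intro P _ _ M U V hM hU hV hU0 hV0 hUV hVU hUn hVn
    rw [Nat.cast_zero, contDiff_zero, continuous_iff_continuousAt]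
    intro p
    have hI : Continuous fun q => ∫ t in (0 : ℝ)..1, ‖M q t - M p t‖ := by
      refine intervalIntegral.continuous_parametric_intervalIntegral_of_continuous' ?_ _ _
      exact (hM.continuous.sub ((hMc hM p).comp continuous_snd)).norm
    have hI0 : Tendsto (fun q => ∫ t in (0 : ℝ)..1, ‖M q t - M p t‖) (𝓝 p) (𝓝 0) := by
      have := hI.tendsto p
      simpa using this
    rw [ContinuousAt, tendsto_iff_norm_sub_tendsto_zero]
    -- By Duhamel's formula and the unit bounds on the propagators, the difference of the solutions
    -- is at most the integral of the difference of the generators.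
    refine squeeze_zero (fun _ => norm_nonneg _) (fun q => ?_) hI0
    rw [transport_sub_eq (hMc hM p) (hMc hM q) (hU q) (hV p) (hU0 q) (hV0 p) (hUV p 1)]
    refine (norm_mul_le _ _).trans ?_
    have h1 : ‖∫ t in (0 : ℝ)..1, V p t * (M q t - M p t) * U q t‖ ≤
        ∫ t in (0 : ℝ)..1, ‖M q t - M p t‖ := by
      refine intervalIntegral.norm_integral_le_of_norm_le zero_le_one
        (Eventually.of_forall fun t _ => ?_) ?_
      · refine (norm_mul_le _ _).trans ?_
        refine (mul_le_of_le_one_right (norm_nonneg _) (hUn q t)).trans ?_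
        refine (norm_mul_le _ _).trans ?_
        exact mul_le_of_le_one_left (norm_nonneg _) (hVn p t)
      · exact Continuous.intervalIntegrable (((hMc hM q).sub (hMc hM p)).norm) _ _
    exact (mul_le_of_le_one_left (norm_nonneg _) (hUn p 1)).trans h1
  | succ n ih =>
    intro P _ _ M U V hM hU hV hU0 hV0 hUV hVU hUn hVn
    -- The induction hypothesis is applied with parameter space P × ℝ: rescaling time by the new
    -- parameter makes the value at time 1 the value at an arbitrary time. Hence the parameter space
    -- must be quantified inside the induction.
    have hUs : ContDiff ℝ n fun q : P × ℝ => U q.1 q.2 := by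
      have h := ih (P × ℝ) (fun q r => q.2 • M q.1 (q.2 * r)) (fun q r => U q.1 (q.2 * r))
        (fun q r => V q.1 (q.2 * r)) ?_ ?_ ?_ ?_ ?_ ?_ ?_ ?_ ?_
      · simpa using h
      · have : ContDiff ℝ ∞ fun z : (P × ℝ) × ℝ => (z.1.1, z.1.2 * z.2) := by fun_prop
        exact ContDiff.smul (by fun_prop) (hM.comp this)
      · intro q r
        have h1 : HasDerivAt (fun r => q.2 * r) q.2 r := by
          simpa using (hasDerivAt_id r).const_mul q.2
        refine ((hU q.1 (q.2 * r)).scomp r h1).congr_deriv ?_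
        simp
      · intro q r
        have h1 : HasDerivAt (fun r => q.2 * r) q.2 r := by
          simpa using (hasDerivAt_id r).const_mul q.2
        refine ((hV q.1 (q.2 * r)).scomp r h1).congr_deriv ?_
        simp
      · intro q; simp [hU0]
      · intro q; simp [hV0]
      · intro q r; exact hUV _ _
      · intro q r; exact hVU _ _
      · intro q r; exact hUn _ _
      · intro q r; exact hVn _ _
    -- `V` is the pointwise inverse of `U`, and inversion is smooth at units.
    have hVs : ContDiff ℝ n fun q : P × ℝ => V q.1 q.2 := by
      have e : (fun q : P × ℝ => V q.1 q.2) = fun q => Ring.inverse (U q.1 q.2) := by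
        ext q
        have hu : IsUnit (U q.1 q.2) := ⟨⟨_, _, hUV q.1 q.2, hVU q.1 q.2⟩, rfl⟩
        have h1 := Ring.inverse_mul_cancel _ hu
        calc V q.1 q.2 = (Ring.inverse (U q.1 q.2) * U q.1 q.2) * V q.1 q.2 := by rw [h1, one_mul]
          _ = _ := by rw [mul_assoc, hUV, mul_one]
      rw [e, contDiff_iff_contDiffAt]
      intro q
      have := contDiffAt_ringInverse (n := n) ℝ
        (⟨U q.1 q.2, V q.1 q.2, hUV q.1 q.2, hVU q.1 q.2⟩ : 𝔸ˣ)
      exact this.comp (x := q) (f := fun q : P × ℝ => U q.1 q.2) hUs.contDiffAt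
    -- the slope of `M` in the parameter
    let D : P → ℝ → P →L[ℝ] 𝔸 := fun p t => fderiv ℝ (fun q => M q t) p
    have hD : ContDiff ℝ ∞ ↿D := by
      have h1 : ContDiff ℝ ∞ (Function.uncurry fun (z : P × ℝ) (q : P) => M q z.2) := by
        exact hM.comp (contDiff_snd.prodMk (contDiff_snd.comp contDiff_fst))
      exact h1.fderiv (g := fun z : P × ℝ => z.1) contDiff_fst (by simp)
    -- Hadamard's lemma: the averaged derivative is a smooth slope of the generator.
    let R : P × P → ℝ → P →L[ℝ] 𝔸 := fun q t => ∫ r in (0 : ℝ)..1, D (q.1 + r • (q.2 - q.1)) t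
    have hR : ContDiff ℝ ∞ ↿R := by
      have h1 := contDiff_intervalIntegral (n := ⊤)
        (F := fun (z : (P × P) × ℝ) r => D (z.1.1 + r • (z.1.2 - z.1.1)) z.2) ?_
      · exact h1
      · have : ContDiff ℝ ∞ fun z : ((P × P) × ℝ) × ℝ =>
          (z.1.1.1 + z.2 • (z.1.1.2 - z.1.1.1), z.1.2) := by fun_prop
        exact hD.comp this
    have hRM : ∀ p q t, M q t - M p t = R (p, q) t (q - p) := by
      intro p q t
      have hc : Continuous fun r : ℝ => D (p + r • (q - p)) t :=
        hD.continuous.comp (by fun_prop : Continuous fun r : ℝ => (p + r • (q - p), t))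
      have h1 : ∀ r : ℝ, HasDerivAt (fun r : ℝ => M (p + r • (q - p)) t)
          (D (p + r • (q - p)) t (q - p)) r := by
        intro r
        have h2 : HasFDerivAt (fun q => M q t) (D (p + r • (q - p)) t) (p + r • (q - p)) := by
          refine DifferentiableAt.hasFDerivAt ?_
          have : ContDiff ℝ ∞ fun q => M q t := hM.comp (contDiff_id.prodMk contDiff_const)
          exact this.differentiable (by simp) _
        have h3 : HasDerivAt (fun r : ℝ => p + r • (q - p)) (q - p) r := by
          simpa using ((hasDerivAt_id r).smul_const (q - p)).const_add p
        exact h2.comp_hasDerivAt r h3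
      have h2 := intervalIntegral.integral_eq_sub_of_hasDerivAt (a := 0) (b := 1)
        (fun r _ => h1 r) (Continuous.intervalIntegrable (by fun_prop) _ _)
      simp only [R]
      rw [ContinuousLinearMap.intervalIntegral_apply (hc.intervalIntegrable _ _), h2]
      simp
    -- Duhamel's formula with the slope inserted for the difference of generators gives a slope of
    -- the solution, of class C^n by the induction hypothesis. Its diagonal is the derivative, so
    -- the solution is of class C^{n+1}.
    let Ψ : P × P → P →L[ℝ] 𝔸 := fun q => ∫ t in (0 : ℝ)..1,
      (ContinuousLinearMap.mulLeftRight ℝ 𝔸 (U q.1 1 * V q.1 t) (U q.2 t)).comp (R q t)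
    have hΨ : ContDiff ℝ n Ψ := by
      refine contDiff_intervalIntegral (n := n) ?_
      have hR' : ContDiff ℝ n ↿R := hR.of_le (by exact_mod_cast le_top)
      have a1 : ContDiff ℝ n fun z : (P × P) × ℝ => U z.1.1 1 :=
        hUs.comp (by fun_prop : ContDiff ℝ n fun z : (P × P) × ℝ => (z.1.1, (1 : ℝ)))
      have a2 : ContDiff ℝ n fun z : (P × P) × ℝ => V z.1.1 z.2 :=
        hVs.comp (by fun_prop : ContDiff ℝ n fun z : (P × P) × ℝ => (z.1.1, z.2))
      have a3 : ContDiff ℝ n fun z : (P × P) × ℝ => U z.1.2 z.2 :=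
        hUs.comp (by fun_prop : ContDiff ℝ n fun z : (P × P) × ℝ => (z.1.2, z.2))
      have a4 : ContDiff ℝ n fun z : (P × P) × ℝ =>
          ContinuousLinearMap.mulLeftRight ℝ 𝔸 (U z.1.1 1 * V z.1.1 z.2) (U z.1.2 z.2) :=
        ((ContinuousLinearMap.contDiff _).comp (a1.mul a2)).clm_apply a3
      exact a4.clm_comp hR'
    have hslope : ∀ p q, U q 1 - U p 1 = Ψ (p, q) (q - p) := by
      intro p q
      have hc : Continuous fun t => (ContinuousLinearMap.mulLeftRight ℝ 𝔸 (U p 1 * V p t)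
          (U q t)).comp (R (p, q) t) := by
        have b1 : Continuous (V p) := continuous_iff_continuousAt.2 fun t => (hV p t).continuousAt
        have b2 : Continuous (U q) := continuous_iff_continuousAt.2 fun t => (hU q t).continuousAt
        have b3 : Continuous fun t => R (p, q) t :=
          hR.continuous.comp (by fun_prop : Continuous fun t : ℝ => ((p, q), t))
        have b4 : Continuous fun t => ContinuousLinearMap.mulLeftRight ℝ 𝔸 (U p 1 * V p t)
          (U q t) := ((ContinuousLinearMap.continuous _).comp (continuous_const.mul b1)).clm_apply b2
        exact b4.clm_comp b3
      simp only [Ψ]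
      rw [ContinuousLinearMap.intervalIntegral_apply (hc.intervalIntegrable _ _),
        transport_sub_eq (hMc hM p) (hMc hM q) (hU q) (hV p) (hU0 q) (hV0 p) (hUV p 1),
        ← ContinuousLinearMap.mul_apply' ℝ 𝔸, ← ContinuousLinearMap.intervalIntegral_comp_comm]
      · refine intervalIntegral.integral_congr fun t _ => ?_
        simp only [ContinuousLinearMap.comp_apply, ContinuousLinearMap.mulLeftRight_apply, ← hRM,
          ContinuousLinearMap.mul_apply', mul_assoc]
      · have b1 : Continuous (V p) := continuous_iff_continuousAt.2 fun t => (hV p t).continuousAt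
        have b2 : Continuous (U q) := continuous_iff_continuousAt.2 fun t => (hU q t).continuousAt
        exact ((b1.mul ((hMc hM q).sub (hMc hM p))).mul b2).intervalIntegrable _ _
    have hder : ∀ p, HasFDerivAt (fun p => U p 1) (Ψ (p, p)) p := fun p =>
      hasFDerivAt_of_continuousAt_slope (Ψ := fun q => Ψ (p, q))
        ((hΨ.continuous.comp (Continuous.prodMk_right p)).continuousAt) fun q => hslope p q
    rw [Nat.cast_succ, contDiff_succ_iff_fderiv]
    refine ⟨fun p => (hder p).differentiableAt, by simp, ?_⟩
    have : fderiv ℝ (fun p => U p 1) = fun p => Ψ (p, p) := by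
      ext1 p
      exact (hder p).fderiv
    rw [this]
    exact hΨ.comp (contDiff_id.prodMk contDiff_id)

end LinearTransport

/-! ### Hermitian gauge potentials and Wilson lines. -/

/-- A smooth Hermitian gauge potential. -/
def IsHermitianField {N : ℕ} (A : GaugeField N) : Prop :=
  ∀ μ, SmoothMat (A μ) ∧ ∀ x, (A μ x).IsHermitian

lemma IsGaugeField.isHermitianField {N : ℕ} {𝒢 : Subgroup (Matrix.unitaryGroup (Fin N) ℂ)}
    {A : GaugeField N} (h : IsGaugeField 𝒢 A) : IsHermitianField A :=
  fun μ => ⟨(h μ).1, fun x => ((h μ).2 x).1⟩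

/-- The component of the gauge potential along `b`. -/
noncomputable def gaugeDir {N : ℕ} (A : GaugeField N) (b x : Spacetime) :
    Matrix (Fin N) (Fin N) ℂ :=
  ∑ μ, ((b μ : ℝ) : ℂ) • A μ x

section WilsonLines

open scoped Matrix.Norms.L2Operator

variable {N : ℕ}

/-- The matrix entry as a continuous linear map. -/
noncomputable def entryCLM (i j : Fin N) : Matrix (Fin N) (Fin N) ℂ →L[ℝ] ℂ :=
  LinearMap.toContinuousLinearMap (Matrix.entryLinearMap ℝ ℂ i j)

@[simp] lemma entryCLM_apply (i j : Fin N) (M : Matrix (Fin N) (Fin N) ℂ) :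
    entryCLM i j M = M i j := rfl

lemma matrix_eq_sum_smul_single (M : Matrix (Fin N) (Fin N) ℂ) :
    M = ∑ i, ∑ j, M i j • Matrix.single i j (1 : ℂ) := by
  conv_lhs => rw [Matrix.matrix_eq_sum_single M]
  simp [Matrix.smul_single]

lemma hasDerivAt_matrix_iff {u : ℝ → Matrix (Fin N) (Fin N) ℂ} {u' : Matrix (Fin N) (Fin N) ℂ}
    {t : ℝ} : HasDerivAt u u' t ↔ ∀ i j, HasDerivAt (fun τ => u τ i j) (u' i j) t := by
  constructor
  · intro h i j
    exact (entryCLM i j).hasFDerivAt.comp_hasDerivAt t h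
  · intro h
    have e : u = fun τ => ∑ i, ∑ j, u τ i j • Matrix.single i j (1 : ℂ) := by
      ext1 τ
      exact matrix_eq_sum_smul_single _
    rw [e, matrix_eq_sum_smul_single u']
    refine HasDerivAt.fun_sum fun i _ => HasDerivAt.fun_sum fun j _ => ?_
    exact (h i j).smul_const _

lemma contDiff_matrix_iff {P : Type*} [NormedAddCommGroup P] [NormedSpace ℝ P] {n : WithTop ℕ∞}
    {u : P → Matrix (Fin N) (Fin N) ℂ} :
    ContDiff ℝ n u ↔ ∀ i j, ContDiff ℝ n (fun τ => u τ i j) := by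
  constructor
  · intro h i j
    exact (entryCLM i j).contDiff.comp h
  · intro h
    have e : u = fun τ => ∑ i, ∑ j, u τ i j • Matrix.single i j (1 : ℂ) := by
      ext1 τ
      exact matrix_eq_sum_smul_single _
    rw [e]
    refine ContDiff.sum fun i _ => ContDiff.sum fun j _ => ?_
    exact (h i j).smul contDiff_const

/-- The generator of the transport along the straight path from `x` to `w`. -/
noncomputable def transportGen (A : GaugeField N) (w x : Spacetime) (t : ℝ) :
    Matrix (Fin N) (Fin N) ℂ :=
  Complex.I • gaugeDir A (w - x) (x + t • (w - x))

lemma isTransport_iff {A : GaugeField N} {w x : Spacetime} {u : ℝ → Matrix (Fin N) (Fin N) ℂ} :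
    IsTransport A w x u ↔ u 0 = 1 ∧ ∀ t, HasDerivAt u (transportGen A w x t * u t) t := by
  have e : ∀ t, ∑ μ, (Complex.I * ((w - x) μ : ℝ)) • (A μ (x + t • (w - x)) * u t) =
      transportGen A w x t * u t := by
    intro t
    simp only [transportGen, gaugeDir, Finset.smul_sum, Finset.sum_mul, smul_mul_assoc, smul_smul]
  simp only [IsTransport, hasDerivAt_matrix_iff, e]

variable {A : GaugeField N}

lemma IsHermitianField.star_gaugeDir (hA : IsHermitianField A) (b x : Spacetime) :
    star (gaugeDir A b x) = gaugeDir A b x := by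
  simp only [gaugeDir, star_sum, star_smul]
  refine Finset.sum_congr rfl fun μ _ => ?_
  rw [Matrix.star_eq_conjTranspose, ((hA μ).2 x).eq]
  simp

/-- Of the Lie algebra condition only Hermiticity enters the analysis: it makes the generator
skew-adjoint, hence the transport unitary. -/
lemma IsHermitianField.star_transportGen (hA : IsHermitianField A) (w x : Spacetime) (t : ℝ) :
    star (transportGen A w x t) = -transportGen A w x t := by
  simp [transportGen, star_smul, hA.star_gaugeDir]

lemma IsHermitianField.contDiff_gaugeDir (hA : IsHermitianField A) :
    ContDiff ℝ ∞ fun z : Spacetime × Spacetime => gaugeDir A z.1 z.2 := by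
  unfold gaugeDir
  refine ContDiff.sum fun μ _ => ?_
  have h1 : ContDiff ℝ ∞ fun z : Spacetime × Spacetime => ((z.1 μ : ℝ) : ℂ) := by
    have : ContDiff ℝ ∞ fun z : Spacetime × Spacetime => z.1 μ := by fun_prop
    exact Complex.ofRealCLM.contDiff.comp this
  have h2 : ContDiff ℝ ∞ fun z : Spacetime × Spacetime => A μ z.2 :=
    (contDiff_matrix_iff.2 (hA μ).1).comp contDiff_snd
  exact h1.smul h2

lemma IsHermitianField.contDiff_transportGen (hA : IsHermitianField A) :
    ContDiff ℝ ∞ fun z : (Spacetime × Spacetime) × ℝ => transportGen A z.1.1 z.1.2 z.2 := by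
  have := hA.contDiff_gaugeDir.comp (by fun_prop : ContDiff ℝ ∞ fun z : (Spacetime × Spacetime) × ℝ
    => (z.1.1 - z.1.2, z.1.2 + z.2 • (z.1.1 - z.1.2)))
  exact this.const_smul Complex.I

lemma IsHermitianField.exists_isTransport (hA : IsHermitianField A) (w x : Spacetime) :
    ∃ u, IsTransport A w x u := by
  have hp : Continuous fun t : ℝ => ((w, x), t) := by fun_prop
  have h1 : Continuous fun z : (Spacetime × Spacetime) × ℝ => transportGen A z.1.1 z.1.2 z.2 :=
    hA.contDiff_transportGen.continuous
  have : Continuous fun t => transportGen A w x t :=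
    Continuous.comp (g := fun z : (Spacetime × Spacetime) × ℝ => transportGen A z.1.1 z.1.2 z.2)
      (f := fun t : ℝ => ((w, x), t)) h1 hp
  obtain ⟨u, hu⟩ := exists_linear_transport this
  exact ⟨u, isTransport_iff.2 hu⟩

lemma IsTransport.hasDerivAt_star (hA : IsHermitianField A) {w x : Spacetime}
    {u : ℝ → Matrix (Fin N) (Fin N) ℂ} (h : IsTransport A w x u) (t : ℝ) :
    HasDerivAt (fun t => star (u t)) (-(star (u t) * transportGen A w x t)) t := by
  refine (((isTransport_iff.1 h).2 t).star).congr_deriv ?_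
  rw [star_mul, hA.star_transportGen, mul_neg]

/-- For a skew-adjoint generator u*v is constant. With u = v this is unitarity, and for two
solutions it gives uniqueness. -/
lemma IsTransport.star_mul_eq_one (hA : IsHermitianField A) {w x : Spacetime}
    {u v : ℝ → Matrix (Fin N) (Fin N) ℂ} (hu : IsTransport A w x u) (hv : IsTransport A w x v)
    (t : ℝ) : star (u t) * v t = 1 := by
  have hd : ∀ t, HasDerivAt (fun t => star (u t) * v t) 0 t := by
    intro t
    refine ((hu.hasDerivAt_star hA t).mul ((isTransport_iff.1 hv).2 t)).congr_deriv ?_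
    noncomm_ring
  have h := is_const_of_deriv_eq_zero (fun t => (hd t).differentiableAt) (fun t => (hd t).deriv) t 0
  simpa [hu.1, hv.1] using h

lemma IsTransport.unique (hA : IsHermitianField A) {w x : Spacetime}
    {u v : ℝ → Matrix (Fin N) (Fin N) ℂ} (hu : IsTransport A w x u) (hv : IsTransport A w x v) :
    u = v := by
  ext1 t
  have h1 := hu.star_mul_eq_one hA hv t
  have h2 := mul_eq_one_comm.1 (hu.star_mul_eq_one hA hu t)
  calc u t = u t * (star (u t) * v t) := by rw [h1, mul_one]
    _ = v t := by rw [← mul_assoc, h2, one_mul]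

lemma IsTransport.wilsonLine_eq (hA : IsHermitianField A) {w x : Spacetime}
    {u : ℝ → Matrix (Fin N) (Fin N) ℂ} (hu : IsTransport A w x u) : wilsonLine A w x = u 1 := by
  have h : ∃ u, IsTransport A w x u := ⟨u, hu⟩
  rw [wilsonLine, dif_pos h, IsTransport.unique hA h.choose_spec hu]

lemma IsHermitianField.wilsonLine_mem_unitary (hA : IsHermitianField A) (w x : Spacetime) :
    wilsonLine A w x ∈ Matrix.unitaryGroup (Fin N) ℂ := by
  obtain ⟨u, hu⟩ := hA.exists_isTransport w x
  rw [hu.wilsonLine_eq hA, Matrix.mem_unitaryGroup_iff']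
  exact hu.star_mul_eq_one hA hu 1

/-- This bound depends neither on the distance nor on the gauge field. It lets Wilson lines be
inserted into absolutely convergent integrals, uniformly over rescaled backgrounds. -/
lemma IsHermitianField.norm_wilsonLine_le (hA : IsHermitianField A) (w x : Spacetime)
    (i j : Fin N) : ‖wilsonLine A w x i j‖ ≤ 1 :=
  entry_norm_bound_of_unitary (hA.wilsonLine_mem_unitary w x) i j

lemma norm_le_one_of_star_mul_self {u : Matrix (Fin N) (Fin N) ℂ} (h : star u * u = 1) :
    ‖u‖ ≤ 1 := by
  rcases subsingleton_or_nontrivial (Matrix (Fin N) (Fin N) ℂ) with h0 | h0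
  · rw [Subsingleton.elim u 0, norm_zero]
    exact zero_le_one
  · exact (CStarRing.norm_of_mem_unitary (Unitary.mem_iff.2 ⟨h, mul_eq_one_comm.1 h⟩)).le

/-- Wilson lines depend smoothly on the end points. -/
theorem IsHermitianField.contDiff_wilsonLine (hA : IsHermitianField A) (i j : Fin N) :
    ContDiff ℝ ∞ fun z : Spacetime × Spacetime => wilsonLine A z.1 z.2 i j := by
  choose U hU using fun z : Spacetime × Spacetime => hA.exists_isTransport z.1 z.2
  have hss : ∀ z t, star (U z t) * U z t = 1 := fun z t => (hU z).star_mul_eq_one hA (hU z) t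
  have h : ContDiff ℝ ∞ fun z : Spacetime × Spacetime => wilsonLine A z.1 z.2 := by
    rw [contDiff_infty]
    intro n
    have := contDiff_transport_nat n (Spacetime × Spacetime)
      (fun z => transportGen A z.1 z.2) U (fun z t => star (U z t)) hA.contDiff_transportGen
      (fun z t => (isTransport_iff.1 (hU z)).2 t) (fun z t => (hU z).hasDerivAt_star hA t)
      (fun z => (hU z).1) (fun z => by simp [(hU z).1])
      (fun z t => mul_eq_one_comm.1 (hss z t)) hss
      (fun z t => norm_le_one_of_star_mul_self (hss z t))
      (fun z t => by rw [norm_star]; exact norm_le_one_of_star_mul_self (hss z t))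
    have e : (fun z : Spacetime × Spacetime => wilsonLine A z.1 z.2) = fun z => U z 1 :=
      funext fun z => (hU z).wilsonLine_eq hA
    rw [e]
    exact this
  exact contDiff_matrix_iff.1 h i j

/-- The straight path to `x + t • b` is a reparametrized piece of the line through `x` in direction
`b`. So one solution of the transport equation describes all Wilson lines along this line, and they
can be differentiated in `t`. -/
lemma IsTransport.wilsonLine_path (hA : IsHermitianField A) {b x : Spacetime}
    {u : ℝ → Matrix (Fin N) (Fin N) ℂ} (hu : IsTransport A (x + b) x u) (t : ℝ) :
    wilsonLine A (x + t • b) x = u t := by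
  have h : IsTransport A (x + t • b) x fun r => u (t * r) := by
    rw [isTransport_iff]
    refine ⟨by simpa using hu.1, fun r => ?_⟩
    have h1 : HasDerivAt (fun r => t * r) t r := by
      simpa using (hasDerivAt_id r).const_mul t
    refine (((isTransport_iff.1 hu).2 (t * r)).scomp r h1).congr_deriv ?_
    simp only [transportGen, gaugeDir, add_sub_cancel_left, PiLp.smul_apply, smul_eq_mul,
      smul_mul_assoc, smul_comm t Complex.I]
    congr 1
    rw [← smul_mul_assoc, Finset.smul_sum]
    congr 1
    refine Finset.sum_congr rfl fun μ _ => ?_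
    rw [smul_smul r t b, mul_comm r t, ← smul_smul t r b, Complex.ofReal_mul, mul_smul,
      Complex.coe_smul, Complex.coe_smul]
  rw [h.wilsonLine_eq hA, mul_one]

/-- The reversed path is solved by u(1-t) u(1)*, whose value at time 1 is u(1)*. -/
lemma IsHermitianField.wilsonLine_symm (hA : IsHermitianField A) (w x : Spacetime) :
    wilsonLine A x w = star (wilsonLine A w x) := by
  obtain ⟨u, hu⟩ := hA.exists_isTransport w x
  have h : IsTransport A x w fun t => u (1 - t) * star (u 1) := by
    rw [isTransport_iff]
    refine ⟨by simpa using mul_eq_one_comm.1 (hu.star_mul_eq_one hA hu 1), fun t => ?_⟩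
    have h1 : HasDerivAt (fun t : ℝ => 1 - t) (-1) t := by
      simpa using (hasDerivAt_id t).const_sub 1
    refine ((((isTransport_iff.1 hu).2 (1 - t)).scomp t h1).mul_const _).congr_deriv ?_
    have e : transportGen A w x (1 - t) = -transportGen A x w t := by
      have e1 : x + (1 - t) • (w - x) = w + t • (x - w) := by module
      simp only [transportGen, gaugeDir, e1, ← smul_neg, ← Finset.sum_neg_distrib]
      congr 1
      refine Finset.sum_congr rfl fun μ _ => ?_
      rw [smul_neg, ← neg_smul]
      simp
    rw [e]
    simp [mul_assoc]
  rw [h.wilsonLine_eq hA, hu.wilsonLine_eq hA, sub_self, hu.1, one_mul]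

lemma IsHermitianField.wilsonLine_self (hA : IsHermitianField A) (x : Spacetime) :
    wilsonLine A x x = 1 := by
  obtain ⟨u, hu⟩ := hA.exists_isTransport (x + 0) x
  have := hu.wilsonLine_path hA 0
  rwa [smul_zero, add_zero, hu.1] at this

lemma IsHermitianField.wilsonLine_mul_symm (hA : IsHermitianField A) (w x : Spacetime) :
    wilsonLine A w x * wilsonLine A x w = 1 := by
  rw [hA.wilsonLine_symm w x]
  exact (Matrix.mem_unitaryGroup_iff).1 (hA.wilsonLine_mem_unitary w x)

lemma IsHermitianField.hasDerivAt_wilsonLine_left (hA : IsHermitianField A) (x b : Spacetime)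
    (t : ℝ) (i j : Fin N) : HasDerivAt (fun t : ℝ => wilsonLine A (x + t • b) x i j)
      (Complex.I * (gaugeDir A b (x + t • b) * wilsonLine A (x + t • b) x) i j) t := by
  obtain ⟨u, hu⟩ := hA.exists_isTransport (x + b) x
  simp_rw [hu.wilsonLine_path hA]
  refine (hasDerivAt_matrix_iff.1 ((isTransport_iff.1 hu).2 t) i j).congr_deriv ?_
  simp [transportGen]

lemma IsHermitianField.hasDerivAt_wilsonLine_right (hA : IsHermitianField A) (x b : Spacetime)
    (t : ℝ) (i j : Fin N) : HasDerivAt (fun t : ℝ => wilsonLine A x (x + t • b) i j)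
      (-(Complex.I * (wilsonLine A x (x + t • b) * gaugeDir A b (x + t • b)) i j)) t := by
  obtain ⟨u, hu⟩ := hA.exists_isTransport (x + b) x
  have e : ∀ t : ℝ, wilsonLine A x (x + t • b) = star (u t) := fun t => by
    rw [hA.wilsonLine_symm, hu.wilsonLine_path hA]
  simp_rw [e]
  refine (hasDerivAt_matrix_iff.1 (hu.hasDerivAt_star hA t) i j).congr_deriv ?_
  simp [transportGen]

lemma IsHermitianField.slowGauge (hA : IsHermitianField A) (ε : ℝ) :
    IsHermitianField (slowGauge ε A) := by
  intro μ
  refine ⟨fun i j => ?_, fun x => ?_⟩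
  · have : ContDiff ℝ ∞ fun x : Spacetime => A μ (ε • x) i j :=
      ((hA μ).1 i j).comp (contDiff_id.const_smul ε)
    exact this.const_smul (ε : ℂ)
  · have := (hA μ).2 (ε • x)
    simp only [_root_.slowGauge, Matrix.IsHermitian, Matrix.conjTranspose_smul, this.eq]
    simp

end WilsonLines

/-! ### Calculus of directional derivatives. -/

section DirectionalDerivatives

variable {P G V W : Type*} [NormedAddCommGroup P] [NormedSpace ℝ P] [NormedAddCommGroup G]
  [NormedSpace ℝ G] [NormedAddCommGroup V] [NormedSpace ℝ V] [NormedAddCommGroup W]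
  [NormedSpace ℝ W]

/-- The directional derivative. -/
noncomputable def dirDeriv (v : P) (f : P → V) (z : P) : V := fderiv ℝ f z v

lemma ContDiff.differentiable_infty {f : P → V} (h : ContDiff ℝ ∞ f) : Differentiable ℝ f :=
  h.differentiable (by simp)

lemma ContDiff.dirDeriv {f : P → V} (h : ContDiff ℝ ∞ f) (v : P) :
    ContDiff ℝ ∞ (dirDeriv v f) :=
  (h.fderiv_right (m := ∞) (by simp)).clm_apply contDiff_const

lemma ContDiff.iterate_dirDeriv {f : P → V} (h : ContDiff ℝ ∞ f) (v : P) (m : ℕ) :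
    ContDiff ℝ ∞ ((_root_.dirDeriv v)^[m] f) := by
  induction m with
  | zero => exact h
  | succ m ih => rw [Function.iterate_succ_apply']; exact ih.dirDeriv v

lemma ContDiff.uncurry_dirDeriv {F : P → G → V} (h : ContDiff ℝ ∞ ↿F) (b : G) :
    ContDiff ℝ ∞ ↿(fun p => _root_.dirDeriv b (F p)) := by
  have h1 : ContDiff ℝ ∞ (Function.uncurry fun (z : P × G) (y : G) => F z.1 y) :=
    h.comp (contDiff_fst.fst.prodMk contDiff_snd)
  exact (h1.fderiv (g := fun z : P × G => z.2) contDiff_snd (by simp)).clm_apply contDiff_const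

lemma ContDiff.uncurry_iterate_dirDeriv {F : P → G → V} (h : ContDiff ℝ ∞ ↿F) (b : G) (m : ℕ) :
    ContDiff ℝ ∞ ↿(fun p => (_root_.dirDeriv b)^[m] (F p)) := by
  induction m with
  | zero => exact h
  | succ m ih =>
    simp only [Function.iterate_succ_apply']
    exact ih.uncurry_dirDeriv b

lemma ContDiff.uncurry_dirDeriv_left {F : P → G → V} (h : ContDiff ℝ ∞ ↿F) (v : P) :
    ContDiff ℝ ∞ ↿(fun p y => _root_.dirDeriv v (fun q => F q y) p) := by
  have h1 : ContDiff ℝ ∞ (Function.uncurry fun (z : P × G) (q : P) => F q z.2) :=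
    h.comp (contDiff_snd.prodMk contDiff_fst.snd)
  exact (h1.fderiv (g := fun z : P × G => z.1) contDiff_fst (by simp)).clm_apply contDiff_const

lemma ContDiff.curry_right {n : WithTop ℕ∞} {F : P → G → V} (h : ContDiff ℝ n ↿F) (p : P) :
    ContDiff ℝ n (F p) :=
  h.comp (contDiff_const.prodMk contDiff_id)

lemma ContDiff.curry_left {n : WithTop ℕ∞} {F : P → G → V} (h : ContDiff ℝ n ↿F) (y : G) :
    ContDiff ℝ n (fun p => F p y) :=
  h.comp (contDiff_id.prodMk contDiff_const)

lemma dirDeriv_fst_eq {F : P → G → V} (h : ContDiff ℝ ∞ ↿F) (v : P) (p : P) (y : G) :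
    dirDeriv v (fun q => F q y) p = dirDeriv (v, 0) ↿F (p, y) := by
  have h1 : HasFDerivAt ↿F (fderiv ℝ ↿F (p, y)) (p, y) :=
    (h.differentiable_infty _).hasFDerivAt
  have hl : HasFDerivAt (fun x : P => (x, y)) (ContinuousLinearMap.inl ℝ P G) p :=
    hasFDerivAt_prodMk_left p y
  have h4 := HasFDerivAt.comp (x := p) (f := fun x : P => (x, y)) h1 hl
  have e : ↿F ∘ (fun x : P => (x, y)) = fun q => F q y := rfl
  rw [e] at h4
  simp [dirDeriv, h4.fderiv]

lemma dirDeriv_snd_eq {F : P → G → V} (h : ContDiff ℝ ∞ ↿F) (b : G) (p : P) (y : G) :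
    dirDeriv b (F p) y = dirDeriv (0, b) ↿F (p, y) := by
  have h1 : HasFDerivAt ↿F (fderiv ℝ ↿F (p, y)) (p, y) :=
    (h.differentiable_infty _).hasFDerivAt
  have hl : HasFDerivAt (fun x : G => (p, x)) (ContinuousLinearMap.inr ℝ P G) y :=
    hasFDerivAt_prodMk_right p y
  have h4 := HasFDerivAt.comp (x := y) (f := fun x : G => (p, x)) h1 hl
  have e : ↿F ∘ (fun x : G => (p, x)) = F p := rfl
  rw [e] at h4
  simp [dirDeriv, h4.fderiv]

lemma dirDeriv_comm {f : P → V} (h : ContDiff ℝ ∞ f) (v w z : P) :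
    dirDeriv v (dirDeriv w f) z = dirDeriv w (dirDeriv v f) z := by
  have h1 : ContDiff ℝ ∞ (fderiv ℝ f) := h.fderiv_right (by simp)
  have h2 : ∀ v w, dirDeriv v (dirDeriv w f) z = fderiv ℝ (fderiv ℝ f) z v w := by
    intro v w
    have := ((h1.differentiable_infty z).hasFDerivAt.clm_apply (hasFDerivAt_const w z))
    change fderiv ℝ (fun y => fderiv ℝ f y w) z v = _
    rw [this.fderiv]
    simp
  rw [h2, h2]
  exact second_derivative_symmetric (f := f) (f' := fderiv ℝ f)
    (fun y => (h.differentiable_infty y).hasFDerivAt) (h1.differentiable_infty z).hasFDerivAt v w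

/-- Both partial derivatives are directional derivatives on the product space, where second
derivatives are symmetric. Later `p` is the gauge parameter time and `y` the relative coordinate. -/
lemma dirDeriv_curry_comm {F : P → G → V} (h : ContDiff ℝ ∞ ↿F) (v : P) (b : G) (p : P) (y : G) :
    dirDeriv v (fun q => dirDeriv b (F q) y) p =
      dirDeriv b (fun y => dirDeriv v (fun q => F q y) p) y := by
  have e1 : (fun q => dirDeriv b (F q) y) = fun q => (fun q y => dirDeriv (0, b) ↿F (q, y)) q y := by
    ext q; exact dirDeriv_snd_eq h b q y
  have e2 : (fun y => dirDeriv v (fun q => F q y) p) =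
      (fun q y => dirDeriv (v, 0) ↿F (q, y)) p := by
    ext y; exact dirDeriv_fst_eq h v p y
  have hh : ∀ w, ContDiff ℝ ∞ ↿(fun q y => dirDeriv w ↿F (q, y)) := fun w => h.dirDeriv w
  rw [e1, e2, dirDeriv_fst_eq (hh _), dirDeriv_snd_eq (hh _)]
  exact dirDeriv_comm h _ _ _

lemma dirDeriv_iterate_curry_comm {F : P → G → V} (h : ContDiff ℝ ∞ ↿F) (v : P) (b : G) (m : ℕ)
    (p : P) (y : G) :
    dirDeriv v (fun q => (dirDeriv b)^[m] (F q) y) p =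
      (dirDeriv b)^[m] (fun y => dirDeriv v (fun q => F q y) p) y := by
  induction m generalizing y with
  | zero => rfl
  | succ m ih =>
    simp only [Function.iterate_succ_apply']
    rw [dirDeriv_curry_comm (F := fun q => (dirDeriv b)^[m] (F q)) (h.uncurry_iterate_dirDeriv b m)]
    congr 1
    ext y
    exact ih y

lemma dirDeriv_add {f g : P → V} (hf : ContDiff ℝ ∞ f) (hg : ContDiff ℝ ∞ g) (v : P) :
    dirDeriv v (fun z => f z + g z) = fun z => dirDeriv v f z + dirDeriv v g z := by
  ext z
  simp [dirDeriv, fderiv_fun_add (hf.differentiable_infty z) (hg.differentiable_infty z)]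

lemma dirDeriv_clm (L : V →L[ℝ] W) {f : P → V} (hf : ContDiff ℝ ∞ f) (v : P) :
    dirDeriv v (fun z => L (f z)) = fun z => L (dirDeriv v f z) := by
  ext z
  have := L.hasFDerivAt.comp z (hf.differentiable_infty z).hasFDerivAt
  simp only [dirDeriv]
  rw [show (fun z => L (f z)) = L ∘ f from rfl, this.fderiv]
  rfl

lemma dirDeriv_sum {ι : Type*} {s : Finset ι} {f : ι → P → V} (hf : ∀ i, ContDiff ℝ ∞ (f i))
    (v : P) : dirDeriv v (fun z => ∑ i ∈ s, f i z) = fun z => ∑ i ∈ s, dirDeriv v (f i) z := by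
  ext z
  simp [dirDeriv, fderiv_fun_sum fun i _ => (hf i).differentiable_infty z]

lemma dirDeriv_iterate_sum {ι : Type*} {s : Finset ι} {f : ι → P → V}
    (hf : ∀ i, ContDiff ℝ ∞ (f i)) (v : P) (m : ℕ) :
    (dirDeriv v)^[m] (fun z => ∑ i ∈ s, f i z) = fun z => ∑ i ∈ s, (dirDeriv v)^[m] (f i) z := by
  induction m with
  | zero => rfl
  | succ m ih =>
    simp only [Function.iterate_succ_apply']
    rw [ih, dirDeriv_sum fun i => (hf i).iterate_dirDeriv v m]

lemma HasCompactSupport.dirDeriv {f : P → V} (h : HasCompactSupport f) (v : P) :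
    HasCompactSupport (_root_.dirDeriv v f) :=
  h.fderiv_apply ℝ v

lemma hasDerivAt_dirDeriv {f : P → V} (hf : ContDiff ℝ ∞ f) (b x : P) (t : ℝ) :
    HasDerivAt (fun t : ℝ => f (x + t • b)) (dirDeriv b f (x + t • b)) t := by
  have h3 : HasDerivAt (fun r : ℝ => x + r • b) b t := by
    simpa using ((hasDerivAt_id t).smul_const b).const_add x
  exact (hf.differentiable_infty _).hasFDerivAt.comp_hasDerivAt t h3

/-- Restriction to a line makes iterated directional derivatives accessible to the one-variable
Leibniz rule. -/
lemma iteratedDeriv_line {f : P → V} (hf : ContDiff ℝ ∞ f) (b x : P) (m : ℕ) (t : ℝ) :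
    iteratedDeriv m (fun t : ℝ => f (x + t • b)) t = (dirDeriv b)^[m] f (x + t • b) := by
  induction m generalizing t with
  | zero => simp
  | succ m ih =>
    rw [iteratedDeriv_succ, funext ih, Function.iterate_succ_apply']
    exact (hasDerivAt_dirDeriv (hf.iterate_dirDeriv b m) b x t).deriv

lemma dirDeriv_iterate_eventuallyEq {f g : P → V} {x : P} (h : f =ᶠ[𝓝 x] g) (v : P) (m : ℕ) :
    (dirDeriv v)^[m] f =ᶠ[𝓝 x] (dirDeriv v)^[m] g := by
  induction m with
  | zero => exact h
  | succ m ih =>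
    simp only [Function.iterate_succ_apply']
    filter_upwards [ih.fderiv (𝕜 := ℝ)] with z hz
    simp [dirDeriv, hz]

/-- The general Leibniz rule, for an array of functions whose derivatives are the sums of two
neighbours. -/
lemma iteratedDeriv_eq_sum_antidiagonal {B : ℕ → ℕ → ℝ → V}
    (hB : ∀ i j t, HasDerivAt (B i j) (B (i + 1) j t + B i (j + 1) t) t) (m : ℕ) (t : ℝ) :
    iteratedDeriv m (B 0 0) t =
      ∑ ij ∈ Finset.HasAntidiagonal.antidiagonal m, m.choose ij.1 • B ij.1 ij.2 t := by
  induction m generalizing t with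
  | zero => simp
  | succ m ih =>
    rw [iteratedDeriv_succ, funext ih,
      Finset.sum_antidiagonal_choose_succ_nsmul (fun i j => B i j t)]
    have : HasDerivAt (fun t => ∑ ij ∈ Finset.HasAntidiagonal.antidiagonal m, m.choose ij.1 • B ij.1 ij.2 t)
      (∑ ij ∈ Finset.HasAntidiagonal.antidiagonal m, m.choose ij.1 • (B (ij.1 + 1) ij.2 t + B ij.1 (ij.2 + 1) t))
      t := HasDerivAt.fun_sum fun ij _ => (hB ij.1 ij.2 t).const_smul (m.choose ij.1)
    rw [this.deriv]
    simp only [smul_add, Finset.sum_add_distrib]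
    rw [add_comm]
    congr 1
    refine Finset.sum_congr rfl fun ij h => ?_
    rw [m.choose_symm_of_eq_add (Finset.HasAntidiagonal.mem_antidiagonal.1 h).symm]

lemma integral_dirDeriv_eq_zero [MeasurableSpace P] [BorelSpace P] [FiniteDimensional ℝ P]
    {ν : Measure P} [ν.IsAddHaarMeasure] {f : P → V} (hf : ContDiff ℝ ∞ f)
    (hc : HasCompactSupport f) (v : P) : ∫ x, dirDeriv v f x ∂ν = 0 := by
  have h := integral_smul_fderiv_eq_neg_fderiv_smul_of_integrable (𝕜 := ℝ) (μ := ν)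
    (f := fun _ : P => (1 : ℝ)) (g := f) (v := v) ?_ ?_ ?_ ?_ ?_
  · simpa [dirDeriv] using h
  · simp
  · simp only [one_smul]
    exact (hf.dirDeriv v).continuous.integrable_of_hasCompactSupport (hc.dirDeriv v)
  · simpa using hf.continuous.integrable_of_hasCompactSupport hc
  · simp
  · exact fun x _ => hf.differentiable_infty x

end DirectionalDerivatives

/-! ### Fourier transform, inversion at the origin, Parseval. -/

section Fourier

variable {V : Type*} [NormedAddCommGroup V] [NormedSpace ℂ V]

/-- The Fourier transform `∫ dy e^{ipy} g(y)`. -/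
noncomputable def fourierPlus (g : Spacetime → V) (p : Spacetime) : V :=
  ∫ y, Complex.exp (Complex.I * (inner ℝ p y : ℝ)) • g y

open FourierTransform in
-- The sign and the factor 2π of the standard convention are absorbed in the frequency -p/(2π); the
-- Jacobian of this rescaling in four dimensions is the (2π)⁴ of the momentum measure.
lemma fourierPlus_eq (g : Spacetime → V) (p : Spacetime) :
    fourierPlus g p = 𝓕 g ((-(2 * Real.pi)⁻¹ : ℝ) • p) := by
  rw [Real.fourier_eq', fourierPlus]
  refine integral_congr_ae (Eventually.of_forall fun y => ?_)
  simp only [inner_smul_right, real_inner_comm p y]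
  congr 2
  have : (Real.pi : ℂ) ≠ 0 := by exact_mod_cast Real.pi_ne_zero
  push_cast
  field_simp

lemma norm_fourierPlus_le (g : Spacetime → V) (p : Spacetime) : ‖fourierPlus g p‖ ≤ ∫ y, ‖g y‖ := by
  refine (norm_integral_le_integral_norm _).trans_eq ?_
  simp [norm_smul]

lemma continuous_fourierPlus {g : Spacetime → V} (hg : Integrable g) :
    Continuous (fourierPlus g) := by
  refine continuous_of_dominated (bound := fun y => ‖g y‖) ?_ ?_ hg.norm ?_
  · intro p
    refine AEStronglyMeasurable.smul ?_ hg.1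
    exact Continuous.aestronglyMeasurable (by fun_prop)
  · intro p
    exact Eventually.of_forall fun y => by simp [norm_smul]
  · exact Eventually.of_forall fun y => by fun_prop

lemma integrable_exp_smul {g : Spacetime → V} (hg : Integrable g) (p : Spacetime) :
    Integrable fun y => Complex.exp (Complex.I * (inner ℝ p y : ℝ)) • g y := by
  refine hg.norm.mono' ?_ (Eventually.of_forall fun y => by simp [norm_smul])
  exact AEStronglyMeasurable.smul (Continuous.aestronglyMeasurable (by fun_prop)) hg.1

/-- The operator `i ∂_b`. -/
noncomputable def iDeriv (b : Spacetime) (g : Spacetime → V) (y : Spacetime) : V :=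
  Complex.I • dirDeriv b g y

lemma HasCompactSupport.iDeriv {g : Spacetime → V} (h : HasCompactSupport g) (b : Spacetime) :
    HasCompactSupport (iDeriv b g) :=
  (h.dirDeriv b).smul_left (f := fun _ => Complex.I)

lemma iDeriv_iterate {g : Spacetime → V} (h : ContDiff ℝ ∞ g) (b : Spacetime) (m : ℕ) :
    (iDeriv b)^[m] g = fun y => Complex.I ^ m • (dirDeriv b)^[m] g y := by
  induction m with
  | zero => simp
  | succ m ih =>
    rw [Function.iterate_succ_apply', ih]
    ext y
    have := congrFun (dirDeriv_clm (W := V)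
      ((Complex.I ^ m) • (ContinuousLinearMap.id ℝ V)) (h.iterate_dirDeriv b m) b) y
    simp only [smul_apply, ContinuousLinearMap.id_apply] at this
    simp only [iDeriv, Function.iterate_succ_apply', this, smul_smul, pow_succ']

lemma ContDiff.iterate_iDeriv {g : Spacetime → V} (h : ContDiff ℝ ∞ g) (b : Spacetime) (m : ℕ) :
    ContDiff ℝ ∞ ((_root_.iDeriv b)^[m] g) := by
  rw [iDeriv_iterate h]; exact (h.iterate_dirDeriv b m).const_smul _

lemma HasCompactSupport.iterate_iDeriv {g : Spacetime → V} (h : HasCompactSupport g)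
    (b : Spacetime) (m : ℕ) : HasCompactSupport ((_root_.iDeriv b)^[m] g) := by
  induction m with
  | zero => exact h
  | succ m ih => rw [Function.iterate_succ_apply']; exact ih.iDeriv b

/-- Integration by parts gives -i⟨b,p⟩, and the factor i in the operator cancels it: i∂_b
corresponds to ⟨b,p⟩ without sign. -/
lemma fourierPlus_iDeriv {g : Spacetime → V} (hg : ContDiff ℝ ∞ g) (hc : HasCompactSupport g)
    (b p : Spacetime) :
    fourierPlus (iDeriv b g) p = ((inner ℝ b p : ℝ) : ℂ) • fourierPlus g p := by
  let e : Spacetime → ℂ := fun y => Complex.exp (Complex.I * (inner ℝ p y : ℝ))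
  have he : ∀ y, HasFDerivAt e ((e y * Complex.I) • (Complex.ofRealCLM.comp (innerSL ℝ p))) y := by
    intro y
    have h1 : HasFDerivAt (fun y : Spacetime => Complex.I * ((inner ℝ p y : ℝ) : ℂ))
        (Complex.I • (Complex.ofRealCLM.comp (innerSL ℝ p))) y :=
      ((Complex.ofRealCLM.comp (innerSL ℝ p)).hasFDerivAt).const_mul Complex.I
    refine h1.cexp.congr_fderiv ?_
    rw [smul_smul]
  have hec : Continuous e := by fun_prop
  have hd : ∀ y, fderiv ℝ e y b = (Complex.I * ((inner ℝ b p : ℝ) : ℂ)) * e y := by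
    intro y
    rw [(he y).fderiv]
    simp only [smul_apply, ContinuousLinearMap.comp_apply, innerSL_apply_apply,
      Complex.ofRealCLM_apply, smul_eq_mul, real_inner_comm p b]
    ring
  have h := integral_smul_fderiv_eq_neg_fderiv_smul_of_integrable (𝕜 := ℂ) (μ := volume)
    (f := e) (g := g) (v := b) ?_ ?_ ?_ ?_ ?_
  · have h1 : fourierPlus (iDeriv b g) p = Complex.I • ∫ y, e y • fderiv ℝ g y b := by
      rw [fourierPlus, ← integral_smul]
      refine integral_congr_ae (Eventually.of_forall fun y => ?_)
      simp only [iDeriv, dirDeriv, e]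
      rw [smul_comm]
    rw [h1, h]
    simp only [hd, mul_smul]
    rw [integral_smul, integral_smul, smul_neg, smul_smul, Complex.I_mul_I, neg_one_smul, neg_neg]
    rfl
  · simp only [hd]
    refine Continuous.integrable_of_hasCompactSupport ?_ ?_
    · exact (continuous_const.mul hec).smul hg.continuous
    · exact hc.smul_left (f := fun y => (Complex.I * ((inner ℝ b p : ℝ) : ℂ)) * e y)
  · refine Continuous.integrable_of_hasCompactSupport (hec.smul (hg.dirDeriv b).continuous) ?_
    exact (hc.dirDeriv b).smul_left
  · exact Continuous.integrable_of_hasCompactSupport (hec.smul hg.continuous) hc.smul_left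
  · exact fun y _ => (he y).differentiableAt
  · exact fun y _ => hg.differentiable_infty y

lemma fourierPlus_iterate_iDeriv {g : Spacetime → V} (hg : ContDiff ℝ ∞ g)
    (hc : HasCompactSupport g) (b p : Spacetime) (m : ℕ) :
    fourierPlus ((iDeriv b)^[m] g) p = ((inner ℝ b p : ℝ) : ℂ) ^ m • fourierPlus g p := by
  induction m with
  | zero => simp
  | succ m ih =>
    rw [Function.iterate_succ_apply', fourierPlus_iDeriv (hg.iterate_iDeriv b m)
      (hc.iterate_iDeriv b m), ih, smul_smul, pow_succ']

lemma integral_comp_neg_inv_two_pi {W : Type*} [NormedAddCommGroup W] [NormedSpace ℝ W]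
    (f : Spacetime → W) :
    ∫ p, f ((-(2 * Real.pi)⁻¹ : ℝ) • p) = ((2 * Real.pi) ^ 4 : ℝ) • ∫ w, f w := by
  rw [Measure.integral_comp_smul]
  congr 1
  simp only [finrank_euclideanSpace, Fintype.card_fin]
  rw [abs_inv, abs_pow, abs_neg, abs_inv, abs_of_pos Real.two_pi_pos, inv_pow, inv_inv]

lemma neg_inv_two_pi_ne_zero : (-(2 * Real.pi)⁻¹ : ℝ) ≠ 0 :=
  neg_ne_zero.2 (inv_ne_zero Real.two_pi_pos.ne')

open FourierTransform in
lemma integrable_fourier_of_smooth {g : Spacetime → V} (hg : ContDiff ℝ ∞ g)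
    (hc : HasCompactSupport g) : Integrable (𝓕 g) := by
  have := (𝓕 (hc.toSchwartzMap hg)).integrable (μ := volume)
  rwa [SchwartzMap.fourier_coe] at this

lemma integrable_fourierPlus {g : Spacetime → V} (hg : ContDiff ℝ ∞ g)
    (hc : HasCompactSupport g) : Integrable (fourierPlus g) := by
  rw [funext (fourierPlus_eq g)]
  exact (integrable_fourier_of_smooth hg hc).comp_smul neg_inv_two_pi_ne_zero

/-- The transform of the regulator profile is integrable, that of an integrable kernel only bounded;
the product converges absolutely. This is why the point-split integrals exist for two-point
functions. -/
lemma integrable_fourierPlus_smul {g : Spacetime → ℂ} (hg : ContDiff ℝ ∞ g)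
    (hc : HasCompactSupport g) {φ : Spacetime → V} (hφ : Integrable φ) :
    Integrable fun p => fourierPlus g p • fourierPlus φ p :=
  (integrable_fourierPlus hg hc).smul_bdd (∫ y, ‖φ y‖)
    (continuous_fourierPlus hφ).aestronglyMeasurable
    (Eventually.of_forall fun p => norm_fourierPlus_le φ p)

variable [CompleteSpace V]

open FourierTransform in
/-- Fourier inversion at the origin. -/
lemma integral_fourierPlus {g : Spacetime → V} (hg : ContDiff ℝ ∞ g) (hc : HasCompactSupport g) :
    ∫ p, fourierPlus g p = ((2 * Real.pi) ^ 4 : ℝ) • g 0 := by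
  simp only [fourierPlus_eq]
  rw [integral_comp_neg_inv_two_pi (𝓕 g)]
  congr 1
  have h := congrFun (hg.continuous.fourierInv_fourier_eq
    (hg.continuous.integrable_of_hasCompactSupport hc) (integrable_fourier_of_smooth hg hc)) 0
  rw [← h, Real.fourierInv_eq]
  simp

open FourierTransform in
/-- The Parseval formula. -/
lemma integral_fourierPlus_smul {g : Spacetime → ℂ} (hg : ContDiff ℝ ∞ g)
    (hc : HasCompactSupport g) {φ : Spacetime → V} (hφ : Integrable φ) :
    ∫ p, fourierPlus g p • fourierPlus φ p = ((2 * Real.pi) ^ 4 : ℝ) • ∫ y, g (-y) • φ y := by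
  simp only [fourierPlus_eq]
  rw [integral_comp_neg_inv_two_pi (fun w => 𝓕 g w • 𝓕 φ w)]
  congr 1
  have hi := integrable_fourier_of_smooth hg hc
  have h := VectorFourier.integral_bilin_fourierIntegral_eq_flip (ContinuousLinearMap.lsmul ℂ ℂ)
    (μ := volume) (ν := volume) (L := innerₗ Spacetime) Real.continuous_fourierChar continuous_inner
    hi hφ
  simp only [flip_innerₗ, ContinuousLinearMap.lsmul_apply] at h
  -- Transforming twice reflects the argument; self-adjointness of the transform then moves one of
  -- the two onto the other factor.
  have e : ∀ y, g (-y) = 𝓕 (𝓕 g) y := by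
    intro y
    have h := congrFun (hg.continuous.fourierInv_fourier_eq
      (hg.continuous.integrable_of_hasCompactSupport hc) hi) (-y)
    rw [← h, Real.fourierInv_eq, Real.fourier_eq]
    simp
  simp only [e]
  exact h.symm

end Fourier

/-! ### The symbol as a finite sum of powers of linear forms in the momentum. -/

namespace DiracSymbol

variable {s : Type*} [Fintype s] (Q : DiracSymbol s)

/-- The power series in `x` multiplying `D_{μ₁}…D_{μ_m}`, entry by entry. -/
noncomputable def xSeries (m : ℕ) (μ : Fin m → Fin 4) (x : Spacetime) : Matrix s s ℂ :=
  Matrix.of fun a b => ∑' n, ∑ ν : Fin n → Fin 4,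
    (((n + m).factorial : ℂ) * ∏ i, ((x (ν i) : ℝ) : ℂ)) * Q.coeff n m ν μ a b

lemma norm_coord_le (x : Spacetime) (i : Fin 4) : ‖((x i : ℝ) : ℂ)‖ ≤ ‖x‖ := by
  rw [Complex.norm_real]
  exact PiLp.norm_apply_le x i

lemma norm_prod_coord_le (x : Spacetime) {n : ℕ} (ν : Fin n → Fin 4) :
    ‖∏ i, ((x (ν i) : ℝ) : ℂ)‖ ≤ ‖x‖ ^ n := by
  rw [norm_prod]
  refine (Finset.prod_le_prod (fun _ _ => norm_nonneg _) fun i _ => norm_coord_le x (ν i)).trans ?_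
  simp

lemma sum_norm_coeff_le (n m : ℕ) (μ : Fin m → Fin 4) (a b : s) :
    ∑ ν : Fin n → Fin 4, ‖Q.coeff n m ν μ a b‖ ≤ ∑ ν, ∑ μ, ‖Q.coeff n m ν μ a b‖ :=
  Finset.sum_le_sum fun ν _ => Finset.single_le_sum (f := fun μ => ‖Q.coeff n m ν μ a b‖)
    (fun _ _ => norm_nonneg _) (Finset.mem_univ μ)

lemma summable_xSeries (m : ℕ) (μ : Fin m → Fin 4) (x : Spacetime) (a b : s) :
    Summable fun n => ∑ ν : Fin n → Fin 4,
      (((n + m).factorial : ℂ) * ∏ i, ((x (ν i) : ℝ) : ℂ)) * Q.coeff n m ν μ a b := by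
  refine Summable.of_norm_bounded (Q.summable_coeff m ‖x‖ (norm_nonneg _) a b) fun n => ?_
  refine (norm_sum_le _ _).trans ?_
  calc _ ≤ ∑ ν : Fin n → Fin 4, ((n + m).factorial : ℝ) * ‖x‖ ^ n * ‖Q.coeff n m ν μ a b‖ := by
        refine Finset.sum_le_sum fun ν _ => ?_
        rw [norm_mul, norm_mul, Complex.norm_natCast]
        gcongr
        exact norm_prod_coord_le x ν
    _ ≤ _ := by
        rw [← Finset.mul_sum]
        exact mul_le_mul_of_nonneg_left (Q.sum_norm_coeff_le n m μ a b) (by positivity)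

/-- A coordinate as a continuous linear map into the complex numbers. -/
noncomputable def coordCLM (i : Fin 4) : Spacetime →L[ℝ] ℂ :=
  Complex.ofRealCLM.comp (EuclideanSpace.proj i)

lemma norm_coordCLM_le (i : Fin 4) : ‖coordCLM i‖ ≤ 1 := by
  refine ContinuousLinearMap.opNorm_le_bound _ zero_le_one fun x => ?_
  rw [one_mul]
  exact norm_coord_le x i

/-- The power series as a formal multilinear series. -/
noncomputable def xFormalSeries (m : ℕ) (μ : Fin m → Fin 4) (a b : s) :
    FormalMultilinearSeries ℝ Spacetime ℂ := fun n =>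
  ∑ ν : Fin n → Fin 4, (((n + m).factorial : ℂ) * Q.coeff n m ν μ a b) •
    (ContinuousMultilinearMap.mkPiAlgebraFin ℝ n ℂ).compContinuousLinearMap fun i => coordCLM (ν i)

lemma contDiff_xSeries (m : ℕ) (μ : Fin m → Fin 4) (a b : s) :
    ContDiff ℝ ∞ fun x => Q.xSeries m μ x a b := by
  let p := Q.xFormalSeries m μ a b
  -- The summability condition on the coefficients holds for every radius and already contains the
  -- factorial that counts permutations, so the series is entire.
  have hr : p.radius = ⊤ := by
    refine p.radius_eq_top_of_summable_norm fun r => ?_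
    refine Summable.of_nonneg_of_le (fun n => by positivity) (fun n => ?_)
      (Q.summable_coeff m r r.2 a b)
    have h1 : ‖p n‖ ≤ ((n + m).factorial : ℝ) * ∑ ν, ∑ μ, ‖Q.coeff n m ν μ a b‖ := by
      refine (norm_sum_le _ _).trans ?_
      calc _ ≤ ∑ ν : Fin n → Fin 4, ((n + m).factorial : ℝ) * ‖Q.coeff n m ν μ a b‖ := by
            refine Finset.sum_le_sum fun ν _ => ?_
            rw [norm_smul, norm_mul, Complex.norm_natCast]
            refine mul_le_of_le_one_right (by positivity) ?_
            refine (ContinuousMultilinearMap.norm_compContinuousLinearMap_le _ _).trans ?_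
            rw [ContinuousMultilinearMap.norm_mkPiAlgebraFin, one_mul]
            exact Finset.prod_le_one (fun _ _ => norm_nonneg _) fun i _ => norm_coordCLM_le _
        _ ≤ _ := by
            rw [← Finset.mul_sum]
            exact mul_le_mul_of_nonneg_left (Q.sum_norm_coeff_le n m μ a b) (by positivity)
    calc ‖p n‖ * (r : ℝ) ^ n ≤ _ := mul_le_mul_of_nonneg_right h1 (by positivity)
      _ = _ := by ring
  have h := p.hasFPowerSeriesOnBall (by rw [hr]; exact ENNReal.coe_lt_top)
  have h2 : ContDiffOn ℝ ∞ p.sum (Metric.eball 0 p.radius) := h.analyticOnNhd.contDiffOn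
    (Metric.isOpen_eball.uniqueDiffOn)
  rw [hr] at h2
  have h3 : ContDiff ℝ ∞ p.sum := by
    rw [← contDiffOn_univ]
    refine h2.mono fun x _ => ?_
    simp
  convert h3 using 2 with x
  simp only [xSeries, Matrix.of_apply, FormalMultilinearSeries.sum]
  congr 1
  ext n
  simp only [p, xFormalSeries, sum_apply, smul_apply,
    ContinuousMultilinearMap.compContinuousLinearMap_apply,
    ContinuousMultilinearMap.mkPiAlgebraFin_apply, List.prod_ofFn, coordCLM,
    ContinuousLinearMap.comp_apply, PiLp.proj_apply, Complex.ofRealCLM_apply, smul_eq_mul]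
  refine Finset.sum_congr rfl fun ν _ => ?_
  ring

/-- The indices of the terms in the expansion of the symbol in powers `⟨b, p⟩ ^ m`. -/
abbrev RidgeIndex : Type := (m : Fin (Q.order + 1)) × ((Fin m → Fin 4) × Finset (Fin m))

variable {Q}

/-- The exponent of a term `⟨b, p⟩ ^ m` of the symbol. -/
def RidgeIndex.deg (τ : Q.RidgeIndex) : ℕ := τ.1

/-- The direction of a term `⟨b, p⟩ ^ m` of the symbol. -/
noncomputable def RidgeIndex.dir (τ : Q.RidgeIndex) : Spacetime :=
  ∑ i ∈ τ.2.2ᶜ, unitVec (τ.2.1 i)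

/-- The coefficient of a term `⟨b, p⟩ ^ m` of the symbol. -/
noncomputable def RidgeIndex.coeff (τ : Q.RidgeIndex) (x : Spacetime) : Matrix s s ℂ :=
  (((-1) ^ τ.2.2.card * (τ.deg.factorial : ℂ)⁻¹) * Complex.I ^ τ.deg) • Q.xSeries τ.1 τ.2.1 x

lemma RidgeIndex.contDiff_coeff (τ : Q.RidgeIndex) (a b : s) :
    ContDiff ℝ ∞ fun x => τ.coeff x a b :=
  (Q.contDiff_xSeries _ _ a b).const_smul
    (((-1) ^ τ.2.2.card * (τ.deg.factorial : ℂ)⁻¹) * Complex.I ^ τ.deg)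

lemma inner_unitVec (i : Fin 4) (p : Spacetime) : inner ℝ (unitVec i) p = p i := by
  simp [unitVec, EuclideanSpace.inner_single_left]

/-- For commuting factors all m! permutations give the same product, so polarization can be divided
by m!. -/
lemma prod_eq_polarization {m : ℕ} (z : Fin m → ℂ) :
    ∏ i, z i = ∑ S : Finset (Fin m), ((-1) ^ S.card * (m.factorial : ℂ)⁻¹) * (∑ i ∈ Sᶜ, z i) ^ m := by
  have h := sum_perm_prod_eq (R := ℂ) z
  have h1 : ∀ σ : Equiv.Perm (Fin m), (List.ofFn (z ∘ σ)).prod = ∏ i, z i := fun σ => by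
    rw [List.prod_ofFn]
    exact Equiv.prod_comp σ z
  simp_rw [h1] at h
  rw [Finset.sum_const, Finset.card_univ, Fintype.card_perm, Fintype.card_fin, nsmul_eq_mul] at h
  have h0 : (m.factorial : ℂ) ≠ 0 := by exact_mod_cast m.factorial_ne_zero
  rw [eq_comm, ← mul_right_inj' h0, h, Finset.mul_sum]
  refine Finset.sum_congr rfl fun S _ => ?_
  rw [zsmul_eq_mul]
  push_cast
  field_simp

lemma symbol_eq_sum_xSeries (x p : Spacetime) :
    Q.symbol x p = ∑ m ∈ Finset.range (Q.order + 1), ∑ μ : Fin m → Fin 4,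
      (∏ j, (Complex.I * ((p (μ j) : ℝ) : ℂ))) • Q.xSeries m μ x := by
  unfold symbol
  refine Finset.sum_congr rfl fun m _ => ?_
  refine HasSum.tsum_eq ?_
  have key : ∀ a b, HasSum (fun n => (∑ ν : Fin n → Fin 4, ∑ μ : Fin m → Fin 4,
      ((((n + m).factorial : ℂ) * (∏ i, ((x (ν i) : ℝ) : ℂ)) *
      ∏ j, (Complex.I * ((p (μ j) : ℝ) : ℂ))) • Q.coeff n m ν μ)) a b)
      ((∑ μ : Fin m → Fin 4, (∏ j, (Complex.I * ((p (μ j) : ℝ) : ℂ))) • Q.xSeries m μ x) a b) := by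
    intro a b
    simp only [Matrix.sum_apply, Matrix.smul_apply, smul_eq_mul]
    have := hasSum_sum (s := Finset.univ) fun (μ : Fin m → Fin 4) _ =>
      ((Q.summable_xSeries m μ x a b).hasSum.mul_left (∏ j, (Complex.I * ((p (μ j) : ℝ) : ℂ))))
    refine (this.congr_fun fun n => ?_)
    rw [Finset.sum_comm]
    refine Finset.sum_congr rfl fun μ _ => ?_
    rw [Finset.mul_sum]
    refine Finset.sum_congr rfl fun ν _ => ?_
    ring
  exact Pi.hasSum.2 fun a => Pi.hasSum.2 fun b => key a b

/-- The symbol is a finite sum of powers of linear functions of `p` with smooth coefficients. -/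
theorem symbol_eq_sum_ridge (x p : Spacetime) :
    Q.symbol x p = ∑ τ : Q.RidgeIndex, ((inner ℝ τ.dir p : ℝ) : ℂ) ^ τ.deg • τ.coeff x := by
  rw [symbol_eq_sum_xSeries, Fintype.sum_sigma, ← Fin.sum_univ_eq_sum_range (fun m =>
    ∑ μ : Fin m → Fin 4, (∏ j, (Complex.I * ((p (μ j) : ℝ) : ℂ))) • Q.xSeries m μ x)]
  refine Finset.sum_congr rfl fun m _ => ?_
  rw [Fintype.sum_prod_type]
  refine Finset.sum_congr rfl fun μ _ => ?_
  rw [Finset.prod_mul_distrib, prod_eq_polarization (fun j => ((p (μ j) : ℝ) : ℂ)), Finset.mul_sum,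
    Finset.sum_smul]
  refine Finset.sum_congr rfl fun S _ => ?_
  simp only [RidgeIndex.coeff, RidgeIndex.deg, RidgeIndex.dir, smul_smul, sum_inner, inner_unitVec]
  congr 1
  simp only [Finset.prod_const, Finset.card_univ, Fintype.card_fin]
  push_cast
  ring

/-- The scalar factor of a momentum derivative of `⟨b, p⟩ ^ m`. -/
noncomputable def RidgeIndex.factor (τ : Q.RidgeIndex) (l : List (Fin 4)) : ℂ :=
  (τ.deg.descFactorial l.length : ℂ) * (l.map fun μ => ((τ.dir μ : ℝ) : ℂ)).prod

/-- Each momentum derivative lowers the exponent by one and brings down the exponent and a component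
of the direction. If there are more derivatives than powers, the descending factorial vanishes, so
the truncated subtraction in the exponent is harmless. -/
theorem pDerivs_eq_sum_ridge (l : List (Fin 4)) (x p : Spacetime) :
    Q.pDerivs l x p = ∑ τ : Q.RidgeIndex,
      (τ.factor l * ((inner ℝ τ.dir p : ℝ) : ℂ) ^ (τ.deg - l.length)) • τ.coeff x := by
  induction l generalizing p with
  | nil =>
    simp only [pDerivs, matPartials, List.foldr_nil, RidgeIndex.factor]
    rw [symbol_eq_sum_ridge]
    simp
  | cons μ l ih =>
    have h1 : Q.pDerivs (μ :: l) x p = matPartial μ (Q.pDerivs l x) p := rfl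
    rw [h1, funext ih]
    ext a b
    have hd : ∀ τ : Q.RidgeIndex, HasFDerivAt (fun q : Spacetime =>
        ((τ.factor l * ((inner ℝ τ.dir q : ℝ) : ℂ) ^ (τ.deg - l.length)) • τ.coeff x) a b)
        ((τ.factor l * (((τ.deg - l.length : ℕ) : ℂ) * ((inner ℝ τ.dir p : ℝ) : ℂ) ^
          (τ.deg - l.length - 1)) * τ.coeff x a b) •
          (Complex.ofRealCLM.comp (innerSL ℝ τ.dir))) p := by
      intro τ
      have h2 := ((((Complex.ofRealCLM.comp (innerSL ℝ τ.dir)).hasFDerivAt (x := p)).pow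
        (τ.deg - l.length)).const_mul (τ.factor l)).mul_const (τ.coeff x a b)
      refine h2.congr_fderiv ?_
      ext v
      simp
      ring
    simp only [matPartial, Matrix.of_apply, Matrix.sum_apply]
    rw [(HasFDerivAt.fun_sum fun τ _ => hd τ).fderiv]
    simp only [sum_apply, smul_apply, ContinuousLinearMap.comp_apply, innerSL_apply_apply,
      Complex.ofRealCLM_apply, Matrix.smul_apply, smul_eq_mul]
    refine Finset.sum_congr rfl fun τ _ => ?_
    rw [real_inner_comm (unitVec μ) τ.dir, inner_unitVec]
    simp only [RidgeIndex.factor, List.length_cons, List.map_cons, List.prod_cons,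
      Nat.descFactorial_succ, Nat.sub_sub]
    push_cast
    ring

lemma slow_symbol (ε : ℝ) (x p : Spacetime) : (Q.slow ε).symbol x p = Q.symbol (ε • x) p := by
  unfold symbol slow
  refine Finset.sum_congr rfl fun m _ => tsum_congr fun n => ?_
  refine Finset.sum_congr rfl fun ν _ => Finset.sum_congr rfl fun μ _ => ?_
  rw [smul_smul]
  congr 1
  simp only [PiLp.smul_apply, smul_eq_mul, Complex.ofReal_mul, Finset.prod_mul_distrib,
    Finset.prod_const, Finset.card_univ, Fintype.card_fin]
  ring

lemma slow_pDerivs (ε : ℝ) (l : List (Fin 4)) (x p : Spacetime) :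
    (Q.slow ε).pDerivs l x p = Q.pDerivs l (ε • x) p := by
  unfold pDerivs
  simp only [slow_symbol]

/-- Symmetry in the momentum indices compensates for the reversal of the order of covariant
derivatives in integrations by parts. -/
lemma RidgeIndex.factor_perm (τ : Q.RidgeIndex) {l l' : List (Fin 4)} (h : l.Perm l') :
    τ.factor l = τ.factor l' := by
  rw [factor, factor, h.length_eq, (h.map _).prod_eq]

lemma pDerivs_perm {l l' : List (Fin 4)} (h : l.Perm l') (x p : Spacetime) :
    Q.pDerivs l x p = Q.pDerivs l' x p := by
  rw [pDerivs_eq_sum_ridge, pDerivs_eq_sum_ridge, h.length_eq]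
  simp only [RidgeIndex.factor_perm _ h]

lemma RidgeIndex.deg_le (τ : Q.RidgeIndex) : τ.deg ≤ Q.order := Nat.lt_succ_iff.1 τ.1.2

lemma RidgeIndex.factor_eq_zero (τ : Q.RidgeIndex) {l : List (Fin 4)} (h : Q.order < l.length) :
    τ.factor l = 0 := by
  rw [factor, Nat.descFactorial_of_lt (τ.deg_le.trans_lt h)]
  simp

lemma pDerivs_eq_zero_of_order_lt {l : List (Fin 4)} (h : Q.order < l.length) (x p : Spacetime) :
    Q.pDerivs l x p = 0 := by
  rw [pDerivs_eq_sum_ridge]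
  simp [RidgeIndex.factor_eq_zero _ h]

lemma HigherDerivsVanish.pDerivs_eq_zero (hQ : Q.HigherDerivsVanish) {l : List (Fin 4)}
    (h : 3 ≤ l.length) (x p : Spacetime) : Q.pDerivs l x p = 0 := by
  induction l generalizing p with
  | nil => simp at h
  | cons μ l ih =>
    rcases h.eq_or_lt with h | h
    · obtain ⟨ν, ρ, rfl⟩ := List.length_eq_two.1 (by simpa using h.symm : l.length = 2)
      exact hQ μ ν ρ x p
    · have h1 : Q.pDerivs (μ :: l) x p = matPartial μ (Q.pDerivs l x) p := rfl
      have h2 : Q.pDerivs l x = fun _ => 0 := funext fun p => ih (by simpa [Nat.lt_succ_iff] using h) p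
      rw [h1, h2]
      ext a b
      simp [matPartial]

end DiracSymbol

/-! ### Covariant derivatives of fields along fixed directions. -/

section CovariantFields

variable {N : ℕ} {s : Type*} {Λ : Type*} [NormedRing Λ] [NormedAlgebra ℂ Λ]

/-- The covariant derivative along `b` in the fundamental representation. -/
noncomputable def covFundDir (A : GaugeField N) (b : Spacetime) (ψ : Spacetime → s × Fin N → Λ)
    (x : Spacetime) : s × Fin N → Λ :=
  fun a => dirDeriv b (fun z => ψ z a) x - Complex.I • gaugeAct (gaugeDir A b x) (ψ x) a

/-- The covariant derivative along `b` of conjugate fields. -/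
noncomputable def covFundDirBar (A : GaugeField N) (b : Spacetime)
    (φ : Spacetime → s × Fin N → Λ) (x : Spacetime) : s × Fin N → Λ :=
  fun a => dirDeriv b (fun z => φ z a) x + Complex.I • gaugeActRight (φ x) (gaugeDir A b x) a

lemma gaugeDir_unitVec (A : GaugeField N) (μ : Fin 4) (x : Spacetime) :
    gaugeDir A (unitVec μ) x = A μ x := by
  simp [gaugeDir, unitVec]

lemma gaugeDir_add (A : GaugeField N) (b c x : Spacetime) :
    gaugeDir A (b + c) x = gaugeDir A b x + gaugeDir A c x := by
  simp [gaugeDir, add_smul, Finset.sum_add_distrib]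

lemma gaugeAct_add (U W : Matrix (Fin N) (Fin N) ℂ) (v : s × Fin N → Λ) :
    gaugeAct (U + W) v = gaugeAct U v + gaugeAct W v := by
  ext a; simp [gaugeAct, add_smul, Finset.sum_add_distrib]

lemma covFund_eq_covFundDir (A : GaugeField N) (μ : Fin 4) (ψ : Spacetime → s × Fin N → Λ) :
    covFund A μ ψ = covFundDir A (unitVec μ) ψ := by
  ext x a
  simp [covFund, covFundDir, dirDeriv, gaugeDir_unitVec]

variable (s N Λ) in
/-- Smooth fermion fields. -/
def smoothFields : Submodule ℂ (Spacetime → s × Fin N → Λ) where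
  carrier := {ψ | ∀ a, ContDiff ℝ ∞ fun x => ψ x a}
  add_mem' := fun hf hg a => (hf a).add (hg a)
  zero_mem' := fun _ => contDiff_const
  smul_mem' := fun c _ hf a => (hf a).const_smul c

lemma IsHermitianField.contDiff_gaugeDir_entry {A : GaugeField N} (hA : IsHermitianField A)
    (b : Spacetime) (i j : Fin N) : ContDiff ℝ ∞ fun x => gaugeDir A b x i j := by
  simp only [gaugeDir, Matrix.sum_apply, Matrix.smul_apply]
  exact ContDiff.sum fun μ _ => ((hA μ).1 i j).const_smul (((b μ : ℝ) : ℂ))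

lemma contDiff_gaugeAct {P : Type*} [NormedAddCommGroup P] [NormedSpace ℝ P]
    {U : P → Matrix (Fin N) (Fin N) ℂ} {v : P → s × Fin N → Λ}
    (hU : ∀ i j, ContDiff ℝ ∞ fun x => U x i j) (hv : ∀ a, ContDiff ℝ ∞ fun x => v x a)
    (a : s × Fin N) : ContDiff ℝ ∞ fun x => gaugeAct (U x) (v x) a :=
  ContDiff.sum fun _ _ => (hU _ _).smul (hv _)

lemma contDiff_gaugeActRight {P : Type*} [NormedAddCommGroup P] [NormedSpace ℝ P]
    {U : P → Matrix (Fin N) (Fin N) ℂ} {v : P → s × Fin N → Λ}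
    (hU : ∀ i j, ContDiff ℝ ∞ fun x => U x i j) (hv : ∀ a, ContDiff ℝ ∞ fun x => v x a)
    (a : s × Fin N) : ContDiff ℝ ∞ fun x => gaugeActRight (v x) (U x) a :=
  ContDiff.sum fun _ _ => (hU _ _).smul (hv _)

variable {A : GaugeField N} (hA : IsHermitianField A)
include hA

lemma covFundDir_mem {ψ : Spacetime → s × Fin N → Λ} (hψ : ψ ∈ smoothFields N s Λ)
    (b : Spacetime) : covFundDir A b ψ ∈ smoothFields N s Λ := fun a =>
  ((hψ a).dirDeriv b).sub ((contDiff_gaugeAct (hA.contDiff_gaugeDir_entry b) hψ a).const_smul _)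

lemma covFundDirBar_mem {ψ : Spacetime → s × Fin N → Λ} (hψ : ψ ∈ smoothFields N s Λ)
    (b : Spacetime) : covFundDirBar A b ψ ∈ smoothFields N s Λ := fun a =>
  ((hψ a).dirDeriv b).add
    ((contDiff_gaugeActRight (hA.contDiff_gaugeDir_entry b) hψ a).const_smul _)

lemma covFundDir_iterate_mem {ψ : Spacetime → s × Fin N → Λ} (hψ : ψ ∈ smoothFields N s Λ)
    (b : Spacetime) (m : ℕ) : (covFundDir A b)^[m] ψ ∈ smoothFields N s Λ := by
  induction m with
  | zero => exact hψ
  | succ m ih => rw [Function.iterate_succ_apply']; exact covFundDir_mem hA ih b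

lemma covFundDirBar_iterate_mem {ψ : Spacetime → s × Fin N → Λ} (hψ : ψ ∈ smoothFields N s Λ)
    (b : Spacetime) (m : ℕ) : (covFundDirBar A b)^[m] ψ ∈ smoothFields N s Λ := by
  induction m with
  | zero => exact hψ
  | succ m ih => rw [Function.iterate_succ_apply']; exact covFundDirBar_mem hA ih b

end CovariantFields

/-! ### Coordinates and covariant derivatives as operators; the symmetrized operator. -/

section FieldOperators

variable {N : ℕ} {s : Type*} {Λ : Type*} [NormedRing Λ] [NormedAlgebra ℂ Λ]

variable (N s Λ) in
/-- Multiplication by a coordinate. -/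
noncomputable def coordEnd (ν : Fin 4) : Module.End ℂ (smoothFields N s Λ) where
  toFun ψ := ⟨fun x a => ((x ν : ℝ) : ℂ) • ψ.1 x a, fun a =>
    (DiracSymbol.coordCLM ν).contDiff.smul (ψ.2 a)⟩
  map_add' ψ φ := by ext x a; simp
  map_smul' c ψ := by ext x a; simp [smul_comm c]

variable (s Λ) in
/-- The covariant derivative along `b`, as an endomorphism of the smooth fields. -/
noncomputable def covEnd {A : GaugeField N} (hA : IsHermitianField A) (b : Spacetime) :
    Module.End ℂ (smoothFields N s Λ) where
  toFun ψ := ⟨covFundDir A b ψ.1, covFundDir_mem hA ψ.2 b⟩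
  map_add' ψ φ := by
    ext x a
    have := congrFun (dirDeriv_add (ψ.2 a) (φ.2 a) b) x
    simp only [Submodule.coe_add, Pi.add_apply, covFundDir, gaugeAct, smul_add,
      Finset.sum_add_distrib, this]
    abel
  map_smul' c ψ := by
    ext x a
    have := congrFun (dirDeriv_clm (W := Λ) (c • (ContinuousLinearMap.id ℝ Λ)) (ψ.2 a) b) x
    simp only [smul_apply, ContinuousLinearMap.id_apply] at this
    simp only [Submodule.coe_smul, Pi.smul_apply, covFundDir, gaugeAct, this, smul_sub,
      RingHom.id_apply, Finset.smul_sum]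
    congr 1
    refine Finset.sum_congr rfl fun j _ => ?_
    simp only [smul_smul]
    congr 1
    ring

variable {A : GaugeField N} (hA : IsHermitianField A)

/-- Linearity in the direction makes the sums of D_μ produced by polarization powers of one
covariant derivative. -/
lemma covEnd_sum {ι : Type*} (S : Finset ι) (b : ι → Spacetime) :
    covEnd s Λ hA (∑ i ∈ S, b i) = ∑ i ∈ S, covEnd s Λ hA (b i) := by
  classical
  have h0 : covEnd s Λ hA 0 = 0 := by
    ext ψ x a
    simp [covEnd, covFundDir, dirDeriv, gaugeDir, gaugeAct]
  have hadd : ∀ b c, covEnd s Λ hA (b + c) = covEnd s Λ hA b + covEnd s Λ hA c := by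
    intro b c
    ext ψ x a
    simp only [covEnd, LinearMap.coe_mk, AddHom.coe_mk, LinearMap.add_apply, Submodule.coe_add,
      Pi.add_apply, covFundDir, dirDeriv, map_add, gaugeDir_add, gaugeAct_add, smul_add]
    abel
  induction S using Finset.induction_on with
  | empty => simp [h0]
  | insert i S hi ih => rw [Finset.sum_insert hi, Finset.sum_insert hi, hadd, ih]

lemma covEnd_pow_apply (b : Spacetime) (m : ℕ) (ψ : smoothFields N s Λ) :
    ((covEnd s Λ hA b ^ m) ψ).1 = (covFundDir A b)^[m] ψ.1 := by
  induction m with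
  | zero => simp
  | succ m ih =>
    rw [pow_succ', Module.End.mul_apply, Function.iterate_succ_apply', ← ih]
    rfl

lemma coordEnd_commute (ν ρ : Fin 4) : Commute (coordEnd N s Λ ν) (coordEnd N s Λ ρ) := by
  ext ψ x a
  simp [coordEnd, smul_smul, mul_comm]

/-- The gauge term commutes with multiplication by a coordinate, so the commutator is the scalar
b^ν. This is the centrality on which Weyl ordering rests. -/
lemma covEnd_mul_coordEnd (b : Spacetime) (ν : Fin 4) :
    covEnd s Λ hA b * coordEnd N s Λ ν =
      coordEnd N s Λ ν * covEnd s Λ hA b + algebraMap ℂ _ ((b ν : ℝ) : ℂ) := by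
  ext ψ x a
  have h : dirDeriv b (fun z => ((z ν : ℝ) : ℂ) • ψ.1 z a) x =
      ((x ν : ℝ) : ℂ) • dirDeriv b (fun z => ψ.1 z a) x + ((b ν : ℝ) : ℂ) • ψ.1 x a := by
    have h1 : HasFDerivAt (fun z => DiracSymbol.coordCLM ν z • ψ.1 z a) _ x :=
      ((DiracSymbol.coordCLM ν).hasFDerivAt (x := x)).smul
        ((ψ.2 a).differentiable_infty x).hasFDerivAt
    simp only [dirDeriv]
    change fderiv ℝ (fun z => DiracSymbol.coordCLM ν z • ψ.1 z a) x b = _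
    rw [h1.fderiv]
    simp only [add_apply, smul_apply, ContinuousLinearMap.smulRight_apply]
    rfl
  simp only [covEnd, coordEnd, Module.End.mul_apply, LinearMap.coe_mk, AddHom.coe_mk,
    LinearMap.add_apply, Submodule.coe_add, Pi.add_apply, covFundDir, h, gaugeAct,
    Module.algebraMap_end_apply, Submodule.coe_smul, Pi.smul_apply, smul_sub, Finset.smul_sum]
  simp only [smul_comm ((x ν : ℝ) : ℂ)]
  abel

lemma coordEnd_list_prod_apply {n : ℕ} (ν : Fin n → Fin 4) (ψ : smoothFields N s Λ) (x : Spacetime)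
    (a : s × Fin N) : ((List.ofFn fun i => coordEnd N s Λ (ν i)).prod ψ).1 x a =
      (∏ i, ((x (ν i) : ℝ) : ℂ)) • ψ.1 x a := by
  induction n with
  | zero => simp
  | succ n ih =>
    rw [List.ofFn_succ, List.prod_cons, Module.End.mul_apply, Fin.prod_univ_succ, mul_smul, ← ih]
    rfl

lemma wordOp_eq_list_prod (w : List (Fin 4 ⊕ Fin 4)) (ψ : smoothFields N s Λ) :
    wordOp A w ψ.1 = ((w.map (Sum.elim (coordEnd N s Λ)
      (fun μ => covEnd s Λ hA (unitVec μ)))).prod ψ).1 := by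
  induction w with
  | nil => simp [wordOp]
  | cons a w ih =>
    have h : wordOp A (a :: w) ψ.1 = letterOp A a (wordOp A w ψ.1) := rfl
    rw [h, ih, List.map_cons, List.prod_cons, Module.End.mul_apply]
    cases a with
    | inl ν => rfl
    | inr μ => exact covFund_eq_covFundDir _ _ _

/-- The symmetrized product of coordinates and covariant derivatives, in terms of powers of
covariant derivatives in fixed directions. -/
theorem symmetrizedOp_eq {n m : ℕ} (ν : Fin n → Fin 4) (μ : Fin m → Fin 4)
    (ψ : smoothFields N s Λ) (x : Spacetime) (a : s × Fin N) :
    symmetrizedOp A ν μ ψ.1 x a = ∑ S : Finset (Fin m),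
      ((-1) ^ S.card * (m.factorial : ℂ)⁻¹ * ((2⁻¹ : ℂ) ^ m) * ((n + m).factorial : ℂ)) •
        ∑ i ∈ Finset.range (m + 1), (m.choose i : ℂ) •
          ((covEnd s Λ hA (∑ k ∈ Sᶜ, unitVec (μ k)) ^ i *
            (List.ofFn fun k => coordEnd N s Λ (ν k)).prod *
            covEnd s Λ hA (∑ k ∈ Sᶜ, unitVec (μ k)) ^ (m - i)) ψ).1 x a := by
  have h0 : (m.factorial : ℂ) ≠ 0 := by exact_mod_cast m.factorial_ne_zero
  have h1 := factorial_smul_sum_perm_append (fun k => coordEnd N s Λ (ν k))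
    (fun k => covEnd s Λ hA (unitVec (μ k)))
  -- After polarization only one covariant derivative occurs in each word, so the noncommutativity
  -- of the D_μ plays no role.
  have h2 : ∀ S : Finset (Fin m), _ := fun S => sum_perm_append_const (m := m)
    (fun k => coordEnd N s Λ (ν k)) (covEnd s Λ hA (∑ k ∈ Sᶜ, unitVec (μ k)))
    (fun i j => coordEnd_commute _ _)
    (fun k => algebraMap ℂ _ (((∑ k ∈ Sᶜ, unitVec (μ k) : Spacetime) (ν k) : ℝ) : ℂ))
    (fun k z => Algebra.commutes _ _) (fun k => covEnd_mul_coordEnd hA _ _)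
  simp_rw [← covEnd_sum, h2] at h1
  have h3 : symmetrizedOp A ν μ ψ.1 x a = ((∑ σ : Equiv.Perm (Fin (n + m)),
      (List.ofFn (Fin.append (fun k => coordEnd N s Λ (ν k))
        (fun k => covEnd s Λ hA (unitVec (μ k))) ∘ σ)).prod) ψ).1 x a := by
    simp only [symmetrizedOp, LinearMap.sum_apply, AddSubmonoidClass.coe_finsetSum,
      Finset.sum_apply]
    refine Finset.sum_congr rfl fun σ _ => ?_
    have e : (Sum.elim (coordEnd N s Λ) (fun μ => covEnd s Λ hA (unitVec μ))) ∘
        (Fin.append (fun i => .inl (ν i)) (fun j => .inr (μ j))) =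
        Fin.append (fun k => coordEnd N s Λ (ν k)) (fun k => covEnd s Λ hA (unitVec (μ k))) := by
      ext k : 1
      refine Fin.addCases (fun i => ?_) (fun i => ?_) k <;> simp
    rw [wordOp_eq_list_prod hA, List.map_ofFn, ← Function.comp_assoc, e]
  have h4 := congrArg (fun L : Module.End ℂ (smoothFields N s Λ) => (L ψ).1 x a) h1
  simp only [LinearMap.smul_apply, LinearMap.sum_apply, Submodule.coe_smul, Pi.smul_apply,
    AddSubmonoidClass.coe_finsetSum, Finset.sum_apply] at h4 h3
  rw [← h3] at h4
  rw [← inv_smul_smul₀ h0 (symmetrizedOp A ν μ ψ.1 x a), h4, Finset.smul_sum]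
  refine Finset.sum_congr rfl fun S _ => ?_
  rw [smul_smul, smul_smul, smul_smul]
  congr 1
  ring

end FieldOperators

/-! ### The weak form of the Dirac operator. -/

section WeakForm

variable {N : ℕ} {s : Type*} {Λ : Type*} [NormedRing Λ] [NormedAlgebra ℂ Λ]

lemma covFundDirBar_eq_zero_of_notMem_tsupport {A : GaugeField N} {b : Spacetime}
    {φ : Spacetime → s × Fin N → Λ} {x : Spacetime} (hx : x ∉ tsupport φ) :
    covFundDirBar A b φ x = 0 := by
  have h0 : φ =ᶠ[𝓝 x] 0 := notMem_tsupport_iff_eventuallyEq.1 hx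
  ext a
  have h1 : (fun z => φ z a) =ᶠ[𝓝 x] fun _ => 0 := by
    filter_upwards [h0] with z hz; simp [hz]
  simp [covFundDirBar, dirDeriv, h1.fderiv_eq, h0.eq_of_nhds, gaugeActRight]

lemma covFundDirBar_tsupport_subset (A : GaugeField N) (b : Spacetime)
    (φ : Spacetime → s × Fin N → Λ) : tsupport (covFundDirBar A b φ) ⊆ tsupport φ :=
  closure_minimal (fun _ hx => by_contra fun h => hx (covFundDirBar_eq_zero_of_notMem_tsupport h))
    (isClosed_tsupport φ)

lemma covFundDirBar_iterate_tsupport_subset (A : GaugeField N) (b : Spacetime)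
    (φ : Spacetime → s × Fin N → Λ) (m : ℕ) :
    tsupport ((covFundDirBar A b)^[m] φ) ⊆ tsupport φ := by
  induction m with
  | zero => exact subset_rfl
  | succ m ih =>
    rw [Function.iterate_succ_apply']
    exact (covFundDirBar_tsupport_subset _ _ _).trans ih

lemma HasCompactSupport.covFundDirBar_iterate {φ : Spacetime → s × Fin N → Λ}
    (hc : HasCompactSupport φ) (A : GaugeField N) (b : Spacetime) (m : ℕ) :
    HasCompactSupport ((covFundDirBar A b)^[m] φ) :=
  hc.of_isClosed_subset (isClosed_tsupport _) (covFundDirBar_iterate_tsupport_subset A b φ m)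

lemma hasCompactSupport_sum_mul {φ χ : Spacetime → s × Fin N → Λ} (hc : HasCompactSupport φ)
    (a c : s) : HasCompactSupport fun x => ∑ j, φ x (a, j) * χ x (c, j) :=
  hc.mono fun x hx => by
    contrapose! hx
    simp [Function.notMem_support.1 hx]

lemma contDiff_sum_mul {φ χ : Spacetime → s × Fin N → Λ} (hφ : φ ∈ smoothFields N s Λ)
    (hχ : χ ∈ smoothFields N s Λ) (a c : s) :
    ContDiff ℝ ∞ fun x => ∑ j, φ x (a, j) * χ x (c, j) :=
  ContDiff.sum fun _ _ => (hφ _).mul (hχ _)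

/-- In the sum over the gauge index the connection terms of the two fields cancel, and the ordinary
Leibniz rule remains. -/
lemma sum_mul_covFundDir_add {A : GaugeField N} {φ χ : Spacetime → s × Fin N → Λ}
    (hφ : φ ∈ smoothFields N s Λ) (hχ : χ ∈ smoothFields N s Λ) (b : Spacetime) (a c : s)
    (x : Spacetime) :
    ∑ j, φ x (a, j) * covFundDir A b χ x (c, j) + ∑ j, covFundDirBar A b φ x (a, j) * χ x (c, j) =
      dirDeriv b (fun x => ∑ j, φ x (a, j) * χ x (c, j)) x := by
  have h1 : ∀ j, dirDeriv b (fun x => φ x (a, j) * χ x (c, j)) x =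
      φ x (a, j) * dirDeriv b (fun x => χ x (c, j)) x +
        dirDeriv b (fun x => φ x (a, j)) x * χ x (c, j) := by
    intro j
    simp only [dirDeriv]
    rw [fderiv_fun_mul' ((hφ _).differentiable_infty x) ((hχ _).differentiable_infty x)]
    simp
  rw [dirDeriv_sum fun j => (hφ _).mul (hχ _)]
  simp only [h1, covFundDir, covFundDirBar, mul_sub, add_mul, Finset.sum_add_distrib,
    Finset.sum_sub_distrib, gaugeAct, gaugeActRight, mul_smul_comm, smul_mul_assoc, Finset.smul_sum,
    Finset.mul_sum, Finset.sum_mul]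
  rw [Finset.sum_comm (f := fun j k => Complex.I • gaugeDir A b x j k • (φ x (a, j) * χ x (c, k)))]
  abel

variable {A : GaugeField N}

/-- Integration by parts for covariant derivatives. -/
lemma integral_sum_mul_covFundDir (hA : IsHermitianField A) {φ χ : Spacetime → s × Fin N → Λ}
    (hφ : φ ∈ smoothFields N s Λ) (hc : HasCompactSupport φ) (hχ : χ ∈ smoothFields N s Λ)
    (b : Spacetime) (a c : s) :
    ∫ x, ∑ j, φ x (a, j) * covFundDir A b χ x (c, j) =
      -∫ x, ∑ j, covFundDirBar A b φ x (a, j) * χ x (c, j) := by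
  have h := integral_dirDeriv_eq_zero (ν := volume) (contDiff_sum_mul hφ hχ a c)
    (hasCompactSupport_sum_mul hc a c) b
  simp only [← sum_mul_covFundDir_add (A := A) hφ hχ] at h
  rw [integral_add] at h
  · exact eq_neg_of_add_eq_zero_left h
  · exact (contDiff_sum_mul hφ (covFundDir_mem hA hχ b) a c).continuous.integrable_of_hasCompactSupport
      (hasCompactSupport_sum_mul hc a c)
  · exact (contDiff_sum_mul (covFundDirBar_mem hA hφ b) hχ a c).continuous.integrable_of_hasCompactSupport
      (hasCompactSupport_sum_mul (hc.covFundDirBar_iterate A b 1) a c)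

lemma integral_sum_mul_covFundDir_iterate (hA : IsHermitianField A)
    {φ χ : Spacetime → s × Fin N → Λ}
    (hφ : φ ∈ smoothFields N s Λ) (hc : HasCompactSupport φ) (hχ : χ ∈ smoothFields N s Λ)
    (b : Spacetime) (a c : s) (i : ℕ) :
    ∫ x, ∑ j, φ x (a, j) * (covFundDir A b)^[i] χ x (c, j) =
      ((-1) ^ i : ℂ) • ∫ x, ∑ j, (covFundDirBar A b)^[i] φ x (a, j) * χ x (c, j) := by
  induction i generalizing φ with
  | zero => simp
  | succ i ih =>
    simp only [Function.iterate_succ_apply' (covFundDir A b)]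
    rw [integral_sum_mul_covFundDir hA hφ hc (covFundDir_iterate_mem hA hχ b i), ih
      (covFundDirBar_mem hA hφ b) (hc.covFundDirBar_iterate A b 1), pow_succ, mul_smul, neg_one_smul,
      smul_neg]
    rfl

lemma covEnd_pow_mul_coordEnd (hA : IsHermitianField A) (b : Spacetime) (ν : Fin 4) (k : ℕ) :
    covEnd s Λ hA b ^ (k + 1) * coordEnd N s Λ ν =
      coordEnd N s Λ ν * covEnd s Λ hA b ^ (k + 1) +
        algebraMap ℂ _ (((k + 1 : ℕ) : ℂ) * ((b ν : ℝ) : ℂ)) * covEnd s Λ hA b ^ k := by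
  induction k with
  | zero => simp [covEnd_mul_coordEnd hA]
  | succ k ih =>
    rw [pow_succ' _ (k + 1), mul_assoc, ih, mul_add, ← mul_assoc, covEnd_mul_coordEnd hA,
      ← mul_assoc, ← Algebra.commutes (_ * _ : ℂ) (covEnd s Λ hA b), mul_assoc _ (covEnd s Λ hA b),
      ← pow_succ', add_mul, mul_assoc, ← pow_succ', add_assoc, ← add_mul, ← map_add]
    congr 3
    push_cast
    ring

/-- The first covariant derivatives, up to order `k`, are bounded by `M` on `K`. -/
def CovBounded (hA : IsHermitianField A) (K : Set Spacetime) (b : Spacetime) (k : ℕ) (M : ℝ)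
    (χ : smoothFields N s Λ) : Prop :=
  ∀ j ≤ k, ∀ x ∈ K, ∀ a, ‖((covEnd s Λ hA b ^ j) χ).1 x a‖ ≤ M

/-- The commutator of D_b^j with x^ν is j b^ν D_b^{j-1}. So a coordinate costs a factor R + k‖b‖ and
no further derivatives. Products of n coordinates then grow only geometrically, as the summation of
the power series in x requires. -/
lemma CovBounded.coordEnd {hA : IsHermitianField A} {K : Set Spacetime} {b : Spacetime} {k : ℕ}
    {M R : ℝ} {χ : smoothFields N s Λ} (h : CovBounded hA K b k M χ) (hM : 0 ≤ M)
    (hR : ∀ x ∈ K, ‖x‖ ≤ R) (ν : Fin 4) :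
    CovBounded hA K b k ((R + k * ‖b‖) * M) (_root_.coordEnd N s Λ ν χ) := by
  intro j hj x hx a
  have hx1 : ‖((x ν : ℝ) : ℂ)‖ ≤ R := (DiracSymbol.norm_coord_le x ν).trans (hR x hx)
  have hb : ‖((b ν : ℝ) : ℂ)‖ ≤ ‖b‖ := DiracSymbol.norm_coord_le b ν
  have hR0 : 0 ≤ R := (norm_nonneg _).trans hx1
  rcases j with _ | j
  · rw [pow_zero, Module.End.one_apply]
    change ‖((x ν : ℝ) : ℂ) • χ.1 x a‖ ≤ _
    rw [norm_smul]
    have := h 0 (Nat.zero_le _) x hx a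
    rw [pow_zero, Module.End.one_apply] at this
    calc _ ≤ R * M := by gcongr
      _ ≤ _ := by gcongr; nlinarith [norm_nonneg b, (Nat.cast_nonneg k : (0 : ℝ) ≤ k)]
  · rw [← Module.End.mul_apply, covEnd_pow_mul_coordEnd]
    have e : ((_root_.coordEnd N s Λ ν * covEnd s Λ hA b ^ (j + 1) +
        algebraMap ℂ _ (((j + 1 : ℕ) : ℂ) * ((b ν : ℝ) : ℂ)) * covEnd s Λ hA b ^ j) χ).1 x a =
        ((x ν : ℝ) : ℂ) • ((covEnd s Λ hA b ^ (j + 1)) χ).1 x a +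
        (((j + 1 : ℕ) : ℂ) * ((b ν : ℝ) : ℂ)) • ((covEnd s Λ hA b ^ j) χ).1 x a := rfl
    rw [e]
    refine (norm_add_le _ _).trans ?_
    rw [norm_smul, norm_smul, norm_mul, Complex.norm_natCast, add_mul]
    have h1 := h (j + 1) hj x hx a
    have h2 := h j (by omega) x hx a
    have h3 : ((j + 1 : ℕ) : ℝ) ≤ k := by exact_mod_cast hj
    gcongr

lemma CovBounded.coordEnd_list {hA : IsHermitianField A} {K : Set Spacetime} {b : Spacetime} {k : ℕ}
    {M R : ℝ} {χ : smoothFields N s Λ} (h : CovBounded hA K b k M χ) (hM : 0 ≤ M) (hR0 : 0 ≤ R)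
    (hR : ∀ x ∈ K, ‖x‖ ≤ R) {n : ℕ} (ν : Fin n → Fin 4) :
    CovBounded hA K b k ((R + k * ‖b‖) ^ n * M)
      ((List.ofFn fun i => _root_.coordEnd N s Λ (ν i)).prod χ) := by
  induction n with
  | zero => simpa using h
  | succ n ih =>
    rw [List.ofFn_succ, List.prod_cons, Module.End.mul_apply, pow_succ', mul_assoc]
    exact (ih _).coordEnd (by positivity) hR _

lemma exists_covBounded [Finite s] (hA : IsHermitianField A) {K : Set Spacetime} (hK : IsCompact K)
    (b : Spacetime) (k : ℕ) (χ : smoothFields N s Λ) : ∃ M, 0 ≤ M ∧ CovBounded hA K b k M χ := by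
  have := Fintype.ofFinite s
  have h : ∀ (j : Fin (k + 1)) (a : s × Fin N), ∃ C, ∀ x ∈ K,
      ‖((covEnd s Λ hA b ^ (j : ℕ)) χ).1 x a‖ ≤ C := fun j a =>
    hK.exists_bound_of_continuousOn (((covEnd s Λ hA b ^ (j : ℕ)) χ).2 a).continuous.continuousOn
  choose C hC using h
  refine ⟨∑ j, ∑ a, |C j a|, by positivity, fun j hj x hx a => ?_⟩
  refine (hC ⟨j, by omega⟩ a x hx).trans ((le_abs_self _).trans ?_)
  refine (Finset.single_le_sum (f := fun a => |C ⟨j, by omega⟩ a|) (fun _ _ => abs_nonneg _)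
    (Finset.mem_univ a)).trans ?_
  exact Finset.single_le_sum (f := fun j => ∑ a, |C j a|) (fun _ _ => by positivity)
    (Finset.mem_univ _)

/-- Exchange of a sum with the pairing with a function of compact support. -/
lemma hasSum_integral_mul_of_bounded [CompleteSpace Λ] {φ : Spacetime → Λ} (hφ : Continuous φ)
    (hc : HasCompactSupport φ) {T : ℕ → Spacetime → Λ} (hT : ∀ n, Continuous (T n)) {c : ℕ → ℝ}
    (hs : Summable c) (hb : ∀ n, ∀ x ∈ tsupport φ, ‖T n x‖ ≤ c n) :
    HasSum (fun n => ∫ x, φ x * T n x) (∫ x, φ x * ∑' n, T n x) := by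
  have h0 : ∀ n x, ‖φ x * T n x‖ ≤ ‖φ x‖ * c n := fun n x => by
    by_cases hx : x ∈ tsupport φ
    · exact (norm_mul_le _ _).trans (by gcongr; exact hb n x hx)
    · simp [image_eq_zero_of_notMem_tsupport hx]
  refine hasSum_integral_of_dominated_convergence (fun n x => ‖φ x‖ * c n) ?_ ?_ ?_ ?_ ?_
  · exact fun n => (hφ.mul (hT n)).aestronglyMeasurable
  · exact fun n => Eventually.of_forall (h0 n)
  · exact Eventually.of_forall fun x => hs.mul_left _
  · simp only [tsum_mul_left]
    exact (hφ.integrable_of_hasCompactSupport hc).norm.mul_const _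
  · refine Eventually.of_forall fun x => ?_
    by_cases hx : x ∈ tsupport φ
    · exact (Summable.of_norm_bounded hs fun n => hb n x hx).hasSum.mul_left _
    · simp [image_eq_zero_of_notMem_tsupport hx, hasSum_zero]

end WeakForm

section WeakForm

variable {N : ℕ} {s : Type*} {Λ : Type*} [NormedRing Λ] [NormedAlgebra ℂ Λ]

lemma integrable_mul_tsum_of_bounded {φ : Spacetime → Λ} (hφ : Continuous φ)
    (hc : HasCompactSupport φ) {T : ℕ → Spacetime → Λ} (hT : ∀ n, Continuous (T n)) {c : ℕ → ℝ}
    [CompleteSpace Λ] (hs : Summable c) (hb : ∀ n, ∀ x ∈ tsupport φ, ‖T n x‖ ≤ c n) :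
    Integrable fun x => φ x * ∑' n, T n x := by
  refine ((hφ.integrable_of_hasCompactSupport hc).norm.mul_const (∑' n, c n)).mono' ?_ ?_
  · refine aestronglyMeasurable_of_tendsto_ae atTop
      (f := fun n x => φ x * ∑ i ∈ Finset.range n, T i x) (fun n => ?_) ?_
    · exact (hφ.mul (continuous_finsetSum _ fun i _ => hT i)).aestronglyMeasurable
    · refine Eventually.of_forall fun x => ?_
      by_cases hx : x ∈ tsupport φ
      · exact (Summable.of_norm_bounded hs fun n => hb n x hx).hasSum.tendsto_sum_nat.const_mul _
      · simp [image_eq_zero_of_notMem_tsupport hx]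
  · refine Eventually.of_forall fun x => ?_
    by_cases hx : x ∈ tsupport φ
    · refine (norm_mul_le _ _).trans ?_
      gcongr
      exact tsum_of_norm_bounded hs.hasSum fun n => hb n x hx
    · simp [image_eq_zero_of_notMem_tsupport hx]

lemma norm_unitVec (μ : Fin 4) : ‖unitVec μ‖ = 1 := by simp [unitVec]

lemma norm_sum_unitVec_le {m : ℕ} (μ : Fin m → Fin 4) (S : Finset (Fin m)) :
    ‖∑ k ∈ S, unitVec (μ k)‖ ≤ m := by
  refine (norm_sum_le _ _).trans ?_
  simp only [norm_unitVec, Finset.sum_const, nsmul_eq_mul, mul_one]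
  exact_mod_cast (Finset.card_le_univ S).trans_eq (Fintype.card_fin m)

variable {A : GaugeField N} (hA : IsHermitianField A)

lemma symmetrizedOp_mem (hA : IsHermitianField A) {n m : ℕ} (ν : Fin n → Fin 4) (μ : Fin m → Fin 4)
    (ψ : smoothFields N s Λ) : symmetrizedOp A ν μ ψ.1 ∈ smoothFields N s Λ := by
  intro a
  simp only [symmetrizedOp_eq hA]
  exact ContDiff.sum fun S _ => (ContDiff.sum fun i _ =>
    ((((covEnd s Λ hA (∑ k ∈ Sᶜ, unitVec (μ k)) ^ i *
            (List.ofFn fun k => coordEnd N s Λ (ν k)).prod *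
            covEnd s Λ hA (∑ k ∈ Sᶜ, unitVec (μ k)) ^ (m - i)) ψ).2 a).const_smul
              (m.choose i : ℂ))).const_smul _

/-- The constant is uniform in `n`. The shift m · m arises because at most m derivatives are taken,
in a direction of length at most m. -/
lemma exists_norm_symmetrizedOp_le [Finite s] (hA : IsHermitianField A) {K : Set Spacetime}
    {R : ℝ} (hR0 : 0 ≤ R) (hK : IsCompact K) (hR : ∀ x ∈ K, ‖x‖ ≤ R) (m : ℕ)
    (ψ : smoothFields N s Λ) :
    ∃ C, 0 ≤ C ∧ ∀ (n : ℕ) (ν : Fin n → Fin 4) (μ : Fin m → Fin 4), ∀ x ∈ K, ∀ a,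
      ‖symmetrizedOp A ν μ ψ.1 x a‖ ≤ C * (((n + m).factorial : ℝ) * (R + m * m) ^ n) := by
  have h := fun (μ : Fin m → Fin 4) (S : Finset (Fin m)) (i : ℕ) =>
    exists_covBounded (Λ := Λ) hA hK (∑ k ∈ Sᶜ, unitVec (μ k)) m
      ((covEnd s Λ hA (∑ k ∈ Sᶜ, unitVec (μ k)) ^ (m - i)) ψ)
  choose M hM0 hM using h
  let t : (Fin m → Fin 4) → Finset (Fin m) → ℝ := fun μ S =>
    ‖((-1) ^ S.card * (m.factorial : ℂ)⁻¹ * ((2⁻¹ : ℂ) ^ m))‖ * ∑ i ∈ Finset.range (m + 1),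
      ‖(m.choose i : ℂ)‖ * M μ S i
  have ht : ∀ μ S, 0 ≤ t μ S := fun μ S =>
    mul_nonneg (norm_nonneg _) (Finset.sum_nonneg fun i _ => mul_nonneg (norm_nonneg _) (hM0 _ _ _))
  refine ⟨∑ μ, ∑ S, t μ S, Finset.sum_nonneg fun _ _ => Finset.sum_nonneg fun _ _ => ht _ _,
    fun n ν μ x hx a => ?_⟩
  refine le_trans ?_ (mul_le_mul_of_nonneg_right (Finset.single_le_sum
    (f := fun μ => ∑ S, t μ S) (fun _ _ => Finset.sum_nonneg fun _ _ => ht _ _)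
    (Finset.mem_univ μ)) (by positivity))
  rw [symmetrizedOp_eq hA, Finset.sum_mul]
  refine (norm_sum_le _ _).trans (Finset.sum_le_sum fun S _ => ?_)
  rw [norm_smul, norm_mul _ (((n + m).factorial : ℕ) : ℂ), Complex.norm_natCast]
  simp only [t]
  rw [mul_assoc ‖_‖, mul_assoc ‖_‖]
  refine mul_le_mul_of_nonneg_left (a := ‖((-1) ^ S.card * (m.factorial : ℂ)⁻¹ * (2⁻¹ : ℂ) ^ m)‖)
    ?_ (norm_nonneg _)
  rw [mul_comm (Finset.sum _ _), mul_assoc]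
  refine mul_le_mul_of_nonneg_left ?_ (by positivity)
  refine (norm_sum_le _ _).trans ?_
  rw [Finset.mul_sum]
  refine Finset.sum_le_sum fun i hi => ?_
  rw [norm_smul, mul_left_comm]
  refine mul_le_mul_of_nonneg_left (a := ‖(m.choose i : ℂ)‖) ?_ (norm_nonneg _)
  rw [mul_assoc, Module.End.mul_apply, Module.End.mul_apply]
  refine ((hM μ S i).coordEnd_list (hM0 _ _ _) hR0 hR ν i (by simpa [Nat.lt_succ_iff] using hi)
    x hx a).trans ?_
  have := norm_sum_unitVec_le μ Sᶜ
  have := hM0 μ S i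
  gcongr

variable [Fintype s]

/-- The part of the Dirac operator of order `m` in `D` and order `n` in `x`. -/
noncomputable def diracTerm (A : GaugeField N) (Q : DiracSymbol s) (m n : ℕ)
    (ψ : Spacetime → s × Fin N → Λ) (x : Spacetime) (a : s × Fin N) : Λ :=
  ∑ ν : Fin n → Fin 4, ∑ μ : Fin m → Fin 4,
    ∑ b, Q.coeff n m ν μ a.1 b • symmetrizedOp A ν μ ψ x (b, a.2)

lemma exists_norm_diracTerm_le (hA : IsHermitianField A) (Q : DiracSymbol s) {K : Set Spacetime}
    (hK : IsCompact K) (m : ℕ) (ψ : smoothFields N s Λ) :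
    ∃ c : ℕ → ℝ, Summable c ∧ ∀ n, ∀ x ∈ K, ∀ a, ‖diracTerm A Q m n ψ.1 x a‖ ≤ c n := by
  obtain ⟨R, hR0, hR⟩ : ∃ R, 0 ≤ R ∧ ∀ x ∈ K, ‖x‖ ≤ R := by
    obtain ⟨R, hR⟩ := hK.isBounded.exists_norm_le
    exact ⟨max R 0, le_max_right _ _, fun x hx => (hR x hx).trans (le_max_left _ _)⟩
  obtain ⟨C, hC0, hC⟩ := exists_norm_symmetrizedOp_le hA hR0 hK hR m ψ
  refine ⟨fun n => ∑ a : s, C * ∑ b, ((n + m).factorial : ℝ) * (R + m * m) ^ n *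
    ∑ ν, ∑ μ, ‖Q.coeff n m ν μ a b‖, ?_, fun n x hx a => ?_⟩
  -- Convergence of the power series everywhere is needed here: commutators enlarge the radius from
  -- R to R + m².
  · exact summable_sum fun a _ => (summable_sum fun b _ =>
      Q.summable_coeff m (R + m * m) (by positivity) a b).mul_left C
  · refine le_trans ?_ (Finset.single_le_sum (f := fun a => C * ∑ b, ((n + m).factorial : ℝ) *
      (R + m * m) ^ n * ∑ ν, ∑ μ, ‖Q.coeff n m ν μ a b‖) (fun _ _ => by positivity)
      (Finset.mem_univ a.1))
    refine (norm_sum_le _ _).trans ?_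
    calc _ ≤ ∑ ν : Fin n → Fin 4, ∑ μ : Fin m → Fin 4, ∑ b, ‖Q.coeff n m ν μ a.1 b‖ *
          (C * (((n + m).factorial : ℝ) * (R + m * m) ^ n)) := by
          refine Finset.sum_le_sum fun ν _ => (norm_sum_le _ _).trans ?_
          refine Finset.sum_le_sum fun μ _ => (norm_sum_le _ _).trans ?_
          refine Finset.sum_le_sum fun b _ => ?_
          rw [norm_smul]
          gcongr
          exact hC n ν μ x hx _
      _ = _ := by
          simp only [← Finset.sum_mul]
          simp only [Finset.sum_comm (s := (Finset.univ : Finset (Fin m → Fin 4)))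
            (t := (Finset.univ : Finset s))]
          rw [Finset.sum_comm]
          simp only [← Finset.mul_sum]
          ring

lemma continuous_diracTerm (hA : IsHermitianField A) (Q : DiracSymbol s) (m n : ℕ)
    (ψ : smoothFields N s Λ) (a : s × Fin N) : Continuous fun x => diracTerm A Q m n ψ.1 x a :=
  continuous_finsetSum _ fun ν _ => continuous_finsetSum _ fun μ _ => continuous_finsetSum _
    fun b _ => (symmetrizedOp_mem hA ν μ ψ (b, a.2)).continuous.const_smul _

/-- The pairing of two fields through a power of the covariant derivative distributed over
both. -/
noncomputable def ridgePairing (A : GaugeField N) (b : Spacetime) (m : ℕ) (a c : s)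
    (f : Spacetime → ℂ) (φ ψ : Spacetime → s × Fin N → Λ) : Λ :=
  ∑ i ∈ Finset.range (m + 1), (((m.choose i : ℂ) * (-1) ^ i)) •
    ∫ x, ∑ j, (covFundDirBar A b)^[i] φ x (a, j) * (f x • (covFundDir A b)^[m - i] ψ x (c, j))

/-- The derivatives to the left of the coordinates are integrated by parts, which leaves a
multiplication operator between the two fields. In this form the monomials can be summed to the
power series. -/
lemma integral_sum_mul_word (hA : IsHermitianField A) {φ : Spacetime → s × Fin N → Λ}
    (hφ : φ ∈ smoothFields N s Λ) (hc : HasCompactSupport φ) (ψ : smoothFields N s Λ)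
    (b : Spacetime) (m : ℕ) (a c : s) {n : ℕ} (ν : Fin n → Fin 4) :
    ∫ x, ∑ j, φ x (a, j) * ∑ i ∈ Finset.range (m + 1), (m.choose i : ℂ) •
      ((covEnd s Λ hA b ^ i * (List.ofFn fun k => coordEnd N s Λ (ν k)).prod *
        covEnd s Λ hA b ^ (m - i)) ψ).1 x (c, j) =
      ridgePairing A b m a c (fun x => ∏ k, ((x (ν k) : ℝ) : ℂ)) φ ψ.1 := by
  have h1 : ∀ x, ∑ j, φ x (a, j) * ∑ i ∈ Finset.range (m + 1), (m.choose i : ℂ) •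
      ((covEnd s Λ hA b ^ i * (List.ofFn fun k => coordEnd N s Λ (ν k)).prod *
        covEnd s Λ hA b ^ (m - i)) ψ).1 x (c, j) =
      ∑ i ∈ Finset.range (m + 1), (m.choose i : ℂ) • ∑ j, φ x (a, j) *
      (covFundDir A b)^[i] (((List.ofFn fun k => coordEnd N s Λ (ν k)).prod *
        covEnd s Λ hA b ^ (m - i)) ψ).1 x (c, j) := by
    intro x
    simp only [Finset.mul_sum, Finset.smul_sum, mul_smul_comm, ← covEnd_pow_apply hA,
      ← Module.End.mul_apply, ← mul_assoc]
    exact Finset.sum_comm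
  simp only [h1]
  rw [integral_finsetSum, ridgePairing]
  · refine Finset.sum_congr rfl fun i _ => ?_
    rw [integral_smul, integral_sum_mul_covFundDir_iterate hA hφ hc (SetLike.coe_mem _), smul_smul]
    simp only [Module.End.mul_apply, coordEnd_list_prod_apply, covEnd_pow_apply]
  · intro i _
    have := (contDiff_sum_mul hφ (covFundDir_iterate_mem hA (SetLike.coe_mem
      (((List.ofFn fun k => coordEnd N s Λ (ν k)).prod * covEnd s Λ hA b ^ (m - i)) ψ)) b i)
      a c).continuous.integrable_of_hasCompactSupport (μ := volume)
      (hasCompactSupport_sum_mul hc a c)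
    exact this.smul (m.choose i : ℂ)

lemma ridgePairing_integrable (hA : IsHermitianField A) {φ ψ : Spacetime → s × Fin N → Λ}
    (hφ : φ ∈ smoothFields N s Λ) (hc : HasCompactSupport φ) (hψ : ψ ∈ smoothFields N s Λ)
    (b : Spacetime) (m i : ℕ) (a c : s) {f : Spacetime → ℂ} (hf : Continuous f) (j : Fin N) :
    Integrable fun x =>
      (covFundDirBar A b)^[i] φ x (a, j) * (f x • (covFundDir A b)^[m] ψ x (c, j)) := by
  refine Continuous.integrable_of_hasCompactSupport ?_ ?_
  · exact (covFundDirBar_iterate_mem hA hφ b i _).continuous.mul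
      (hf.smul (covFundDir_iterate_mem hA hψ b _ _).continuous)
  · refine (hc.covFundDirBar_iterate A b i).mono fun x hx => ?_
    contrapose! hx
    simp [Function.notMem_support.1 hx]

lemma ridgePairing_sum (hA : IsHermitianField A) {φ ψ : Spacetime → s × Fin N → Λ}
    (hφ : φ ∈ smoothFields N s Λ) (hc : HasCompactSupport φ) (hψ : ψ ∈ smoothFields N s Λ)
    (b : Spacetime) (m : ℕ) (a c : s) {κ : Type*} [Fintype κ] (k : κ → ℂ)
    {f : κ → Spacetime → ℂ} (hf : ∀ ν, Continuous (f ν)) :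
    ridgePairing A b m a c (fun x => ∑ ν, k ν * f ν x) φ ψ =
      ∑ ν, k ν • ridgePairing A b m a c (f ν) φ ψ := by
  simp only [ridgePairing, Finset.smul_sum]
  rw [Finset.sum_comm]
  refine Finset.sum_congr rfl fun i _ => ?_
  simp only [smul_comm (k _)]
  rw [← Finset.smul_sum]
  simp only [← integral_smul]
  rw [← integral_finsetSum]
  · rw [integral_smul]
    congr 1
    refine integral_congr_ae (Eventually.of_forall fun x => ?_)
    dsimp only
    simp only [Finset.smul_sum]
    rw [Finset.sum_comm]
    simp only [Finset.sum_smul, Finset.mul_sum, mul_smul, mul_smul_comm]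
  · intro ν _
    have := integrable_finsetSum Finset.univ fun j _ =>
      ridgePairing_integrable hA hφ hc hψ b (m - i) i a c (hf ν) j
    exact this.smul (k ν)

lemma hasSum_ridgePairing [CompleteSpace Λ] (hA : IsHermitianField A)
    {φ ψ : Spacetime → s × Fin N → Λ}
    (hφ : φ ∈ smoothFields N s Λ) (hc : HasCompactSupport φ) (hψ : ψ ∈ smoothFields N s Λ)
    (b : Spacetime) (m : ℕ) (a c : s) {g : ℕ → Spacetime → ℂ} (hg : ∀ n, Continuous (g n))
    (hg' : Continuous fun x => ∑' n, g n x)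
    {e : ℕ → ℝ} (he : Summable e) (hb : ∀ n, ∀ x ∈ tsupport φ, ‖g n x‖ ≤ e n) :
    HasSum (fun n => ridgePairing A b m a c (g n) φ ψ)
      (ridgePairing A b m a c (fun x => ∑' n, g n x) φ ψ) := by
  refine hasSum_sum fun i _ => HasSum.const_smul _ ?_
  have hi := fun {f : Spacetime → ℂ} (hf : Continuous f) (j : Fin N) =>
    ridgePairing_integrable hA hφ hc hψ b (m - i) i a c hf j
  rw [integral_finsetSum _ fun j _ => hi hg' j]
  simp only [fun n => integral_finsetSum Finset.univ fun j _ => hi (hg n) j]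
  refine hasSum_sum fun j _ => ?_
  have hcψ := (covFundDir_iterate_mem hA hψ b (m - i) (c, j)).continuous
  have hcφ := (covFundDirBar_iterate_mem hA hφ b i (a, j)).continuous
  have hs : HasCompactSupport fun x => (covFundDirBar A b)^[i] φ x (a, j) :=
    (hc.covFundDirBar_iterate A b i).comp_left (g := fun v : s × Fin N → Λ => v (a, j)) rfl
  have hsub : tsupport (fun x => (covFundDirBar A b)^[i] φ x (a, j)) ⊆ tsupport φ := by
    refine subset_trans (closure_mono fun x hx => ?_)
      (covFundDirBar_iterate_tsupport_subset A b φ i)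
    contrapose! hx
    simp [Function.notMem_support.1 hx]
  obtain ⟨M, hM⟩ := hc.isCompact.exists_bound_of_continuousOn hcψ.continuousOn
  have h := hasSum_integral_mul_of_bounded hcφ hs (T := fun n x =>
    g n x • (covFundDir A b)^[m - i] ψ x (c, j)) (fun n => (hg n).smul hcψ)
    (c := fun n => e n * |M|) (he.mul_right _) (fun n x hx => ?_)
  · convert h using 2
    funext x
    by_cases hx : x ∈ tsupport φ
    · rw [Summable.tsum_smul_const]
      exact Summable.of_norm_bounded he fun n => hb n x hx
    · have : (covFundDirBar A b)^[i] φ x (a, j) = 0 :=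
        image_eq_zero_of_notMem_tsupport (f := fun x => (covFundDirBar A b)^[i] φ x (a, j))
          fun h => hx (hsub h)
      simp [this]
  · rw [norm_smul]
    gcongr
    · exact (norm_nonneg _).trans (hb n x (hsub hx))
    · exact hb n x (hsub hx)
    · exact (hM x (hsub hx)).trans (le_abs_self _)

lemma integral_sum_mul_diracTerm (hA : IsHermitianField A) (Q : DiracSymbol s)
    {φ : Spacetime → s × Fin N → Λ}
    (hφ : φ ∈ smoothFields N s Λ) (hc : HasCompactSupport φ) (ψ : smoothFields N s Λ)
    (m n : ℕ) (a : s) :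
    ∑ j, ∫ x, φ x (a, j) * diracTerm A Q m n ψ.1 x (a, j) =
      ∑ c : s, ∑ μ : Fin m → Fin 4, ∑ S : Finset (Fin m),
        ((-1) ^ S.card * (m.factorial : ℂ)⁻¹ * ((2⁻¹ : ℂ) ^ m)) •
        ridgePairing A (∑ k ∈ Sᶜ, unitVec (μ k)) m a c (fun x => ∑ ν : Fin n → Fin 4,
          (((n + m).factorial : ℂ) * ∏ i, ((x (ν i) : ℝ) : ℂ)) * Q.coeff n m ν μ a c) φ ψ.1 := by
  rw [← integral_finsetSum]
  swap
  · intro j _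
    refine Continuous.integrable_of_hasCompactSupport
      ((hφ _).continuous.mul (continuous_diracTerm hA Q m n ψ _)) ?_
    refine hc.mono fun x hx => ?_
    contrapose! hx
    simp [Function.notMem_support.1 hx]
  have hcont : ∀ ν : Fin n → Fin 4, Continuous fun x : Spacetime => ∏ i, ((x (ν i) : ℝ) : ℂ) :=
    fun ν => continuous_finsetProd _ fun i _ => (DiracSymbol.coordCLM (ν i)).continuous
  have e1 : ∀ (c : s) (μ : Fin m → Fin 4) (S : Finset (Fin m)),
      ridgePairing A (∑ k ∈ Sᶜ, unitVec (μ k)) m a c (fun x => ∑ ν : Fin n → Fin 4,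
        (((n + m).factorial : ℂ) * ∏ i, ((x (ν i) : ℝ) : ℂ)) * Q.coeff n m ν μ a c) φ ψ.1 =
      ∑ ν : Fin n → Fin 4, (((n + m).factorial : ℂ) * Q.coeff n m ν μ a c) •
        ridgePairing A (∑ k ∈ Sᶜ, unitVec (μ k)) m a c (fun x => ∏ i, ((x (ν i) : ℝ) : ℂ)) φ ψ.1 := by
    intro c μ S
    rw [← ridgePairing_sum hA hφ hc ψ.2 _ _ _ _ _ hcont]
    congr 1
    ext x
    exact Finset.sum_congr rfl fun ν _ => by ring
  simp only [e1, Finset.smul_sum, ← integral_sum_mul_word hA hφ hc, smul_smul]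
  -- All finite indices are collected into one, so that the integral is exchanged with a single
  -- finite sum; `e4` and the final equivalence only reorder them.
  let K : (Fin n → Fin 4) × (Fin m → Fin 4) × s × Finset (Fin m) → ℂ := fun z =>
    Q.coeff n m z.1 z.2.1 a z.2.2.1 * ((-1) ^ z.2.2.2.card * (m.factorial : ℂ)⁻¹ *
      ((2⁻¹ : ℂ) ^ m) * ((n + m).factorial : ℂ))
  let W : (Fin n → Fin 4) × (Fin m → Fin 4) × s × Finset (Fin m) → Spacetime → Fin N → Λ :=
    fun z x j => ∑ i ∈ Finset.range (m + 1), (m.choose i : ℂ) •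
      ((covEnd s Λ hA (∑ k ∈ z.2.2.2ᶜ, unitVec (z.2.1 k)) ^ i *
        (List.ofFn fun k => coordEnd N s Λ (z.1 k)).prod *
        covEnd s Λ hA (∑ k ∈ z.2.2.2ᶜ, unitVec (z.2.1 k)) ^ (m - i)) ψ).1 x (z.2.2.1, j)
  have e2 : ∀ x, ∑ j, φ x (a, j) * diracTerm A Q m n ψ.1 x (a, j) =
      ∑ z, K z • ∑ j, φ x (a, j) * W z x j := by
    intro x
    have e3 : ∀ j, diracTerm A Q m n ψ.1 x (a, j) = ∑ z, K z • W z x j := by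
      intro j
      simp only [Fintype.sum_prod_type, diracTerm, symmetrizedOp_eq hA, K, W, mul_smul (Q.coeff _ _ _ _ _ _),
        ← Finset.smul_sum (r := Q.coeff _ _ _ _ _ _)]
    simp only [e3, Finset.mul_sum, Finset.smul_sum (r := K _), mul_smul_comm]
    exact Finset.sum_comm
  have hW : ∀ z, Integrable fun x => ∑ j, φ x (a, j) * W z x j := by
    intro z
    refine integrable_finsetSum _ fun j _ => Continuous.integrable_of_hasCompactSupport
      ((hφ _).continuous.mul ?_) ?_
    · exact continuous_finsetSum _ fun i _ => Continuous.const_smul (Subtype.prop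
        ((covEnd s Λ hA (∑ k ∈ z.2.2.2ᶜ, unitVec (z.2.1 k)) ^ i *
        (List.ofFn fun k => coordEnd N s Λ (z.1 k)).prod *
        covEnd s Λ hA (∑ k ∈ z.2.2.2ᶜ, unitVec (z.2.1 k)) ^ (m - i)) ψ) (z.2.2.1, j)).continuous _
    · refine hc.mono fun x hx => ?_
      contrapose! hx
      simp [Function.notMem_support.1 hx]
  simp only [e2]
  rw [integral_finsetSum Finset.univ (f := fun z x => K z • ∑ j, φ x (a, j) * W z x j)
    fun z _ => (hW z).smul (K z)]
  simp only [integral_smul]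
  have e4 : ∑ c : s, ∑ μ : Fin m → Fin 4, ∑ S : Finset (Fin m), ∑ ν : Fin n → Fin 4,
      ((-1) ^ S.card * (m.factorial : ℂ)⁻¹ * ((2⁻¹ : ℂ) ^ m) *
        (((n + m).factorial : ℂ) * Q.coeff n m ν μ a c)) •
        ∫ x, ∑ j, φ x (a, j) * W (ν, μ, c, S) x j =
      ∑ z : s × (Fin m → Fin 4) × Finset (Fin m) × (Fin n → Fin 4),
        ((-1) ^ z.2.2.1.card * (m.factorial : ℂ)⁻¹ * ((2⁻¹ : ℂ) ^ m) *
        (((n + m).factorial : ℂ) * Q.coeff n m z.2.2.2 z.2.1 a z.1)) •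
        ∫ x, ∑ j, φ x (a, j) * W (z.2.2.2, z.2.1, z.1, z.2.2.1) x j := by
    simp only [Fintype.sum_prod_type]
  refine Eq.trans ?_ e4.symm
  refine Fintype.sum_equiv ⟨fun z => (z.2.2.1, z.2.1, z.2.2.2, z.1),
    fun z => (z.2.2.2, z.2.1, z.1, z.2.2.1), fun _ => rfl, fun _ => rfl⟩ _ _ fun z => ?_
  simp only [Equiv.coe_fn_mk, K]
  congr 1
  ring

/-- The weak form of the Dirac operator. -/
theorem integral_sum_mul_diracOp [CompleteSpace Λ] (hA : IsHermitianField A) (Q : DiracSymbol s)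
    {φ ψ : Spacetime → s × Fin N → Λ}
    (hφ : φ ∈ smoothFields N s Λ) (hc : HasCompactSupport φ) (hψ : ψ ∈ smoothFields N s Λ) :
    ∫ x, ∑ a, φ x a * diracOp A Q ψ x a =
      ∑ a : s, ∑ m ∈ Finset.range (Q.order + 1), ∑ c : s, ∑ μ : Fin m → Fin 4,
        ∑ S : Finset (Fin m), ((-1) ^ S.card * (m.factorial : ℂ)⁻¹ * ((2⁻¹ : ℂ) ^ m)) •
        ridgePairing A (∑ k ∈ Sᶜ, unitVec (μ k)) m a c (fun x => Q.xSeries m μ x a c) φ ψ := by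
  lift ψ to smoothFields N s Λ using hψ
  have hcs : ∀ a, HasCompactSupport fun x => φ x a := fun a =>
    hc.comp_left (g := fun v : s × Fin N → Λ => v a) rfl
  have hsub : ∀ a, tsupport (fun x => φ x a) ⊆ tsupport φ := fun a => closure_mono fun x hx => by
    contrapose! hx
    simp [Function.notMem_support.1 hx]
  have hb := fun m => exists_norm_diracTerm_le hA Q hc.isCompact m ψ
  choose C hC hb using hb
  have e1 : ∀ x, ∑ a, φ x a * diracOp A Q ψ.1 x a = ∑ a : s, ∑ m ∈ Finset.range (Q.order + 1),
      ∑ j, φ x (a, j) * ∑' n, diracTerm A Q m n ψ.1 x (a, j) := by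
    intro x
    rw [Fintype.sum_prod_type]
    refine Finset.sum_congr rfl fun a _ => ?_
    rw [Finset.sum_comm]
    refine Finset.sum_congr rfl fun j _ => ?_
    rw [← Finset.mul_sum]
    rfl
  have hi : ∀ m a, Integrable fun x => φ x a * ∑' n, diracTerm A Q m n ψ.1 x a := fun m a =>
    integrable_mul_tsum_of_bounded (hφ a).continuous (hcs a)
      (fun n => continuous_diracTerm hA Q m n ψ a) (hC m) fun n x hx => hb m n x (hsub a hx) a
  simp only [e1]
  rw [integral_finsetSum _ fun a _ => integrable_finsetSum _ fun m _ =>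
    integrable_finsetSum _ fun j _ => hi m _]
  refine Finset.sum_congr rfl fun a _ => ?_
  rw [integral_finsetSum _ fun m _ => integrable_finsetSum _ fun j _ => hi m _]
  refine Finset.sum_congr rfl fun m _ => ?_
  rw [integral_finsetSum _ fun j _ => hi m _]
  -- Both sides are sums over the order n in x with equal terms by `integral_sum_mul_diracTerm`, so
  -- they agree by uniqueness of sums.
  have h1 : HasSum (fun n => ∑ j, ∫ x, φ x (a, j) * diracTerm A Q m n ψ.1 x (a, j))
      (∑ j, ∫ x, φ x (a, j) * ∑' n, diracTerm A Q m n ψ.1 x (a, j)) :=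
    hasSum_sum fun j _ => hasSum_integral_mul_of_bounded (hφ (a, j)).continuous (hcs _)
      (fun n => continuous_diracTerm hA Q m n ψ (a, j)) (hC m) fun n x hx => hb m n x (hsub _ hx) _
  refine h1.unique ?_
  simp only [integral_sum_mul_diracTerm hA Q hφ hc]
  obtain ⟨R, hR0, hR⟩ : ∃ R, 0 ≤ R ∧ ∀ x ∈ tsupport φ, ‖x‖ ≤ R := by
    obtain ⟨R, hR⟩ := hc.isCompact.isBounded.exists_norm_le
    exact ⟨max R 0, le_max_right _ _, fun x hx => (hR x hx).trans (le_max_left _ _)⟩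
  refine hasSum_sum fun c _ => hasSum_sum fun μ _ => hasSum_sum fun S _ => HasSum.const_smul _ ?_
  refine hasSum_ridgePairing hA hφ hc ψ.2 _ m a c (fun n => ?_)
    (Q.contDiff_xSeries m μ a c).continuous (Q.summable_coeff m R hR0 a c) fun n x hx => ?_
  · exact continuous_finsetSum _ fun ν _ => (continuous_const.mul (continuous_finsetProd _
      fun i _ => (DiracSymbol.coordCLM (ν i)).continuous)).mul continuous_const
  · refine (norm_sum_le _ _).trans ?_
    calc _ ≤ ∑ ν : Fin n → Fin 4, ((n + m).factorial : ℝ) * R ^ n * ‖Q.coeff n m ν μ a c‖ := by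
          refine Finset.sum_le_sum fun ν _ => ?_
          rw [norm_mul, norm_mul, Complex.norm_natCast]
          gcongr
          exact (DiracSymbol.norm_prod_coord_le x ν).trans (pow_le_pow_left₀ (norm_nonneg _) (hR x hx) n)
      _ ≤ _ := by
          rw [← Finset.mul_sum]
          exact mul_le_mul_of_nonneg_left (Q.sum_norm_coeff_le n m μ a c) (by positivity)

end WeakForm

/-! ### Smooth compactly supported families of kernels. -/

section TestFamilies

variable {m n : Type*} {V : Type*} [NormedAddCommGroup V] [NormedSpace ℂ V]

/-- Smooth matrix-valued functions of two points with compact support. -/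
structure IsTestFamily (F : Spacetime → Spacetime → Matrix m n V) : Prop where
  smooth : ∀ i j, ContDiff ℝ ∞ ↿(fun x y => F x y i j)
  compact : ∃ K, IsCompact K ∧ ∀ x y, x ∉ K ∨ y ∉ K → F x y = 0

namespace IsTestFamily

variable {F : Spacetime → Spacetime → Matrix m n V}

lemma hasCompactSupport_right (h : IsTestFamily F) (x : Spacetime) (i : m) (j : n) :
    HasCompactSupport fun y => F x y i j := by
  obtain ⟨K, hK, h0⟩ := h.compact
  exact HasCompactSupport.intro hK fun y hy => by rw [h0 x y (Or.inr hy)]; rfl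

lemma contDiff_right (h : IsTestFamily F) (x : Spacetime) (i : m) (j : n) :
    ContDiff ℝ ∞ fun y => F x y i j :=
  (h.smooth i j).curry_right (F := fun x y => F x y i j) x

lemma contDiff_left (h : IsTestFamily F) (y : Spacetime) (i : m) (j : n) :
    ContDiff ℝ ∞ fun x => F x y i j :=
  (h.smooth i j).curry_left (F := fun x y => F x y i j) y

lemma smul_right (h : IsTestFamily F) {g : Spacetime → ℂ} (hg : ContDiff ℝ ∞ g) :
    IsTestFamily fun x y => g y • F x y where
  smooth i j := (hg.comp contDiff_snd).smul (h.smooth i j)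
  compact := by
    obtain ⟨K, hK, h0⟩ := h.compact
    exact ⟨K, hK, fun x y hxy => by rw [h0 x y hxy, smul_zero]⟩

lemma contDiff_matIntegral [CompleteSpace V] (h : IsTestFamily F) :
    SmoothMat fun x => matIntegral volume (F x) := by
  intro i j
  obtain ⟨K, hK, h0⟩ := h.compact
  have := contDiff_integral_smul (n := ⊤) (ν := (volume : Measure Spacetime)) hK
    (F := fun x y => F x y i j) (f := fun _ => 1)
    (fun x y hy => by rw [h0 x y (Or.inr hy)]; rfl) (locallyIntegrable_const 1) (h.smooth i j)
  simp only [one_smul] at this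
  exact this

lemma matPartial_matIntegral [CompleteSpace V] (h : IsTestFamily F) (μ : Fin 4) (x : Spacetime) :
    matPartial μ (fun x => matIntegral volume (F x)) x =
      matIntegral volume fun y => matPartial μ (fun x => F x y) x := by
  ext i j
  obtain ⟨K, hK, h0⟩ := h.compact
  have h1 := hasFDerivAt_integral_smul (ν := (volume : Measure Spacetime)) hK
    (F := fun x y => F x y i j) (f := fun _ => 1)
    (fun x y hy => by rw [h0 x y (Or.inr hy)]; rfl) (locallyIntegrable_const 1)
    ((h.smooth i j).of_le (by simp)) x
  simp only [one_smul] at h1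
  simp only [matPartial, matIntegral, Matrix.of_apply]
  rw [h1.fderiv]
  have hcont : Continuous fun y => fderiv ℝ (fun x => F x y i j) x := by
    have h2 : ContDiff ℝ ∞ (Function.uncurry fun (y : Spacetime) (q : Spacetime) => F q y i j) :=
      (h.smooth i j).comp (contDiff_snd.prodMk contDiff_fst)
    exact (h2.fderiv (g := fun _ : Spacetime => x) contDiff_const (n := ∞) (m := ∞) le_rfl).continuous
  refine ContinuousLinearMap.integral_apply (hcont.integrable_of_hasCompactSupport ?_) _
  refine HasCompactSupport.intro hK fun y hy => ?_
  have : (fun x => F x y i j) = fun _ => 0 := by ext x; rw [h0 x y (Or.inr hy)]; rfl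
  rw [this]; simp

lemma matPartial (h : IsTestFamily F) (μ : Fin 4) :
    IsTestFamily fun x y => matPartial μ (fun x => F x y) x where
  smooth i j := (h.smooth i j).uncurry_dirDeriv_left (F := fun x y => F x y i j) (unitVec μ)
  compact := by
    obtain ⟨K, hK, h0⟩ := h.compact
    refine ⟨K, hK, fun x y hxy => ?_⟩
    ext i j
    have : (fun x => F x y i j) =ᶠ[𝓝 x] fun _ => 0 := by
      rcases hxy with hx | hy
      · filter_upwards [hK.isClosed.isOpen_compl.mem_nhds hx] with z hz
        simp [h0 z y (Or.inl hz)]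
      · exact Eventually.of_forall fun z => by simp [h0 z y (Or.inr hy)]
    simp [_root_.matPartial, this.fderiv_eq]

end IsTestFamily

end TestFamilies

/-! ### The adjoint covariant derivative and its exchange with integrals. -/

section CovAdj

variable {N : ℕ} {Λ : Type*} [NormedRing Λ] [NormedAlgebra ℂ Λ] {A : GaugeField N}

lemma gaugeMat_mul_apply (U : Matrix (Fin N) (Fin N) ℂ) (F : Matrix (Fin N) (Fin N) Λ)
    (i j : Fin N) : (gaugeMat Λ U * F) i j = ∑ k, U i k • F k j := by
  simp [Matrix.mul_apply, gaugeMat, Algebra.smul_def]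

lemma mul_gaugeMat_apply (U : Matrix (Fin N) (Fin N) ℂ) (F : Matrix (Fin N) (Fin N) Λ)
    (i j : Fin N) : (F * gaugeMat Λ U) i j = ∑ k, U k j • F i k := by
  simp [Matrix.mul_apply, gaugeMat, Algebra.smul_def, Algebra.commutes]

lemma covAdj_apply (A : GaugeField N) (μ : Fin 4) (F : Spacetime → Matrix (Fin N) (Fin N) Λ)
    (x : Spacetime) (i j : Fin N) : covAdj A μ F x i j = dirDeriv (unitVec μ) (fun z => F z i j) x -
      Complex.I • (∑ k, A μ x i k • F x k j - ∑ k, A μ x k j • F x i k) := by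
  simp only [covAdj, Matrix.sub_apply, Matrix.smul_apply, gaugeMat_mul_apply, mul_gaugeMat_apply]
  rfl

lemma IsHermitianField.smoothMat_covAdj (hA : IsHermitianField A) (μ : Fin 4)
    {F : Spacetime → Matrix (Fin N) (Fin N) Λ} (hF : SmoothMat F) : SmoothMat (covAdj A μ F) := by
  intro i j
  simp only [covAdj_apply]
  exact ((hF i j).dirDeriv _).sub (ContDiff.const_smul _ ((ContDiff.sum fun k _ =>
    ((hA μ).1 i k).smul (hF k j)).sub (ContDiff.sum fun k _ => ((hA μ).1 k j).smul (hF i k))))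

lemma IsHermitianField.smoothMat_covAdjs (hA : IsHermitianField A) (l : List (Fin 4))
    {F : Spacetime → Matrix (Fin N) (Fin N) Λ} (hF : SmoothMat F) : SmoothMat (covAdjs A l F) := by
  induction l with
  | nil => exact hF
  | cons μ l ih => exact hA.smoothMat_covAdj μ ih

lemma covAdj_eventuallyEq {F G : Spacetime → Matrix (Fin N) (Fin N) Λ} {x : Spacetime}
    (h : F =ᶠ[𝓝 x] G) (μ : Fin 4) : covAdj A μ F =ᶠ[𝓝 x] covAdj A μ G := by
  filter_upwards [h.eventuallyEq_nhds] with z hz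
  ext i j
  have h1 : (fun w => F w i j) =ᶠ[𝓝 z] fun w => G w i j := by
    filter_upwards [hz] with w hw; rw [hw]
  simp only [covAdj_apply, dirDeriv, h1.fderiv_eq, hz.eq_of_nhds]

lemma covAdjs_eventuallyEq {F G : Spacetime → Matrix (Fin N) (Fin N) Λ} {x : Spacetime}
    (h : F =ᶠ[𝓝 x] G) (l : List (Fin 4)) : covAdjs A l F =ᶠ[𝓝 x] covAdjs A l G := by
  induction l with
  | nil => exact h
  | cons μ l ih => exact covAdj_eventuallyEq ih μ

lemma covAdj_zero (A : GaugeField N) (μ : Fin 4) :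
    covAdj A μ (fun _ => (0 : Matrix (Fin N) (Fin N) Λ)) = fun _ => 0 := by
  ext x i j
  simp [covAdj_apply, dirDeriv]

lemma covAdjs_zero (A : GaugeField N) (l : List (Fin 4)) :
    covAdjs A l (fun _ => (0 : Matrix (Fin N) (Fin N) Λ)) = fun _ => 0 := by
  induction l with
  | nil => rfl
  | cons μ l ih =>
    change covAdj A μ (covAdjs A l _) = _
    rw [ih, covAdj_zero]

lemma IsHermitianField.isTestFamily_covAdj (hA : IsHermitianField A) (μ : Fin 4)
    {F : Spacetime → Spacetime → Matrix (Fin N) (Fin N) Λ} (hF : IsTestFamily F) :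
    IsTestFamily fun x y => covAdj A μ (fun z => F z y) x where
  smooth i j := by
    simp only [covAdj_apply]
    have hA' : ∀ i j, ContDiff ℝ ∞ fun z : Spacetime × Spacetime => A μ z.1 i j := fun i j =>
      ((hA μ).1 i j).comp contDiff_fst
    exact ((hF.smooth i j).uncurry_dirDeriv_left (F := fun x y => F x y i j) (unitVec μ)).sub
      (ContDiff.const_smul _ ((ContDiff.sum fun k _ => (hA' i k).smul (hF.smooth k j)).sub
        (ContDiff.sum fun k _ => (hA' k j).smul (hF.smooth i k))))
  compact := by
    obtain ⟨K, hK, h0⟩ := hF.compact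
    refine ⟨K, hK, fun x y hxy => ?_⟩
    have : (fun z => F z y) =ᶠ[𝓝 x] fun _ => 0 := by
      rcases hxy with hx | hy
      · filter_upwards [hK.isClosed.isOpen_compl.mem_nhds hx] with z hz
        exact h0 z y (Or.inl hz)
      · exact Eventually.of_forall fun z => h0 z y (Or.inr hy)
    rw [(covAdj_eventuallyEq this μ).eq_of_nhds, covAdj_zero]

lemma IsHermitianField.isTestFamily_covAdjs (hA : IsHermitianField A) (l : List (Fin 4))
    {F : Spacetime → Spacetime → Matrix (Fin N) (Fin N) Λ} (hF : IsTestFamily F) :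
    IsTestFamily fun x y => covAdjs A l (fun z => F z y) x := by
  induction l with
  | nil => exact hF
  | cons μ l ih => exact hA.isTestFamily_covAdj μ ih

lemma covAdj_matIntegral [CompleteSpace Λ] (μ : Fin 4)
    {F : Spacetime → Spacetime → Matrix (Fin N) (Fin N) Λ} (hF : IsTestFamily F) (x : Spacetime) :
    covAdj A μ (fun z => matIntegral volume (F z)) x =
      matIntegral volume fun y => covAdj A μ (fun z => F z y) x := by
  have hi : ∀ i j, Integrable fun y => F x y i j := fun i j =>
    (hF.contDiff_right x i j).continuous.integrable_of_hasCompactSupport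
      (hF.hasCompactSupport_right x i j)
  have hd : ∀ i j, Integrable fun y => dirDeriv (unitVec μ) (fun z => F z y i j) x := fun i j =>
    ((hF.matPartial μ).contDiff_right x i j).continuous.integrable_of_hasCompactSupport
      ((hF.matPartial μ).hasCompactSupport_right x i j)
  ext i j
  have h1 : dirDeriv (unitVec μ) (fun z => ∫ y, F z y i j) x =
      ∫ y, dirDeriv (unitVec μ) (fun z => F z y i j) x :=
    congrFun (congrFun (hF.matPartial_matIntegral μ x) i) j
  simp only [matIntegral, Matrix.of_apply, covAdj_apply]
  have h2 : Integrable fun y => ∑ k, A μ x i k • F x y k j :=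
    integrable_finsetSum _ fun k _ => (hi k j).fun_smul _
  have h3 : Integrable fun y => ∑ k, A μ x k j • F x y i k :=
    integrable_finsetSum _ fun k _ => (hi i k).fun_smul _
  have h4 : Integrable fun y => ∑ k, A μ x i k • F x y k j - ∑ k, A μ x k j • F x y i k := h2.sub h3
  rw [h1, integral_sub (hd i j) (h4.fun_smul Complex.I), integral_smul, integral_sub h2 h3,
    integral_finsetSum _ fun k _ => (hi k j).fun_smul (A μ x i k),
    integral_finsetSum _ fun k _ => (hi i k).fun_smul (A μ x k j)]
  simp only [integral_smul]

lemma covAdjs_matIntegral [CompleteSpace Λ] (hA : IsHermitianField A) (l : List (Fin 4))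
    {F : Spacetime → Spacetime → Matrix (Fin N) (Fin N) Λ} (hF : IsTestFamily F) (x : Spacetime) :
    covAdjs A l (fun z => matIntegral volume (F z)) x =
      matIntegral volume fun y => covAdjs A l (fun z => F z y) x := by
  induction l generalizing x with
  | nil => rfl
  | cons μ l ih =>
    change covAdj A μ (covAdjs A l _) x = _
    rw [funext ih]
    exact covAdj_matIntegral μ (hA.isTestFamily_covAdjs l hF) x

lemma covAdj_smul (A : GaugeField N) (μ : Fin 4) (c : ℂ)
    {F : Spacetime → Matrix (Fin N) (Fin N) Λ} (hF : SmoothMat F) :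
    covAdj A μ (fun z => c • F z) = fun z => c • covAdj A μ F z := by
  ext x i j
  have := congrFun (dirDeriv_clm (W := Λ) (c • (ContinuousLinearMap.id ℝ Λ)) (hF i j) (unitVec μ)) x
  simp only [smul_apply, ContinuousLinearMap.id_apply] at this
  simp only [covAdj_apply, Matrix.smul_apply, this, smul_sub, Finset.smul_sum, smul_comm c]

lemma covAdjs_smul (hA : IsHermitianField A) (l : List (Fin 4)) (c : ℂ)
    {F : Spacetime → Matrix (Fin N) (Fin N) Λ} (hF : SmoothMat F) :
    covAdjs A l (fun z => c • F z) = fun z => c • covAdjs A l F z := by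
  induction l with
  | nil => rfl
  | cons μ l ih =>
    change covAdj A μ (covAdjs A l _) = _
    rw [ih, covAdj_smul A μ c (hA.smoothMat_covAdjs l hF)]
    rfl

end CovAdj

/-! ### Transported kernels and moments in relative coordinates. -/

section Kernels

variable {N : ℕ} {s : Type*} [Fintype s] [DecidableEq s] {Λ : Type*} [NormedRing Λ]
  [NormedAlgebra ℂ Λ]

/-- The kernel `X`, in relative coordinates, with both arguments transported to the midpoint. -/
noncomputable def transportedKernel (A : GaugeField N)
    (X : Spacetime → Spacetime → Matrix (s × Fin N) (s × Fin N) Λ) (x y : Spacetime) :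
    Matrix (s × Fin N) (s × Fin N) Λ :=
  liftGauge Λ (wilsonLine A x (x - (2⁻¹ : ℝ) • y)) * X (x - (2⁻¹ : ℝ) • y) (x + (2⁻¹ : ℝ) • y) *
    liftGauge Λ (wilsonLine A (x + (2⁻¹ : ℝ) • y) x)

lemma liftGauge_mul_apply (U : Matrix (Fin N) (Fin N) ℂ) (F : Matrix (s × Fin N) (s × Fin N) Λ)
    (a b : s × Fin N) : (liftGauge Λ U * F : Matrix (s × Fin N) (s × Fin N) Λ) a b = ∑ k, U a.2 k • F (a.1, k) b := by
  simp only [Matrix.mul_apply, liftGauge, Matrix.map_apply, Matrix.kroneckerMap_apply,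
    Fintype.sum_prod_type, Algebra.smul_def]
  rw [Finset.sum_eq_single a.1]
  · simp
  · intro c _ hc; simp [Matrix.one_apply_ne' hc]
  · simp

lemma mul_liftGauge_apply (U : Matrix (Fin N) (Fin N) ℂ) (F : Matrix (s × Fin N) (s × Fin N) Λ)
    (a b : s × Fin N) : (F * liftGauge Λ U : Matrix (s × Fin N) (s × Fin N) Λ) a b = ∑ k, U k b.2 • F a (b.1, k) := by
  simp only [Matrix.mul_apply, liftGauge, Matrix.map_apply, Matrix.kroneckerMap_apply,
    Fintype.sum_prod_type, Algebra.smul_def]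
  rw [Finset.sum_eq_single b.1]
  · simp [Algebra.commutes]
  · intro c _ hc; simp [Matrix.one_apply_ne hc]
  · simp

lemma liftGauge_mul_mul_apply (U W : Matrix (Fin N) (Fin N) ℂ)
    (F : Matrix (s × Fin N) (s × Fin N) Λ) (a b : s × Fin N) :
    (liftGauge Λ U * F * liftGauge Λ W : Matrix (s × Fin N) (s × Fin N) Λ) a b =
      ∑ l, ∑ k, (U a.2 k * W l b.2) • F (a.1, k) (b.1, l) := by
  simp only [mul_liftGauge_apply, liftGauge_mul_apply, Finset.smul_sum, smul_smul]
  simp only [mul_comm]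

lemma trD_mul_liftSpin_apply (F : Matrix (s × Fin N) (s × Fin N) Λ) (M : Matrix s s ℂ)
    (i j : Fin N) : trD (F * liftSpin Λ M) i j = ∑ a, ∑ b, M b a • F (a, i) (b, j) := by
  simp only [trD, Matrix.of_apply, Matrix.mul_apply, liftSpin, Matrix.map_apply,
    Matrix.kroneckerMap_apply, Fintype.sum_prod_type]
  refine Finset.sum_congr rfl fun a _ => Finset.sum_congr rfl fun b _ => ?_
  rw [Finset.sum_eq_single j]
  · simp [Algebra.smul_def, Algebra.commutes]
  · intro c _ hc; simp [Matrix.one_apply_ne hc]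
  · simp

lemma wigner_apply (A : GaugeField N)
    (X : Spacetime → Spacetime → Matrix (s × Fin N) (s × Fin N) Λ) (x p : Spacetime)
    (a b : s × Fin N) :
    wigner A X x p a b = fourierPlus (fun y => transportedKernel A X x y a b) p := rfl

lemma momentDensity_apply (A : GaugeField N) (Q : DiracSymbol s)
    (X : Spacetime → Spacetime → Matrix (s × Fin N) (s × Fin N) Λ) (l : List (Fin 4))
    (x p : Spacetime) (i j : Fin N) : momentDensity A Q X l x p i j =
      ∑ a, ∑ b, Q.pDerivs l x p b a • wigner A X x p (a, i) (b, j) :=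
  trD_mul_liftSpin_apply _ _ _ _

variable {A : GaugeField N} (hA : IsHermitianField A)
  {X : Spacetime → Spacetime → Matrix (s × Fin N) (s × Fin N) Λ}

lemma IsTestFamily.transported (hA : IsHermitianField A) (hX : IsTestFamily X) :
    IsTestFamily (transportedKernel A X) where
  smooth a b := by
    simp only [transportedKernel, liftGauge_mul_mul_apply]
    have h1 : ContDiff ℝ ∞ fun z : Spacetime × Spacetime => z.1 - (2⁻¹ : ℝ) • z.2 :=
      contDiff_fst.sub (contDiff_snd.const_smul _)
    have h2 : ContDiff ℝ ∞ fun z : Spacetime × Spacetime => z.1 + (2⁻¹ : ℝ) • z.2 :=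
      contDiff_fst.add (contDiff_snd.const_smul _)
    change ContDiff ℝ ∞ fun z : Spacetime × Spacetime => ∑ l, ∑ k,
      (wilsonLine A z.1 (z.1 - (2⁻¹ : ℝ) • z.2) a.2 k *
        wilsonLine A (z.1 + (2⁻¹ : ℝ) • z.2) z.1 l b.2) •
        X (z.1 - (2⁻¹ : ℝ) • z.2) (z.1 + (2⁻¹ : ℝ) • z.2) (a.1, k) (b.1, l)
    exact ContDiff.sum fun l _ => ContDiff.sum fun k _ =>
      (((hA.contDiff_wilsonLine a.2 k).comp (contDiff_fst.prodMk h1)).mul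
        ((hA.contDiff_wilsonLine l b.2).comp (h2.prodMk contDiff_fst))).smul
        ((hX.smooth (a.1, k) (b.1, l)).comp (h1.prodMk h2))
  compact := by
    obtain ⟨K, hK, h0⟩ := hX.compact
    -- If both end points lie in `K`, then x is their midpoint and y their difference; the two
    -- images contain all such values.
    refine ⟨((fun z : Spacetime × Spacetime => (2⁻¹ : ℝ) • (z.1 + z.2)) '' (K ×ˢ K)) ∪
      ((fun z : Spacetime × Spacetime => z.2 - z.1) '' (K ×ˢ K)),
      ((hK.prod hK).image (by fun_prop)).union ((hK.prod hK).image (by fun_prop)),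
      fun x y hxy => ?_⟩
    suffices X (x - (2⁻¹ : ℝ) • y) (x + (2⁻¹ : ℝ) • y) = 0 by
      simp [transportedKernel, this]
    by_contra hne
    have h3 : x - (2⁻¹ : ℝ) • y ∈ K ∧ x + (2⁻¹ : ℝ) • y ∈ K := by
      by_contra h4
      exact hne (h0 _ _ (by tauto))
    rcases hxy with hx | hy
    · refine hx (Or.inl ⟨(_, _), h3, ?_⟩)
      simp only
      module
    · refine hy (Or.inr ⟨(_, _), h3, ?_⟩)
      simp only
      module

/-- The kernel whose Fourier transform is the moment density. -/
noncomputable def momentKernel (A : GaugeField N) (Q : DiracSymbol s)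
    (X : Spacetime → Spacetime → Matrix (s × Fin N) (s × Fin N) Λ) (l : List (Fin 4))
    (x y : Spacetime) : Matrix (Fin N) (Fin N) Λ :=
  Matrix.of fun i j => ∑ τ : Q.RidgeIndex, ∑ a, ∑ b, (τ.factor l * τ.coeff x b a) •
    (iDeriv τ.dir)^[τ.deg - l.length] (fun y => transportedKernel A X x y (a, i) (b, j)) y

lemma momentKernel_apply (hA : IsHermitianField A) (hX : IsTestFamily X) (Q : DiracSymbol s)
    (l : List (Fin 4)) (x y : Spacetime) (i j : Fin N) : momentKernel A Q X l x y i j =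
      ∑ τ : Q.RidgeIndex, ∑ a, ∑ b,
        (τ.factor l * τ.coeff x b a * Complex.I ^ (τ.deg - l.length)) •
        (dirDeriv τ.dir)^[τ.deg - l.length] (fun y => transportedKernel A X x y (a, i) (b, j)) y := by
  simp only [momentKernel, Matrix.of_apply, mul_smul]
  refine Finset.sum_congr rfl fun τ _ => Finset.sum_congr rfl fun a _ =>
    Finset.sum_congr rfl fun b _ => ?_
  rw [iDeriv_iterate ((hX.transported hA).contDiff_right x _ _)]

lemma IsTestFamily.momentKernel (hA : IsHermitianField A) (hX : IsTestFamily X) (Q : DiracSymbol s)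
    (l : List (Fin 4)) : IsTestFamily (momentKernel A Q X l) where
  smooth i j := by
    simp only [momentKernel_apply hA hX]
    exact ContDiff.sum fun τ _ => ContDiff.sum fun a _ => ContDiff.sum fun b _ =>
      ((contDiff_const.mul ((τ.contDiff_coeff b a).comp contDiff_fst)).mul contDiff_const).smul
        (((hX.transported hA).smooth (a, i) (b, j)).uncurry_iterate_dirDeriv
          (F := fun x y => transportedKernel A X x y (a, i) (b, j)) τ.dir _)
  compact := by
    obtain ⟨K, hK, h0⟩ := (hX.transported hA).compact
    refine ⟨K, hK, fun x y hxy => ?_⟩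
    ext i j
    rw [momentKernel_apply hA hX]
    refine Finset.sum_eq_zero fun τ _ => Finset.sum_eq_zero fun a _ =>
      Finset.sum_eq_zero fun b _ => ?_
    have h1 : (fun y => transportedKernel A X x y (a, i) (b, j)) =ᶠ[𝓝 y] fun _ => 0 := by
      rcases hxy with hx | hy
      · exact Eventually.of_forall fun z => by simp [h0 x z (Or.inl hx)]
      · filter_upwards [hK.isClosed.isOpen_compl.mem_nhds hy] with z hz
        simp [h0 x z (Or.inr hz)]
    have h2 : ∀ m, (dirDeriv τ.dir)^[m] (fun _ : Spacetime => (0 : Λ)) = fun _ => 0 := fun m => by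
      induction m with
      | zero => rfl
      | succ m ih => rw [Function.iterate_succ_apply', ih]; ext; simp [dirDeriv]
    rw [(dirDeriv_iterate_eventuallyEq h1 τ.dir _).eq_of_nhds, h2, smul_zero]

/-- A power of ⟨b,p⟩ in front of the Wigner transform is the same power of i∂_b acting on the
transported kernel. -/
lemma momentDensity_eq_fourierPlus (hA : IsHermitianField A) (hX : IsTestFamily X)
    (Q : DiracSymbol s) (l : List (Fin 4)) (x p : Spacetime) (i j : Fin N) :
    momentDensity A Q X l x p i j = fourierPlus (fun y => momentKernel A Q X l x y i j) p := by
  have hs := fun (a b : s) => (hX.transported hA).contDiff_right x (a, i) (b, j)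
  have hc := fun (a b : s) => (hX.transported hA).hasCompactSupport_right x (a, i) (b, j)
  have hi : ∀ (τ : Q.RidgeIndex) (a b : s), Integrable fun y =>
      Complex.exp (Complex.I * (inner ℝ p y : ℝ)) • (τ.factor l * τ.coeff x b a) •
      (iDeriv τ.dir)^[τ.deg - l.length] (fun y => transportedKernel A X x y (a, i) (b, j)) y :=
    fun τ a b => integrable_exp_smul (Integrable.fun_smul _ (((hs a b).iterate_iDeriv τ.dir
      (τ.deg - l.length)).continuous.integrable_of_hasCompactSupport ((hc a b).iterate_iDeriv _ _))) p
  simp only [momentKernel, Matrix.of_apply, fourierPlus, Finset.smul_sum]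
  rw [integral_finsetSum _ fun τ _ => integrable_finsetSum _ fun a _ => integrable_finsetSum _
    fun b _ => hi τ a b]
  simp only [fun τ => integral_finsetSum Finset.univ fun a _ => integrable_finsetSum Finset.univ
    fun b _ => hi τ a b, fun τ a => integral_finsetSum Finset.univ fun b _ => hi τ a b]
  rw [momentDensity_apply, Finset.sum_comm (s := (Finset.univ : Finset Q.RidgeIndex))]
  refine Finset.sum_congr rfl fun a _ => ?_
  rw [Finset.sum_comm (s := (Finset.univ : Finset Q.RidgeIndex))]
  refine Finset.sum_congr rfl fun b _ => ?_
  rw [Q.pDerivs_eq_sum_ridge, Matrix.sum_apply, Finset.sum_smul]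
  refine Finset.sum_congr rfl fun τ _ => ?_
  have h1 := fourierPlus_iterate_iDeriv (hs a b) (hc a b) τ.dir p (τ.deg - l.length)
  simp only [smul_comm (Complex.exp _), integral_smul]
  rw [← fourierPlus, h1, wigner_apply, Matrix.smul_apply, smul_eq_mul, smul_smul]
  congr 1
  ring

lemma momentKernel_perm (Q : DiracSymbol s) {l l' : List (Fin 4)} (h : l.Perm l') :
    momentKernel A Q X l = momentKernel A Q X l' := by
  ext x y i j
  simp only [momentKernel, Matrix.of_apply, h.length_eq, DiracSymbol.RidgeIndex.factor_perm _ h]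

lemma momentKernel_eq_zero (Q : DiracSymbol s) {l : List (Fin 4)} (h : Q.order < l.length) :
    momentKernel A Q X l = fun _ _ => 0 := by
  ext x y i j
  simp [momentKernel, DiracSymbol.RidgeIndex.factor_eq_zero _ h]

end Kernels

/-! ### The regulator as point splitting. -/

section Cutoff

/-- The point-splitting profile, rescaled to the distance `δ`. -/
noncomputable def rescaledProfile (η : Spacetime → ℂ) (δ : ℝ) (y : Spacetime) : ℂ :=
  ((δ ^ 4)⁻¹ : ℝ) • η (δ⁻¹ • y)

variable {η : Spacetime → ℂ}

lemma cutoff_eq_fourierPlus_smul (η : Spacetime → ℂ) (δ : ℝ) (p : Spacetime) :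
    cutoff η δ p = fourierPlus η (δ • p) := by
  simp only [cutoff, fourierPlus, inner_smul_left, smul_eq_mul]
  congr 1
  ext y
  rw [mul_comm]
  simp

/-- The substitution y → y/δ makes the regulator the transform of a profile of width δ, to which
inversion and Parseval apply. -/
lemma cutoff_eq_fourierPlus (η : Spacetime → ℂ) {δ : ℝ} (hδ : 0 < δ) :
    cutoff η δ = fourierPlus (rescaledProfile η δ) := by
  ext p
  have h := Measure.integral_comp_inv_smul (μ := (volume : Measure Spacetime))
    (fun y => Complex.exp (Complex.I * (inner ℝ (δ • p) y : ℝ)) • η y) δ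
  rw [cutoff_eq_fourierPlus_smul, fourierPlus]
  have h4 : |δ ^ Module.finrank ℝ Spacetime| = δ ^ 4 := by
    simp [abs_of_pos hδ]
  rw [h4] at h
  rw [← inv_smul_smul₀ (pow_pos hδ 4).ne' (∫ y, _), ← h, ← integral_smul, fourierPlus]
  congr 1
  ext y
  rw [rescaledProfile, inner_smul_left, inner_smul_right, smul_comm]
  congr 4
  simp [mul_inv_cancel_left₀ hδ.ne']

lemma IsProfile.integrable (hη : IsProfile η) : Integrable η :=
  hη.1.continuous.integrable_of_hasCompactSupport hη.2.1

lemma IsProfile.contDiff_rescaledProfile (hη : IsProfile η) (δ : ℝ) :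
    ContDiff ℝ ∞ (rescaledProfile η δ) :=
  (hη.1.comp (contDiff_id.const_smul δ⁻¹)).const_smul ((δ ^ 4)⁻¹ : ℝ)

lemma IsProfile.hasCompactSupport_rescaledProfile (hη : IsProfile η) {δ : ℝ} (hδ : 0 < δ) :
    HasCompactSupport (rescaledProfile η δ) :=
  (hη.2.1.comp_smul (inv_ne_zero hδ.ne')).smul_left (f := fun _ => ((δ ^ 4)⁻¹ : ℝ))

lemma norm_cutoff_le (η : Spacetime → ℂ) (δ : ℝ) (p : Spacetime) : ‖cutoff η δ p‖ ≤ ∫ y, ‖η y‖ := by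
  rw [cutoff_eq_fourierPlus_smul]
  exact norm_fourierPlus_le η _

lemma IsProfile.continuous_cutoff (hη : IsProfile η) (δ : ℝ) : Continuous (cutoff η δ) := by
  have h : cutoff η δ = fun p => fourierPlus η (δ • p) := funext (cutoff_eq_fourierPlus_smul η δ)
  rw [h]
  exact (continuous_fourierPlus hη.integrable).comp (continuous_const_smul δ)

lemma IsProfile.tendsto_cutoff (hη : IsProfile η) (p : Spacetime) :
    Tendsto (fun δ => cutoff η δ p) (𝓝[>] 0) (𝓝 1) := by
  have h : (fun δ => cutoff η δ p) = fun δ => fourierPlus η (δ • p) :=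
    funext fun δ => cutoff_eq_fourierPlus_smul η δ p
  rw [h]
  have h1 : Continuous fun δ : ℝ => fourierPlus η (δ • p) :=
    (continuous_fourierPlus hη.integrable).comp (continuous_id.smul continuous_const)
  have h2 := h1.tendsto 0
  have h3 : fourierPlus η ((0 : ℝ) • p) = 1 := by
    rw [← hη.2.2, fourierPlus]
    simp
  rw [h3] at h2
  exact h2.mono_left nhdsWithin_le_nhds

variable {N : ℕ} {Λ : Type*} [NormedRing Λ] [NormedAlgebra ℂ Λ]

lemma momentumIntegral_apply (χ : Spacetime → ℂ) (F : Spacetime → Matrix (Fin N) (Fin N) Λ)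
    (i j : Fin N) : momentumIntegral χ F i j =
      (((2 * Real.pi) ^ 4)⁻¹ : ℝ) • ∫ p, χ p • F p i j := by
  simp only [momentumIntegral, matIntegral, Matrix.of_apply, Matrix.smul_apply, mul_smul,
    integral_smul, Complex.coe_smul]

/-- Fourier inversion: without regulator, the momentum integral evaluates the kernel at coincident
points. -/
lemma momentumIntegral_one [CompleteSpace Λ] {F K : Spacetime → Matrix (Fin N) (Fin N) Λ}
    (hs : ∀ i j, ContDiff ℝ ∞ fun y => K y i j) (hc : ∀ i j, HasCompactSupport fun y => K y i j)
    (hF : ∀ p i j, F p i j = fourierPlus (fun y => K y i j) p) :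
    momentumIntegral (fun _ => 1) F = K 0 := by
  ext i j
  simp only [momentumIntegral_apply, one_smul, hF]
  rw [integral_fourierPlus (hs i j) (hc i j), inv_smul_smul₀ (by positivity)]

lemma momentumIntegral_cutoff [CompleteSpace Λ] {F K : Spacetime → Matrix (Fin N) (Fin N) Λ}
    (hK : ∀ i j, Integrable fun y => K y i j)
    (hF : ∀ p i j, F p i j = fourierPlus (fun y => K y i j) p) (hη : IsProfile η) {δ : ℝ}
    (hδ : 0 < δ) :
    momentumIntegral (cutoff η δ) F =
      matIntegral volume fun y => rescaledProfile η δ (-y) • K y := by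
  ext i j
  simp only [momentumIntegral_apply, hF, cutoff_eq_fourierPlus η hδ]
  rw [integral_fourierPlus_smul (hη.contDiff_rescaledProfile δ)
    (hη.hasCompactSupport_rescaledProfile hδ) (hK i j), inv_smul_smul₀ (by positivity)]
  rfl

/-- Dominated convergence: the regulator is bounded by the integral of ‖η‖, for all δ, and tends
pointwise to the integral of η, which is 1. -/
lemma IsProfile.tendsto_momentumIntegral (hη : IsProfile η)
    {F : Spacetime → Matrix (Fin N) (Fin N) Λ} (hF : ∀ i j, Integrable fun p => F p i j) :
    Tendsto (fun δ => momentumIntegral (cutoff η δ) F) (𝓝[>] 0)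
      (𝓝 (momentumIntegral (fun _ => 1) F)) := by
  refine tendsto_pi_nhds.2 fun i => tendsto_pi_nhds.2 fun j => ?_
  simp only [momentumIntegral_apply]
  refine Tendsto.const_smul ?_ _
  refine tendsto_integral_filter_of_dominated_convergence
    (fun p => (∫ y, ‖η y‖) * ‖F p i j‖) ?_ ?_ ((hF i j).norm.const_mul _) ?_
  · exact Eventually.of_forall fun δ =>
      (hη.continuous_cutoff δ).aestronglyMeasurable.smul (hF i j).1
  · refine Eventually.of_forall fun δ => Eventually.of_forall fun p => ?_
    rw [norm_smul]
    gcongr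
    exact norm_cutoff_le η δ p
  · exact Eventually.of_forall fun p => (hη.tendsto_cutoff p).smul_const _

end Cutoff

section FiniteSums

variable {m n : Type*} {V : Type*} [NormedAddCommGroup V] [NormedSpace ℂ V]

lemma IsTestFamily.const_smul {F : Spacetime → Spacetime → Matrix m n V} (h : IsTestFamily F)
    (c : ℂ) : IsTestFamily fun x y => c • F x y :=
  h.smul_right (g := fun _ => c) contDiff_const

lemma IsTestFamily.sum {ι : Type*} {S : Finset ι} {F : ι → Spacetime → Spacetime → Matrix m n V}
    (h : ∀ i, IsTestFamily (F i)) : IsTestFamily fun x y => ∑ i ∈ S, F i x y where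
  smooth i j := by
    simp only [Matrix.sum_apply]
    exact ContDiff.sum fun k _ => (h k).smooth i j
  compact := by
    choose K hK h0 using fun i => (h i).compact
    refine ⟨⋃ i ∈ S, K i, S.isCompact_biUnion fun i _ => hK i, fun x y hxy => ?_⟩
    refine Finset.sum_eq_zero fun i hi => h0 i x y (hxy.imp ?_ ?_) <;>
    exact fun h hx => h (Set.mem_biUnion hi hx)

end FiniteSums

/-! ### The current in position space. -/

section Currents

variable {N : ℕ} {s : Type*} [Fintype s] [DecidableEq s] {Λ : Type*} [NormedRing Λ]
  [NormedAlgebra ℂ Λ] {A : GaugeField N}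
  {X : Spacetime → Spacetime → Matrix (s × Fin N) (s × Fin N) Λ}

/-- The kernel whose Fourier transform is the current density. -/
noncomputable def currentKernel (A : GaugeField N) (Q : DiracSymbol s)
    (X : Spacetime → Spacetime → Matrix (s × Fin N) (s × Fin N) Λ) (μ : Fin 4)
    (x y : Spacetime) : Matrix (Fin N) (Fin N) Λ :=
  ∑ k ∈ Finset.range (Q.order + 1), gradCoeff k • ∑ l : Fin (2 * k) → Fin 4,
    covAdjs A (List.ofFn l) (fun z => momentKernel A Q X (List.ofFn l ++ [μ]) z y) x

lemma IsTestFamily.currentKernel (hA : IsHermitianField A) (hX : IsTestFamily X)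
    (Q : DiracSymbol s) (μ : Fin 4) : IsTestFamily (currentKernel A Q X μ) :=
  IsTestFamily.sum fun k => (IsTestFamily.sum fun l =>
    hA.isTestFamily_covAdjs (List.ofFn l) (hX.momentKernel hA Q (List.ofFn l ++ [μ]))).const_smul _

lemma contDiff_exp_inner (p : Spacetime) :
    ContDiff ℝ ∞ fun y : Spacetime => Complex.exp (Complex.I * (inner ℝ p y : ℝ)) := by
  have h : ContDiff ℝ ∞ fun y : Spacetime => ((inner ℝ p y : ℝ) : ℂ) :=
    (Complex.ofRealCLM.comp (innerSL ℝ p)).contDiff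
  exact (contDiff_const.mul h).cexp

variable [CompleteSpace Λ]

lemma covAdjs_momentDensity (hA : IsHermitianField A) (hX : IsTestFamily X)
    (Q : DiracSymbol s) (l l' : List (Fin 4)) (x p : Spacetime) (i j : Fin N) :
    covAdjs A l (fun z => momentDensity A Q X l' z p) x i j =
      fourierPlus (fun y => covAdjs A l (fun z => momentKernel A Q X l' z y) x i j) p := by
  have h : (fun z => momentDensity A Q X l' z p) = fun z => matIntegral volume fun y =>
      Complex.exp (Complex.I * (inner ℝ p y : ℝ)) • momentKernel A Q X l' z y := by
    ext z i j
    rw [momentDensity_eq_fourierPlus hA hX]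
    rfl
  rw [h, covAdjs_matIntegral hA l ((hX.momentKernel hA Q l').smul_right (contDiff_exp_inner p))]
  simp only [fun y => covAdjs_smul hA l (Complex.exp (Complex.I * (inner ℝ p y : ℝ)))
    (fun i j => (hX.momentKernel hA Q l').contDiff_left y i j)]
  rfl

lemma currentDensity_eq_fourierPlus (hA : IsHermitianField A) (hX : IsTestFamily X)
    (Q : DiracSymbol s) (μ : Fin 4) (x p : Spacetime) (i j : Fin N) :
    currentDensity A Q X μ x p i j = fourierPlus (fun y => currentKernel A Q X μ x y i j) p := by
  have hT := fun (k : ℕ) (l : Fin (2 * k) → Fin 4) =>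
    hA.isTestFamily_covAdjs (List.ofFn l) (hX.momentKernel hA Q (List.ofFn l ++ [μ]))
  have hi : ∀ k (l : Fin (2 * k) → Fin 4), Integrable fun y =>
      Complex.exp (Complex.I * (inner ℝ p y : ℝ)) • gradCoeff k •
        covAdjs A (List.ofFn l) (fun z => momentKernel A Q X (List.ofFn l ++ [μ]) z y) x i j :=
    fun k l => integrable_exp_smul (Integrable.fun_smul _ (((hT k l).contDiff_right x i
      j).continuous.integrable_of_hasCompactSupport ((hT k l).hasCompactSupport_right x i j))) p
  -- The gradient series is finite: for k beyond the order of Q the 2k + 1 momentum derivatives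
  -- annihilate the symbol.
  rw [currentDensity, tsum_eq_sum (s := Finset.range (Q.order + 1))]
  · simp only [currentKernel, Matrix.sum_apply, Matrix.smul_apply, fourierPlus, Finset.smul_sum]
    rw [integral_finsetSum _ fun k _ => integrable_finsetSum _ fun l _ => hi k l]
    refine Finset.sum_congr rfl fun k _ => ?_
    rw [integral_finsetSum _ fun l _ => hi k l]
    refine Finset.sum_congr rfl fun l _ => ?_
    rw [covAdjs_momentDensity hA hX]
    simp only [smul_comm (Complex.exp _), integral_smul]
    rfl
  · intro k hk
    have hk' : Q.order < k := by simpa [Nat.lt_succ_iff] using hk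
    ext i j
    simp only [Matrix.smul_apply, Matrix.sum_apply, covAdjs_momentDensity hA hX,
      Matrix.zero_apply]
    rw [Finset.sum_eq_zero, smul_zero]
    intro l _
    rw [momentKernel_eq_zero Q (l := List.ofFn l ++ [μ]) (by simp; omega)]
    simp only [covAdjs_zero]
    simp [fourierPlus]

lemma integrable_currentDensity (hA : IsHermitianField A) (hX : IsTestFamily X)
    (Q : DiracSymbol s) (μ : Fin 4) (x : Spacetime) (i j : Fin N) :
    Integrable fun p => currentDensity A Q X μ x p i j := by
  simp only [currentDensity_eq_fourierPlus hA hX]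
  exact integrable_fourierPlus ((hX.currentKernel hA Q μ).contDiff_right x i j)
    ((hX.currentKernel hA Q μ).hasCompactSupport_right x i j)

/-- The current is a finite combination of covariant derivatives at y = 0 of the transported kernel.
Smoothness, locality and the Noether identity are all read off from this form. -/
lemma vectorCurrent_one (hA : IsHermitianField A) (hX : IsTestFamily X)
    (Q : DiracSymbol s) (μ : Fin 4) (x : Spacetime) :
    vectorCurrent A Q (fun _ => 1) X μ x = -currentKernel A Q X μ x 0 := by
  rw [vectorCurrent, momentumIntegral_one (fun i j => (hX.currentKernel hA Q μ).contDiff_right x i j)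
    (fun i j => (hX.currentKernel hA Q μ).hasCompactSupport_right x i j)
    (fun p i j => currentDensity_eq_fourierPlus hA hX Q μ x p i j)]

lemma tendsto_vectorCurrent_cutoff (hA : IsHermitianField A) (hX : IsTestFamily X)
    (Q : DiracSymbol s) (μ : Fin 4) (x : Spacetime) {η : Spacetime → ℂ} (hη : IsProfile η) :
    Tendsto (fun δ => vectorCurrent A Q (cutoff η δ) X μ x) (𝓝[>] 0)
      (𝓝 (vectorCurrent A Q (fun _ => 1) X μ x)) :=
  (hη.tendsto_momentumIntegral fun i j => integrable_currentDensity hA hX Q μ x i j).neg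

lemma momentumIntegral_cutoff_momentDensity (hA : IsHermitianField A) (hX : IsTestFamily X)
    (Q : DiracSymbol s) (l : List (Fin 4)) {η : Spacetime → ℂ} (hη : IsProfile η) {δ : ℝ}
    (hδ : 0 < δ) (x : Spacetime) :
    momentumIntegral (cutoff η δ) (momentDensity A Q X l x) =
      matIntegral volume fun y => rescaledProfile η δ (-y) • momentKernel A Q X l x y :=
  momentumIntegral_cutoff (fun i j => ((hX.momentKernel hA Q l).contDiff_right x i
    j).continuous.integrable_of_hasCompactSupport
      ((hX.momentKernel hA Q l).hasCompactSupport_right x i j))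
    (fun p i j => momentDensity_eq_fourierPlus hA hX Q l x p i j) hη hδ

lemma smoothMat_momentumIntegral_cutoff (hA : IsHermitianField A) (hX : IsTestFamily X)
    (Q : DiracSymbol s) (l : List (Fin 4)) {η : Spacetime → ℂ} (hη : IsProfile η) {δ : ℝ}
    (hδ : 0 < δ) :
    SmoothMat fun x => momentumIntegral (cutoff η δ) (momentDensity A Q X l x) := by
  simp only [momentumIntegral_cutoff_momentDensity hA hX Q l hη hδ]
  exact ((hX.momentKernel hA Q l).smul_right
    ((hη.contDiff_rescaledProfile δ).comp contDiff_neg)).contDiff_matIntegral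

/-- For test kernels the covariant derivatives may be taken after the momentum integral, so that
they can later be moved to the test function. -/
lemma vectorCurrent_cutoff (hA : IsHermitianField A) (hX : IsTestFamily X)
    (Q : DiracSymbol s) (μ : Fin 4) {η : Spacetime → ℂ} (hη : IsProfile η) {δ : ℝ}
    (hδ : 0 < δ) (x : Spacetime) :
    vectorCurrent A Q (cutoff η δ) X μ x =
      -∑ k ∈ Finset.range (Q.order + 1), gradCoeff k • ∑ l : Fin (2 * k) → Fin 4,
        covAdjs A (List.ofFn l) (fun z => momentumIntegral (cutoff η δ)
          (momentDensity A Q X (List.ofFn l ++ [μ]) z)) x := by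
  have hcut : ContDiff ℝ ∞ fun y => rescaledProfile η δ (-y) :=
    (hη.contDiff_rescaledProfile δ).comp contDiff_neg
  have hT := fun (k : ℕ) (l : Fin (2 * k) → Fin 4) =>
    (hA.isTestFamily_covAdjs (List.ofFn l)
      (hX.momentKernel hA Q (List.ofFn l ++ [μ]))).smul_right hcut
  have hi : ∀ k (l : Fin (2 * k) → Fin 4) i j, Integrable fun y =>
      gradCoeff k • rescaledProfile η δ (-y) •
        covAdjs A (List.ofFn l) (fun z => momentKernel A Q X (List.ofFn l ++ [μ]) z y) x i j :=
    fun k l i j => Integrable.fun_smul _ (((hT k l).contDiff_right x i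
      j).continuous.integrable_of_hasCompactSupport ((hT k l).hasCompactSupport_right x i j))
  rw [vectorCurrent, momentumIntegral_cutoff (fun i j =>
    ((hX.currentKernel hA Q μ).contDiff_right x i j).continuous.integrable_of_hasCompactSupport
    ((hX.currentKernel hA Q μ).hasCompactSupport_right x i j))
    (fun p i j => currentDensity_eq_fourierPlus hA hX Q μ x p i j) hη hδ]
  congr 1
  ext i j
  simp only [momentumIntegral_cutoff_momentDensity hA hX Q _ hη hδ, Matrix.sum_apply,
    Matrix.smul_apply, covAdjs_matIntegral hA _ ((hX.momentKernel hA Q _).smul_right hcut),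
    fun (l l' : List (Fin 4)) y => covAdjs_smul hA l (rescaledProfile η δ (-y))
    (fun i j => (hX.momentKernel hA Q l').contDiff_left y i j)]
  simp only [matIntegral, Matrix.of_apply, currentKernel, Matrix.smul_apply, Matrix.sum_apply,
    Finset.smul_sum, smul_comm (rescaledProfile _ _ _) (gradCoeff _)]
  rw [integral_finsetSum _ fun k _ => integrable_finsetSum _ fun l _ => hi k l i j]
  refine Finset.sum_congr rfl fun k _ => ?_
  rw [integral_finsetSum _ fun l _ => hi k l i j]
  simp only [integral_smul]

end Currents

/-! ### The Leibniz rule along a line. -/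

section Leibniz

variable {V W Z : Type*} [NormedAddCommGroup V] [NormedSpace ℝ V] [NormedAddCommGroup W]
  [NormedSpace ℝ W] [NormedAddCommGroup Z] [NormedSpace ℝ Z]

/-- The Leibniz rule for a sum of bilinear products of functions that come with all their rescaled
derivatives. -/
lemma iteratedDeriv_sum_bilinear {κ : Type*} (S : Finset κ) (L : V →L[ℝ] W →L[ℝ] Z)
    {f : κ → ℕ → ℝ → V} {g : κ → ℕ → ℝ → W} {c d : ℝ}
    (hf : ∀ k i t, HasDerivAt (f k i) (c • f k (i + 1) t) t)
    (hg : ∀ k i t, HasDerivAt (g k i) (d • g k (i + 1) t) t) (m : ℕ) (t : ℝ) :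
    iteratedDeriv m (fun t => ∑ k ∈ S, L (f k 0 t) (g k 0 t)) t = ∑ i ∈ Finset.range (m + 1),
      ((m.choose i : ℝ) * (c ^ i * d ^ (m - i))) • ∑ k ∈ S, L (f k i t) (g k (m - i) t) := by
  have hB : ∀ i j t, HasDerivAt (fun t => ∑ k ∈ S, (c ^ i * d ^ j) • L (f k i t) (g k j t))
      (∑ k ∈ S, (c ^ (i + 1) * d ^ j) • L (f k (i + 1) t) (g k j t) +
        ∑ k ∈ S, (c ^ i * d ^ (j + 1)) • L (f k i t) (g k (j + 1) t)) t := by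
    intro i j t
    rw [← Finset.sum_add_distrib]
    refine HasDerivAt.fun_sum fun k _ => ?_
    have h1 : HasDerivAt (fun t => L (f k i t)) (L (c • f k (i + 1) t)) t :=
      L.hasFDerivAt.comp_hasDerivAt t (hf k i t)
    refine ((h1.clm_apply (hg k j t)).const_smul (c ^ i * d ^ j)).congr_deriv ?_
    simp only [map_smul, smul_apply, smul_add, smul_smul]
    congr 2 <;> ring
  have h := iteratedDeriv_eq_sum_antidiagonal hB m t
  rw [Finset.Nat.sum_antidiagonal_eq_sum_range_succ_mk] at h
  simp only [pow_zero, mul_one, one_smul] at h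
  rw [h]
  refine Finset.sum_congr rfl fun i _ => ?_
  rw [mul_smul, Nat.cast_smul_eq_nsmul, Finset.smul_sum (s := S) (r := c ^ i * d ^ (m - i))]

end Leibniz

/-! ### Transported fields and the action as a functional of the kernel. -/

section Transport

variable {N : ℕ} {s : Type*} {Λ : Type*} [NormedRing Λ] [NormedAlgebra ℂ Λ] {A : GaugeField N}

/-- The derivative of the Wilson line at its moving end supplies exactly the connection term:
transport turns ordinary derivatives into covariant ones. -/
lemma IsHermitianField.hasDerivAt_gaugeAct_wilsonLine (hA : IsHermitianField A)
    {ψ : Spacetime → s × Fin N → Λ} (hψ : ψ ∈ smoothFields N s Λ) (x b : Spacetime) (t : ℝ)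
    (a : s × Fin N) :
    HasDerivAt (fun t : ℝ => gaugeAct (wilsonLine A x (x + t • b)) (ψ (x + t • b)) a)
      (gaugeAct (wilsonLine A x (x + t • b)) (covFundDir A b ψ (x + t • b)) a) t := by
  have h := HasDerivAt.fun_sum (u := Finset.univ) fun j _ =>
    (hA.hasDerivAt_wilsonLine_right x b t a.2 j).smul (hasDerivAt_dirDeriv (hψ (a.1, j)) b x t)
  refine h.congr_deriv ?_
  simp only [gaugeAct, covFundDir, smul_sub, Finset.sum_add_distrib, Finset.sum_sub_distrib,
    Finset.smul_sum, Matrix.mul_apply, Finset.mul_sum, neg_smul, Finset.sum_neg_distrib,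
    Finset.sum_smul, smul_smul]
  rw [Finset.sum_comm, sub_eq_add_neg]
  congr 2
  refine Finset.sum_congr rfl fun j _ => Finset.sum_congr rfl fun k _ => ?_
  congr 1
  ring

lemma IsHermitianField.hasDerivAt_gaugeActRight_wilsonLine (hA : IsHermitianField A)
    {φ : Spacetime → s × Fin N → Λ} (hφ : φ ∈ smoothFields N s Λ) (x b : Spacetime) (t : ℝ)
    (a : s × Fin N) :
    HasDerivAt (fun t : ℝ => gaugeActRight (φ (x + t • b)) (wilsonLine A (x + t • b) x) a)
      (gaugeActRight (covFundDirBar A b φ (x + t • b)) (wilsonLine A (x + t • b) x) a) t := by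
  have h := HasDerivAt.fun_sum (u := Finset.univ) fun j _ =>
    (hA.hasDerivAt_wilsonLine_left x b t j a.2).smul (hasDerivAt_dirDeriv (hφ (a.1, j)) b x t)
  refine h.congr_deriv ?_
  simp only [gaugeActRight, covFundDirBar, smul_add, Finset.sum_add_distrib,
    Finset.smul_sum, Matrix.mul_apply, Finset.mul_sum, Finset.sum_smul, smul_smul]
  rw [Finset.sum_comm (f := fun j k => (Complex.I * (gaugeDir A b (x + t • b) j k *
    wilsonLine A (x + t • b) x k a.2)) • φ (x + t • b) (a.1, j))]
  congr 1
  refine Finset.sum_congr rfl fun j _ => Finset.sum_congr rfl fun k _ => ?_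
  congr 1
  ring

lemma gaugeAct_one (v : s × Fin N → Λ) : gaugeAct 1 v = v := by
  ext a; simp [gaugeAct, Matrix.one_apply]

lemma gaugeActRight_one (v : s × Fin N → Λ) : gaugeActRight v 1 = v := by
  ext a; simp [gaugeActRight, Matrix.one_apply]

lemma hasDerivAt_comp_mul_const {V : Type*} [NormedAddCommGroup V] [NormedSpace ℝ V]
    {f : ℝ → V} {f' : V} {c t : ℝ} (h : HasDerivAt f f' (t * c)) :
    HasDerivAt (fun t => f (t * c)) (c • f') t :=
  h.scomp t (by simpa using (hasDerivAt_id t).mul_const c)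

variable [Fintype s] [DecidableEq s]

/-- The minus sign is the anticommutation of ψ with ψ̄. It is the only Grassmann property used for
the action. -/
lemma sum_transportedKernel_eq {X : Spacetime → Spacetime → Matrix (s × Fin N) (s × Fin N) Λ}
    {φ ψ : Spacetime → s × Fin N → Λ} (hX : ∀ x y p q, X x y p q = -(φ y q * ψ x p))
    (x y : Spacetime) (a c : s) :
    ∑ i, transportedKernel A X x y (c, i) (a, i) = -∑ i,
      gaugeActRight (φ (x + (2⁻¹ : ℝ) • y)) (wilsonLine A (x + (2⁻¹ : ℝ) • y) x) (a, i) *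
      gaugeAct (wilsonLine A x (x - (2⁻¹ : ℝ) • y)) (ψ (x - (2⁻¹ : ℝ) • y)) (c, i) := by
  rw [← Finset.sum_neg_distrib]
  refine Finset.sum_congr rfl fun i _ => ?_
  rw [transportedKernel, liftGauge_mul_mul_apply, gaugeAct, gaugeActRight, Finset.sum_mul_sum,
    ← Finset.sum_neg_distrib]
  refine Finset.sum_congr rfl fun l _ => ?_
  rw [← Finset.sum_neg_distrib]
  refine Finset.sum_congr rfl fun k _ => ?_
  rw [hX, smul_neg, smul_mul_smul_comm, mul_comm (wilsonLine A x _ _ _)]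

lemma sum_dirDeriv_transportedKernel (hA : IsHermitianField A)
    {X : Spacetime → Spacetime → Matrix (s × Fin N) (s × Fin N) Λ} (hXt : IsTestFamily X)
    {φ ψ : Spacetime → s × Fin N → Λ} (hφ : φ ∈ smoothFields N s Λ) (hψ : ψ ∈ smoothFields N s Λ)
    (hX : ∀ x y p q, X x y p q = -(φ y q * ψ x p)) (b : Spacetime) (m : ℕ)
    (x : Spacetime) (a c : s) :
    ∑ i, (dirDeriv b)^[m] (fun y => transportedKernel A X x y (c, i) (a, i)) 0 =
      -∑ i ∈ Finset.range (m + 1), ((m.choose i : ℝ) * ((2⁻¹) ^ i * (-2⁻¹) ^ (m - i))) • ∑ j,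
        (covFundDirBar A b)^[i] φ x (a, j) * (covFundDir A b)^[m - i] ψ x (c, j) := by
  have hs := fun i => (hXt.transported hA).contDiff_right x (c, i) (a, i)
  have h1 := congrFun (dirDeriv_iterate_sum (s := Finset.univ) hs b m) 0
  rw [← h1, funext fun y => sum_transportedKernel_eq hX x y a c]
  have hsm : ContDiff ℝ ∞ fun y : Spacetime => -∑ i,
      gaugeActRight (φ (x + (2⁻¹ : ℝ) • y)) (wilsonLine A (x + (2⁻¹ : ℝ) • y) x) (a, i) *
      gaugeAct (wilsonLine A x (x - (2⁻¹ : ℝ) • y)) (ψ (x - (2⁻¹ : ℝ) • y)) (c, i) := by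
    rw [← funext fun y => sum_transportedKernel_eq hX x y a c]
    exact ContDiff.sum fun i _ => hs i
  have h2 := iteratedDeriv_line hsm b 0 m 0
  rw [zero_smul, add_zero] at h2
  rw [← h2]
  -- On the line y = tb the conjugate field moves with speed 1/2 and the field with speed -1/2;
  -- these are the factors in the Leibniz rule. At t = 0 all Wilson lines are 1.
  let R : Fin N → ℕ → ℝ → Λ := fun j i t => gaugeActRight ((covFundDirBar A b)^[i] φ
    (x + (t * 2⁻¹) • b)) (wilsonLine A (x + (t * 2⁻¹) • b) x) (a, j)
  let L : Fin N → ℕ → ℝ → Λ := fun j i t => gaugeAct (wilsonLine A x (x + (t * -2⁻¹) • b))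
    ((covFundDir A b)^[i] ψ (x + (t * -2⁻¹) • b)) (c, j)
  have hR : ∀ j i t, HasDerivAt (R j i) ((2⁻¹ : ℝ) • R j (i + 1) t) t := fun j i t => by
    simp only [R, Function.iterate_succ_apply' (covFundDirBar A b)]
    exact hasDerivAt_comp_mul_const (hA.hasDerivAt_gaugeActRight_wilsonLine
      (covFundDirBar_iterate_mem hA hφ b i) x b (t * 2⁻¹) (a, j))
  have hL : ∀ j i t, HasDerivAt (L j i) ((-2⁻¹ : ℝ) • L j (i + 1) t) t := fun j i t => by
    simp only [L, Function.iterate_succ_apply' (covFundDir A b)]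
    exact hasDerivAt_comp_mul_const (hA.hasDerivAt_gaugeAct_wilsonLine
      (covFundDir_iterate_mem hA hψ b i) x b (t * -2⁻¹) (c, j))
  have h3 : (fun t : ℝ => -∑ i,
      gaugeActRight (φ (x + (2⁻¹ : ℝ) • ((0 : Spacetime) + t • b)))
        (wilsonLine A (x + (2⁻¹ : ℝ) • ((0 : Spacetime) + t • b)) x) (a, i) *
      gaugeAct (wilsonLine A x (x - (2⁻¹ : ℝ) • ((0 : Spacetime) + t • b)))
        (ψ (x - (2⁻¹ : ℝ) • ((0 : Spacetime) + t • b))) (c, i)) =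
      fun t => -∑ j, R j 0 t * L j 0 t := by
    ext t
    have e1 : x + (2⁻¹ : ℝ) • ((0 : Spacetime) + t • b) = x + (t * 2⁻¹) • b := by module
    have e2 : x - (2⁻¹ : ℝ) • ((0 : Spacetime) + t • b) = x + (t * -2⁻¹) • b := by module
    rw [e1, e2]
    rfl
  rw [h3, iteratedDeriv_fun_neg]
  congr 1
  have h4 := iteratedDeriv_sum_bilinear Finset.univ (ContinuousLinearMap.mul ℝ Λ) hR hL m 0
  simp only [ContinuousLinearMap.mul_apply'] at h4
  rw [h4]
  refine Finset.sum_congr rfl fun i _ => ?_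
  congr 1
  refine Finset.sum_congr rfl fun j _ => ?_
  simp only [R, L, zero_mul, zero_smul, add_zero, hA.wilsonLine_self, gaugeAct_one,
    gaugeActRight_one]

/-- The action as a functional of the kernel `ψ(x) ψ̄(y)`. -/
theorem fermionAction_eq [CompleteSpace Λ] (hA : IsHermitianField A) (Q : DiracSymbol s)
    {X : Spacetime → Spacetime → Matrix (s × Fin N) (s × Fin N) Λ} (hXt : IsTestFamily X)
    {φ ψ : Spacetime → s × Fin N → Λ} (hφ : φ ∈ smoothFields N s Λ) (hc : HasCompactSupport φ)
    (hψ : ψ ∈ smoothFields N s Λ) (hX : ∀ x y p q, X x y p q = -(φ y q * ψ x p)) :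
    fermionAction A Q ψ φ = ∫ x, (momentKernel A Q X [] x 0).trace := by
  have hint := fun (τ : Q.RidgeIndex) (a c : s) (i : ℕ) => integrable_finsetSum Finset.univ
    fun j _ => ridgePairing_integrable hA hφ hc hψ τ.dir (τ.deg - i) i a c
      (Q.contDiff_xSeries τ.1 τ.2.1 a c).continuous j
  have h1 : ∀ x, (momentKernel A Q X [] x 0).trace = ∑ τ : Q.RidgeIndex, ∑ c, ∑ a,
      -∑ i ∈ Finset.range (τ.deg + 1), (((-1) ^ τ.2.2.card * (τ.deg.factorial : ℂ)⁻¹ *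
        (2⁻¹ : ℂ) ^ τ.deg) * ((τ.deg.choose i : ℂ) * (-1) ^ i)) •
        ∑ j, (covFundDirBar A τ.dir)^[i] φ x (a, j) *
          (Q.xSeries τ.1 τ.2.1 x a c • (covFundDir A τ.dir)^[τ.deg - i] ψ x (c, j)) := by
    intro x
    simp only [Matrix.trace, Matrix.diag, momentKernel_apply hA hXt]
    rw [Finset.sum_comm]
    refine Finset.sum_congr rfl fun τ _ => ?_
    rw [Finset.sum_comm]
    refine Finset.sum_congr rfl fun c _ => ?_
    rw [Finset.sum_comm]
    refine Finset.sum_congr rfl fun a _ => ?_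
    rw [← Finset.smul_sum, List.length_nil, Nat.sub_zero,
      sum_dirDeriv_transportedKernel hA hXt hφ hψ hX, smul_neg, Finset.smul_sum]
    congr 1
    refine Finset.sum_congr rfl fun i hi => ?_
    have hi' : i ≤ τ.deg := by simpa [Nat.lt_succ_iff] using hi
    simp only [mul_smul_comm]
    rw [← Finset.smul_sum, smul_smul, ← Complex.coe_smul, smul_smul]
    congr 1
    -- One factor I^m comes from D = ip in the symbol, the other from i∂_b in the moment. Together
    -- with (-1)^{m-i} from the Leibniz rule they give (-1)^i, the sign of the integration by parts.
    have hI : Complex.I ^ τ.deg * Complex.I ^ τ.deg = (-1) ^ i * (-1) ^ (τ.deg - i) := by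
      rw [← mul_pow, Complex.I_mul_I, ← pow_add, Nat.add_sub_cancel' hi']
    have h2 : ((-1 : ℂ) ^ (τ.deg - i)) * (-1) ^ (τ.deg - i) = 1 := by
      rw [← mul_pow]; simp
    have h3 : (2⁻¹ : ℂ) ^ τ.deg = 2⁻¹ ^ i * 2⁻¹ ^ (τ.deg - i) := by
      rw [← pow_add, Nat.add_sub_cancel' hi']
    have h4 : (-2⁻¹ : ℂ) ^ (τ.deg - i) = (-1) ^ (τ.deg - i) * 2⁻¹ ^ (τ.deg - i) := by
      rw [← mul_pow]; simp
    simp only [DiracSymbol.RidgeIndex.factor, DiracSymbol.RidgeIndex.coeff, List.length_nil,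
      Nat.descFactorial_zero, List.map_nil, List.prod_nil, Matrix.smul_apply, smul_eq_mul]
    push_cast
    rw [h4, h3]
    linear_combination ((-1) ^ τ.2.2.card * (τ.deg.factorial : ℂ)⁻¹ * Q.xSeries τ.1 τ.2.1 x a c *
      (τ.deg.choose i : ℂ) * 2⁻¹ ^ i * 2⁻¹ ^ (τ.deg - i) * (-1) ^ (τ.deg - i)) * hI +
      ((-1) ^ τ.2.2.card * (τ.deg.factorial : ℂ)⁻¹ * Q.xSeries τ.1 τ.2.1 x a c *
      (τ.deg.choose i : ℂ) * 2⁻¹ ^ i * 2⁻¹ ^ (τ.deg - i) * (-1) ^ i) * h2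
  let w : Q.RidgeIndex → s → s → Spacetime → Λ := fun τ c a x =>
    ∑ i ∈ Finset.range (τ.deg + 1), ((τ.deg.choose i : ℂ) * (-1) ^ i) •
        ∑ j, (covFundDirBar A τ.dir)^[i] φ x (a, j) *
          (Q.xSeries τ.1 τ.2.1 x a c • (covFundDir A τ.dir)^[τ.deg - i] ψ x (c, j))
  have hw : ∀ τ c a, Integrable (w τ c a) := fun τ c a =>
    integrable_finsetSum _ fun i _ => (hint τ a c i).fun_smul _
  have hw' : ∀ τ c a, ∫ x, w τ c a x = ridgePairing A τ.dir τ.deg a c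
      (fun x => Q.xSeries τ.1 τ.2.1 x a c) φ ψ := fun τ c a => by
    rw [integral_finsetSum _ fun i _ => (hint τ a c i).fun_smul _]
    simp only [integral_smul]
    rfl
  have h2 : ∀ x, (momentKernel A Q X [] x 0).trace = -∑ z : Q.RidgeIndex × s × s,
      ((-1) ^ z.1.2.2.card * (z.1.deg.factorial : ℂ)⁻¹ * (2⁻¹ : ℂ) ^ z.1.deg) •
        w z.1 z.2.1 z.2.2 x := by
    intro x
    simp only [h1, Fintype.sum_prod_type, Finset.sum_neg_distrib, w, Finset.smul_sum (r := _ * _ ^ _),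
      mul_smul]
  simp only [h2, integral_neg]
  rw [integral_finsetSum _ fun z _ => (hw z.1 z.2.1 z.2.2).fun_smul _, fermionAction,
    integral_sum_mul_diracOp hA Q hφ hc hψ]
  simp only [integral_smul, hw', Fintype.sum_prod_type]
  congr 1
  refine Eq.trans ?_ (Finset.sum_comm.trans (Finset.sum_congr rfl fun τ _ => Finset.sum_comm))
  refine Finset.sum_congr rfl fun a _ => ?_
  rw [Fintype.sum_sigma, ← Fin.sum_univ_eq_sum_range (fun m => ∑ c : s, ∑ μ : Fin m → Fin 4,
        ∑ S : Finset (Fin m), ((-1) ^ S.card * (m.factorial : ℂ)⁻¹ * ((2⁻¹ : ℂ) ^ m)) •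
        ridgePairing A (∑ k ∈ Sᶜ, unitVec (μ k)) m a c (fun x => Q.xSeries m μ x a c) φ ψ)]
  refine Finset.sum_congr rfl fun m _ => ?_
  rw [Finset.sum_comm]
  simp only [Fintype.sum_prod_type]
  exact Finset.sum_congr rfl fun μ _ => Finset.sum_comm

end Transport

/-! ### Exponentials of gauge parameters. -/

section MatrixExp

open scoped Matrix.Norms.L2Operator

variable {N : ℕ}

lemma contDiff_exp_smul_entry {P : Type*} [NormedAddCommGroup P] [NormedSpace ℝ P]
    {α : P → Matrix (Fin N) (Fin N) ℂ} (hα : ∀ i j, ContDiff ℝ ∞ fun x => α x i j) (c : ℂ)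
    (i j : Fin N) :
    ContDiff ℝ ∞ fun z : ℝ × P => NormedSpace.exp ((c * (z.1 : ℂ)) • α z.2) i j := by
  have h1 : ContDiff ℝ ∞ (NormedSpace.exp : Matrix (Fin N) (Fin N) ℂ → _) := by
    have : AnalyticOnNhd ℂ (NormedSpace.exp : Matrix (Fin N) (Fin N) ℂ → _) Set.univ :=
      fun x _ => NormedSpace.exp_analytic x
    exact (ContDiff.restrict_scalars ℝ (contDiffOn_univ.1 (this.contDiffOn uniqueDiffOn_univ)))
  have h2 : ContDiff ℝ ∞ fun z : ℝ × P => (c * (z.1 : ℂ)) • α z.2 :=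
    (contDiff_const.mul (Complex.ofRealCLM.contDiff.comp contDiff_fst)).smul
      ((contDiff_matrix_iff.2 hα).comp contDiff_snd)
  exact contDiff_matrix_iff.1 (h1.comp h2) i j

lemma hasDerivAt_exp_smul_entry_zero (M : Matrix (Fin N) (Fin N) ℂ) (c : ℂ) (i j : Fin N) :
    HasDerivAt (fun t : ℝ => NormedSpace.exp ((c * (t : ℂ)) • M) i j) ((c • M) i j) 0 := by
  have h := HasDerivAt.scomp (0 : ℝ) (hasDerivAt_exp_smul_const (𝕂 := ℂ) (c • M) ((0 : ℝ) : ℂ))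
    Complex.ofRealCLM.hasDerivAt
  have h2 : HasDerivAt (fun t : ℝ => NormedSpace.exp ((c * (t : ℂ)) • M)) (c • M) 0 := by
    have e : (fun t : ℝ => NormedSpace.exp ((c * (t : ℂ)) • M)) =
        (fun u : ℂ => NormedSpace.exp (u • c • M)) ∘ Complex.ofReal := by
      ext1 t
      simp [smul_smul, mul_comm]
    rw [e]
    exact h.congr_deriv (by simp)
  exact hasDerivAt_matrix_iff.1 h2 i j

end MatrixExp

/-! ### Adjoint covariant derivatives along a direction. -/

section CovAdjDir

open scoped Matrix.Norms.L2Operator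

variable {N : ℕ} {A : GaugeField N}

/-- The covariant derivative along `b` in the adjoint representation. -/
noncomputable def covAdjDir (A : GaugeField N) (b : Spacetime)
    (F : Spacetime → Matrix (Fin N) (Fin N) ℂ) (x : Spacetime) : Matrix (Fin N) (Fin N) ℂ :=
  Matrix.of (fun i j => dirDeriv b (fun z => F z i j) x) -
    Complex.I • (gaugeDir A b x * F x - F x * gaugeDir A b x)

lemma sum_smul_unitVec (b : Spacetime) : ∑ μ, b μ • unitVec μ = b := by
  ext i
  simp [unitVec, Pi.single_apply]

lemma gaugeMat_complex (U : Matrix (Fin N) (Fin N) ℂ) : gaugeMat ℂ U = U := by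
  ext i j; simp [gaugeMat]

lemma covAdjDir_eq_sum (A : GaugeField N) (b : Spacetime)
    (F : Spacetime → Matrix (Fin N) (Fin N) ℂ) (x : Spacetime) :
    covAdjDir A b F x = ∑ μ, ((b μ : ℝ) : ℂ) • covAdj A μ F x := by
  have h1 : Matrix.of (fun i j => dirDeriv b (fun z => F z i j) x) =
      ∑ μ, ((b μ : ℝ) : ℂ) • matPartial μ F x := by
    ext i j
    simp only [Matrix.of_apply, Matrix.sum_apply, Matrix.smul_apply, matPartial, dirDeriv]
    conv_lhs => rw [← sum_smul_unitVec b]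
    simp
  simp only [covAdjDir, covAdj, gaugeMat_complex, h1, smul_sub, Finset.sum_sub_distrib, gaugeDir,
    Finset.sum_mul, Finset.mul_sum, smul_mul_assoc, mul_smul_comm, Finset.smul_sum]
  simp only [smul_comm Complex.I]

lemma IsHermitianField.smoothMat_covAdjDir (hA : IsHermitianField A) (b : Spacetime)
    {F : Spacetime → Matrix (Fin N) (Fin N) ℂ} (hF : SmoothMat F) : SmoothMat (covAdjDir A b F) := by
  intro i j
  simp only [covAdjDir_eq_sum, Matrix.sum_apply, Matrix.smul_apply]
  exact ContDiff.sum fun μ _ => (hA.smoothMat_covAdj μ hF i j).const_smul ((b μ : ℝ) : ℂ)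

lemma IsHermitianField.smoothMat_covAdjDir_iterate (hA : IsHermitianField A) (b : Spacetime)
    {F : Spacetime → Matrix (Fin N) (Fin N) ℂ} (hF : SmoothMat F) (n : ℕ) :
    SmoothMat ((covAdjDir A b)^[n] F) := by
  induction n with
  | zero => exact hF
  | succ n ih => rw [Function.iterate_succ_apply']; exact hA.smoothMat_covAdjDir b ih

lemma covAdj_sum {Λ : Type*} [NormedRing Λ] [NormedAlgebra ℂ Λ] {κ : Type*} (S : Finset κ)
    (A : GaugeField N) (μ : Fin 4)
    {F : κ → Spacetime → Matrix (Fin N) (Fin N) Λ} (hF : ∀ k, SmoothMat (F k)) (x : Spacetime) :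
    covAdj A μ (fun z => ∑ k ∈ S, F k z) x = ∑ k ∈ S, covAdj A μ (F k) x := by
  ext i j
  simp only [covAdj_apply, Matrix.sum_apply, dirDeriv_sum fun k => hF k i j, Finset.smul_sum,
    Finset.sum_sub_distrib, smul_sub]
  congr 1
  congr 1 <;> exact Finset.sum_comm

lemma sum_fin_succ_eq {M : Type*} [AddCommMonoid M] {n : ℕ} (f : (Fin (n + 1) → Fin 4) → M) :
    ∑ w, f w = ∑ μ, ∑ w, f (Fin.cons μ w) := by
  rw [← Fintype.sum_prod_type', ← (Fin.consEquiv fun _ => Fin 4).sum_comp]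
  rfl

/-- The expansion keeps the order of the derivatives, since they do not commute; only the components
of `b` do. -/
lemma covAdjDir_iterate (hA : IsHermitianField A) (b : Spacetime)
    {F : Spacetime → Matrix (Fin N) (Fin N) ℂ} (hF : SmoothMat F) (n : ℕ) (x : Spacetime) :
    (covAdjDir A b)^[n] F x =
      ∑ w : Fin n → Fin 4, (∏ i, ((b (w i) : ℝ) : ℂ)) • covAdjs A (List.ofFn w) F x := by
  induction n generalizing x with
  | zero => simp [covAdjs]
  | succ n ih =>
    rw [Function.iterate_succ_apply', covAdjDir_eq_sum, sum_fin_succ_eq]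
    refine Finset.sum_congr rfl fun μ _ => ?_
    rw [funext ih, covAdj_sum Finset.univ A μ (F := fun (w : Fin n → Fin 4) x =>
      (∏ i, ((b (w i) : ℝ) : ℂ)) • covAdjs A (List.ofFn w) F x)
      (fun w i j => (hA.smoothMat_covAdjs _ hF i j).const_smul (∏ i, ((b (w i) : ℝ) : ℂ))),
      Finset.smul_sum]
    refine Finset.sum_congr rfl fun w _ => ?_
    rw [covAdj_smul A μ _ (hA.smoothMat_covAdjs _ hF), smul_smul, Fin.prod_univ_succ]
    simp only [Fin.cons_zero, Fin.cons_succ, List.ofFn_succ]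
    rfl

/-- A matrix field, transported along straight lines. -/
lemma IsHermitianField.hasDerivAt_transported (hA : IsHermitianField A)
    {F : Spacetime → Matrix (Fin N) (Fin N) ℂ} (hF : SmoothMat F) (x b : Spacetime) (t : ℝ) :
    HasDerivAt (fun t : ℝ => wilsonLine A x (x + t • b) * F (x + t • b) * wilsonLine A (x + t • b) x)
      (wilsonLine A x (x + t • b) * covAdjDir A b F (x + t • b) * wilsonLine A (x + t • b) x) t := by
  have h1 : HasDerivAt (fun t : ℝ => wilsonLine A x (x + t • b))
      (-(Complex.I • (wilsonLine A x (x + t • b) * gaugeDir A b (x + t • b)))) t :=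
    hasDerivAt_matrix_iff.2 fun i j => hA.hasDerivAt_wilsonLine_right x b t i j
  have h2 : HasDerivAt (fun t : ℝ => wilsonLine A (x + t • b) x)
      (Complex.I • (gaugeDir A b (x + t • b) * wilsonLine A (x + t • b) x)) t :=
    hasDerivAt_matrix_iff.2 fun i j => hA.hasDerivAt_wilsonLine_left x b t i j
  have h3 : HasDerivAt (fun t : ℝ => F (x + t • b))
      (Matrix.of fun i j => dirDeriv b (fun z => F z i j) (x + t • b)) t :=
    hasDerivAt_matrix_iff.2 fun i j => hasDerivAt_dirDeriv (hF i j) b x t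
  refine ((h1.mul h3).mul h2).congr_deriv ?_
  rw [covAdjDir]
  simp only [Pi.mul_apply, mul_sub, sub_mul, add_mul, mul_smul_comm, smul_mul_assoc, smul_sub,
    neg_mul, mul_assoc]
  abel

end CovAdjDir

/-! ### Integration by parts under the gauge trace. -/

section IntegrationByParts

variable {N : ℕ} {Λ : Type*} [NormedRing Λ] [NormedAlgebra ℂ Λ] {A : GaugeField N}

lemma trace_mul_gaugeMat (F : Matrix (Fin N) (Fin N) Λ) (U : Matrix (Fin N) (Fin N) ℂ) :
    (F * gaugeMat Λ U).trace = (gaugeMat Λ U * F).trace := by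
  simp only [Matrix.trace, Matrix.diag, mul_gaugeMat_apply, gaugeMat_mul_apply]
  exact Finset.sum_comm

lemma gaugeMat_mul (U W : Matrix (Fin N) (Fin N) ℂ) :
    gaugeMat Λ (U * W) = gaugeMat Λ U * gaugeMat Λ W :=
  Matrix.map_mul

lemma gaugeMat_sub (U W : Matrix (Fin N) (Fin N) ℂ) :
    gaugeMat Λ (U - W) = gaugeMat Λ U - gaugeMat Λ W := by
  ext i j; simp [gaugeMat]

lemma gaugeMat_smul (c : ℂ) (U : Matrix (Fin N) (Fin N) ℂ) :
    gaugeMat Λ (c • U) = c • gaugeMat Λ U := by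
  ext i j
  simp only [gaugeMat, Matrix.map_apply, Matrix.smul_apply, smul_eq_mul, map_mul]
  rw [Algebra.smul_def]

lemma trace_gaugeMat_mul (U : Matrix (Fin N) (Fin N) ℂ) (F : Matrix (Fin N) (Fin N) Λ) :
    (gaugeMat Λ U * F).trace = ∑ i, ∑ k, U i k • F k i := by
  simp only [Matrix.trace, Matrix.diag, gaugeMat_mul_apply]

lemma contDiff_trace_gaugeMat_mul {α : Spacetime → Matrix (Fin N) (Fin N) ℂ}
    {F : Spacetime → Matrix (Fin N) (Fin N) Λ} (hα : SmoothMat α) (hF : SmoothMat F) :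
    ContDiff ℝ ∞ fun x => (gaugeMat Λ (α x) * F x).trace := by
  simp only [trace_gaugeMat_mul]
  exact ContDiff.sum fun i _ => ContDiff.sum fun k _ => (hα i k).smul (hF k i)

lemma hasCompactSupport_trace_gaugeMat_mul {α : Spacetime → Matrix (Fin N) (Fin N) ℂ}
    (hα : HasCompactSupport α) (F : Spacetime → Matrix (Fin N) (Fin N) Λ) :
    HasCompactSupport fun x => (gaugeMat Λ (α x) * F x).trace :=
  hα.mono fun x hx => by
    contrapose! hx
    simp [trace_gaugeMat_mul, Function.notMem_support.1 hx]

lemma integrable_trace_gaugeMat_mul {α : Spacetime → Matrix (Fin N) (Fin N) ℂ}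
    {F : Spacetime → Matrix (Fin N) (Fin N) Λ} (hα : SmoothMat α) (hc : HasCompactSupport α)
    (hF : SmoothMat F) : Integrable fun x => (gaugeMat Λ (α x) * F x).trace :=
  (contDiff_trace_gaugeMat_mul hα hF).continuous.integrable_of_hasCompactSupport
    (hasCompactSupport_trace_gaugeMat_mul hc F)

lemma HasCompactSupport.covAdj {α : Spacetime → Matrix (Fin N) (Fin N) Λ}
    (hc : HasCompactSupport α) (A : GaugeField N) (μ : Fin 4) :
    HasCompactSupport (covAdj A μ α) :=
  HasCompactSupport.intro hc.isCompact fun x hx => by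
    rw [(covAdj_eventuallyEq (notMem_tsupport_iff_eventuallyEq.1 hx) μ).eq_of_nhds]
    exact congrFun (covAdj_zero A μ) x

lemma HasCompactSupport.covAdjs {α : Spacetime → Matrix (Fin N) (Fin N) Λ}
    (hc : HasCompactSupport α) (A : GaugeField N) (l : List (Fin 4)) :
    HasCompactSupport (covAdjs A l α) := by
  induction l with
  | nil => exact hc
  | cons μ l ih => exact ih.covAdj A μ

/-- The commutator terms cancel in the trace. Cyclicity is available although Λ is noncommutative,
because one of the exchanged matrices is scalar. -/
lemma integral_trace_gaugeMat_mul_covAdj (hA : IsHermitianField A)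
    {α : Spacetime → Matrix (Fin N) (Fin N) ℂ}
    {F : Spacetime → Matrix (Fin N) (Fin N) Λ} (hα : SmoothMat α) (hc : HasCompactSupport α)
    (hF : SmoothMat F) (μ : Fin 4) :
    ∫ x, (gaugeMat Λ (α x) * covAdj A μ F x).trace =
      -∫ x, (gaugeMat Λ (covAdj A μ α x) * F x).trace := by
  have h1 : ∀ x, dirDeriv (unitVec μ) (fun x => (gaugeMat Λ (α x) * F x).trace) x =
      (gaugeMat Λ (α x) * covAdj A μ F x).trace + (gaugeMat Λ (covAdj A μ α x) * F x).trace := by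
    intro x
    have h2 : dirDeriv (unitVec μ) (fun x => (gaugeMat Λ (α x) * F x).trace) x =
        (gaugeMat Λ (α x) * matPartial μ F x).trace + (gaugeMat Λ (matPartial μ α x) * F x).trace := by
      simp only [trace_gaugeMat_mul]
      rw [dirDeriv_sum (f := fun i x => ∑ k, α x i k • F x k i)
        fun i => ContDiff.sum fun k _ => (hα i k).smul (hF k i), ← Finset.sum_add_distrib]
      refine Finset.sum_congr rfl fun i _ => ?_
      rw [dirDeriv_sum (f := fun k x => α x i k • F x k i) fun k => (hα i k).smul (hF k i), ← Finset.sum_add_distrib]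
      refine Finset.sum_congr rfl fun k _ => ?_
      simp only [dirDeriv, matPartial, Matrix.of_apply]
      rw [(((hα i k).differentiable_infty x).hasFDerivAt.fun_smul
        ((hF k i).differentiable_infty x).hasFDerivAt).fderiv]
      simp
    have h3 : (gaugeMat Λ (α x) * F x * gaugeMat Λ (A μ x)).trace =
        (gaugeMat Λ (A μ x) * gaugeMat Λ (α x) * F x).trace := by
      rw [trace_mul_gaugeMat, mul_assoc]
    rw [h2]
    simp only [covAdj, gaugeMat_complex, gaugeMat_sub, gaugeMat_smul, gaugeMat_mul, mul_sub, sub_mul,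
      Matrix.trace_sub, mul_smul_comm, smul_mul_assoc, Matrix.trace_smul, ← mul_assoc, h3]
    simp only [smul_sub]
    abel
  have h := integral_dirDeriv_eq_zero (ν := volume) (contDiff_trace_gaugeMat_mul hα hF)
    (hasCompactSupport_trace_gaugeMat_mul hc F) (unitVec μ)
  simp only [h1] at h
  rw [integral_add (integrable_trace_gaugeMat_mul hα hc (hA.smoothMat_covAdj μ hF))
    (integrable_trace_gaugeMat_mul (hA.smoothMat_covAdj μ hα) (hc.covAdj A μ) hF)] at h
  exact eq_neg_of_add_eq_zero_left h

lemma covAdjs_append (A : GaugeField N) (l l' : List (Fin 4))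
    (F : Spacetime → Matrix (Fin N) (Fin N) Λ) :
    covAdjs A (l ++ l') F = covAdjs A l (covAdjs A l' F) :=
  List.foldr_append

/-- The outermost derivative moves first and becomes the innermost one on α, so the order is
reversed. -/
lemma integral_trace_gaugeMat_mul_covAdjs (hA : IsHermitianField A)
    {α : Spacetime → Matrix (Fin N) (Fin N) ℂ}
    {F : Spacetime → Matrix (Fin N) (Fin N) Λ} (hα : SmoothMat α) (hc : HasCompactSupport α)
    (hF : SmoothMat F) (l : List (Fin 4)) :
    ∫ x, (gaugeMat Λ (α x) * covAdjs A l F x).trace =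
      ((-1) ^ l.length : ℂ) • ∫ x, (gaugeMat Λ (covAdjs A l.reverse α x) * F x).trace := by
  induction l generalizing α with
  | nil => simp [covAdjs]
  | cons μ l ih =>
    change ∫ x, (gaugeMat Λ (α x) * covAdj A μ (covAdjs A l F) x).trace = _
    rw [integral_trace_gaugeMat_mul_covAdj hA hα hc (hA.smoothMat_covAdjs l hF),
      ih (hA.smoothMat_covAdj μ hα) (hc.covAdj A μ), List.reverse_cons, covAdjs_append,
      List.length_cons, pow_succ, mul_smul, neg_one_smul, smul_neg]
    rfl

end IntegrationByParts

/-! ### The first variation of the kernel and of the action. -/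

section Variation

variable {N : ℕ} {s : Type*} [Fintype s] [DecidableEq s] {Λ : Type*} [NormedRing Λ]
  [NormedAlgebra ℂ Λ] {A : GaugeField N}
  {X : Spacetime → Spacetime → Matrix (s × Fin N) (s × Fin N) Λ}
  {α : Spacetime → Matrix (Fin N) (Fin N) ℂ}

/-- The kernel `e^{itα(x)} X(x, y) e^{-itα(y)}`. -/
noncomputable def gaugedKernel (α : Spacetime → Matrix (Fin N) (Fin N) ℂ)
    (X : Spacetime → Spacetime → Matrix (s × Fin N) (s × Fin N) Λ) (t : ℝ) (x y : Spacetime) :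
    Matrix (s × Fin N) (s × Fin N) Λ :=
  liftGauge Λ (NormedSpace.exp ((Complex.I * t) • α x)) * X x y *
    liftGauge Λ (NormedSpace.exp ((-Complex.I * t) • α y))

/-- The first variation of the kernel `X` under a gauge transformation. -/
noncomputable def gaugeVariation (α : Spacetime → Matrix (Fin N) (Fin N) ℂ)
    (X : Spacetime → Spacetime → Matrix (s × Fin N) (s × Fin N) Λ) (x y : Spacetime) :
    Matrix (s × Fin N) (s × Fin N) Λ :=
  liftGauge Λ (Complex.I • α x) * X x y - X x y * liftGauge Λ (Complex.I • α y)

lemma contDiff_gaugedKernel (hα : SmoothMat α) (hX : IsTestFamily X) (a b : s × Fin N) :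
    ContDiff ℝ ∞ fun z : ℝ × Spacetime × Spacetime => gaugedKernel α X z.1 z.2.1 z.2.2 a b := by
  simp only [gaugedKernel, liftGauge_mul_mul_apply]
  exact ContDiff.sum fun l _ => ContDiff.sum fun k _ =>
    (((contDiff_exp_smul_entry hα Complex.I a.2 k).comp
        (contDiff_fst.prodMk contDiff_snd.fst)).mul
      ((contDiff_exp_smul_entry hα (-Complex.I) l b.2).comp
        (contDiff_fst.prodMk contDiff_snd.snd))).smul
      ((hX.smooth (a.1, k) (b.1, l)).comp contDiff_snd)

lemma contDiff_freeze {F : ℝ → Spacetime → Spacetime → Λ}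
    (hF : ContDiff ℝ ∞ fun z : ℝ × Spacetime × Spacetime => F z.1 z.2.1 z.2.2) (t : ℝ) :
    ContDiff ℝ ∞ ↿(F t) :=
  hF.comp (contDiff_const.prodMk contDiff_id : ContDiff ℝ ∞ fun z : Spacetime × Spacetime => (t, z))

lemma IsTestFamily.gaugedKernel (hα : SmoothMat α) (hX : IsTestFamily X) (t : ℝ) :
    IsTestFamily (gaugedKernel α X t) where
  smooth a b := contDiff_freeze (F := fun t x y => _root_.gaugedKernel α X t x y a b)
    (contDiff_gaugedKernel hα hX a b) t
  compact := by
    obtain ⟨K, hK, h0⟩ := hX.compact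
    exact ⟨K, hK, fun x y hxy => by simp [_root_.gaugedKernel, h0 x y hxy]⟩

lemma gaugeVariation_apply (x y : Spacetime) (a b : s × Fin N) :
    gaugeVariation α X x y a b = ∑ k, (Complex.I • α x) a.2 k • X x y (a.1, k) b -
      ∑ l, (Complex.I • α y) l b.2 • X x y a (b.1, l) := by
  simp only [gaugeVariation, Matrix.sub_apply, liftGauge_mul_apply, mul_liftGauge_apply]

lemma IsTestFamily.gaugeVariation (hα : SmoothMat α) (hX : IsTestFamily X) :
    IsTestFamily (gaugeVariation α X) where
  smooth a b := by
    simp only [gaugeVariation_apply]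
    exact (ContDiff.sum fun k _ => (((hα a.2 k).const_smul Complex.I).comp contDiff_fst).smul
      (hX.smooth (a.1, k) b)).sub (ContDiff.sum fun l _ =>
        (((hα l b.2).const_smul Complex.I).comp contDiff_snd).smul (hX.smooth a (b.1, l)))
  compact := by
    obtain ⟨K, hK, h0⟩ := hX.compact
    exact ⟨K, hK, fun x y hxy => by simp [_root_.gaugeVariation, h0 x y hxy]⟩

lemma hasDerivAt_gaugedKernel (x y : Spacetime) (a b : s × Fin N) :
    HasDerivAt (fun t => gaugedKernel α X t x y a b) (gaugeVariation α X x y a b) 0 := by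
  simp only [gaugedKernel, liftGauge_mul_mul_apply]
  refine (HasDerivAt.fun_sum fun l _ => HasDerivAt.fun_sum fun k _ =>
    ((hasDerivAt_exp_smul_entry_zero (α x) Complex.I a.2 k).mul
      (hasDerivAt_exp_smul_entry_zero (α y) (-Complex.I) l b.2)).smul_const
        (X x y (a.1, k) (b.1, l))).congr_deriv ?_
  simp only [Complex.ofReal_zero, mul_zero, zero_smul, NormedSpace.exp_zero, add_smul,
    Finset.sum_add_distrib, gaugeVariation_apply, Matrix.one_apply, mul_ite, ite_mul, mul_one, one_mul,
    zero_mul, ite_smul, Finset.sum_ite_eq, Finset.mem_univ, if_true,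
    neg_smul, Matrix.neg_apply, Finset.sum_neg_distrib, sub_eq_add_neg]
  congr 1
  rw [Finset.sum_comm]
  simp

lemma hasDerivAt_transportedKernel_gaugedKernel (x y : Spacetime) (a b : s × Fin N) :
    HasDerivAt (fun t => transportedKernel A (gaugedKernel α X t) x y a b)
      (transportedKernel A (gaugeVariation α X) x y a b) 0 := by
  simp only [transportedKernel, liftGauge_mul_mul_apply]
  exact HasDerivAt.fun_sum fun l _ => HasDerivAt.fun_sum fun k _ =>
    (hasDerivAt_gaugedKernel _ _ _ _).const_smul (wilsonLine A x (x - (2⁻¹ : ℝ) • y) a.2 k *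
      wilsonLine A (x + (2⁻¹ : ℝ) • y) x l b.2)

lemma contDiff_transportedKernel_family (hA : IsHermitianField A)
    {F : ℝ → Spacetime → Spacetime → Matrix (s × Fin N) (s × Fin N) Λ}
    (hF : ∀ a b, ContDiff ℝ ∞ fun z : ℝ × Spacetime × Spacetime => F z.1 z.2.1 z.2.2 a b)
    (a b : s × Fin N) :
    ContDiff ℝ ∞ fun z : (ℝ × Spacetime) × Spacetime =>
      transportedKernel A (F z.1.1) z.1.2 z.2 a b := by
  simp only [transportedKernel, liftGauge_mul_mul_apply]
  have h1 : ContDiff ℝ ∞ fun z : (ℝ × Spacetime) × Spacetime => z.1.2 - (2⁻¹ : ℝ) • z.2 :=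
    contDiff_fst.snd.sub (contDiff_snd.const_smul _)
  have h2 : ContDiff ℝ ∞ fun z : (ℝ × Spacetime) × Spacetime => z.1.2 + (2⁻¹ : ℝ) • z.2 :=
    contDiff_fst.snd.add (contDiff_snd.const_smul _)
  have h3 : ContDiff ℝ ∞ fun z : (ℝ × Spacetime) × Spacetime =>
      (z.1.1, z.1.2 - (2⁻¹ : ℝ) • z.2, z.1.2 + (2⁻¹ : ℝ) • z.2) :=
    contDiff_fst.fst.prodMk (h1.prodMk h2)
  refine ContDiff.sum fun l _ => ContDiff.sum fun k _ => ?_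
  have h4 := (hA.contDiff_wilsonLine a.2 k).comp (contDiff_fst.snd.prodMk h1)
  have h5 := (hA.contDiff_wilsonLine l b.2).comp (h2.prodMk contDiff_fst.snd)
  exact (h4.mul h5).smul ((hF (a.1, k) (b.1, l)).comp h3)

lemma contDiff_transportedKernel_gaugedKernel (hA : IsHermitianField A) (hα : SmoothMat α)
    (hX : IsTestFamily X) (a b : s × Fin N) :
    ContDiff ℝ ∞ ↿(fun (z : ℝ × Spacetime) (y : Spacetime) =>
      transportedKernel A (gaugedKernel α X z.1) z.2 y a b) :=
  contDiff_transportedKernel_family hA (contDiff_gaugedKernel hα hX) a b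

/-- Differentiation under the integral, for smooth integrands of compact support. -/
lemma hasDerivAt_integral_of_contDiff {V : Type*} [NormedAddCommGroup V] [NormedSpace ℝ V]
    [CompleteSpace V] {F : ℝ → Spacetime → V} (hF : ContDiff ℝ ∞ ↿F) {K : Set Spacetime}
    (hK : IsCompact K) (h0 : ∀ t x, x ∉ K → F t x = 0) (t : ℝ) :
    HasDerivAt (fun t => ∫ x, F t x) (∫ x, dirDeriv 1 (fun t => F t x) t) t := by
  have h1 := (hasFDerivAt_integral_smul (ν := (volume : Measure Spacetime)) hK (F := F)
    (f := fun _ => 1) h0 (locallyIntegrable_const 1) (hF.of_le (by simp)) t).hasDerivAt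
  simp only [one_smul] at h1
  convert h1 using 1
  have hcont : Continuous fun x => fderiv ℝ (fun t => F t x) t := by
    have h2 : ContDiff ℝ ∞ (Function.uncurry fun (x : Spacetime) (q : ℝ) => F q x) :=
      hF.comp (contDiff_snd.prodMk contDiff_fst)
    exact (h2.fderiv (g := fun _ : Spacetime => t) contDiff_const (n := ∞) (m := ∞)
      le_rfl).continuous
  refine (ContinuousLinearMap.integral_apply (hcont.integrable_of_hasCompactSupport ?_) _).symm
  refine HasCompactSupport.intro hK fun x hx => ?_
  have : (fun t => F t x) = fun _ => 0 := by ext t; rw [h0 t x hx]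
  rw [this]; simp

lemma trace_momentKernel (hA : IsHermitianField A) (hX : IsTestFamily X) (Q : DiracSymbol s)
    (l : List (Fin 4)) (x y : Spacetime) : (momentKernel A Q X l x y).trace =
      ∑ τ : Q.RidgeIndex, ∑ a, ∑ b,
        (τ.factor l * τ.coeff x b a * Complex.I ^ (τ.deg - l.length)) •
        ∑ i, (dirDeriv τ.dir)^[τ.deg - l.length]
          (fun y => transportedKernel A X x y (a, i) (b, i)) y := by
  simp only [Matrix.trace, Matrix.diag, momentKernel_apply hA hX, Finset.smul_sum]
  rw [Finset.sum_comm]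
  refine Finset.sum_congr rfl fun τ _ => ?_
  rw [Finset.sum_comm]
  exact Finset.sum_congr rfl fun a _ => Finset.sum_comm

lemma dirDeriv_iterate_zero {P V : Type*} [NormedAddCommGroup P] [NormedSpace ℝ P]
    [NormedAddCommGroup V] [NormedSpace ℝ V] (v : P) (m : ℕ) :
    (dirDeriv v)^[m] (fun _ : P => (0 : V)) = fun _ => 0 := by
  induction m with
  | zero => rfl
  | succ m ih => rw [Function.iterate_succ_apply', ih]; ext; simp [dirDeriv]

/-- The first variation of the action, as a functional of the kernel. -/
lemma hasDerivAt_integral_trace_momentKernel [CompleteSpace Λ] (hA : IsHermitianField A)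
    (hα : SmoothMat α) (hX : IsTestFamily X) (Q : DiracSymbol s) :
    HasDerivAt (fun t => ∫ x, (momentKernel A Q (gaugedKernel α X t) [] x 0).trace)
      (∫ x, (momentKernel A Q (gaugeVariation α X) [] x 0).trace) 0 := by
  have hs := fun a b => contDiff_transportedKernel_gaugedKernel hA hα hX a b
  have hs' := fun (τ : Q.RidgeIndex) a b => (hs a b).uncurry_iterate_dirDeriv
    (F := fun (z : ℝ × Spacetime) (y : Spacetime) =>
      transportedKernel A (gaugedKernel α X z.1) z.2 y a b) τ.dir (τ.deg - ([] : List (Fin 4)).length)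
  have hs0 : ∀ (τ : Q.RidgeIndex) a b, ContDiff ℝ ∞ fun z : ℝ × Spacetime =>
      (dirDeriv τ.dir)^[τ.deg - ([] : List (Fin 4)).length]
        (fun y => transportedKernel A (gaugedKernel α X z.1) z.2 y a b) 0 := fun τ a b =>
    (hs' τ a b).curry_left (F := fun (z : ℝ × Spacetime) =>
      (dirDeriv τ.dir)^[τ.deg - ([] : List (Fin 4)).length]
        (fun y => transportedKernel A (gaugedKernel α X z.1) z.2 y a b)) 0
  obtain ⟨K, hK, h0⟩ := hX.compact
  have hF : ContDiff ℝ ∞ ↿(fun (t : ℝ) (x : Spacetime) =>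
      (momentKernel A Q (gaugedKernel α X t) [] x 0).trace) := by
    simp only [fun t => trace_momentKernel hA (hX.gaugedKernel hα t)]
    change ContDiff ℝ ∞ fun z : ℝ × Spacetime => ∑ τ : Q.RidgeIndex, ∑ a, ∑ b,
      (τ.factor [] * τ.coeff z.2 b a * Complex.I ^ (τ.deg - ([] : List (Fin 4)).length)) •
        ∑ i, (dirDeriv τ.dir)^[τ.deg - ([] : List (Fin 4)).length]
          (fun y => transportedKernel A (gaugedKernel α X z.1) z.2 y (a, i) (b, i)) 0
    exact ContDiff.sum fun τ _ => ContDiff.sum fun a _ => ContDiff.sum fun b _ =>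
      ((contDiff_const.mul ((τ.contDiff_coeff b a).comp contDiff_snd)).mul contDiff_const).smul
        (ContDiff.sum fun i _ => hs0 τ (a, i) (b, i))
  have h := hasDerivAt_integral_of_contDiff hF hK (fun t x hx => ?_) 0
  · refine h.congr_deriv (integral_congr_ae (Eventually.of_forall fun x => ?_))
    beta_reduce
    simp only [fun t => trace_momentKernel hA (hX.gaugedKernel hα t),
      trace_momentKernel hA (hX.gaugeVariation hα)]
    have hd : ∀ (τ : Q.RidgeIndex) a b, HasDerivAt (fun t => (dirDeriv τ.dir)^[τ.deg -
        ([] : List (Fin 4)).length] (fun y => transportedKernel A (gaugedKernel α X t) x y a b) 0)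
        ((dirDeriv τ.dir)^[τ.deg - ([] : List (Fin 4)).length]
          (fun y => transportedKernel A (gaugeVariation α X) x y a b) 0) 0 := by
      intro τ a b
      have h1 : ContDiff ℝ ∞ ↿(fun (t : ℝ) (y : Spacetime) =>
          transportedKernel A (gaugedKernel α X t) x y a b) :=
        ContDiff.comp (g := ↿(fun (z : ℝ × Spacetime) (y : Spacetime) =>
          transportedKernel A (gaugedKernel α X z.1) z.2 y a b))
          (f := fun z : ℝ × Spacetime => ((z.1, x), z.2)) (hs a b)
          ((contDiff_fst.prodMk contDiff_const).prodMk contDiff_snd)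
      -- The derivative in the gauge transformation time is moved inside the derivatives in y, where
      -- it is the variation of the transported kernel.
      have h2 := dirDeriv_iterate_curry_comm h1 (1 : ℝ) τ.dir
        (τ.deg - ([] : List (Fin 4)).length) 0 0
      have h3 : ∀ y, dirDeriv (1 : ℝ) (fun t => transportedKernel A (gaugedKernel α X t) x y a b) 0 =
          transportedKernel A (gaugeVariation α X) x y a b := fun y =>
        (hasDerivAt_transportedKernel_gaugedKernel x y a b).deriv
      simp only [h3] at h2
      rw [← h2]
      have h4 : ContDiff ℝ ∞ fun t : ℝ => (dirDeriv τ.dir)^[τ.deg - ([] : List (Fin 4)).length]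
          (fun y => transportedKernel A (gaugedKernel α X t) x y a b) 0 :=
        ContDiff.comp (g := fun z : ℝ × Spacetime =>
          (dirDeriv τ.dir)^[τ.deg - ([] : List (Fin 4)).length]
          (fun y => transportedKernel A (gaugedKernel α X z.1) z.2 y a b) 0)
          (f := fun t : ℝ => (t, x)) (hs0 τ a b) (contDiff_id.prodMk contDiff_const)
      exact (h4.differentiable_infty 0).hasDerivAt
    exact (HasDerivAt.deriv (HasDerivAt.fun_sum fun τ _ => HasDerivAt.fun_sum fun a _ =>
      HasDerivAt.fun_sum fun b _ => (HasDerivAt.fun_sum fun i _ => hd τ (a, i) (b, i)).const_smul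
        (τ.factor [] * τ.coeff x b a * Complex.I ^ (τ.deg - ([] : List (Fin 4)).length))))
  · rw [trace_momentKernel hA (hX.gaugedKernel hα t)]
    refine Finset.sum_eq_zero fun τ _ => Finset.sum_eq_zero fun a _ =>
      Finset.sum_eq_zero fun b _ => ?_
    rw [Finset.sum_eq_zero, smul_zero]
    intro i _
    -- For x outside `K` the point x - y/2 stays outside for small y; this gives a compact support
    -- in x that is independent of t.
    have h1 : (fun y => transportedKernel A (gaugedKernel α X t) x y (a, i) (b, i)) =ᶠ[𝓝 0]
        fun _ => 0 := by
      have h2 : Tendsto (fun y : Spacetime => x - (2⁻¹ : ℝ) • y) (𝓝 0) (𝓝 x) := by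
        have : Continuous fun y : Spacetime => x - (2⁻¹ : ℝ) • y := by fun_prop
        simpa using this.tendsto 0
      filter_upwards [h2.eventually (hK.isClosed.isOpen_compl.mem_nhds hx)] with y hy
      simp [transportedKernel, gaugedKernel, h0 _ (x + (2⁻¹ : ℝ) • y) (Or.inl hy)]
    rw [(dirDeriv_iterate_eventuallyEq h1 τ.dir _).eq_of_nhds, dirDeriv_iterate_zero]

end Variation

/-! ### Reindexing of multi-indices and the numerical coefficients. -/

section Reindexing

lemma sum_fin_snoc_eq {M : Type*} [AddCommMonoid M] {n : ℕ} (f : (Fin (n + 1) → Fin 4) → M) :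
    ∑ w, f w = ∑ μ, ∑ w : Fin n → Fin 4, f (Fin.snoc w μ) := by
  rw [← Fintype.sum_prod_type', ← (Fin.snocEquiv fun _ => Fin 4).sum_comp]
  rfl

lemma ofFn_snoc {n : ℕ} (w : Fin n → Fin 4) (μ : Fin 4) :
    List.ofFn (Fin.snoc w μ : Fin (n + 1) → Fin 4) = List.ofFn w ++ [μ] := by
  rw [List.ofFn_succ']
  simp

lemma reverse_ofFn {n : ℕ} (w : Fin n → Fin 4) :
    (List.ofFn w).reverse = List.ofFn (w ∘ Fin.rev) := by
  induction n with
  | zero => simp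
  | succ n ih =>
    rw [List.ofFn_succ, List.reverse_cons, ih, List.ofFn_succ' (w ∘ Fin.rev)]
    simp only [List.concat_eq_append, Function.comp_def, Fin.rev_castSucc, Fin.rev_last]

lemma sum_reverse_ofFn {M : Type*} [AddCommMonoid M] {n : ℕ} (f : List (Fin 4) → M) :
    ∑ w : Fin n → Fin 4, f (List.ofFn w).reverse = ∑ w : Fin n → Fin 4, f (List.ofFn w) := by
  simp only [reverse_ofFn]
  exact Fintype.sum_equiv (Fin.revPerm.arrowCongr (Equiv.refl _)) _ _ fun w => rfl

lemma sum_range_two_mul {M : Type*} [AddCommMonoid M] (f : ℕ → M) (n : ℕ) :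
    ∑ i ∈ Finset.range (2 * n), f i = ∑ k ∈ Finset.range n, (f (2 * k) + f (2 * k + 1)) := by
  induction n with
  | zero => simp
  | succ n ih => rw [mul_add, mul_one, Finset.sum_range_succ, Finset.sum_range_succ,
      Finset.sum_range_succ, ih, add_assoc]

/-- The coefficient of the covariant derivatives of order `n` of the gauge parameter in the
variation of the action. -/
noncomputable def variationCoeff (n : ℕ) : ℂ :=
  Complex.I ^ (n + 1) * ((-2⁻¹) ^ n - 2⁻¹ ^ n) / n.factorial

/-- Even orders cancel because the two end points lie symmetrically about the midpoint. -/
lemma variationCoeff_even (k : ℕ) : variationCoeff (2 * k) = 0 := by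
  simp [variationCoeff, pow_mul]

lemma variationCoeff_odd (k : ℕ) : variationCoeff (2 * k + 1) = gradCoeff k := by
  have h1 : Complex.I ^ (2 * k + 1 + 1) = -(-1) ^ k := by
    rw [show 2 * k + 1 + 1 = 2 * (k + 1) by ring, pow_mul, Complex.I_sq, pow_succ]; ring
  have h2 : ((-2⁻¹ : ℂ)) ^ (2 * k + 1) - 2⁻¹ ^ (2 * k + 1) = -(4 ^ k)⁻¹ := by
    rw [pow_succ, pow_succ, pow_mul, pow_mul, neg_sq, ← inv_pow]; norm_num; ring
  rw [variationCoeff, gradCoeff, h1, h2]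
  field_simp

/-- On the left is the Leibniz coefficient of D_b^n α, on the right the factor that n momentum
derivatives extract from ⟨b,p⟩^m. They match because C(m,n) is the descending factorial divided by
n!. -/
lemma I_pow_mul_variationCoeff {m n : ℕ} (h : n ≤ m) :
    Complex.I ^ m * ((m.choose n : ℂ) * (Complex.I * ((-2⁻¹) ^ n - 2⁻¹ ^ n))) =
      variationCoeff n * ((m.descFactorial n : ℂ) * Complex.I ^ (m - n)) := by
  have h0 : (n.factorial : ℂ) ≠ 0 := by exact_mod_cast n.factorial_ne_zero
  have h1 : Complex.I ^ m = Complex.I ^ n * Complex.I ^ (m - n) := by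
    rw [← pow_add, Nat.add_sub_cancel' h]
  rw [variationCoeff, h1, Nat.descFactorial_eq_factorial_mul_choose]
  push_cast
  field_simp
  ring

end Reindexing

/-! ### Expansion of the variation in covariant derivatives of the gauge parameter. -/

section KernelVariation

open scoped Matrix.Norms.L2Operator

variable {N : ℕ} {s : Type*} [Fintype s] [DecidableEq s] {Λ : Type*} [NormedRing Λ]
  [NormedAlgebra ℂ Λ] {A : GaugeField N}
  {X : Spacetime → Spacetime → Matrix (s × Fin N) (s × Fin N) Λ}
  {α : Spacetime → Matrix (Fin N) (Fin N) ℂ}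

/-- A matrix field, parallel transported to `x`. -/
noncomputable def transportTo (A : GaugeField N) (F : Spacetime → Matrix (Fin N) (Fin N) ℂ)
    (x z : Spacetime) : Matrix (Fin N) (Fin N) ℂ :=
  wilsonLine A x z * F z * wilsonLine A z x

lemma liftGauge_mul (U W : Matrix (Fin N) (Fin N) ℂ) :
    liftGauge (s := s) Λ (U * W) = liftGauge Λ U * liftGauge Λ W := by
  rw [liftGauge, liftGauge, liftGauge, ← Matrix.map_mul, ← Matrix.mul_kronecker_mul, one_mul]

lemma transportTo_mul_wilsonLine (hA : IsHermitianField A)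
    (F : Spacetime → Matrix (Fin N) (Fin N) ℂ) (x z : Spacetime) :
    transportTo A F x z * wilsonLine A x z = wilsonLine A x z * F z := by
  rw [transportTo, mul_assoc, hA.wilsonLine_mul_symm, mul_one]

lemma wilsonLine_mul_transportTo (hA : IsHermitianField A)
    (F : Spacetime → Matrix (Fin N) (Fin N) ℂ) (x z : Spacetime) :
    wilsonLine A z x * transportTo A F x z = F z * wilsonLine A z x := by
  rw [transportTo, ← mul_assoc, ← mul_assoc, hA.wilsonLine_mul_symm, one_mul]

lemma transportedKernel_gaugeVariation (hA : IsHermitianField A) (x y : Spacetime) :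
    transportedKernel A (gaugeVariation α X) x y =
      liftGauge Λ (Complex.I • transportTo A α x (x - (2⁻¹ : ℝ) • y)) * transportedKernel A X x y -
      transportedKernel A X x y * liftGauge Λ (Complex.I • transportTo A α x (x + (2⁻¹ : ℝ) • y)) := by
  have h1 : ∀ z, Complex.I • transportTo A α x z * wilsonLine A x z =
      wilsonLine A x z * (Complex.I • α z) := fun z => by
    rw [smul_mul_assoc, transportTo_mul_wilsonLine hA, mul_smul_comm]
  have h2 : ∀ z, wilsonLine A z x * (Complex.I • transportTo A α x z) =
      (Complex.I • α z) * wilsonLine A z x := fun z => by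
    rw [smul_mul_assoc, mul_smul_comm, wilsonLine_mul_transportTo hA]
  simp only [transportedKernel, gaugeVariation, mul_sub, sub_mul]
  congr 1
  · rw [← mul_assoc, ← mul_assoc, ← mul_assoc, ← liftGauge_mul, ← liftGauge_mul, h1]
  · simp only [mul_assoc]
    rw [← liftGauge_mul, ← liftGauge_mul, h2]

/-- Under the trace over gauge indices, left and right multiplication contribute to the same
components of the kernel, so only the difference of the transported values of α at the two ends
remains. -/
lemma sum_transportedKernel_gaugeVariation (hA : IsHermitianField A) (x y : Spacetime) (p q : s) :
    ∑ i, transportedKernel A (gaugeVariation α X) x y (p, i) (q, i) = ∑ r : Fin N × Fin N,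
      (Complex.I * (transportTo A α x (x - (2⁻¹ : ℝ) • y) r.1 r.2 -
        transportTo A α x (x + (2⁻¹ : ℝ) • y) r.1 r.2)) •
        transportedKernel A X x y (p, r.2) (q, r.1) := by
  simp only [transportedKernel_gaugeVariation hA, Matrix.sub_apply, liftGauge_mul_apply,
    mul_liftGauge_apply, Finset.sum_sub_distrib, Fintype.sum_prod_type, Matrix.smul_apply,
    smul_eq_mul, mul_sub, sub_smul]
  congr 1
  exact Finset.sum_comm

lemma hasDerivAt_transportTo (hA : IsHermitianField A) (hα : SmoothMat α) (x b : Spacetime) (n : ℕ)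
    (t : ℝ) (i k : Fin N) :
    HasDerivAt (fun t : ℝ => transportTo A ((covAdjDir A b)^[n] α) x (x + t • b) i k)
      (transportTo A ((covAdjDir A b)^[n + 1] α) x (x + t • b) i k) t := by
  rw [Function.iterate_succ_apply']
  exact hasDerivAt_matrix_iff.1
    (hA.hasDerivAt_transported (hA.smoothMat_covAdjDir_iterate b hα n) x b t) i k

lemma sum_dirDeriv_transportedKernel_gaugeVariation (hA : IsHermitianField A) (hα : SmoothMat α)
    (hX : IsTestFamily X) (b : Spacetime) (m : ℕ) (x : Spacetime) (p q : s) :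
    ∑ i, (dirDeriv b)^[m]
        (fun y => transportedKernel A (gaugeVariation α X) x y (p, i) (q, i)) 0 =
      ∑ n ∈ Finset.range (m + 1),
        ((m.choose n : ℂ) * (Complex.I * ((-2⁻¹) ^ n - 2⁻¹ ^ n))) • ∑ r : Fin N × Fin N,
          (covAdjDir A b)^[n] α x r.1 r.2 •
            (dirDeriv b)^[m - n] (fun y => transportedKernel A X x y (p, r.2) (q, r.1)) 0 := by
  have hs := fun i => ((hX.gaugeVariation hα).transported hA).contDiff_right x (p, i) (q, i)
  have hΦ := fun r : Fin N × Fin N => (hX.transported hA).contDiff_right x (p, r.2) (q, r.1)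
  have h1 := congrFun (dirDeriv_iterate_sum (s := Finset.univ) hs b m) 0
  have h2 := iteratedDeriv_line (ContDiff.sum (s := Finset.univ) fun i _ => hs i) b 0 m 0
  rw [zero_smul, add_zero] at h2
  rw [← h1, ← h2]
  -- The powers of -1/2 and 1/2 from the chain rule differ at the two ends. They are included in
  -- `f`, and the Leibniz rule is applied with both rates equal to 1.
  let f : Fin N × Fin N → ℕ → ℝ → ℂ := fun r n t =>
    Complex.I * ((((-2⁻¹ : ℝ) ^ n : ℝ) : ℂ) *
      transportTo A ((covAdjDir A b)^[n] α) x (x + (t * -2⁻¹) • b) r.1 r.2 -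
      (((2⁻¹ : ℝ) ^ n : ℝ) : ℂ) *
        transportTo A ((covAdjDir A b)^[n] α) x (x + (t * 2⁻¹) • b) r.1 r.2)
  let g : Fin N × Fin N → ℕ → ℝ → Λ := fun r n t =>
    (dirDeriv b)^[n] (fun y => transportedKernel A X x y (p, r.2) (q, r.1)) (0 + t • b)
  have hf : ∀ r n t, HasDerivAt (f r n) ((1 : ℝ) • f r (n + 1) t) t := fun r n t => by
    refine ((((hasDerivAt_comp_mul_const (hasDerivAt_transportTo hA hα x b n (t * -2⁻¹) r.1
      r.2)).const_mul ((((-2⁻¹ : ℝ) ^ n : ℝ) : ℂ))).sub ((hasDerivAt_comp_mul_const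
      (hasDerivAt_transportTo hA hα x b n (t * 2⁻¹) r.1 r.2)).const_mul
      ((((2⁻¹ : ℝ) ^ n : ℝ) : ℂ)))).const_mul Complex.I).congr_deriv ?_
    simp only [f, one_smul, pow_succ, Complex.real_smul]
    push_cast
    ring
  have hg : ∀ r n t, HasDerivAt (g r n) ((1 : ℝ) • g r (n + 1) t) t := fun r n t => by
    rw [one_smul]
    simp only [g, Function.iterate_succ_apply']
    exact hasDerivAt_dirDeriv ((hΦ r).iterate_dirDeriv b n) b 0 t
  have h3 : (fun t : ℝ => ∑ i, transportedKernel A (gaugeVariation α X) x (0 + t • b) (p, i) (q, i)) =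
      fun t => ∑ r, ContinuousLinearMap.lsmul ℝ ℂ (f r 0 t) (g r 0 t) := by
    ext t
    have e1 : x - (2⁻¹ : ℝ) • ((0 : Spacetime) + t • b) = x + (t * -2⁻¹) • b := by module
    have e2 : x + (2⁻¹ : ℝ) • ((0 : Spacetime) + t • b) = x + (t * 2⁻¹) • b := by module
    rw [sum_transportedKernel_gaugeVariation hA, e1, e2]
    simp [f, g]
  rw [h3, iteratedDeriv_sum_bilinear Finset.univ (ContinuousLinearMap.lsmul ℝ ℂ) hf hg m 0]
  refine Finset.sum_congr rfl fun n _ => ?_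
  rw [one_pow, one_pow, mul_one, mul_one, mul_smul, ← Complex.coe_smul]
  push_cast
  congr 1
  rw [Finset.smul_sum]
  refine Finset.sum_congr rfl fun r _ => ?_
  simp only [f, g, transportTo, zero_mul, zero_smul, add_zero, hA.wilsonLine_self, one_mul, mul_one,
    ContinuousLinearMap.lsmul_apply, smul_smul]
  congr 1
  push_cast
  ring

/-- The pairing of the covariant derivatives of order `n` of `α` with the moments of order `n`. -/
noncomputable def momentPairing (A : GaugeField N) (Q : DiracSymbol s)
    (X : Spacetime → Spacetime → Matrix (s × Fin N) (s × Fin N) Λ)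
    (α : Spacetime → Matrix (Fin N) (Fin N) ℂ) (n : ℕ) (x : Spacetime) : Λ :=
  ∑ w : Fin n → Fin 4, (gaugeMat Λ (covAdjs A (List.ofFn w) α x) *
    momentKernel A Q X (List.ofFn w) x 0).trace

lemma momentPairing_eq (hA : IsHermitianField A) (hα : SmoothMat α) (hX : IsTestFamily X)
    (Q : DiracSymbol s) (n : ℕ) (x : Spacetime) :
    momentPairing A Q X α n x = ∑ τ : Q.RidgeIndex, ∑ a, ∑ b,
      ((τ.deg.descFactorial n : ℂ) * τ.coeff x b a * Complex.I ^ (τ.deg - n)) •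
        ∑ r : Fin N × Fin N, (covAdjDir A τ.dir)^[n] α x r.1 r.2 •
          (dirDeriv τ.dir)^[τ.deg - n] (fun y => transportedKernel A X x y (a, r.2) (b, r.1)) 0 := by
  simp only [momentPairing, trace_gaugeMat_mul, momentKernel_apply hA hX]
  have h1 : ∀ (w : Fin n → Fin 4), ∑ i, ∑ k, covAdjs A (List.ofFn w) α x i k •
      ∑ τ : Q.RidgeIndex, ∑ a, ∑ b,
        (τ.factor (List.ofFn w) * τ.coeff x b a * Complex.I ^ (τ.deg - (List.ofFn w).length)) •
        (dirDeriv τ.dir)^[τ.deg - (List.ofFn w).length]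
          (fun y => transportedKernel A X x y (a, k) (b, i)) 0 =
      ∑ τ : Q.RidgeIndex, ∑ a, ∑ b, ∑ r : Fin N × Fin N,
        (((τ.deg.descFactorial n : ℂ) * τ.coeff x b a * Complex.I ^ (τ.deg - n)) *
          ((∏ i, ((τ.dir (w i) : ℝ) : ℂ)) * covAdjs A (List.ofFn w) α x r.1 r.2)) •
        (dirDeriv τ.dir)^[τ.deg - n] (fun y => transportedKernel A X x y (a, r.2) (b, r.1)) 0 := by
    intro w
    rw [← Fintype.sum_prod_type' (f := fun i k => covAdjs A (List.ofFn w) α x i k • _)]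
    simp only [Finset.smul_sum]
    rw [Finset.sum_comm]
    refine Finset.sum_congr rfl fun τ _ => ?_
    rw [Finset.sum_comm]
    refine Finset.sum_congr rfl fun a _ => ?_
    rw [Finset.sum_comm]
    refine Finset.sum_congr rfl fun b _ => Finset.sum_congr rfl fun r _ => ?_
    rw [smul_smul, DiracSymbol.RidgeIndex.factor, List.length_ofFn, List.map_ofFn, List.prod_ofFn]
    congr 1
    simp only [Function.comp_def]
    ring
  rw [Finset.sum_congr rfl fun w _ => h1 w, Finset.sum_comm]
  refine Finset.sum_congr rfl fun τ _ => ?_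
  rw [Finset.sum_comm]
  refine Finset.sum_congr rfl fun a _ => ?_
  rw [Finset.sum_comm]
  refine Finset.sum_congr rfl fun b _ => ?_
  rw [Finset.sum_comm, Finset.smul_sum]
  refine Finset.sum_congr rfl fun r _ => ?_
  rw [← Finset.sum_smul, smul_smul, ← Finset.mul_sum, covAdjDir_iterate hA _ hα]
  simp only [Matrix.sum_apply, Matrix.smul_apply, smul_eq_mul]

theorem trace_momentKernel_gaugeVariation (hA : IsHermitianField A) (hα : SmoothMat α)
    (hX : IsTestFamily X) (Q : DiracSymbol s) (x : Spacetime) :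
    (momentKernel A Q (gaugeVariation α X) [] x 0).trace =
      ∑ k ∈ Finset.range (Q.order + 1), gradCoeff k • momentPairing A Q X α (2 * k + 1) x := by
  have h1 : ∑ k ∈ Finset.range (Q.order + 1), gradCoeff k • momentPairing A Q X α (2 * k + 1) x =
      ∑ n ∈ Finset.range (2 * (Q.order + 1)), variationCoeff n • momentPairing A Q X α n x := by
    rw [sum_range_two_mul]
    refine Finset.sum_congr rfl fun k _ => ?_
    rw [variationCoeff_even, variationCoeff_odd, zero_smul, zero_add]
  rw [h1, trace_momentKernel hA (hX.gaugeVariation hα)]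
  simp only [momentPairing_eq hA hα hX, Finset.smul_sum (r := variationCoeff _)]
  refine Eq.trans ?_ Finset.sum_comm
  refine Finset.sum_congr rfl fun τ _ => ?_
  refine Eq.trans ?_ Finset.sum_comm
  refine Finset.sum_congr rfl fun a _ => ?_
  refine Eq.trans ?_ Finset.sum_comm
  refine Finset.sum_congr rfl fun b _ => ?_
  rw [List.length_nil, Nat.sub_zero, sum_dirDeriv_transportedKernel_gaugeVariation hA hα hX,
    Finset.smul_sum]
  -- The range is made independent of the term of the symbol; the added binomial coefficients
  -- vanish.
  refine (Finset.sum_subset (s₂ := Finset.range (2 * (Q.order + 1))) ?_ ?_).trans ?_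
  · exact Finset.range_mono (by have := τ.deg_le; omega)
  · intro n _ hn
    rw [Nat.choose_eq_zero_of_lt (by simpa using hn)]
    simp
  · refine Finset.sum_congr rfl fun n _ => ?_
    rw [smul_smul, smul_smul]
    congr 1
    rcases le_or_gt n τ.deg with h | h
    · have := I_pow_mul_variationCoeff h
      simp only [DiracSymbol.RidgeIndex.factor, List.length_nil, Nat.descFactorial_zero,
        List.map_nil, List.prod_nil]
      push_cast
      linear_combination τ.coeff x b a * this
    · rw [Nat.choose_eq_zero_of_lt h, Nat.descFactorial_eq_zero_iff_lt.2 h]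
      simp

end KernelVariation

/-! ### The Noether identity. -/

section Noether

variable {N : ℕ} {s : Type*} [Fintype s] [DecidableEq s] {Λ : Type*} [NormedRing Λ]
  [NormedAlgebra ℂ Λ] {A : GaugeField N}
  {X : Spacetime → Spacetime → Matrix (s × Fin N) (s × Fin N) Λ}
  {α : Spacetime → Matrix (Fin N) (Fin N) ℂ}

/-- The 2k sign changes cancel. The reversed order of derivatives is undone by summing over all
multi-indices and by the symmetry of the moments. -/
lemma integral_trace_covAdjs_reverse (hA : IsHermitianField A) (hα : SmoothMat α)
    (hc : HasCompactSupport α) (F : List (Fin 4) → Spacetime → Matrix (Fin N) (Fin N) Λ)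
    (hF : ∀ l, SmoothMat (F l)) (hperm : ∀ l l' : List (Fin 4), l.Perm l' → F l = F l')
    (k : ℕ) (μ : Fin 4) :
    ∑ l : Fin (2 * k) → Fin 4, ∫ x, (gaugeMat Λ (α x) *
        covAdjs A (List.ofFn l) (F (List.ofFn l ++ [μ])) x).trace =
      ∑ l : Fin (2 * k) → Fin 4, ∫ x, (gaugeMat Λ (covAdjs A (List.ofFn l) α x) *
        F (List.ofFn l ++ [μ]) x).trace := by
  rw [← sum_reverse_ofFn fun l => ∫ x, (gaugeMat Λ (covAdjs A l α x) * F (l ++ [μ]) x).trace]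
  refine Finset.sum_congr rfl fun l _ => ?_
  rw [integral_trace_gaugeMat_mul_covAdjs hA hα hc (hF _), List.length_ofFn, pow_mul, neg_one_sq,
    one_pow, one_smul, hperm _ _ ((List.reverse_perm (List.ofFn l)).append_right [μ])]

variable [CompleteSpace Λ]

lemma integral_trace_gaugeMat_mul_currentKernel (hA : IsHermitianField A) (hα : SmoothMat α)
    (hc : HasCompactSupport α) (hX : IsTestFamily X) (Q : DiracSymbol s) (μ : Fin 4) :
    ∫ x, (gaugeMat Λ (α x) * currentKernel A Q X μ x 0).trace =
      ∑ k ∈ Finset.range (Q.order + 1), gradCoeff k • ∑ l : Fin (2 * k) → Fin 4,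
        ∫ x, (gaugeMat Λ (covAdjs A (List.ofFn l) α x) *
          momentKernel A Q X (List.ofFn l ++ [μ]) x 0).trace := by
  have hs : ∀ l, SmoothMat fun x => momentKernel A Q X l x 0 := fun l i j =>
    (hX.momentKernel hA Q l).contDiff_left 0 i j
  have hi := fun (k : ℕ) (l : Fin (2 * k) → Fin 4) => integrable_trace_gaugeMat_mul (Λ := Λ) hα hc
    (hA.smoothMat_covAdjs (List.ofFn l) (hs (List.ofFn l ++ [μ])))
  simp only [currentKernel, Finset.mul_sum, mul_smul_comm, Matrix.trace_sum, Matrix.trace_smul]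
  rw [integral_finsetSum _ fun k _ => (integrable_finsetSum _ fun l _ => hi k l).fun_smul _]
  refine Finset.sum_congr rfl fun k _ => ?_
  rw [integral_smul, integral_finsetSum _ fun l _ => hi k l,
    integral_trace_covAdjs_reverse hA hα hc (fun l x => momentKernel A Q X l x 0) hs
      (fun l l' h => by simp only [momentKernel_perm Q h])]

/-- The integrated divergence of the current is the variation of the action. -/
theorem integral_trace_divergence (hA : IsHermitianField A) (hα : SmoothMat α)
    (hc : HasCompactSupport α) (hX : IsTestFamily X) (Q : DiracSymbol s)
    {J : Fin 4 → Spacetime → Matrix (Fin N) (Fin N) Λ}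
    (hJ : ∀ μ x, J μ x = -currentKernel A Q X μ x 0) :
    ∫ x, (gaugeMat Λ (α x) * ∑ μ, covAdj A μ (J μ) x).trace =
      ∫ x, (momentKernel A Q (gaugeVariation α X) [] x 0).trace := by
  have hs : ∀ l, SmoothMat fun x => momentKernel A Q X l x 0 := fun l i j =>
    (hX.momentKernel hA Q l).contDiff_left 0 i j
  have hJs : ∀ μ, SmoothMat (J μ) := fun μ i j => by
    simp only [hJ, Matrix.neg_apply]
    exact ((hX.currentKernel hA Q μ).contDiff_left 0 i j).neg
  have hw := fun (w : List (Fin 4)) => integrable_trace_gaugeMat_mul (Λ := Λ)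
    (hA.smoothMat_covAdjs w hα) (hc.covAdjs A w) (hs w)
  simp only [Finset.mul_sum, Matrix.trace_sum]
  rw [integral_finsetSum _ fun μ _ =>
    integrable_trace_gaugeMat_mul hα hc (hA.smoothMat_covAdj μ (hJs μ))]
  simp only [trace_momentKernel_gaugeVariation hA hα hX Q]
  have hp : ∀ n, Integrable fun x => momentPairing A Q X α n x := fun n =>
    integrable_finsetSum _ fun w _ => hw (List.ofFn w)
  rw [integral_finsetSum _ fun k _ => (hp (2 * k + 1)).fun_smul (gradCoeff k)]
  simp only [integral_smul]
  -- The last index of the multi-index, whose derivative acts on α first, becomes the index of the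
  -- current. The other 2k derivatives are those in the gradient expansion.
  have h1 : ∀ k, ∫ x, momentPairing A Q X α (2 * k + 1) x = ∑ μ, ∑ l : Fin (2 * k) → Fin 4,
      ∫ x, (gaugeMat Λ (covAdjs A (List.ofFn l) (covAdj A μ α) x) *
          momentKernel A Q X (List.ofFn l ++ [μ]) x 0).trace := by
    intro k
    simp only [momentPairing]
    rw [integral_finsetSum _ fun w _ => hw (List.ofFn w), sum_fin_snoc_eq]
    refine Finset.sum_congr rfl fun μ _ => Finset.sum_congr rfl fun l _ => ?_
    rw [ofFn_snoc, covAdjs_append]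
    rfl
  simp only [h1, Finset.smul_sum (r := gradCoeff _)]
  refine Eq.trans ?_ Finset.sum_comm
  refine Finset.sum_congr rfl fun μ _ => ?_
  rw [integral_trace_gaugeMat_mul_covAdj hA hα hc (hJs μ)]
  simp only [hJ, mul_neg, Matrix.trace_neg, integral_neg, neg_neg]
  rw [integral_trace_gaugeMat_mul_currentKernel hA (hA.smoothMat_covAdj μ hα) (hc.covAdj A μ) hX]
  simp only [Finset.smul_sum]

omit [DecidableEq s] [Fintype s] [CompleteSpace Λ] in
lemma IsGrassmannPair.isTestFamily {ψ ψb : Spacetime → s × Fin N → Λ} (h : IsGrassmannPair ψ ψb) :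
    IsTestFamily (fieldKernel ψ ψb) where
  smooth a b := ((h.smooth a).comp contDiff_fst).mul ((h.smooth_bar b).comp contDiff_snd)
  compact := by
    refine ⟨tsupport ψ ∪ tsupport ψb, h.compact.isCompact.union h.compact_bar.isCompact,
      fun x y hxy => ?_⟩
    ext a b
    rcases hxy with hx | hy
    · have : ψ x = 0 := image_eq_zero_of_notMem_tsupport fun h => hx (Or.inl h)
      simp [fieldKernel, this]
    · have : ψb y = 0 := image_eq_zero_of_notMem_tsupport fun h => hy (Or.inr h)
      simp [fieldKernel, this]

/-- The transformation matrices have complex entries, so the transformed fields still anticommute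
and the formula for the action applies to them. -/
lemma fermionAction_gauged (hA : IsHermitianField A) (Q : DiracSymbol s) (hα : SmoothMat α)
    {ψ ψb : Spacetime → s × Fin N → Λ} (h : IsGrassmannPair ψ ψb) (t : ℝ) :
    fermionAction A Q (fun x => gaugeAct (NormedSpace.exp ((Complex.I * t) • α x)) (ψ x))
        (fun x => gaugeActRight (ψb x) (NormedSpace.exp ((-Complex.I * t) • α x))) =
      ∫ x, (momentKernel A Q (gaugedKernel α (fieldKernel ψ ψb) t) [] x 0).trace := by
  have he : ∀ c i j, ContDiff ℝ ∞ fun x => NormedSpace.exp ((c * (t : ℂ)) • α x) i j :=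
    fun c i j => (contDiff_exp_smul_entry hα c i j).comp (contDiff_const.prodMk contDiff_id)
  refine fermionAction_eq hA Q (h.isTestFamily.gaugedKernel hα t) (fun a => ?_) ?_ (fun a => ?_) ?_
  · exact ContDiff.sum fun j _ => (he (-Complex.I) j a.2).smul (h.smooth_bar (a.1, j))
  · refine h.compact_bar.mono fun x hx => ?_
    contrapose! hx
    rw [Function.notMem_support] at hx ⊢
    ext a
    simp [gaugeActRight, hx]
  · exact ContDiff.sum fun j _ => (he Complex.I a.2 j).smul (h.smooth (a.1, j))
  · intro x y p q
    rw [gaugedKernel, liftGauge_mul_mul_apply, gaugeAct, gaugeActRight, Finset.sum_mul_sum,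
      ← Finset.sum_neg_distrib]
    refine Finset.sum_congr rfl fun l _ => ?_
    rw [← Finset.sum_neg_distrib]
    refine Finset.sum_congr rfl fun k _ => ?_
    rw [smul_mul_smul_comm, ← smul_neg, ← h.anticomm_mixed, mul_comm]
    rfl

omit [CompleteSpace Λ] in
lemma momentKernel_eventuallyEq {ψ ψb φ φb : Spacetime → s × Fin N → Λ}
    (h : IsGrassmannPair ψ ψb) (h' : IsGrassmannPair φ φb) (hA : IsHermitianField A)
    (Q : DiracSymbol s) {x : Spacetime} (h1 : ψ =ᶠ[𝓝 x] φ) (h2 : ψb =ᶠ[𝓝 x] φb)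
    (l : List (Fin 4)) :
    (fun z => momentKernel A Q (fieldKernel ψ ψb) l z 0) =ᶠ[𝓝 x]
      fun z => momentKernel A Q (fieldKernel φ φb) l z 0 := by
  filter_upwards [h1.eventuallyEq_nhds, h2.eventuallyEq_nhds] with z hz1 hz2
  have e1 : Tendsto (fun y : Spacetime => z - (2⁻¹ : ℝ) • y) (𝓝 0) (𝓝 z) := by
    have : Continuous fun y : Spacetime => z - (2⁻¹ : ℝ) • y := by fun_prop
    simpa using this.tendsto 0
  have e2 : Tendsto (fun y : Spacetime => z + (2⁻¹ : ℝ) • y) (𝓝 0) (𝓝 z) := by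
    have : Continuous fun y : Spacetime => z + (2⁻¹ : ℝ) • y := by fun_prop
    simpa using this.tendsto 0
  have e3 : transportedKernel A (fieldKernel ψ ψb) z =ᶠ[𝓝 0]
      transportedKernel A (fieldKernel φ φb) z := by
    filter_upwards [e1.eventually hz1, e2.eventually hz2] with y hy1 hy2
    have : fieldKernel ψ ψb (z - (2⁻¹ : ℝ) • y) (z + (2⁻¹ : ℝ) • y) =
        fieldKernel φ φb (z - (2⁻¹ : ℝ) • y) (z + (2⁻¹ : ℝ) • y) := by
      ext a b
      simp only [fieldKernel, Matrix.of_apply, hy1, hy2]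
    simp only [transportedKernel, this]
  ext i j
  simp only [momentKernel_apply hA h.isTestFamily, momentKernel_apply hA h'.isTestFamily]
  refine Finset.sum_congr rfl fun τ _ => Finset.sum_congr rfl fun a _ =>
    Finset.sum_congr rfl fun b _ => ?_
  congr 1
  refine (dirDeriv_iterate_eventuallyEq ?_ _ _).eq_of_nhds
  filter_upwards [e3] with y hy
  rw [hy]

lemma hasDerivAt_fermionAction (hA : IsHermitianField A) (Q : DiracSymbol s) (hα : SmoothMat α)
    (hc : HasCompactSupport α) {ψ ψb : Spacetime → s × Fin N → Λ} (h : IsGrassmannPair ψ ψb)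
    {J : Fin 4 → Spacetime → Matrix (Fin N) (Fin N) Λ}
    (hJ : ∀ μ x, J μ x = -currentKernel A Q (fieldKernel ψ ψb) μ x 0) :
    HasDerivAt
      (fun t : ℝ => fermionAction A Q
        (fun x => gaugeAct (NormedSpace.exp ((Complex.I * t) • α x)) (ψ x))
        (fun x => gaugeActRight (ψb x) (NormedSpace.exp ((-Complex.I * t) • α x))))
      (∫ x, (gaugeMat Λ (α x) * ∑ μ, covAdj A μ (J μ) x).trace) 0 := by
  have h1 := hasDerivAt_integral_trace_momentKernel hA hα h.isTestFamily Q
  have h2 := integral_trace_divergence hA hα hc h.isTestFamily Q hJ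
  have h3 : (fun t : ℝ => fermionAction A Q
        (fun x => gaugeAct (NormedSpace.exp ((Complex.I * t) • α x)) (ψ x))
        (fun x => gaugeActRight (ψb x) (NormedSpace.exp ((-Complex.I * t) • α x)))) =
      fun t => ∫ x, (momentKernel A Q (gaugedKernel α (fieldKernel ψ ψb) t) [] x 0).trace :=
    funext fun t => fermionAction_gauged hA Q hα h t
  rw [h3]
  exact h1.congr_deriv h2.symm

/-- Only the values of `J` on Grassmann pairs enter, so one argument serves the full current and its
leading term. -/
theorem isNoetherCurrent_of_eq {𝒢 : Subgroup (Matrix.unitaryGroup (Fin N) ℂ)}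
    (hA : IsHermitianField A) (Q : DiracSymbol s)
    {J : (Spacetime → s × Fin N → Λ) → (Spacetime → s × Fin N → Λ) →
      Fin 4 → Spacetime → Matrix (Fin N) (Fin N) Λ}
    (hJ : ∀ ψ ψb, IsGrassmannPair ψ ψb → ∀ μ x,
      J ψ ψb μ x = -currentKernel A Q (fieldKernel ψ ψb) μ x 0) :
    IsNoetherCurrent 𝒢 A Q J where
  smooth ψ ψb h μ i j := by
    simp only [hJ ψ ψb h, Matrix.neg_apply]
    exact ((h.isTestFamily.currentKernel hA Q μ).contDiff_left 0 i j).neg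
  isLocal ψ ψb φ φb h h' x h1 h2 μ := by
    rw [hJ ψ ψb h, hJ φ φb h', currentKernel, currentKernel]
    refine congrArg Neg.neg (Finset.sum_congr rfl fun k _ => congrArg (gradCoeff k • ·)
      (Finset.sum_congr rfl fun l _ => ?_))
    exact (covAdjs_eventuallyEq (momentKernel_eventuallyEq h h' hA Q h1 h2 _) _).eq_of_nhds
  variation ψ ψb h α hα := hasDerivAt_fermionAction hA Q hα.1 hα.2.1 h (hJ ψ ψb h)

omit [CompleteSpace Λ] in
lemma DiracSymbol.HigherDerivsVanish.momentDensity_eq_zero {Q : DiracSymbol s}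
    (hQ : Q.HigherDerivsVanish) (A : GaugeField N)
    (X : Spacetime → Spacetime → Matrix (s × Fin N) (s × Fin N) Λ) {l : List (Fin 4)}
    (hl : 3 ≤ l.length) (x p : Spacetime) : momentDensity A Q X l x p = 0 := by
  ext i j
  simp [momentDensity_apply, hQ.pDerivs_eq_zero hl]

omit [CompleteSpace Λ] in
lemma gradCoeff_zero : gradCoeff 0 = 1 := by simp [gradCoeff]

-- Every term with k ≥ 1 carries 2k + 1 ≥ 3 momentum derivatives of Q.
omit [CompleteSpace Λ] in
lemma DiracSymbol.HigherDerivsVanish.vectorCurrent_eq {Q : DiracSymbol s}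
    (hQ : Q.HigherDerivsVanish) (A : GaugeField N) (χ : Spacetime → ℂ)
    (X : Spacetime → Spacetime → Matrix (s × Fin N) (s × Fin N) Λ) (μ : Fin 4) (x : Spacetime) :
    vectorCurrent A Q χ X μ x = leadingCurrent A Q χ X μ x := by
  rw [vectorCurrent, leadingCurrent]
  congr 2
  ext1 p
  rw [currentDensity, tsum_eq_single 0]
  · simp [gradCoeff_zero, covAdjs]
  · intro k hk
    rw [Finset.sum_eq_zero, smul_zero]
    intro l _
    simp only [hQ.momentDensity_eq_zero A X (l := List.ofFn l ++ [μ]) (by simp; omega)]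
    rw [covAdjs_zero]

end Noether

/-! ### The two-point function is the Green function. -/

section GreenFunction

variable {N : ℕ} {s : Type*} [Fintype s] {A : GaugeField N} {Q : DiracSymbol s}
  {E : FieldAlgebra (s × Fin N) →ₗ[ℂ] ℂ} {G : Kernel4 s N}

lemma pairing_comm {ι : Type*} [Fintype ι] (f g : testSpace ι) : pairing f g = pairing g f := by
  change ∫ x, ∑ a, f.1 x a * g.1 x a = ∫ x, ∑ a, g.1 x a * f.1 x a
  simp only [mul_comm]

lemma IsFermionExpectation.derivPsiBar_psiBar (hE : IsFermionExpectation A Q E)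
    (h g : testSpace (s × Fin N)) : E (derivPsiBar h (psiBar g)) = pairing h g := by
  have h1 : derivPsiBar h (psiBar g) = algebraMap ℂ _ (pairing h g) :=
    CliffordAlgebra.contractLeft_ι _ _ _
  rw [h1, Algebra.algebraMap_eq_smul_one, map_smul, hE.normalized, smul_eq_mul, mul_one]

lemma IsFermionExpectation.derivPsi_psi (hE : IsFermionExpectation A Q E)
    (f u : testSpace (s × Fin N)) : E (derivPsi f (psi u)) = pairing f u := by
  have h1 : derivPsi f (psi u) = algebraMap ℂ _ (pairing f u) :=
    CliffordAlgebra.contractLeft_ι _ _ _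
  rw [h1, Algebra.algebraMap_eq_smul_one, map_smul, hE.normalized, smul_eq_mul, mul_one]

/-- The two equations are the Schwinger-Dyson equations with F = ψ̄(g) and F = ψ(u). The derivative
of a generator is a scalar, so only the normalization of the functional is needed. In the second one
the sign from anticommuting the fields cancels the sign of the equation. -/
theorem IsTwoPointFunction.isGreenFunction (hE : IsFermionExpectation A Q E)
    (hG : IsTwoPointFunction E G) : IsGreenFunction A Q G := by
  constructor
  · intro h k g hk
    rw [← hG k g, hE.total_derivPsiBar h k hk, hE.derivPsiBar_psiBar]
  · intro u f k hk
    have hswap : psi u * psiBar k = -(psiBar k * psi u) :=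
      eq_neg_of_add_eq_zero_left (ExteriorAlgebra.ι_add_mul_swap _ _)
    rw [← hG u k, hswap, map_neg, hE.total_derivPsi f k hk, neg_neg, hE.derivPsi_psi, pairing_comm]

end GreenFunction

/-! ### Midpoint and relative coordinates. -/

section MidpointCoordinates

/-- Midpoint and relative coordinates: `(x, y) ↦ (x - y/2, x + y/2)`. -/
noncomputable def midpointEquiv : (Spacetime × Spacetime) ≃L[ℝ] (Spacetime × Spacetime) :=
  LinearEquiv.toContinuousLinearEquiv
    { toFun := fun z => (z.1 - (2⁻¹ : ℝ) • z.2, z.1 + (2⁻¹ : ℝ) • z.2)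
      invFun := fun w => ((2⁻¹ : ℝ) • (w.1 + w.2), w.2 - w.1)
      map_add' := fun z w => by ext1 <;> simp only [Prod.fst_add, Prod.snd_add] <;> module
      map_smul' := fun c z => by
        ext1 <;> simp only [Prod.smul_fst, Prod.smul_snd, RingHom.id_apply] <;> module
      left_inv := fun z => by ext1 <;> simp only <;> module
      right_inv := fun z => by ext1 <;> simp only <;> module }

lemma midpointEquiv_apply (z : Spacetime × Spacetime) :
    midpointEquiv z = (z.1 - (2⁻¹ : ℝ) • z.2, z.1 + (2⁻¹ : ℝ) • z.2) := rfl

/-- The map is a swap followed by two shears, each of which preserves the measure. -/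
lemma measurePreserving_midpointEquiv : MeasurePreserving midpointEquiv := by
  have h1 : MeasurePreserving (fun z : Spacetime × Spacetime => (z.1, z.2 - (2⁻¹ : ℝ) • z.1))
      (volume.prod volume) (volume.prod volume) :=
    (MeasurePreserving.id volume).skew_product (g := fun y x => x - (2⁻¹ : ℝ) • y)
      (by fun_prop) (Eventually.of_forall fun y => (measurePreserving_sub_right volume _).map_eq)
  have h2 := (measurePreserving_prod_add_swap (volume : Measure Spacetime) volume).comp
    (h1.comp Measure.measurePreserving_swap)
  have h3 : (midpointEquiv : Spacetime × Spacetime → Spacetime × Spacetime) =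
      (fun z : Spacetime × Spacetime => (z.2, z.2 + z.1)) ∘
      (fun z : Spacetime × Spacetime => (z.1, z.2 - (2⁻¹ : ℝ) • z.1)) ∘ Prod.swap := by
    ext1 z
    simp only [midpointEquiv_apply, Function.comp_apply, Prod.swap]
    congr 1
    module
  rw [h3]
  exact h2

lemma measurableEmbedding_midpointEquiv : MeasurableEmbedding midpointEquiv :=
  midpointEquiv.toHomeomorph.measurableEmbedding

end MidpointCoordinates

/-! ### Point-split momentum integrals in position space. -/

section Representation

variable {N : ℕ} {s : Type*} [Fintype s] [DecidableEq s] {A : GaugeField N}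
  {X : Kernel4 s N} {H : Spacetime → Matrix (Fin N) (Fin N) ℂ} {η : Spacetime → ℂ} {δ : ℝ}

/-- The weight of a term of the symbol in the point-split momentum integral. -/
noncomputable def splitWeight (η : Spacetime → ℂ) (δ : ℝ) {Q : DiracSymbol s} (τ : Q.RidgeIndex)
    (l : List (Fin 4)) (y : Spacetime) : ℂ :=
  τ.factor l * (iDeriv τ.dir)^[τ.deg - l.length] (rescaledProfile η δ) (-y)

lemma IsProfile.contDiff_splitWeight (hη : IsProfile η) {Q : DiracSymbol s} (τ : Q.RidgeIndex)
    (l : List (Fin 4)) : ContDiff ℝ ∞ (splitWeight η δ τ l) :=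
  contDiff_const.mul (((hη.contDiff_rescaledProfile δ).iterate_iDeriv _ _).comp contDiff_neg)

lemma IsProfile.hasCompactSupport_splitWeight (hη : IsProfile η) (hδ : 0 < δ) {Q : DiracSymbol s}
    (τ : Q.RidgeIndex) (l : List (Fin 4)) : HasCompactSupport (splitWeight η δ τ l) :=
  (((hη.hasCompactSupport_rescaledProfile hδ).iterate_iDeriv τ.dir (τ.deg - l.length)).comp_homeomorph
    (Homeomorph.neg Spacetime)).mul_left

/-- The point-split momentum integral in position space. The momentum derivatives of the symbol may
be taken at another point `x'`. -/
lemma momentumIntegral_cutoff_apply (hη : IsProfile η) (hδ : 0 < δ) (Q Q' : DiracSymbol s)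
    (l : List (Fin 4)) {x x' : Spacetime} (hQ : ∀ p, Q'.pDerivs l x p = Q.pDerivs l x' p)
    (hΦ : ∀ a b, Integrable fun y => transportedKernel A X x y a b) (i j : Fin N) :
    momentumIntegral (cutoff η δ) (momentDensity A Q' X l x) i j =
      ∑ τ : Q.RidgeIndex, ∑ a, ∑ b, τ.coeff x' b a *
        ∫ y, splitWeight η δ τ l y * transportedKernel A X x y (a, i) (b, j) := by
  have hg := hη.contDiff_rescaledProfile δ
  have hc := hη.hasCompactSupport_rescaledProfile hδ
  have h1 : ∀ p, cutoff η δ p • momentDensity A Q' X l x p i j = ∑ τ : Q.RidgeIndex, ∑ a, ∑ b,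
      (τ.coeff x' b a * τ.factor l) *
        (fourierPlus ((iDeriv τ.dir)^[τ.deg - l.length] (rescaledProfile η δ)) p •
          fourierPlus (fun y => transportedKernel A X x y (a, i) (b, j)) p) := by
    intro p
    rw [momentDensity_apply, Finset.smul_sum, Finset.sum_comm (s := (Finset.univ : Finset Q.RidgeIndex))]
    refine Finset.sum_congr rfl fun a _ => ?_
    rw [Finset.smul_sum, Finset.sum_comm (s := (Finset.univ : Finset Q.RidgeIndex))]
    refine Finset.sum_congr rfl fun b _ => ?_
    rw [hQ, Q.pDerivs_eq_sum_ridge, Matrix.sum_apply, Finset.sum_smul, Finset.smul_sum]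
    refine Finset.sum_congr rfl fun τ _ => ?_
    rw [fourierPlus_iterate_iDeriv hg hc, wigner_apply, cutoff_eq_fourierPlus η hδ]
    simp only [Matrix.smul_apply, smul_eq_mul]
    ring
  have hi : ∀ (τ : Q.RidgeIndex) a b, Integrable fun p => (τ.coeff x' b a * τ.factor l) *
        (fourierPlus ((iDeriv τ.dir)^[τ.deg - l.length] (rescaledProfile η δ)) p •
          fourierPlus (fun y => transportedKernel A X x y (a, i) (b, j)) p) := fun τ a b =>
    (integrable_fourierPlus_smul (hg.iterate_iDeriv _ _) (hc.iterate_iDeriv _ _)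
      (hΦ (a, i) (b, j))).const_mul _
  rw [momentumIntegral_apply]
  simp only [h1]
  rw [integral_finsetSum _ fun τ _ => integrable_finsetSum _ fun a _ => integrable_finsetSum _
    fun b _ => hi τ a b, Finset.smul_sum]
  refine Finset.sum_congr rfl fun τ _ => ?_
  rw [integral_finsetSum _ fun a _ => integrable_finsetSum _ fun b _ => hi τ a b, Finset.smul_sum]
  refine Finset.sum_congr rfl fun a _ => ?_
  rw [integral_finsetSum _ fun b _ => hi τ a b, Finset.smul_sum]
  refine Finset.sum_congr rfl fun b _ => ?_
  rw [integral_const_mul, integral_fourierPlus_smul (hg.iterate_iDeriv _ _) (hc.iterate_iDeriv _ _)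
    (hΦ (a, i) (b, j)), mul_smul_comm, inv_smul_smul₀ (by positivity), mul_assoc,
    ← integral_const_mul]
  simp only [splitWeight, smul_eq_mul, mul_assoc]

/-- The kernel, in midpoint and relative coordinates, that represents the pairing of `H` with a
point-split momentum integral. -/
noncomputable def splitKernel (A : GaugeField N) (Q : DiracSymbol s) (η : Spacetime → ℂ) (δ : ℝ)
    (l : List (Fin 4)) (H : Spacetime → Matrix (Fin N) (Fin N) ℂ) (x y : Spacetime) :
    Matrix (s × Fin N) (s × Fin N) ℂ :=
  liftGauge ℂ (wilsonLine A (x + (2⁻¹ : ℝ) • y) x) *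
    (∑ τ : Q.RidgeIndex, splitWeight η δ τ l y • (τ.coeff x ⊗ₖ H x)) *
    liftGauge ℂ (wilsonLine A x (x - (2⁻¹ : ℝ) • y))

lemma isTestFamily_splitKernel (hA : IsHermitianField A) (Q : DiracSymbol s) (hη : IsProfile η)
    (hδ : 0 < δ) (l : List (Fin 4)) (hH : IsMatTest H) :
    IsTestFamily (splitKernel A Q η δ l H) := by
  have h0 : IsTestFamily fun x y => ∑ τ : Q.RidgeIndex, splitWeight η δ τ l y • (τ.coeff x ⊗ₖ H x) := by
    refine IsTestFamily.sum fun τ => ⟨fun a b => ?_, ?_⟩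
    · exact ((hη.contDiff_splitWeight τ l).comp contDiff_snd).smul
        (((τ.contDiff_coeff a.1 b.1).mul (hH.1 a.2 b.2)).comp contDiff_fst)
    · refine ⟨tsupport H ∪ tsupport (splitWeight η δ τ l), hH.2.isCompact.union
        (hη.hasCompactSupport_splitWeight hδ τ l).isCompact, fun x y hxy => ?_⟩
      rcases hxy with hx | hy
      · rw [image_eq_zero_of_notMem_tsupport fun h => hx (Or.inl h), Matrix.kroneckerMap_zero_right _
          (fun a => mul_zero a), smul_zero]
      · rw [image_eq_zero_of_notMem_tsupport fun h => hy (Or.inr h), zero_smul]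
  constructor
  · intro a b
    have h1 : ContDiff ℝ ∞ fun z : Spacetime × Spacetime => z.1 - (2⁻¹ : ℝ) • z.2 :=
      contDiff_fst.sub (contDiff_snd.const_smul _)
    have h2 : ContDiff ℝ ∞ fun z : Spacetime × Spacetime => z.1 + (2⁻¹ : ℝ) • z.2 :=
      contDiff_fst.add (contDiff_snd.const_smul _)
    simp only [splitKernel, liftGauge_mul_mul_apply]
    change ContDiff ℝ ∞ fun z : Spacetime × Spacetime => ∑ i, ∑ k,
      (wilsonLine A (z.1 + (2⁻¹ : ℝ) • z.2) z.1 a.2 k *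
        wilsonLine A z.1 (z.1 - (2⁻¹ : ℝ) • z.2) i b.2) •
        (∑ τ : Q.RidgeIndex, splitWeight η δ τ l z.2 • (τ.coeff z.1 ⊗ₖ H z.1)) (a.1, k) (b.1, i)
    refine ContDiff.sum fun i _ => ContDiff.sum fun k _ => ?_
    have h3 : ContDiff ℝ ∞ fun z : Spacetime × Spacetime => z.1 := contDiff_fst
    have h4 := (hA.contDiff_wilsonLine a.2 k).comp (h2.prodMk h3)
    have h5 := (hA.contDiff_wilsonLine i b.2).comp (h3.prodMk h1)
    exact (h4.mul h5).smul (h0.smooth (a.1, k) (b.1, i))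
  · obtain ⟨K, hK, h⟩ := h0.compact
    exact ⟨K, hK, fun x y hxy => by rw [splitKernel, h x y hxy, mul_zero, zero_mul]⟩

end Representation

/-! ### Functionals of kernels given by test functions on pairs of points. -/

section Representation

variable {N : ℕ} {s : Type*} [Fintype s] [DecidableEq s] {A : GaugeField N}
  {X : Kernel4 s N} {H : Spacetime → Matrix (Fin N) (Fin N) ℂ} {η : Spacetime → ℂ} {δ : ℝ}

lemma integrable_transportedKernel (hA : IsHermitianField A) {x : Spacetime}
    (hX : ∀ a b, Integrable fun y => X (x - (2⁻¹ : ℝ) • y) (x + (2⁻¹ : ℝ) • y) a b)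
    (a b : s × Fin N) : Integrable fun y => transportedKernel A X x y a b := by
  simp only [transportedKernel, liftGauge_mul_mul_apply]
  refine integrable_finsetSum _ fun l _ => integrable_finsetSum _ fun k _ => ?_
  have h1 : Continuous fun y : Spacetime => wilsonLine A x (x - (2⁻¹ : ℝ) • y) a.2 k *
      wilsonLine A (x + (2⁻¹ : ℝ) • y) x l b.2 :=
    ((hA.contDiff_wilsonLine a.2 k).continuous.comp (f := fun y => (x, x - (2⁻¹ : ℝ) • y))
      (by fun_prop)).mul ((hA.contDiff_wilsonLine l b.2).continuous.comp
        (f := fun y => (x + (2⁻¹ : ℝ) • y, x)) (by fun_prop))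
  refine (hX (a.1, k) (b.1, l)).bdd_mul (c := 1 * 1) h1.aestronglyMeasurable
    (Eventually.of_forall fun y => ?_)
  rw [norm_mul]
  exact mul_le_mul (hA.norm_wilsonLine_le _ _ _ _) (hA.norm_wilsonLine_le _ _ _ _)
    (norm_nonneg _) zero_le_one

lemma ae_integrable_slice {f : Spacetime × Spacetime → ℂ} {C : Set Spacetime} (hC : IsCompact C)
    (hf : IntegrableOn f (C ×ˢ Set.univ)) : ∀ᵐ x, x ∈ C → Integrable fun y => f (x, y) := by
  have h1 : Integrable f ((volume.restrict C).prod volume) := by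
    have := Measure.prod_restrict (μ := (volume : Measure Spacetime))
      (ν := (volume : Measure Spacetime)) C Set.univ
    rw [Measure.restrict_univ] at this
    rw [this]
    exact hf
  exact (ae_restrict_iff' hC.measurableSet).1 h1.prod_right_ae

lemma WignerIntegrable.ae_integrable (hX : WignerIntegrable X) {C : Set Spacetime}
    (hC : IsCompact C) : ∀ᵐ x, x ∈ C →
      ∀ a b, Integrable fun y => X (x - (2⁻¹ : ℝ) • y) (x + (2⁻¹ : ℝ) • y) a b := by
  have h := fun a b => ae_integrable_slice hC (hX C hC a b)
  filter_upwards [ae_all_iff.2 fun a => ae_all_iff.2 fun b => h a b] with x hx hxC a b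
  exact hx a b hxC

/-- The weight is bounded and confines the midpoint to a compact set, over which the kernel is
integrable in all relative coordinates. -/
lemma WignerIntegrable.integrable_mul (hX : WignerIntegrable X)
    {g : Spacetime × Spacetime → ℂ} (hg : Continuous g) (hc : HasCompactSupport g)
    (a b : s × Fin N) : Integrable fun z : Spacetime × Spacetime =>
      g z * X (z.1 - (2⁻¹ : ℝ) • z.2) (z.1 + (2⁻¹ : ℝ) • z.2) a b := by
  obtain ⟨B, hB⟩ := hg.bounded_above_of_compact_support hc
  have h1 := hX _ (hc.isCompact.image continuous_fst) a b
  refine IntegrableOn.integrable_of_forall_notMem_eq_zero (s := (Prod.fst '' tsupport g) ×ˢ Set.univ)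
    (Integrable.bdd_mul (c := B) h1 hg.aestronglyMeasurable (Eventually.of_forall hB)) fun z hz => ?_
  have : z ∉ tsupport g := fun h => hz ⟨⟨z, h, rfl⟩, trivial⟩
  rw [image_eq_zero_of_notMem_tsupport this, zero_mul]

/-- The functional `B` of kernels is given by the test function `K`. -/
structure IsRepresentedBy (B : Kernel4 s N → ℂ)
    (K : Spacetime × Spacetime → Matrix (s × Fin N) (s × Fin N) ℂ) : Prop where
  smooth : ∀ a b, ContDiff ℝ ∞ fun z => K z a b
  compact : HasCompactSupport K
  eq_integral : ∀ X, WignerIntegrable X → B X = ∫ z, (K z * X z.1 z.2).trace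

lemma IsRepresentedBy.integrable {B : Kernel4 s N → ℂ}
    {K : Spacetime × Spacetime → Matrix (s × Fin N) (s × Fin N) ℂ} (h : IsRepresentedBy B K)
    (hX : WignerIntegrable X) : Integrable fun z : Spacetime × Spacetime =>
      (K z * X z.1 z.2).trace := by
  rw [← measurePreserving_midpointEquiv.integrable_comp_emb measurableEmbedding_midpointEquiv]
  simp only [Function.comp_def, Matrix.trace, Matrix.diag, Matrix.mul_apply]
  refine integrable_finsetSum _ fun b _ => integrable_finsetSum _ fun a _ => ?_
  refine hX.integrable_mul (g := fun z => K (midpointEquiv z) b a)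
    ((h.smooth b a).continuous.comp midpointEquiv.continuous) ?_ a b
  exact (h.compact.comp_left (g := fun M : Matrix (s × Fin N) (s × Fin N) ℂ => M b a)
    rfl).comp_homeomorph midpointEquiv.toHomeomorph

lemma IsRepresentedBy.const_mul {B : Kernel4 s N → ℂ}
    {K : Spacetime × Spacetime → Matrix (s × Fin N) (s × Fin N) ℂ} (h : IsRepresentedBy B K)
    (c : ℂ) : IsRepresentedBy (fun X => c * B X) (fun z => c • K z) where
  smooth a b := (h.smooth a b).const_smul c
  compact := h.compact.smul_left (f := fun _ => c)
  eq_integral X hX := by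
    simp only [h.eq_integral X hX, smul_mul_assoc, Matrix.trace_smul, smul_eq_mul,
      integral_const_mul]

lemma IsRepresentedBy.sum {κ : Type*} {S : Finset κ} {B : κ → Kernel4 s N → ℂ}
    {K : κ → Spacetime × Spacetime → Matrix (s × Fin N) (s × Fin N) ℂ}
    (h : ∀ k, IsRepresentedBy (B k) (K k)) :
    IsRepresentedBy (fun X => ∑ k ∈ S, B k X) (fun z => ∑ k ∈ S, K k z) where
  smooth a b := by
    simp only [Matrix.sum_apply]
    exact ContDiff.sum fun k _ => (h k).smooth a b
  compact := by
    classical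
    induction S using Finset.induction_on with
    | empty => exact HasCompactSupport.zero
    | insert k S hk ih => simp only [Finset.sum_insert hk]; exact (h k).compact.add ih
  eq_integral X hX := by
    simp only [(h _).eq_integral X hX, Finset.sum_mul, Matrix.trace_sum]
    rw [integral_finsetSum _ fun k _ => (h k).integrable hX]

/-- The test function of a point-split momentum integral, on pairs of points. -/
noncomputable def splitTest (A : GaugeField N) (Q : DiracSymbol s) (η : Spacetime → ℂ) (δ : ℝ)
    (l : List (Fin 4)) (H : Spacetime → Matrix (Fin N) (Fin N) ℂ) (w : Spacetime × Spacetime) :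
    Matrix (s × Fin N) (s × Fin N) ℂ :=
  splitKernel A Q η δ l H (midpointEquiv.symm w).1 (midpointEquiv.symm w).2

/-- By cyclicity the Wilson lines of the test function pass to the kernel and transport it to the
midpoint. -/
lemma trace_splitKernel_mul (Q : DiracSymbol s) (l : List (Fin 4)) (x y : Spacetime) :
    (splitKernel A Q η δ l H x y * X (x - (2⁻¹ : ℝ) • y) (x + (2⁻¹ : ℝ) • y)).trace =
      ∑ τ : Q.RidgeIndex, ∑ j, ∑ i, ∑ b, ∑ a, (τ.coeff x b a * H x j i) *
        (splitWeight η δ τ l y * transportedKernel A X x y (a, i) (b, j)) := by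
  have h1 : (splitKernel A Q η δ l H x y * X (x - (2⁻¹ : ℝ) • y) (x + (2⁻¹ : ℝ) • y)).trace =
      ((∑ τ : Q.RidgeIndex, splitWeight η δ τ l y • (τ.coeff x ⊗ₖ H x)) *
        transportedKernel A X x y).trace := by
    rw [splitKernel, transportedKernel, mul_assoc, mul_assoc, Matrix.trace_mul_comm, mul_assoc]
  rw [h1]
  simp only [Finset.sum_mul, Matrix.trace_sum]
  refine Finset.sum_congr rfl fun τ _ => ?_
  simp only [Matrix.trace, Matrix.diag, Matrix.mul_apply, Matrix.smul_apply, smul_eq_mul,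
    Matrix.kroneckerMap_apply, Fintype.sum_prod_type]
  rw [Finset.sum_comm]
  refine Finset.sum_congr rfl fun j _ => ?_
  refine Eq.trans (Finset.sum_congr rfl fun b _ => Finset.sum_comm) (Finset.sum_comm.trans ?_)
  refine Finset.sum_congr rfl fun i _ => Finset.sum_congr rfl fun b _ =>
    Finset.sum_congr rfl fun a _ => ?_
  ring

lemma integral_trace_splitKernel_mul (hA : IsHermitianField A) (hη : IsProfile η) (hδ : 0 < δ)
    (Q : DiracSymbol s) (l : List (Fin 4)) {x : Spacetime}
    (hX : ∀ a b, Integrable fun y => X (x - (2⁻¹ : ℝ) • y) (x + (2⁻¹ : ℝ) • y) a b) :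
    ∫ y, (splitKernel A Q η δ l H x y * X (x - (2⁻¹ : ℝ) • y) (x + (2⁻¹ : ℝ) • y)).trace =
      (H x * momentumIntegral (cutoff η δ) (momentDensity A Q X l x)).trace := by
  have hΦ := integrable_transportedKernel hA hX
  have hw : ∀ (τ : Q.RidgeIndex) a b, Integrable fun y =>
      splitWeight η δ τ l y * transportedKernel A X x y a b := fun τ a b => by
    obtain ⟨B, hB⟩ := (hη.contDiff_splitWeight (δ := δ) τ l).continuous.bounded_above_of_compact_support
      (hη.hasCompactSupport_splitWeight hδ τ l)
    exact (hΦ a b).bdd_mul (hη.contDiff_splitWeight τ l).continuous.aestronglyMeasurable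
      (Eventually.of_forall hB)
  have hw' := fun (τ : Q.RidgeIndex) (j i : Fin N) (b a : s) =>
    (hw τ (a, i) (b, j)).const_mul (τ.coeff x b a * H x j i)
  simp only [trace_splitKernel_mul]
  rw [integral_finsetSum _ fun τ _ => integrable_finsetSum _ fun j _ => integrable_finsetSum _
    fun i _ => integrable_finsetSum _ fun b _ => integrable_finsetSum _ fun a _ => hw' τ j i b a]
  simp only [Matrix.trace, Matrix.diag, Matrix.mul_apply,
    momentumIntegral_cutoff_apply hη hδ Q Q l (fun _ => rfl) hΦ]
  simp only [Finset.mul_sum]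
  have h2 : ∀ τ : Q.RidgeIndex, ∫ y, ∑ j, ∑ i, ∑ b, ∑ a, (τ.coeff x b a * H x j i) *
        (splitWeight η δ τ l y * transportedKernel A X x y (a, i) (b, j)) =
      ∑ j, ∑ i, ∑ b, ∑ a, (τ.coeff x b a * H x j i) *
        ∫ y, (splitWeight η δ τ l y * transportedKernel A X x y (a, i) (b, j)) := by
    intro τ
    rw [integral_finsetSum _ fun j _ => integrable_finsetSum _
      fun i _ => integrable_finsetSum _ fun b _ => integrable_finsetSum _ fun a _ => hw' τ j i b a]
    refine Finset.sum_congr rfl fun j _ => ?_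
    rw [integral_finsetSum _ fun i _ => integrable_finsetSum _ fun b _ => integrable_finsetSum _
      fun a _ => hw' τ j i b a]
    refine Finset.sum_congr rfl fun i _ => ?_
    rw [integral_finsetSum _ fun b _ => integrable_finsetSum _ fun a _ => hw' τ j i b a]
    refine Finset.sum_congr rfl fun b _ => ?_
    rw [integral_finsetSum _ fun a _ => hw' τ j i b a]
    simp only [integral_const_mul]
  rw [Finset.sum_congr rfl fun τ _ => h2 τ, Finset.sum_comm]
  refine Finset.sum_congr rfl fun j _ => ?_
  rw [Finset.sum_comm]
  refine Finset.sum_congr rfl fun i _ => Finset.sum_congr rfl fun τ _ => ?_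
  rw [Finset.sum_comm]
  refine Finset.sum_congr rfl fun a _ => Finset.sum_congr rfl fun b _ => ?_
  ring

/-- One test function represents the functional on smooth kernels and on two-point functions alike;
this is what transfers identities between fields to expectation values. -/
theorem isRepresentedBy_momentumIntegral (hA : IsHermitianField A) (Q : DiracSymbol s)
    (hη : IsProfile η) (hδ : 0 < δ) (l : List (Fin 4)) (hH : IsMatTest H) :
    IsRepresentedBy (fun X : Kernel4 s N =>
      ∫ x, (H x * momentumIntegral (cutoff η δ) (momentDensity A Q X l x)).trace)
      (splitTest A Q η δ l H) := by
  have hK := isTestFamily_splitKernel (s := s) hA Q hη hδ l hH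
  have hc : HasCompactSupport fun z : Spacetime × Spacetime => splitKernel A Q η δ l H z.1 z.2 := by
    obtain ⟨K, hKc, h0⟩ := hK.compact
    refine HasCompactSupport.intro (hKc.prod hKc) fun z hz => h0 z.1 z.2 ?_
    by_contra h
    push Not at h
    exact hz h
  have hsplit : ∀ z, splitTest A Q η δ l H (midpointEquiv z) =
      splitKernel (s := s) A Q η δ l H z.1 z.2 :=
    fun z => by rw [splitTest, ContinuousLinearEquiv.symm_apply_apply]
  constructor
  · exact fun a b => (hK.smooth a b).comp midpointEquiv.symm.contDiff
  · exact hc.comp_homeomorph midpointEquiv.symm.toHomeomorph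
  intro X hX
  have hint : Integrable fun z : Spacetime × Spacetime => (splitKernel A Q η δ l H z.1 z.2 *
      X (z.1 - (2⁻¹ : ℝ) • z.2) (z.1 + (2⁻¹ : ℝ) • z.2)).trace := by
    simp only [Matrix.trace, Matrix.diag, Matrix.mul_apply]
    refine integrable_finsetSum _ fun b _ => integrable_finsetSum _ fun a _ => ?_
    exact hX.integrable_mul (g := fun z => splitKernel A Q η δ l H z.1 z.2 b a)
      (hK.smooth b a).continuous
        (hc.comp_left (g := fun M : Matrix (s × Fin N) (s × Fin N) ℂ => M b a) rfl) a b
  have h1 : ∫ w, (splitTest A Q η δ l H w * X w.1 w.2).trace = ∫ z : Spacetime × Spacetime,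
      (splitKernel A Q η δ l H z.1 z.2 *
        X (z.1 - (2⁻¹ : ℝ) • z.2) (z.1 + (2⁻¹ : ℝ) • z.2)).trace := by
    rw [← measurePreserving_midpointEquiv.integral_comp measurableEmbedding_midpointEquiv]
    refine integral_congr_ae (Eventually.of_forall fun z => ?_)
    beta_reduce
    rw [hsplit]
    rfl
  rw [h1]
  refine Eq.trans ?_ (integral_prod _ hint).symm
  refine integral_congr_ae ?_
  -- Integrability in y holds for almost every x in the support of `H`, which suffices after Fubini;
  -- elsewhere both sides vanish.
  filter_upwards [hX.ae_integrable hH.2.isCompact] with x hx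
  by_cases hxH : x ∈ tsupport H
  · exact (integral_trace_splitKernel_mul hA hη hδ Q l (hx hxH)).symm
  · have h0 : H x = 0 := image_eq_zero_of_notMem_tsupport hxH
    have h4 : ∀ y, splitKernel (s := s) A Q η δ l H x y = 0 := fun y => by
      simp only [splitKernel, h0, Matrix.kroneckerMap_zero_right _ (fun a => mul_zero a), smul_zero,
        Finset.sum_const_zero, mul_zero, zero_mul]
    simp only [h0, h4, zero_mul, Matrix.trace_zero, integral_zero]

end Representation

/-! ### Expectation values of the current. -/

section Expectation

variable {N : ℕ} {s : Type*} [Fintype s] [DecidableEq s] {A : GaugeField N}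
  {X : Kernel4 s N} {h : Spacetime → Matrix (Fin N) (Fin N) ℂ} {η : Spacetime → ℂ} {δ : ℝ}

lemma gradientTerm_zero (A : GaugeField N) (Q : DiracSymbol s) (χ : Spacetime → ℂ)
    (h : Spacetime → Matrix (Fin N) (Fin N) ℂ) (μ : Fin 4) (G : Kernel4 s N) :
    gradientTerm A Q χ h μ G 0 = leadingValue A Q χ h μ G := by
  have h0 : ∀ f : (Fin (2 * 0) → Fin 4) → ℂ, ∑ l, f l = f Fin.elim0 := fun f =>
    Fintype.sum_eq_single _ fun l hl => absurd (funext fun i : Fin 0 => i.elim0) hl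
  rw [gradientTerm, leadingValue, gradCoeff_zero, one_mul, h0, ← integral_neg]
  simp only [leadingCurrent, mul_neg, Matrix.trace_neg]
  rfl

lemma gradientTerm_eq_zero_of_momentDensity {A : GaugeField N} {Q : DiracSymbol s} {μ : Fin 4}
    {G : Kernel4 s N} {k : ℕ} (h0 : ∀ (l : Fin (2 * k) → Fin 4) x p,
      momentDensity A Q G (List.ofFn l ++ [μ]) x p = 0) (χ : Spacetime → ℂ)
    (h : Spacetime → Matrix (Fin N) (Fin N) ℂ) : gradientTerm A Q χ h μ G k = 0 := by
  have h1 : ∀ (l : Fin (2 * k) → Fin 4) x,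
      momentumIntegral χ (momentDensity A Q G (List.ofFn l ++ [μ]) x) = 0 := fun l x => by
    ext i j
    rw [momentumIntegral_apply]
    simp [h0]
  simp [gradientTerm, h1]

lemma gradientTerm_eq_zero (A : GaugeField N) {Q : DiracSymbol s} {k : ℕ} (hk : Q.order < 2 * k + 1)
    (χ : Spacetime → ℂ) (h : Spacetime → Matrix (Fin N) (Fin N) ℂ) (μ : Fin 4) (G : Kernel4 s N) :
    gradientTerm A Q χ h μ G k = 0 := by
  refine gradientTerm_eq_zero_of_momentDensity (fun l x p => ?_) χ h
  ext i j
  simp [momentDensity_apply, Q.pDerivs_eq_zero_of_order_lt (l := List.ofFn l ++ [μ]) (by simpa using hk)]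

lemma DiracSymbol.HigherDerivsVanish.gradientTerm_succ {Q : DiracSymbol s}
    (hQ : Q.HigherDerivsVanish) (A : GaugeField N) (χ : Spacetime → ℂ)
    (h : Spacetime → Matrix (Fin N) (Fin N) ℂ) (μ : Fin 4) (G : Kernel4 s N) (k : ℕ) :
    gradientTerm A Q χ h μ G (k + 1) = 0 :=
  gradientTerm_eq_zero_of_momentDensity
    (fun l x p => hQ.momentDensity_eq_zero A G (by simp) x p) χ h

lemma sum_gradientTerm (A : GaugeField N) (Q : DiracSymbol s) (χ : Spacetime → ℂ)
    (h : Spacetime → Matrix (Fin N) (Fin N) ℂ) (μ : Fin 4) (G : Kernel4 s N) :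
    ∑ k ∈ Finset.range (Q.order + 1), gradientTerm A Q χ h μ G k =
      leadingValue A Q χ h μ G + ∑ k ∈ Finset.range Q.order, gradientTerm A Q χ h μ G (k + 1) := by
  rw [Finset.sum_range_succ', gradientTerm_zero, add_comm]

lemma leadingValue_add_tsum (A : GaugeField N) (Q : DiracSymbol s) (χ : Spacetime → ℂ)
    (h : Spacetime → Matrix (Fin N) (Fin N) ℂ) (μ : Fin 4) (G : Kernel4 s N) :
    leadingValue A Q χ h μ G + ∑' k, gradientTerm A Q χ h μ G (k + 1) =
      ∑ k ∈ Finset.range (Q.order + 1), gradientTerm A Q χ h μ G k := by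
  rw [sum_gradientTerm, tsum_eq_sum (s := Finset.range Q.order)]
  intro k hk
  exact gradientTerm_eq_zero A (by have : Q.order ≤ k := by simpa using hk
                                   omega) χ h μ G

lemma momentDensity_perm (A : GaugeField N) (Q : DiracSymbol s) (X : Kernel4 s N)
    {l l' : List (Fin 4)} (hl : l.Perm l') : momentDensity A Q X l = momentDensity A Q X l' := by
  ext x p i j
  simp only [momentDensity_apply, Q.pDerivs_perm hl]

lemma smearedCurrent_eq_sum (hA : IsHermitianField A) (Q : DiracSymbol s) (hη : IsProfile η)
    (hδ : 0 < δ) (hh : IsMatTest h) (μ : Fin 4) (hX : IsTestFamily X) :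
    smearedCurrent A Q (cutoff η δ) h μ X =
      ∑ k ∈ Finset.range (Q.order + 1), gradientTerm A Q (cutoff η δ) h μ X k := by
  have hs := fun l => smoothMat_momentumIntegral_cutoff hA hX Q l hη hδ
  have hi : ∀ k (l : Fin (2 * k) → Fin 4), Integrable fun x => (h x * covAdjs A (List.ofFn l)
      (fun z => momentumIntegral (cutoff η δ) (momentDensity A Q X (List.ofFn l ++ [μ]) z)) x).trace :=
    fun k l => by
      simpa only [gaugeMat_complex] using integrable_trace_gaugeMat_mul (Λ := ℂ) hh.1 hh.2
        (hA.smoothMat_covAdjs (List.ofFn l) (hs (List.ofFn l ++ [μ])))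
  rw [smearedCurrent]
  simp only [vectorCurrent_cutoff hA hX Q μ hη hδ, mul_neg, Matrix.trace_neg, Finset.mul_sum,
    mul_smul_comm, Matrix.trace_sum, Matrix.trace_smul]
  rw [integral_neg, integral_finsetSum _ fun k _ =>
    (integrable_finsetSum _ fun l _ => hi k l).fun_smul (gradCoeff k), ← Finset.sum_neg_distrib]
  refine Finset.sum_congr rfl fun k _ => ?_
  rw [integral_smul, integral_finsetSum _ fun l _ => hi k l, gradientTerm]
  have := integral_trace_covAdjs_reverse (Λ := ℂ) hA hh.1 hh.2
    (fun l z => momentumIntegral (cutoff η δ) (momentDensity A Q X l z)) hs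
    (fun l l' hl => by simp only [momentDensity_perm A Q X hl]) k μ
  simp only [gaugeMat_complex] at this
  rw [this, smul_eq_mul]

lemma isTestFamily_vecMulVec (f g : testSpace (s × Fin N)) :
    IsTestFamily fun x y => Matrix.vecMulVec (f.1 x) (g.1 y) where
  smooth a b := ((f.2.1 a).comp contDiff_fst).mul ((g.2.1 b).comp contDiff_snd)
  compact := by
    refine ⟨tsupport f.1 ∪ tsupport g.1, f.2.2.isCompact.union g.2.2.isCompact, fun x y hxy => ?_⟩
    rcases hxy with hx | hy
    · rw [image_eq_zero_of_notMem_tsupport fun h => hx (Or.inl h), Matrix.zero_vecMulVec]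
    · rw [image_eq_zero_of_notMem_tsupport fun h => hy (Or.inr h), Matrix.vecMulVec_zero]

omit [DecidableEq s] [Fintype s] in
lemma IsTestFamily.wignerIntegrable (hX : IsTestFamily X) : WignerIntegrable X := by
  intro C _ a b
  obtain ⟨K, hK, h0⟩ := hX.compact
  have hc : HasCompactSupport fun z : Spacetime × Spacetime => X z.1 z.2 a b :=
    HasCompactSupport.intro (hK.prod hK) fun z hz => by
      rw [h0 z.1 z.2 (by by_contra h; push Not at h; exact hz h)]; rfl
  have h1 : Integrable fun z : Spacetime × Spacetime => X z.1 z.2 a b :=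
    (hX.smooth a b).continuous.integrable_of_hasCompactSupport hc
  rw [← measurePreserving_midpointEquiv.integrable_comp_emb measurableEmbedding_midpointEquiv] at h1
  exact h1.integrableOn

/-- The sum of gradient terms agrees with the smeared current on products of test functions and is
represented by a test function on all admissible kernels. Evaluating the representation at G gives
the expectation value, with no derivative of G taken. -/
lemma hasExpectation_sum_gradientTerm (hA : IsHermitianField A) (Q : DiracSymbol s)
    (hη : IsProfile η) (hδ : 0 < δ) (hh : IsMatTest h) (μ : Fin 4) {G : Kernel4 s N}
    (hG : WignerIntegrable G) :
    HasExpectation G (smearedCurrent A Q (cutoff η δ) h μ)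
      (∑ k ∈ Finset.range (Q.order + 1), gradientTerm A Q (cutoff η δ) h μ G k) := by
  have hrep : ∀ k, IsRepresentedBy
      (fun X : Kernel4 s N => -gradCoeff k * ∑ l : Fin (2 * k) → Fin 4, ∫ x,
        (covAdjs A (List.ofFn l) h x * momentumIntegral (cutoff η δ)
          (momentDensity A Q X (List.ofFn l ++ [μ]) x)).trace) _ := fun k =>
    (IsRepresentedBy.sum fun l => isRepresentedBy_momentumIntegral hA Q hη hδ (List.ofFn l ++ [μ])
      ⟨hA.smoothMat_covAdjs (List.ofFn l) hh.1, hh.2.covAdjs A (List.ofFn l)⟩).const_mul _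
  have hsum := IsRepresentedBy.sum (S := Finset.range (Q.order + 1)) hrep
  have he : ∀ X : Kernel4 s N, ∑ k ∈ Finset.range (Q.order + 1), gradientTerm A Q (cutoff η δ) h μ X k =
      ∑ k ∈ Finset.range (Q.order + 1), -gradCoeff k * ∑ l : Fin (2 * k) → Fin 4, ∫ x,
        (covAdjs A (List.ofFn l) h x * momentumIntegral (cutoff η δ)
          (momentDensity A Q X (List.ofFn l ++ [μ]) x)).trace := fun X => by
    simp only [gradientTerm, neg_mul]
  refine ⟨_, fun a b => hsum.smooth b a, hsum.compact, fun f g => ?_, ?_⟩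
  · have hfg := isTestFamily_vecMulVec f g
    rw [smearedCurrent_eq_sum hA Q hη hδ hh μ hfg, he, hsum.eq_integral _ hfg.wignerIntegrable]
    refine integral_congr_ae (Eventually.of_forall fun z => ?_)
    simp only [Matrix.trace, Matrix.diag, Matrix.mul_apply, Matrix.vecMulVec_apply]
    exact Finset.sum_comm
  · rw [he, hsum.eq_integral _ hG]

/-! ### Removing the point splitting -/

lemma tendsto_integral_momentumIntegral (hη : IsProfile η) {F : Spacetime → Spacetime →
      Matrix (Fin N) (Fin N) ℂ} {H : Spacetime → Matrix (Fin N) (Fin N) ℂ} (hH : IsMatTest H)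
    (hF : ∀ C : Set Spacetime, IsCompact C → ∀ i j, IntegrableOn
      (fun z : Spacetime × Spacetime => F z.1 z.2 i j) (C ×ˢ Set.univ)) :
    Tendsto (fun δ => ∫ x, (H x * momentumIntegral (cutoff η δ) (F x)).trace) (𝓝[>] 0)
      (𝓝 (∫ x, (H x * momentumIntegral (fun _ => 1) (F x)).trace)) := by
  have hHF : ∀ i j, Integrable fun z : Spacetime × Spacetime => H z.1 i j * F z.1 z.2 j i := by
    intro i j
    have hHc : Continuous fun z : Spacetime × Spacetime => H z.1 i j :=
      (hH.1 i j).continuous.comp continuous_fst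
    obtain ⟨B, hB⟩ := (hH.1 i j).continuous.bounded_above_of_compact_support
      (hH.2.comp_left (g := fun M : Matrix (Fin N) (Fin N) ℂ => M i j) rfl)
    refine IntegrableOn.integrable_of_forall_notMem_eq_zero (s := tsupport H ×ˢ Set.univ)
      (Integrable.bdd_mul (c := B) (hF _ hH.2.isCompact j i) hHc.aestronglyMeasurable
        (Eventually.of_forall fun z => hB z.1)) fun z hz => ?_
    rw [image_eq_zero_of_notMem_tsupport fun h => hz ⟨h, trivial⟩]
    simp
  have hχ : ∀ {χ : Spacetime → ℂ} {B : ℝ}, Continuous χ → (∀ p, ‖χ p‖ ≤ B) → ∀ i j,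
      Integrable fun z : Spacetime × Spacetime => χ z.2 * (H z.1 i j * F z.1 z.2 j i) :=
    fun hc hB i j => (hHF i j).bdd_mul (hc.comp continuous_snd).aestronglyMeasurable
      (Eventually.of_forall fun z => hB z.2)
  -- The iterated integral is a double integral over x and p for every bounded continuous regulator,
  -- including the constant 1, so dominated convergence can be applied once on the product space.
  have key : ∀ {χ : Spacetime → ℂ} {B : ℝ}, Continuous χ → (∀ p, ‖χ p‖ ≤ B) →
      ∫ x, (H x * momentumIntegral χ (F x)).trace = ∑ i, ∑ j, (((2 * Real.pi) ^ 4)⁻¹ : ℝ) •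
        ∫ z : Spacetime × Spacetime, χ z.2 * (H z.1 i j * F z.1 z.2 j i) := by
    intro χ B hc hB
    have h1 : ∀ i j, Integrable fun x => H x i j * momentumIntegral χ (F x) j i := fun i j => by
      have := ((hχ hc hB i j).integral_prod_left).const_mul (((((2 * Real.pi) ^ 4)⁻¹ : ℝ)) : ℂ)
      refine this.congr (Eventually.of_forall fun x => ?_)
      simp only [momentumIntegral_apply, smul_eq_mul, Complex.real_smul]
      simp only [mul_left_comm _ (H x i j), integral_const_mul]
    simp only [Matrix.trace, Matrix.diag, Matrix.mul_apply]
    rw [integral_finsetSum _ fun i _ => integrable_finsetSum _ fun j _ => h1 i j]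
    refine Finset.sum_congr rfl fun i _ => ?_
    rw [integral_finsetSum _ fun j _ => h1 i j]
    refine Finset.sum_congr rfl fun j _ => ?_
    have h2 := integral_prod _ (hχ hc hB i j)
    rw [Measure.volume_eq_prod, h2, ← integral_smul]
    refine integral_congr_ae (Eventually.of_forall fun x => ?_)
    simp only [momentumIntegral_apply, smul_eq_mul, Complex.real_smul]
    simp only [mul_left_comm _ (H x i j), integral_const_mul]
  rw [key continuous_const (B := 1) (fun p => by simp)]
  simp only [fun δ => key (hη.continuous_cutoff δ) (norm_cutoff_le η δ)]
  refine tendsto_finsetSum _ fun i _ => tendsto_finsetSum _ fun j _ => Tendsto.const_smul ?_ _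
  refine tendsto_integral_filter_of_dominated_convergence
    (fun z => (∫ y, ‖η y‖) * ‖H z.1 i j * F z.1 z.2 j i‖)
    (Eventually.of_forall fun δ => (hχ (hη.continuous_cutoff δ) (norm_cutoff_le η δ) i j).1)
    (Eventually.of_forall fun δ => Eventually.of_forall fun z => ?_) ((hHF i j).norm.const_mul _)
    (Eventually.of_forall fun z => (hη.tendsto_cutoff z.2).mul_const _)
  rw [norm_mul]
  exact mul_le_mul_of_nonneg_right (norm_cutoff_le η δ z.2) (norm_nonneg _)

lemma tendsto_gradientTerm (hA : IsHermitianField A) (Q : DiracSymbol s) (hη : IsProfile η)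
    (hh : IsMatTest h) (μ : Fin 4) {G : Kernel4 s N} {k : ℕ}
    (hF : ∀ l : Fin (2 * k) → Fin 4, ∀ C : Set Spacetime, IsCompact C → ∀ i j,
      IntegrableOn (fun z : Spacetime × Spacetime =>
        momentDensity A Q G (List.ofFn l ++ [μ]) z.1 z.2 i j) (C ×ˢ Set.univ)) :
    Tendsto (fun δ => gradientTerm A Q (cutoff η δ) h μ G k) (𝓝[>] 0)
      (𝓝 (gradientTerm A Q (fun _ => 1) h μ G k)) :=
  ((tendsto_finsetSum _ fun l _ => tendsto_integral_momentumIntegral hη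
    ⟨hA.smoothMat_covAdjs (List.ofFn l) hh.1, hh.2.covAdjs A (List.ofFn l)⟩ (hF l)).const_mul _).neg

theorem hasCurrentExpectation_sum_gradientTerm (hA : IsHermitianField A) (Q : DiracSymbol s)
    (hh : IsMatTest h) (μ : Fin 4) {G : Kernel4 s N} (hG : WignerIntegrable G)
    (hF : ∀ k, ∀ l : Fin (2 * k) → Fin 4, ∀ C : Set Spacetime, IsCompact C → ∀ i j,
      IntegrableOn (fun z : Spacetime × Spacetime =>
        momentDensity A Q G (List.ofFn l ++ [μ]) z.1 z.2 i j) (C ×ˢ Set.univ)) :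
    HasCurrentExpectation A Q G h μ
      (∑ k ∈ Finset.range (Q.order + 1), gradientTerm A Q (fun _ => 1) h μ G k) :=
  fun _ hη => ⟨_, fun _ hδ => hasExpectation_sum_gradientTerm hA Q hη hδ hh μ hG,
    tendsto_finsetSum _ fun k _ => tendsto_gradientTerm hA Q hη hh μ (hF k)⟩

end Expectation

/-! ### Rescaling of the midpoint. -/

section Scaling

/-- Rescaling the first variable multiplies the measure by a positive finite constant and maps
compact sets to compact sets. -/
lemma integrableOn_of_scaled {f : Spacetime × Spacetime → ℂ} {ε : ℝ} (hε : 0 < ε)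
    (hf : ∀ C : Set Spacetime, IsCompact C →
      IntegrableOn (fun z : Spacetime × Spacetime => f (ε⁻¹ • z.1, z.2)) (C ×ˢ Set.univ))
    {C : Set Spacetime} (hC : IsCompact C) : IntegrableOn f (C ×ˢ Set.univ) := by
  have hε' : ε⁻¹ ≠ 0 := (inv_pos.2 hε).ne'
  let T : Spacetime × Spacetime → Spacetime × Spacetime := Prod.map (fun x => ε⁻¹ • x) id
  have hT : MeasurableEmbedding T :=
    ((Homeomorph.smulOfNeZero ε⁻¹ hε').prodCongr (Homeomorph.refl Spacetime)).measurableEmbedding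
  have h1 := hf _ ((Homeomorph.smulOfNeZero ε⁻¹ hε').isCompact_preimage.2 hC)
  have h2 : IntegrableOn (f ∘ T) (T ⁻¹' (C ×ˢ Set.univ)) := by
    have hset : T ⁻¹' (C ×ˢ Set.univ) =
        (Homeomorph.smulOfNeZero (α := Spacetime) ε⁻¹ hε' ⁻¹' C) ×ˢ Set.univ := by
      ext z; simp [T]
    rw [hset]
    exact h1
  rw [← hT.integrableOn_map_iff] at h2
  have h3 : Measure.map T volume =
      ENNReal.ofReal |(ε⁻¹ ^ Module.finrank ℝ Spacetime)⁻¹| • volume := by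
    rw [Measure.volume_eq_prod, ← Measure.map_prod_map _ _ (by fun_prop) measurable_id,
      Measure.map_id, Measure.map_addHaar_smul volume hε', Measure.prod_smul_left]
  rw [h3, IntegrableOn, Measure.restrict_smul, integrable_smul_measure (by simp [hε.ne'])
    ENNReal.ofReal_ne_top] at h2
  exact h2

/-- A bound on an integral over `C`, in terms of integrals over `C × ℝ⁴`. -/
lemma norm_integral_le_of_slices {κ : Type*} [Fintype κ] {φ : Spacetime → ℂ} {C : Set Spacetime}
    (hC : IsCompact C) (h0 : ∀ x ∉ C, φ x = 0) {f : κ → Spacetime × Spacetime → ℂ} {b B : κ → ℝ}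
    (hb : ∀ k, 0 ≤ b k) (hf : ∀ k, IntegrableOn (f k) (C ×ˢ Set.univ))
    (hB : ∀ k, ∫ z in C ×ˢ Set.univ, ‖f k z‖ ≤ B k)
    (hφ : ∀ᵐ x, x ∈ C → ‖φ x‖ ≤ ∑ k, b k * ∫ y, ‖f k (x, y)‖) :
    ‖∫ x, φ x‖ ≤ ∑ k, b k * B k := by
  have hm : (volume.restrict C).prod volume =
      (volume : Measure (Spacetime × Spacetime)).restrict (C ×ˢ Set.univ) := by
    rw [Measure.volume_eq_prod, ← Measure.prod_restrict, Measure.restrict_univ]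
  have h1 : ∀ k, Integrable (fun z => ‖f k z‖) ((volume.restrict C).prod volume) := fun k => by
    rw [hm]; exact (hf k).norm
  have h2 : ∫ x, φ x = ∫ x in C, φ x := (setIntegral_eq_integral_of_forall_compl_eq_zero h0).symm
  have h3 : ∀ k, Integrable (fun x => b k * ∫ y, ‖f k (x, y)‖) (volume.restrict C) := fun k =>
    (h1 k).integral_prod_left.const_mul _
  rw [h2]
  refine (norm_integral_le_of_norm_le (integrable_finsetSum _ fun k _ => h3 k)
    ((ae_restrict_iff' hC.measurableSet).2 hφ)).trans ?_
  rw [integral_finsetSum _ fun k _ => h3 k]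
  refine Finset.sum_le_sum fun k _ => ?_
  rw [integral_const_mul, ← integral_prod _ (h1 k), hm]
  exact mul_le_mul_of_nonneg_left (hB k) (hb k)

end Scaling

/-! ### Slowly varying backgrounds. -/

section SlowlyVarying

variable {N : ℕ} {s : Type*} [Fintype s] [DecidableEq s] {A : GaugeField N}
  {h H : Spacetime → Matrix (Fin N) (Fin N) ℂ} {η : Spacetime → ℂ} {δ : ℝ}

/-- The prefactor of the slow gauge field matches the ε from the chain rule, so the whole covariant
derivative scales. -/
lemma covAdj_slowGauge (A : GaugeField N) (ε : ℝ) (c : ℂ) (μ : Fin 4) (hH : SmoothMat H)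
    (x : Spacetime) : covAdj (slowGauge ε A) μ (fun z => c • H (ε • z)) x =
      (c * ε) • covAdj A μ H (ε • x) := by
  ext i j
  have h1 : dirDeriv (unitVec μ) (fun z => c • H (ε • z) i j) x =
      (c * ε) • dirDeriv (unitVec μ) (fun z => H z i j) (ε • x) := by
    have h2 := ((((hH i j).differentiable_infty (ε • x)).hasFDerivAt.comp x
      ((hasFDerivAt_id x).const_smul ε)).const_smul c).fderiv
    change fderiv ℝ (c • ((fun z => H z i j) ∘ fun z => ε • z)) x (unitVec μ) = _
    refine (congrArg (fun L : Spacetime →L[ℝ] ℂ => L (unitVec μ)) h2).trans ?_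
    simp [dirDeriv, mul_assoc]
  simp only [covAdj_apply, Matrix.smul_apply, slowGauge, smul_eq_mul, mul_sub, Finset.mul_sum]
  congr 2 <;> refine Finset.sum_congr rfl fun k _ => ?_ <;> ring

lemma covAdjs_slowGauge (hA : IsHermitianField A) (ε : ℝ) (hh : SmoothMat h) (l : List (Fin 4))
    (x : Spacetime) : covAdjs (slowGauge ε A) l (slowTest ε h) x =
      ((ε : ℂ) ^ (4 + l.length)) • covAdjs A l h (ε • x) := by
  induction l generalizing x with
  | nil => rfl
  | cons μ l ih =>
    change covAdj (slowGauge ε A) μ (covAdjs (slowGauge ε A) l (slowTest ε h)) x = _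
    rw [funext ih, covAdj_slowGauge A ε _ μ (hA.smoothMat_covAdjs l hh), List.length_cons,
      ← add_assoc, pow_succ]
    rfl

lemma isMatTest_slowTest (hh : IsMatTest h) {ε : ℝ} (hε : 0 < ε) : IsMatTest (slowTest ε h) := by
  refine ⟨fun i j => ?_, ?_⟩
  · change ContDiff ℝ ∞ fun x => ((ε : ℂ) ^ 4) • h (ε • x) i j
    exact ((hh.1 i j).comp (contDiff_id.const_smul ε)).const_smul _
  exact (hh.2.comp_homeomorph (Homeomorph.smulOfNeZero ε hε.ne')).smul_left (f := fun _ => (ε : ℂ) ^ 4)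

/-- The factor ε⁴ of the test function cancels the Jacobian of X = εx, which leaves one ε for each
derivative. -/
lemma integral_trace_covAdjs_slowTest (hA : IsHermitianField A) {ε : ℝ} (hε : 0 < ε)
    (hh : SmoothMat h) (l : List (Fin 4)) (M : Spacetime → Matrix (Fin N) (Fin N) ℂ) :
    ∫ x, (covAdjs (slowGauge ε A) l (slowTest ε h) x * M x).trace =
      (ε : ℂ) ^ l.length * ∫ x, (covAdjs A l h x * M (ε⁻¹ • x)).trace := by
  let g : Spacetime → ℂ := fun x => (covAdjs A l h x * M (ε⁻¹ • x)).trace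
  have h1 : ∀ x, (covAdjs (slowGauge ε A) l (slowTest ε h) x * M x).trace =
      (ε : ℂ) ^ (4 + l.length) * g (ε • x) := fun x => by
    simp only [g]
    rw [covAdjs_slowGauge hA ε hh, smul_mul_assoc, Matrix.trace_smul, smul_eq_mul,
      inv_smul_smul₀ hε.ne']
  simp only [h1]
  rw [integral_const_mul, Measure.integral_comp_smul]
  have h4 : |(ε ^ Module.finrank ℝ Spacetime)⁻¹| = (ε ^ 4)⁻¹ := by
    rw [abs_of_pos (by positivity)]; simp
  rw [h4, Complex.real_smul, pow_add]
  have : (ε : ℂ) ≠ 0 := by exact_mod_cast hε.ne'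
  change _ = (ε : ℂ) ^ l.length * ∫ x, g x
  push_cast
  field_simp

lemma norm_transportedKernel_le (hA : IsHermitianField A) (X : Kernel4 s N) (x y : Spacetime)
    (a b : s × Fin N) : ‖transportedKernel A X x y a b‖ ≤
      ∑ r : Fin N × Fin N, ‖X (x - (2⁻¹ : ℝ) • y) (x + (2⁻¹ : ℝ) • y) (a.1, r.1) (b.1, r.2)‖ := by
  rw [transportedKernel, liftGauge_mul_mul_apply, Finset.sum_comm, Fintype.sum_prod_type]
  refine (norm_sum_le _ _).trans (Finset.sum_le_sum fun k _ => (norm_sum_le _ _).trans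
    (Finset.sum_le_sum fun l _ => ?_))
  rw [norm_smul, norm_mul]
  exact mul_le_of_le_one_left (norm_nonneg _) (mul_le_one₀ (hA.norm_wilsonLine_le _ _ _ _)
    (norm_nonneg _) (hA.norm_wilsonLine_le _ _ _ _))

/-- A uniform bound on the pairing of a test function with a momentum integral. -/
lemma exists_bound_momentumIntegral_one (hH : IsMatTest H)
    {F : ℝ → Spacetime → Spacetime → Matrix (Fin N) (Fin N) ℂ}
    (hF : ∀ i j, UniformlyIntegrable fun ε z => F ε z.1 z.2 i j) :
    ∃ c, ∀ ε ∈ Set.Ioc (0 : ℝ) 1,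
      ‖∫ x, (H x * momentumIntegral (fun _ => 1) (F ε x)).trace‖ ≤ c := by
  choose b hb using fun i j => (hH.1 i j).continuous.bounded_above_of_compact_support
    (hH.2.comp_left (g := fun M : Matrix (Fin N) (Fin N) ℂ => M i j) rfl)
  choose B hB using fun i j => hF i j _ hH.2.isCompact
  have hb0 : ∀ i j, 0 ≤ b i j := fun i j => (norm_nonneg _).trans (hb i j 0)
  refine ⟨∑ r : Fin N × Fin N, b r.1 r.2 * ((2 * Real.pi) ^ 4)⁻¹ * B r.2 r.1, fun ε hε => ?_⟩
  refine norm_integral_le_of_slices hH.2.isCompact (fun x hx => ?_)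
    (f := fun r z => F ε z.1 z.2 r.2 r.1)
    (fun r => mul_nonneg (hb0 r.1 r.2) (by positivity)) (fun r => (hB r.2 r.1 ε hε).1)
    (fun r => (hB r.2 r.1 ε hε).2) (Eventually.of_forall fun x _ => ?_)
  · rw [image_eq_zero_of_notMem_tsupport hx, zero_mul, Matrix.trace_zero]
  · simp only [Matrix.trace, Matrix.diag, Matrix.mul_apply]
    rw [Fintype.sum_prod_type]
    refine (norm_sum_le _ _).trans (Finset.sum_le_sum fun i _ => (norm_sum_le _ _).trans
      (Finset.sum_le_sum fun j _ => ?_))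
    rw [norm_mul, momentumIntegral_apply, norm_smul, mul_assoc]
    simp only [one_smul]
    rw [Real.norm_of_nonneg (by positivity)]
    exact mul_le_mul (hb i j x) (mul_le_mul_of_nonneg_left (norm_integral_le_integral_norm _)
      (by positivity)) (by positivity) (hb0 i j)

/-- A uniform bound on the pairing of a test function with a point-split momentum integral, in a
slowly varying background. -/
lemma exists_bound_momentumIntegral_cutoff (hA : IsHermitianField A) (Q : DiracSymbol s)
    (hη : IsProfile η) (hδ : 0 < δ) (l : List (Fin 4)) (hH : IsMatTest H) {G : ℝ → Kernel4 s N}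
    (hG : ∀ a b, UniformlyIntegrable fun ε z =>
        G ε (ε⁻¹ • z.1 - (2⁻¹ : ℝ) • z.2) (ε⁻¹ • z.1 + (2⁻¹ : ℝ) • z.2) a b) :
    ∃ c, ∀ ε ∈ Set.Ioc (0 : ℝ) 1, ‖∫ x, (H x * momentumIntegral (cutoff η δ)
      (momentDensity (slowGauge ε A) (Q.slow ε) (G ε) l (ε⁻¹ • x))).trace‖ ≤ c := by
  have hHc : ∀ i j (τ : Q.RidgeIndex) a b, ∃ b', ∀ x, ‖H x i j * τ.coeff x b a‖ ≤ b' :=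
    fun i j τ a b => ((hH.1 i j).continuous.mul
      (τ.contDiff_coeff b a).continuous).bounded_above_of_compact_support
      (HasCompactSupport.mul_right (f := fun x => H x i j)
        (hH.2.comp_left (g := fun M : Matrix (Fin N) (Fin N) ℂ => M i j) rfl))
  choose b hb using hHc
  choose w hw using fun τ : Q.RidgeIndex =>
    (hη.contDiff_splitWeight (δ := δ) τ l).continuous.bounded_above_of_compact_support
      (hη.hasCompactSupport_splitWeight hδ τ l)
  choose B hB using fun a b => hG a b _ hH.2.isCompact
  have hb0 : ∀ i j τ a c, 0 ≤ b i j τ a c := fun i j τ a c => (norm_nonneg _).trans (hb i j τ a c 0)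
  have hw0 : ∀ τ, 0 ≤ w τ := fun τ => (norm_nonneg _).trans (hw τ 0)
  let κ := Fin N × Fin N × Q.RidgeIndex × s × s × Fin N × Fin N
  refine ⟨∑ r : κ, (b r.1 r.2.1 r.2.2.1 r.2.2.2.1 r.2.2.2.2.1 * w r.2.2.1) *
    B (r.2.2.2.1, r.2.2.2.2.2.1) (r.2.2.2.2.1, r.2.2.2.2.2.2), fun ε hε => ?_⟩
  refine norm_integral_le_of_slices hH.2.isCompact (fun x hx => ?_)
    (f := fun (r : κ) (z : Spacetime × Spacetime) =>
      G ε (ε⁻¹ • z.1 - (2⁻¹ : ℝ) • z.2) (ε⁻¹ • z.1 + (2⁻¹ : ℝ) • z.2)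
        (r.2.2.2.1, r.2.2.2.2.2.1) (r.2.2.2.2.1, r.2.2.2.2.2.2))
    (fun r => mul_nonneg (hb0 _ _ _ _ _) (hw0 _)) (fun r => (hB _ _ ε hε).1)
    (fun r => (hB _ _ ε hε).2) ?_
  · rw [image_eq_zero_of_notMem_tsupport hx, zero_mul, Matrix.trace_zero]
  · have hsl := fun a b => ae_integrable_slice hH.2.isCompact (hB a b ε hε).1
    filter_upwards [ae_all_iff.2 fun a => ae_all_iff.2 fun b => hsl a b] with x hx hxH
    have hX := fun a b => hx a b hxH
    have hΦ := integrable_transportedKernel (hA.slowGauge ε) (X := G ε) hX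
    -- Neither the weight nor the bound on the Wilson lines depends on ε, so the estimate involves ε
    -- only through the integral of the kernel.
    have hsw : ∀ (τ : Q.RidgeIndex) p q, ‖∫ y, splitWeight η δ τ l y *
        transportedKernel (slowGauge ε A) (G ε) (ε⁻¹ • x) y p q‖ ≤
        ∑ r : Fin N × Fin N, w τ * ∫ y, ‖G ε (ε⁻¹ • x - (2⁻¹ : ℝ) • y) (ε⁻¹ • x + (2⁻¹ : ℝ) • y)
          (p.1, r.1) (q.1, r.2)‖ := by
      intro τ p q
      have hi := fun r : Fin N × Fin N => (hX (p.1, r.1) (q.1, r.2)).norm.const_mul (w τ)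
      refine (norm_integral_le_of_norm_le (integrable_finsetSum Finset.univ fun r _ => hi r)
        (Eventually.of_forall fun y => ?_)).trans_eq ?_
      · rw [norm_mul, ← Finset.mul_sum]
        exact mul_le_mul (hw τ y) (norm_transportedKernel_le (hA.slowGauge ε) _ _ _ _ _)
          (norm_nonneg _) (hw0 τ)
      · rw [integral_finsetSum _ fun r _ => hi r]
        simp only [integral_const_mul]
    simp only [Matrix.trace, Matrix.diag, Matrix.mul_apply]
    rw [Fintype.sum_prod_type]
    refine (norm_sum_le _ _).trans (Finset.sum_le_sum fun i _ => ?_)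
    rw [Fintype.sum_prod_type]
    refine (norm_sum_le _ _).trans (Finset.sum_le_sum fun j _ => ?_)
    -- The slow symbol at x/ε has the momentum derivatives of Q at x; expanding it with the terms of
    -- Q keeps the coefficients and their index set independent of ε.
    rw [momentumIntegral_cutoff_apply hη hδ Q (Q.slow ε) l (x' := x)
      (fun p => by rw [Q.slow_pDerivs, smul_inv_smul₀ hε.1.ne']) hΦ, Finset.mul_sum,
      Fintype.sum_prod_type]
    refine (norm_sum_le _ _).trans (Finset.sum_le_sum fun τ _ => ?_)
    rw [Finset.mul_sum, Fintype.sum_prod_type]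
    refine (norm_sum_le _ _).trans (Finset.sum_le_sum fun a _ => ?_)
    rw [Finset.mul_sum, Fintype.sum_prod_type]
    refine (norm_sum_le _ _).trans (Finset.sum_le_sum fun c _ => ?_)
    rw [← mul_assoc, norm_mul]
    refine (mul_le_mul (hb i j τ a c x) (hsw τ (a, j) (c, i)) (norm_nonneg _)
      (hb0 _ _ _ _ _)).trans_eq ?_
    rw [Finset.mul_sum]
    simp only [mul_assoc]

lemma wignerIntegrable_of_uniformlyIntegrable {G : ℝ → Kernel4 s N}
    (hG : ∀ a b, UniformlyIntegrable fun ε z =>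
        G ε (ε⁻¹ • z.1 - (2⁻¹ : ℝ) • z.2) (ε⁻¹ • z.1 + (2⁻¹ : ℝ) • z.2) a b) {ε : ℝ}
    (hε : ε ∈ Set.Ioc (0 : ℝ) 1) : WignerIntegrable (G ε) := fun _ hC a b =>
  integrableOn_of_scaled (f := fun z => G ε (z.1 - (2⁻¹ : ℝ) • z.2) (z.1 + (2⁻¹ : ℝ) • z.2) a b) hε.1
    (fun _ hC' => let ⟨_, hB⟩ := hG a b _ hC'; (hB ε hε).1) hC

/-- The gradient corrections are of second order in a slowly varying background. -/
lemma exists_bound_sum_gradientTerm (hA : IsHermitianField A) (Q : DiracSymbol s)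
    (hh : IsMatTest h) (μ : Fin 4) (χ : Spacetime → ℂ) {G : ℝ → Kernel4 s N}
    (hb : ∀ (l : List (Fin 4)) k (l' : Fin (2 * k) → Fin 4), ∃ c, ∀ ε ∈ Set.Ioc (0 : ℝ) 1,
      ‖∫ x, (covAdjs A l h x * momentumIntegral χ (momentDensity (slowGauge ε A) (Q.slow ε) (G ε)
        (List.ofFn l' ++ [μ]) (ε⁻¹ • x))).trace‖ ≤ c) :
    ∃ c : ℝ, ∀ ε ∈ Set.Ioc (0 : ℝ) 1,
      ‖∑ k ∈ Finset.range (Q.order + 1),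
          gradientTerm (slowGauge ε A) (Q.slow ε) χ (slowTest ε h) μ (G ε) k -
        leadingValue (slowGauge ε A) (Q.slow ε) χ (slowTest ε h) μ (G ε)‖ ≤ c * ε ^ 2 := by
  choose c hc using fun k l => hb (List.ofFn l) k l
  refine ⟨∑ k ∈ Finset.range Q.order, ‖gradCoeff (k + 1)‖ * ∑ l, c (k + 1) l, fun ε hε => ?_⟩
  have h1 := sum_gradientTerm (slowGauge ε A) (Q.slow ε) χ (slowTest ε h) μ (G ε)
  change ∑ k ∈ Finset.range (Q.order + 1), _ = _ + ∑ k ∈ Finset.range Q.order, _ at h1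
  rw [h1, add_sub_cancel_left, Finset.sum_mul]
  refine (norm_sum_le _ _).trans (Finset.sum_le_sum fun k _ => ?_)
  rw [gradientTerm, norm_neg, norm_mul, mul_assoc, Finset.sum_mul]
  refine mul_le_mul_of_nonneg_left ((norm_sum_le _ _).trans (Finset.sum_le_sum fun l _ => ?_))
    (norm_nonneg _)
  have h2 := hc (k + 1) l ε hε
  rw [integral_trace_covAdjs_slowTest hA hε.1 hh.1, norm_mul, List.length_ofFn, norm_pow,
    Complex.norm_real, Real.norm_of_nonneg hε.1.le, mul_comm]
  -- All remaining terms have at least two covariant derivatives on the test function, and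
  -- ε^{2(k+1)} ≤ ε² for ε ≤ 1.
  exact mul_le_mul h2 (pow_le_pow_of_le_one hε.1.le hε.2 (by omega)) (pow_nonneg hε.1.le _)
    ((norm_nonneg _).trans h2)

end SlowlyVarying

theorem theorem7 {N : ℕ} {s : Type*} [Fintype s] [DecidableEq s]
    (𝒢 : Subgroup (Matrix.unitaryGroup (Fin N) ℂ)) (A : GaugeField N) (hA : IsGaugeField 𝒢 A)
    (Q : DiracSymbol s) :
    -- the Noether current, to all orders in the covariant derivative
    (∀ (Λ : Type*) [NormedRing Λ] [NormedAlgebra ℂ Λ] [CompleteSpace Λ],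
      IsNoetherCurrent (Λ := Λ) 𝒢 A Q
        (fun ψ ψb => vectorCurrent A Q (fun _ => 1) (fieldKernel ψ ψb)) ∧
      (Q.HigherDerivsVanish → IsNoetherCurrent (Λ := Λ) 𝒢 A Q
        (fun ψ ψb => leadingCurrent A Q (fun _ => 1) (fieldKernel ψ ψb))) ∧
      ∀ ψ ψb : Spacetime → s × Fin N → Λ, IsGrassmannPair ψ ψb → ∀ μ x,
        (∀ i j, Integrable fun p => currentDensity A Q (fieldKernel ψ ψb) μ x p i j) ∧
        ∀ η, IsProfile η →
          Tendsto (fun δ => vectorCurrent A Q (cutoff η δ) (fieldKernel ψ ψb) μ x) (𝓝[>] 0)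
            (𝓝 (vectorCurrent A Q (fun _ => 1) (fieldKernel ψ ψb) μ x))) ∧
    -- its expectation value
    (∀ (E : FieldAlgebra (s × Fin N) →ₗ[ℂ] ℂ) (G : Kernel4 s N),
      IsFermionExpectation A Q E → IsTwoPointFunction E G → WignerIntegrable G →
      IsGreenFunction A Q G ∧
      ∀ (μ : Fin 4) (h : Spacetime → Matrix (Fin N) (Fin N) ℂ), IsMatTest h →
        -- exact, with all gradient terms
        (∀ η, IsProfile η → ∀ δ, 0 < δ →
          HasExpectation G (smearedCurrent A Q (cutoff η δ) h μ)
            (leadingValue A Q (cutoff η δ) h μ G +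
              ∑' k, gradientTerm A Q (cutoff η δ) h μ G (k + 1))) ∧
        ((∀ k, ∀ l : Fin (2 * k) → Fin 4, ∀ C : Set Spacetime, IsCompact C → ∀ i j,
            IntegrableOn (fun z : Spacetime × Spacetime =>
              momentDensity A Q G (List.ofFn l ++ [μ]) z.1 z.2 i j) (C ×ˢ Set.univ)) →
          HasCurrentExpectation A Q G h μ
            (leadingValue A Q (fun _ => 1) h μ G +
              ∑' k, gradientTerm A Q (fun _ => 1) h μ G (k + 1))) ∧
        -- exact, without gradient terms, if the higher derivatives of `Q` vanish
        (Q.HigherDerivsVanish →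
          (∀ η, IsProfile η → ∀ δ, 0 < δ →
            HasExpectation G (smearedCurrent A Q (cutoff η δ) h μ)
              (leadingValue A Q (cutoff η δ) h μ G)) ∧
          ((∀ C : Set Spacetime, IsCompact C → ∀ i j,
              IntegrableOn (fun z : Spacetime × Spacetime =>
                momentDensity A Q G [μ] z.1 z.2 i j) (C ×ˢ Set.univ)) →
            HasCurrentExpectation A Q G h μ (leadingValue A Q (fun _ => 1) h μ G)))) ∧
    -- up to second order in the gradients, if the background varies slowly
    (∀ (E : ℝ → FieldAlgebra (s × Fin N) →ₗ[ℂ] ℂ) (G : ℝ → Kernel4 s N),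
      (∀ ε ∈ Set.Ioc (0 : ℝ) 1,
        IsFermionExpectation (slowGauge ε A) (Q.slow ε) (E ε) ∧ IsTwoPointFunction (E ε) (G ε)) →
      (∀ a b, UniformlyIntegrable fun ε z =>
        G ε (ε⁻¹ • z.1 - (2⁻¹ : ℝ) • z.2) (ε⁻¹ • z.1 + (2⁻¹ : ℝ) • z.2) a b) →
      ∀ (μ : Fin 4) (h : Spacetime → Matrix (Fin N) (Fin N) ℂ), IsMatTest h →
        (∀ η, IsProfile η → ∀ δ, 0 < δ → ∃ c : ℝ, ∀ ε ∈ Set.Ioc (0 : ℝ) 1, ∃ v,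
          HasExpectation (G ε)
            (smearedCurrent (slowGauge ε A) (Q.slow ε) (cutoff η δ) (slowTest ε h) μ) v ∧
          ‖v - leadingValue (slowGauge ε A) (Q.slow ε) (cutoff η δ) (slowTest ε h) μ (G ε)‖ ≤
            c * ε ^ 2) ∧
        ((∀ k, ∀ l : Fin (2 * k) → Fin 4, ∀ i j, UniformlyIntegrable fun ε z =>
            momentDensity (slowGauge ε A) (Q.slow ε) (G ε) (List.ofFn l ++ [μ])
              (ε⁻¹ • z.1) z.2 i j) →
          ∃ c : ℝ, ∀ ε ∈ Set.Ioc (0 : ℝ) 1, ∃ v,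
            HasCurrentExpectation (slowGauge ε A) (Q.slow ε) (G ε) (slowTest ε h) μ v ∧
            ‖v - leadingValue (slowGauge ε A) (Q.slow ε) (fun _ => 1) (slowTest ε h) μ (G ε)‖ ≤
              c * ε ^ 2)) := by
  have hA' := hA.isHermitianField
  refine ⟨?_, ?_, ?_⟩
  · intro Λ _ _ _
    refine ⟨isNoetherCurrent_of_eq hA' Q fun ψ ψb hψ μ x =>
      vectorCurrent_one hA' hψ.isTestFamily Q μ x, fun hQ =>
      isNoetherCurrent_of_eq hA' Q fun ψ ψb hψ μ x => ?_, fun ψ ψb hψ μ x => ⟨fun i j =>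
        integrable_currentDensity hA' hψ.isTestFamily Q μ x i j, fun η hη =>
        tendsto_vectorCurrent_cutoff hA' hψ.isTestFamily Q μ x hη⟩⟩
    rw [← hQ.vectorCurrent_eq, vectorCurrent_one hA' hψ.isTestFamily Q μ x]
  · intro E G hE hEG hG
    refine ⟨hEG.isGreenFunction hE, fun μ h hh => ⟨fun η hη δ hδ => ?_, fun hF => ?_, fun hQ => ?_⟩⟩
    · rw [leadingValue_add_tsum]
      exact hasExpectation_sum_gradientTerm hA' Q hη hδ hh μ hG
    · rw [leadingValue_add_tsum]
      exact hasCurrentExpectation_sum_gradientTerm hA' Q hh μ hG hF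
    · have hsum : ∀ χ, ∑ k ∈ Finset.range (Q.order + 1), gradientTerm A Q χ h μ G k =
          leadingValue A Q χ h μ G := fun χ => by
        rw [sum_gradientTerm, Finset.sum_eq_zero fun k _ => hQ.gradientTerm_succ A χ h μ G k,
          add_zero]
      refine ⟨fun η hη δ hδ => ?_, fun hF => ?_⟩
      · rw [← hsum]
        exact hasExpectation_sum_gradientTerm hA' Q hη hδ hh μ hG
      · rw [← hsum]
        refine hasCurrentExpectation_sum_gradientTerm hA' Q hh μ hG fun k l C hC i j => ?_
        -- Integrability is assumed only for the leading term; for k ≥ 1 the integrand is zero.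
        cases k with
        | zero => simpa using hF C hC i j
        | succ k =>
          have h0 : ∀ x p, momentDensity A Q G (List.ofFn l ++ [μ]) x p = 0 := fun x p =>
            hQ.momentDensity_eq_zero A G (by simp) x p
          simp only [h0, Matrix.zero_apply]
          exact integrableOn_zero
  · intro E G _ hG μ h hh
    have hT : ∀ l : List (Fin 4), IsMatTest (covAdjs A l h) := fun l =>
      ⟨hA'.smoothMat_covAdjs l hh.1, hh.2.covAdjs A l⟩
    have hW := fun ε hε => wignerIntegrable_of_uniformlyIntegrable (ε := ε) hG hε
    refine ⟨fun η hη δ hδ => ?_, fun hF => ?_⟩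
    · obtain ⟨c, hc⟩ := exists_bound_sum_gradientTerm hA' Q hh μ (cutoff η δ) fun l k l' =>
        exists_bound_momentumIntegral_cutoff hA' Q hη hδ (List.ofFn l' ++ [μ]) (hT l) hG
      exact ⟨c, fun ε hε => ⟨_, hasExpectation_sum_gradientTerm (hA'.slowGauge ε) (Q.slow ε) hη hδ
        (isMatTest_slowTest hh hε.1) μ (hW ε hε), hc ε hε⟩⟩
    · obtain ⟨c, hc⟩ := exists_bound_sum_gradientTerm hA' Q hh μ (fun _ => 1) fun l k l' =>
        exists_bound_momentumIntegral_one (hT l) (F := fun ε x p =>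
          momentDensity (slowGauge ε A) (Q.slow ε) (G ε) (List.ofFn l' ++ [μ]) (ε⁻¹ • x) p) (hF k l')
      refine ⟨c, fun ε hε => ⟨_, hasCurrentExpectation_sum_gradientTerm (hA'.slowGauge ε) (Q.slow ε)
        (isMatTest_slowTest hh hε.1) μ (hW ε hε) fun k l C hC i j => ?_, hc ε hε⟩⟩
      -- The assumption is stated in X = εx; at fixed ε it is converted back to x.
      refine integrableOn_of_scaled (f := fun z => momentDensity (slowGauge ε A) (Q.slow ε) (G ε)
        (List.ofFn l ++ [μ]) z.1 z.2 i j) hε.1 (fun C' hC' => ?_) hC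
      obtain ⟨B, hB⟩ := hF k l i j C' hC'
      exact (hB ε hε).1
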